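/- \textbf{Conventions.} The curvature tensor is normalized so that $\mathrm{Rm}(e_i\wedge e_j,e_i\wedge e_j)=R_{ijij}$ is the sectional curvature of the plane spanned by the orthonormal vectors $e_i,e_j$, and $\mathrm{Rm}$ is extended complex multilinearly; $S^2_B(\mathfrak{so}(n))$ is the space of symmetric bilinear forms on $\mathfrak{so}(n)=\Lambda^2\mathbb R^n$ satisfying the first Bianchi identity. For $S\subset\mathfrak{so}(n,\mathbb C)$ put $\mathcal C(S)=\{R\in S^2_B(\mathfrak{so}(n)) : R(v,\bar v)\ge 0\ \text{for all } v\in S\}$, and let $S_1=\mathfrak{so}(n,\mathbb C)$, $S_2=\{v\in\mathfrak{so}(n,\mathbb C):\operatorname{tr}(v^2)=0\}$, $S_3=\{v\in\mathfrak{so}(n,\mathbb C):\operatorname{rank}v=2,\ v^2=0\}$, $S_4=\{v\in\mathfrak{so}(n,\mathbb C):\operatorname{rank}v=2,\ v^3=0\}$, $S_5=\{v\in\mathfrak{so}(n,\mathbb C):\operatorname{rank}v=2\}$. These are the conditions of non-negative curvature operator, $2$-non-negative curvature operator, weakly PIC, weakly PIC$_1$ and weakly PIC$_2$, respectively. Let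 $\mathrm I$ be the curvature operator of the unit round sphere. Membership of $\mathrm{Rm}_g(p)$ in $\mathcal C(S_i)$ is understood through an orthonormal basis of $T_pM$ (its choice is irrelevant). Let $g(t)$, $t\in(a,b)$, be a smooth solution of the Ricci flow $\partial_t g=-2\,\mathrm{Ric}$ on a manifold $M$ (no completeness or curvature bound is assumed). For functions $u,F$ on $M\times(a,b)$ we say that $\partial_t u\le\Delta u+F$ holds (i) \emph{in the barrier sense}, if for every $(q,\tau)\in M\times(a,b)$ there are a neighbourhood $U\subset M\times(a,b)$ of $(q,\tau)$ and a $C^\infty$ function $\varphi:U\to\mathbb R$ with $\varphi\le u$ on $U$, $\varphi(q,\tau)=u(q,\tau)$ and $(\partial_t-\Delta_{g(\tau)})\varphi\le F$ at $(q,\tau)$; (ii) \emph{in the viscosity sense}, if $u$ is upper semicontinuous and, whenever $\psi$ is a $C^\infty$ function on an open neighbourhood $U\subset M\times(a,b)$ of a point $(q,\tau)$ with $\psi\ge u$ on $U$ and $\psi(q,\tau)=u(q,\tau)$, one has $(\partial_t-\Delta_{g(\tau)})\psi\le F$ at $(q,\tau)$. \textbf{Theorem.} (a) Let $n\in\mathbb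 N$ and $\mathcal C=\mathcal C(S_i)$ with $i\in\{1,\dots,5\}$, and assume $n\ne 6$ if $i=3$. There is a constant $C\in(0,\infty)$, depending only on $n$ and $i$, such that for every smooth Ricci flow $g(t)$, $t\in(a,b)$, on an $n$-dimensional manifold $M$ the following holds. For all $p\in M$, $t\in(a,b)$ the infimum $$\ell(p,t)=\inf\{\alpha\ge 0 : \mathrm{Rm}_{g(t)}(p)+\alpha\,\mathrm I\in\mathcal C\}$$ is attained, and the function $\ell$ satisfies $$\partial_t\ell\le\Delta\ell+\mathrm{scal}\cdot\ell+C\ell^2$$ in the barrier sense and in the viscosity sense. (b) Let $m\in\mathbb N$. There is a constant $C\in(0,\infty)$, depending only on $m$, such that for every smooth Ricci flow $g(t)$, $t\in(a,b)$, on a manifold $M$ of real dimension $2m$ for which every $g(t)$ is Kähler with respect to one fixed complex structure $J$ the following holds. For a tensor $R$ with the symmetries of a curvature tensor and $x,y\in T^{1,0}_pM$ put $K_{\mathbb C}(R)(x,y)=-R(x,\bar x,y,\bar y)$, and let $\tilde{\mathrm I}$ be the Kähler curvature tensor of constant holomorphic sectional curvature $2$, i.e. $-\tilde{\mathrm I}_{a\bar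 b c\bar d}=\delta_{ab}\delta_{cd}+\delta_{ad}\delta_{bc}$ in a unitary frame of $T^{1,0}M$. For all $p\in M$, $t\in(a,b)$ the infimum $$\tilde\ell(p,t)=\inf\{\alpha\ge 0 : K_{\mathbb C}(\mathrm{Rm}_{g(t)}+\alpha\,\tilde{\mathrm I})(x,y)\ge 0\ \text{for all } x,y\in T^{1,0}_pM\}$$ is attained, and the function $\tilde\ell$ satisfies $$\partial_t\tilde\ell\le\Delta\tilde\ell+\mathrm{scal}\cdot\tilde\ell+C\tilde\ell^2$$ in the barrier sense and in the viscosity sense. -/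

import Mathlib

open Set Bundle Matrix
open scoped Manifold ContDiff

noncomputable section

/-! ### Algebraic curvature operators and the cones -/

/-- Membership of a `(4,0)`-tensor (given by its components in an orthonormal basis of `ℝⁿ`) in
the space `S²_B(so(n))` of algebraic curvature operators: a symmetric bilinear form on
`so(n) = Λ²ℝⁿ` satisfying the first Bianchi identity. -/
structure IsAlgCurvature {n : ℕ} (R : Fin n → Fin n → Fin n → Fin n → ℝ) : Prop where
  antisymm : ∀ i j k l, R i j k l = -R j i k l
  pair_symm : ∀ i j k l, R i j k l = R k l i j
  bianchi : ∀ i j k l, R i j k l + R j k i l + R k i j l = 0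

/-- The complex bilinear extension of `R` to `so(n, ℂ)`, normalized by
`R (e_i ∧ e_j) (e_k ∧ e_l) = R_ijkl`, where `e_i ∧ e_j` is the matrix with entry `1` at `(i,j)`,
entry `-1` at `(j,i)` and zeros elsewhere. -/
def curvForm {n : ℕ} (R : Fin n → Fin n → Fin n → Fin n → ℝ) (v w : Matrix (Fin n) (Fin n) ℂ) :
    ℂ :=
  (1 / 4 : ℂ) * ∑ i, ∑ j, ∑ k, ∑ l, (R i j k l : ℂ) * v i j * w k l

/-- The cone `C(S)` of all algebraic curvature operators `R` with `R(v, v̄) ≥ 0` for all `v ∈ S`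
(the number `R(v, v̄)` is real). -/
def curvCone {n : ℕ} (S : Set (Matrix (Fin n) (Fin n) ℂ)) :
    Set (Fin n → Fin n → Fin n → Fin n → ℝ) :=
  {R | IsAlgCurvature R ∧ ∀ v ∈ S, 0 ≤ (curvForm R v (v.map (starRingEnd ℂ))).re}

/-- The five curvature conditions: nonnegative curvature operator, 2-nonnegative curvature
operator, weakly PIC, weakly PIC1, weakly PIC2. -/
inductive CurvCondition where
  | nonneg
  | twoNonneg
  | pic
  | picOne
  | picTwo

/-- The subsets `S ⊆ so(n, ℂ)` defining the five conditions. -/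
def CurvCondition.gen (n : ℕ) : CurvCondition → Set (Matrix (Fin n) (Fin n) ℂ)
  | .nonneg => {v | v ∈ LieAlgebra.Orthogonal.so (Fin n) ℂ}
  | .twoNonneg => {v | v ∈ LieAlgebra.Orthogonal.so (Fin n) ℂ ∧ (v ^ 2).trace = 0}
  | .pic => {v | v ∈ LieAlgebra.Orthogonal.so (Fin n) ℂ ∧ v.rank = 2 ∧ v ^ 2 = 0}
  | .picOne => {v | v ∈ LieAlgebra.Orthogonal.so (Fin n) ℂ ∧ v.rank = 2 ∧ v ^ 3 = 0}
  | .picTwo => {v | v ∈ LieAlgebra.Orthogonal.so (Fin n) ℂ ∧ v.rank = 2}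

/-- The curvature operator of the unit round sphere, in an orthonormal basis. -/
def sphereCurv (n : ℕ) (i j k l : Fin n) : ℝ :=
  (if i = k then 1 else 0) * (if j = l then 1 else 0)
    - (if i = l then 1 else 0) * (if j = k then 1 else 0)

/-! ### Riemannian geometry in coordinates

`G : EuclideanSpace ℝ (Fin n) → Matrix (Fin n) (Fin n) ℝ` is the matrix of a metric in a chart. -/

/-- The `i`-th partial derivative. -/
def partialD {n : ℕ} (i : Fin n) (f : EuclideanSpace ℝ (Fin n) → ℝ)
    (y : EuclideanSpace ℝ (Fin n)) : ℝ :=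
  fderiv ℝ f y (EuclideanSpace.single i 1)

/-- The Christoffel symbol `Γ^k_ij`. -/
def christoffel {n : ℕ} (G : EuclideanSpace ℝ (Fin n) → Matrix (Fin n) (Fin n) ℝ) (k i j : Fin n)
    (y : EuclideanSpace ℝ (Fin n)) : ℝ :=
  (1 / 2) * ∑ l, (G y)⁻¹ k l *
    (partialD i (fun z => G z j l) y + partialD j (fun z => G z i l) y
      - partialD l (fun z => G z i j) y)

/-- The `∂_m`-component of
`R(∂_i, ∂_j) ∂_l = ∇_i ∇_j ∂_l - ∇_j ∇_i ∂_l`. -/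
def curvEndo {n : ℕ} (G : EuclideanSpace ℝ (Fin n) → Matrix (Fin n) (Fin n) ℝ) (m i j l : Fin n)
    (y : EuclideanSpace ℝ (Fin n)) : ℝ :=
  partialD i (christoffel G m j l) y - partialD j (christoffel G m i l) y
    + ∑ p, (christoffel G m i p y * christoffel G p j l y
      - christoffel G m j p y * christoffel G p i l y)

/-- The curvature tensor `R_ijkl = g(R(∂_i, ∂_j) ∂_l, ∂_k)`; in an orthonormal basis `R_ijij` is
the sectional curvature of the plane spanned by `e_i, e_j`. -/
def curvTensor {n : ℕ} (G : EuclideanSpace ℝ (Fin n) → Matrix (Fin n) (Fin n) ℝ)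
    (y : EuclideanSpace ℝ (Fin n)) (i j k l : Fin n) : ℝ :=
  ∑ m, G y k m * curvEndo G m i j l y

/-- The Ricci tensor `R_ij = g^{kl} R_ikjl`. -/
def ricciTensor {n : ℕ} (G : EuclideanSpace ℝ (Fin n) → Matrix (Fin n) (Fin n) ℝ)
    (y : EuclideanSpace ℝ (Fin n)) (i j : Fin n) : ℝ :=
  ∑ k, ∑ l, (G y)⁻¹ k l * curvTensor G y i k j l

/-- The scalar curvature. -/
def scalarCurv {n : ℕ} (G : EuclideanSpace ℝ (Fin n) → Matrix (Fin n) (Fin n) ℝ)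
    (y : EuclideanSpace ℝ (Fin n)) : ℝ :=
  ∑ i, ∑ j, (G y)⁻¹ i j * ricciTensor G y i j

/-- The Laplace-Beltrami operator `g^{ij} (∂_i ∂_j f - Γ^k_ij ∂_k f)`. -/
def laplaceCoord {n : ℕ} (G : EuclideanSpace ℝ (Fin n) → Matrix (Fin n) (Fin n) ℝ)
    (f : EuclideanSpace ℝ (Fin n) → ℝ) (y : EuclideanSpace ℝ (Fin n)) : ℝ :=
  ∑ i, ∑ j, (G y)⁻¹ i j *
    (partialD i (partialD j f) y - ∑ k, christoffel G k i j y * partialD k f y)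

/-! ### Riemannian geometry on a manifold -/

/-- Smooth Riemannian metrics on an `n`-manifold. -/
abbrev RMetric (n : ℕ) (M : Type*) [TopologicalSpace M]
    [ChartedSpace (EuclideanSpace ℝ (Fin n)) M] [IsManifold (𝓡 n) ∞ M] :=
  ContMDiffRiemannianMetric (𝓡 n) ∞ (EuclideanSpace ℝ (Fin n))
    (fun p : M => TangentSpace (𝓡 n) p)

section Manifold

variable {n : ℕ} {M : Type*} [TopologicalSpace M] [ChartedSpace (EuclideanSpace ℝ (Fin n)) M]

/-- The coordinate vector field `∂_i` of the chart at `p`, at the point with coordinates `y`. -/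
def coordVec (p : M) (y : EuclideanSpace ℝ (Fin n)) (i : Fin n) :
    TangentSpace (𝓡 n) ((extChartAt (𝓡 n) p).symm y) :=
  mfderiv 𝓘(ℝ, EuclideanSpace ℝ (Fin n)) (𝓡 n) (extChartAt (𝓡 n) p).symm y
    (EuclideanSpace.single i (1 : ℝ) : EuclideanSpace ℝ (Fin n))

/-- The components `J^i_j`, defined by `J ∂_j = J^i_j ∂_i`, of an endomorphism field in the chart
at `p`, at the point with coordinates `y`. -/
def coordEndo (J : ∀ q : M, TangentSpace (𝓡 n) q →L[ℝ] TangentSpace (𝓡 n) q) (p : M)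
    (y : EuclideanSpace ℝ (Fin n)) : Matrix (Fin n) (Fin n) ℝ :=
  Matrix.of fun i j =>
    (show EuclideanSpace ℝ (Fin n) from
      mfderiv (𝓡 n) 𝓘(ℝ, EuclideanSpace ℝ (Fin n)) (extChartAt (𝓡 n) p)
        ((extChartAt (𝓡 n) p).symm y)
        (J ((extChartAt (𝓡 n) p).symm y) (coordVec p y j))) i

variable [IsManifold (𝓡 n) ∞ M]

/-- The matrix `g_ij` of the metric in the chart at `p`, as a function of the coordinates `y`. -/
def coordMetric (g : RMetric n M) (p : M) (y : EuclideanSpace ℝ (Fin n)) :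
    Matrix (Fin n) (Fin n) ℝ :=
  Matrix.of fun i j => g.inner ((extChartAt (𝓡 n) p).symm y) (coordVec p y i) (coordVec p y j)

/-- The components at `p` of the curvature tensor, in the coordinates of the chart at `p`. -/
def curvAt (g : RMetric n M) (p : M) : Fin n → Fin n → Fin n → Fin n → ℝ :=
  curvTensor (coordMetric g p) (extChartAt (𝓡 n) p p)

/-- The scalar curvature at `p`. -/
def scalAt (g : RMetric n M) (p : M) : ℝ :=
  scalarCurv (coordMetric g p) (extChartAt (𝓡 n) p p)

/-- The Laplacian of `f` at `p`. -/
def laplaceAt (g : RMetric n M) (f : M → ℝ) (p : M) : ℝ :=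
  laplaceCoord (coordMetric g p) (fun y => f ((extChartAt (𝓡 n) p).symm y))
    (extChartAt (𝓡 n) p p)

/-- `b` is an orthonormal basis of `T_pM`; `b a i` is the `i`-th coordinate of the `a`-th vector
in the chart at `p`. -/
def IsOrthonormalFrame (g : RMetric n M) (p : M) (b : Fin n → Fin n → ℝ) : Prop :=
  ∀ a c, ∑ i, ∑ j, coordMetric g p (extChartAt (𝓡 n) p p) i j * b a i * b c j
    = if a = c then 1 else 0

/-- The components of the curvature tensor at `p` with respect to the basis `b` of `T_pM`. -/
def curvInFrame (g : RMetric n M) (p : M) (b : Fin n → Fin n → ℝ) (a c d e : Fin n) : ℝ :=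
  ∑ i, ∑ j, ∑ k, ∑ l, curvAt g p i j k l * b a i * b c j * b d k * b e l

/-- The set of all `α ≥ 0` with `Rm_g(p) + α I ∈ C(S)`. The cones are `O(n)`-invariant, so the
choice of the orthonormal basis identifying `T_pM` with `ℝⁿ` does not matter. -/
def ellSet (c : CurvCondition) (g : RMetric n M) (p : M) : Set ℝ :=
  {α | 0 ≤ α ∧ ∀ b, IsOrthonormalFrame g p b →
    (fun i j k l => curvInFrame g p b i j k l + α * sphereCurv n i j k l) ∈ curvCone (c.gen n)}

/-- The number `ℓ(p)`: the infimum of all `α ≥ 0` with `Rm_g(p) + α I ∈ C(S)`. -/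
def ell (c : CurvCondition) (g : RMetric n M) (p : M) : ℝ := sInf (ellSet c g p)

/-! ### Ricci flow -/

/-- `(g t)`, `t ∈ T`, is a smooth solution of the Ricci flow `∂_t g = -2 Ric`. -/
structure IsRicciFlow (g : ℝ → RMetric n M) (T : Set ℝ) : Prop where
  smooth : ContMDiffOn ((𝓡 n).prod 𝓘(ℝ, ℝ))
    ((𝓡 n).prod 𝓘(ℝ, EuclideanSpace ℝ (Fin n) →L[ℝ] EuclideanSpace ℝ (Fin n) →L[ℝ] ℝ)) ∞
    (fun z : M × ℝ =>
      (TotalSpace.mk' (EuclideanSpace ℝ (Fin n) →L[ℝ] EuclideanSpace ℝ (Fin n) →L[ℝ] ℝ)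
        (E := fun q : M => TangentSpace (𝓡 n) q →L[ℝ] TangentSpace (𝓡 n) q →L[ℝ] ℝ)
        z.1 ((g z.2).inner z.1)))
    (univ ×ˢ T)
  evolution : ∀ t ∈ T, ∀ p : M, ∀ y ∈ (extChartAt (𝓡 n) p).target, ∀ i j,
    HasDerivAt (fun s => coordMetric (g s) p y i j)
      (-2 * ricciTensor (coordMetric (g t) p) y i j) t

/-- The evolution inequality `∂_t u ≤ Δ u + F` along `g` holds in the barrier sense on `M × T`:
at every point there is a smooth lower barrier satisfying it at that point. -/
def BarrierIneq (g : ℝ → RMetric n M) (T : Set ℝ) (u F : M → ℝ → ℝ) : Prop :=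
  ∀ q : M, ∀ τ ∈ T, ∃ U : Set (M × ℝ), IsOpen U ∧ (q, τ) ∈ U ∧ U ⊆ univ ×ˢ T ∧
    ∃ φ : M × ℝ → ℝ, ContMDiffOn ((𝓡 n).prod 𝓘(ℝ, ℝ)) 𝓘(ℝ, ℝ) ∞ φ U ∧
      (∀ z ∈ U, φ z ≤ u z.1 z.2) ∧ φ (q, τ) = u q τ ∧
      deriv (fun t => φ (q, t)) τ - laplaceAt (g τ) (fun p => φ (p, τ)) q ≤ F q τ

/-- The evolution inequality `∂_t u ≤ Δ u + F` along `g` holds in the viscosity sense on `M × T`: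
`u` is upper semicontinuous, and every smooth function touching `u` from above at a point
satisfies it at that point. -/
def ViscosityIneq (g : ℝ → RMetric n M) (T : Set ℝ) (u F : M → ℝ → ℝ) : Prop :=
  UpperSemicontinuousOn (fun z : M × ℝ => u z.1 z.2) (univ ×ˢ T) ∧
  ∀ q : M, ∀ τ ∈ T, ∀ U : Set (M × ℝ), IsOpen U → (q, τ) ∈ U → U ⊆ univ ×ˢ T →
    ∀ ψ : M × ℝ → ℝ, ContMDiffOn ((𝓡 n).prod 𝓘(ℝ, ℝ)) 𝓘(ℝ, ℝ) ∞ ψ U →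
      (∀ z ∈ U, u z.1 z.2 ≤ ψ z) → ψ (q, τ) = u q τ →
      deriv (fun t => ψ (q, t)) τ - laplaceAt (g τ) (fun p => ψ (p, τ)) q ≤ F q τ

/-! ### Kähler geometry -/

/-- `(M, g, J)` is Kähler: `J` is a smooth field of endomorphisms of the tangent spaces with
`J² = -1`, it is orthogonal with respect to `g`, and it is parallel,
`∂_i J^k_j + Γ^k_il J^l_j - Γ^l_ij J^k_l = 0`. -/
structure IsKaehler (g : RMetric n M)
    (J : ∀ q : M, TangentSpace (𝓡 n) q →L[ℝ] TangentSpace (𝓡 n) q) : Prop where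
  smooth : ContMDiff (𝓡 n)
    ((𝓡 n).prod 𝓘(ℝ, EuclideanSpace ℝ (Fin n) →L[ℝ] EuclideanSpace ℝ (Fin n))) ∞
    (fun q : M => (TotalSpace.mk' (EuclideanSpace ℝ (Fin n) →L[ℝ] EuclideanSpace ℝ (Fin n))
      (E := fun q : M => TangentSpace (𝓡 n) q →L[ℝ] TangentSpace (𝓡 n) q) q (J q)))
  sq : ∀ q v, J q (J q v) = -v
  orthogonal : ∀ q v w, g.inner q (J q v) (J q w) = g.inner q v w
  parallel : ∀ p : M, ∀ y ∈ (extChartAt (𝓡 n) p).target, ∀ i j k,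
    partialD i (fun z => coordEndo J p z k j) y
      + ∑ l, (christoffel (coordMetric g p) k i l y * coordEndo J p y l j
        - christoffel (coordMetric g p) l i j y * coordEndo J p y k l) = 0

/-- `x = x^i ∂_i` (complex components in the chart at `p`) is a vector of type `(1,0)` at `p`:
`J x = √-1 x` in the complexified tangent space. -/
def IsTypeOneZero (J : ∀ q : M, TangentSpace (𝓡 n) q →L[ℝ] TangentSpace (𝓡 n) q) (p : M)
    (x : Fin n → ℂ) : Prop :=
  ∀ i, ∑ j, (coordEndo J p (extChartAt (𝓡 n) p p) i j : ℂ) * x j = Complex.I * x i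

/-- `K_ℂ(R)(x, y) = -R(x, x̄, y, ȳ)` for the complex multilinear extension of `R`
(a real number for every tensor `R` with the symmetries of a curvature tensor). -/
def bisectional (R : Fin n → Fin n → Fin n → Fin n → ℝ) (x y : Fin n → ℂ) : ℝ :=
  -(∑ i, ∑ j, ∑ k, ∑ l, (R i j k l : ℂ) * x i * (starRingEnd ℂ) (x j) * y k *
    (starRingEnd ℂ) (y l)).re

/-- The curvature tensor at `p` of constant holomorphic sectional curvature `2`:
with `ω(X, Y) = g(X, JY)`,
`Ĩ(X,Y,Z,W) = ½ (g(X,Z) g(Y,W) - g(X,W) g(Y,Z) + ω(X,Z) ω(Y,W) - ω(X,W) ω(Y,Z) + 2 ω(X,Y) ω(Z,W))`.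
In a unitary frame of `T^{1,0}` this says `-Ĩ_{a b̄ c d̄} = δ_ab δ_cd + δ_ad δ_bc`. -/
def projCurv (g : RMetric n M) (J : ∀ q : M, TangentSpace (𝓡 n) q →L[ℝ] TangentSpace (𝓡 n) q)
    (p : M) (i j k l : Fin n) : ℝ :=
  let h := coordMetric g p (extChartAt (𝓡 n) p p)
  let w := h * coordEndo J p (extChartAt (𝓡 n) p p)
  (1 / 2) * (h i k * h j l - h i l * h j k + w i k * w j l - w i l * w j k + 2 * w i j * w k l)

/-- The set of all `α ≥ 0` such that `Rm_g(p) + α Ĩ` has nonnegative bisectional curvature. -/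
def ellKaehlerSet (g : RMetric n M)
    (J : ∀ q : M, TangentSpace (𝓡 n) q →L[ℝ] TangentSpace (𝓡 n) q) (p : M) : Set ℝ :=
  {α | 0 ≤ α ∧ ∀ x y, IsTypeOneZero J p x → IsTypeOneZero J p y →
    0 ≤ bisectional (fun i j k l => curvAt g p i j k l + α * projCurv g J p i j k l) x y}

/-- The infimum of all `α ≥ 0` such that `Rm_g(p) + α Ĩ` has nonnegative bisectional curvature. -/
def ellKaehler (g : RMetric n M)
    (J : ∀ q : M, TangentSpace (𝓡 n) q →L[ℝ] TangentSpace (𝓡 n) q) (p : M) : ℝ :=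
  sInf (ellKaehlerSet g J p)

end Manifold

end

open scoped Kronecker
open Finset (sum_congr mul_sum sum_comm sum_add_distrib sum_mul sum_sub_distrib sum_neg_distrib
  sum_nonneg sum_eq_zero sum_ite_eq' sum_ite_eq sum_insert sum_eq_single single_le_sum sum_singleton
  sum_mul_sum sum_const_zero card_insert_of_notMem)
open Complex (I re_ofReal_mul conj_ofReal add_re ofReal ofReal_mul I_mul_I re_sum ofReal_sum ofReal_re
  norm_real ofReal_ne_zero re im sub_re conj_mul' mul_conj' ofRealHom ofReal_pow ofReal_zero ofReal_one
  conj_I ofReal_add ofReal_eq_one)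
open Real (norm_eq_abs sq_sqrt mul_self_sqrt sqrt_pos)
open CurvCondition (nonneg twoNonneg pic picOne picTwo)
open RCLike (star_def)
open Fintype (sum_prod_type)
open LieAlgebra.Orthogonal (mem_so)

noncomputable section

local notation:max "Eℝ" n:max => EuclideanSpace ℝ (Fin n)
local notation:max "Eℂ" n:max => EuclideanSpace ℂ (Fin n)
local notation:max "Sℝ" n:max => EuclideanSpace ℝ (Fin n) × ℝ
local notation:max "Mℝ" n:max => Matrix (Fin n) (Fin n) ℝ
local notation:max "Mℂ" n:max => Matrix (Fin n) (Fin n) ℂ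
local notation:max "Tℝ" n:max => Fin n → Fin n → Fin n → Fin n → ℝ
local notation:max "Vℂ" n:max => Fin n → ℂ
local notation:max "χ" n:max => extChartAt (𝓡 n)
local notation:max "conj" => starRingEnd ℂ
local notation:max "C∞" => ContDiffOn ℝ ∞
local notation:max "IsAlg" => IsAlgCurvature
local notation:max "𝕊" n:max => sphereCurv n
local notation:max "ℛ" => curvForm
local notation:max "⟪" a ", " b "⟫" => (inner ℝ a b : ℝ)

variable {X : Type*} [NormedAddCommGroup X] [NormedSpace ℝ X] {n : ℕ} {R : Tℝ n} {K : Mℝ n}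
  {v w : Mℂ n} {x y : Vℂ n}

theorem sum_ext {ι N : Type*} [Fintype ι] [AddCommMonoid N] {f g : ι → N} (h : ∀ i, f i = g i) : ∑ i, f i = ∑ i, g i :=
    Finset.sum_congr rfl fun i _ => h i

section Calculus

/-- The derivative of `f` at `x` in the direction `v`. -/
def dD (v : X) (f : X → ℝ) (x : X) : ℝ := fderiv ℝ f x v

lemma smooth_diffAt {f : X → ℝ} {U : Set X} (hU : IsOpen U) (hf : C∞ f U) {x : X} (hx : x ∈ U) : DifferentiableAt ℝ f x
    := (hf.contDiffAt (hU.mem_nhds hx)).differentiableAt (by simp)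

lemma smooth_dD {f : X → ℝ} {U : Set X} (hU : IsOpen U) (hf : C∞ f U) (v : X) : C∞ (dD v f) U := (hf.fderiv_of_isOpen hU
  (by simp)).clm_apply contDiffOn_const

lemma dD_congr {f g : X → ℝ} {U : Set X} (hU : IsOpen U) (h : ∀ y ∈ U, f y = g y) {x : X} (hx : x ∈ U) (v : X) : dD v f
    x = dD v g x := by
  have : f =ᶠ[nhds x] g := Filter.eventually_of_mem (hU.mem_nhds hx) h
  simp only [dD, this.fderiv_eq]

lemma dD_const (v : X) (c : ℝ) (x : X) : dD v (fun _ => c) x = 0 := by simp [dD]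

lemma dD_add {f g : X → ℝ} {x : X} (hf : DifferentiableAt ℝ f x) (hg : DifferentiableAt ℝ g x) (v : X) : dD v (fun y =>
    f y + g y) x = dD v f x + dD v g x := by simp [dD, fderiv_fun_add hf hg]

lemma dD_sub {f g : X → ℝ} {x : X} (hf : DifferentiableAt ℝ f x) (hg : DifferentiableAt ℝ g x) (v : X) : dD v (fun y =>
    f y - g y) x = dD v f x - dD v g x := by simp [dD, fderiv_fun_sub hf hg]

lemma dD_neg (f : X → ℝ) (x v : X) : dD v (fun y => - f y) x = - dD v f x := by simp [dD, fderiv_fun_neg]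

lemma dD_mul {f g : X → ℝ} {x : X} (hf : DifferentiableAt ℝ f x) (hg : DifferentiableAt ℝ g x) (v : X) : dD v (fun y =>
    f y * g y) x = dD v f x * g x + f x * dD v g x := by simp [dD, fderiv_fun_mul hf hg]; ring

lemma dD_const_mul {f : X → ℝ} {x : X} (hf : DifferentiableAt ℝ f x) (c : ℝ) (v : X) : dD v (fun y => c * f y) x = c *
    dD v f x := by simp [dD, fderiv_const_mul hf]

lemma dD_sum {ι : Type*} {s : Finset ι} {f : ι → X → ℝ} {x : X} (hf : ∀ i ∈ s, DifferentiableAt ℝ (f i) x) (v : X) : dD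
    v (fun y => ∑ i ∈ s, f i y) x = ∑ i ∈ s, dD v (f i) x := by simp [dD, fderiv_fun_sum hf]

lemma dD_comm {f : X → ℝ} {U : Set X} (hU : IsOpen U) (hf : C∞ f U) {x : X} (hx : x ∈ U) (v w : X) : dD v (dD w f) x =
    dD w (dD v f) x := by
  have hs : IsSymmSndFDerivAt ℝ f x := (hf.contDiffAt (hU.mem_nhds hx)).isSymmSndFDerivAt (by simp [minSmoothness_of_isRCLikeNormedField]; exact ENat.LEInfty.out)
  have hd := ((hf.fderiv_of_isOpen hU (m := ∞) (by simp)).contDiffAt (hU.mem_nhds hx)).differentiableAt (by simp)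
  have h (a b : X) : dD a (dD b f) x = fderiv ℝ (fderiv ℝ f) x a b := by
    unfold dD
    rw [fderiv_clm_apply hd (differentiableAt_const b)]
    simp
  rw [h, h, hs.eq]

/-- Smoothness of a matrix-valued function on a set, entrywise. -/
def MSmooth {m n : Type*} (M : X → Matrix m n ℝ) (U : Set X) : Prop := ∀ a b, C∞ (fun x => M x a b) U

/-- The entrywise derivative of a matrix-valued function in the direction `v`. -/
def mD {m n : Type*} (v : X) (M : X → Matrix m n ℝ) (x : X) : Matrix m n ℝ := of fun a b => dD v (fun y => M y a b) x

variable {l m n : Type*} {U : Set X} {M N : X → Matrix m n ℝ} {x : X}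

lemma mD_apply (v : X) (M : X → Matrix m n ℝ) (x : X) (a : m) (b : n) : mD v M x a b = dD v (fun y => M y a b) x := rfl

lemma MSmooth.mono {V : Set X} (h : MSmooth M U) (hV : V ⊆ U) : MSmooth M V := fun a b => (h a b).mono hV

lemma MSmooth.mD (hU : IsOpen U) (h : MSmooth M U) (v : X) : MSmooth (mD v M) U := fun a b => smooth_dD hU (h a b) v

lemma MSmooth.add (h : MSmooth M U) (h' : MSmooth N U) : MSmooth (fun x => M x + N x) U := fun a b => (h a b).add (h' a
  b)

lemma MSmooth.sub (h : MSmooth M U) (h' : MSmooth N U) : MSmooth (fun x => M x - N x) U := fun a b => (h a b).sub (h' a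
  b)

lemma MSmooth.transpose (h : MSmooth M U) : MSmooth (fun x => (M x)ᵀ) U := fun a b => h b a

lemma MSmooth.const (c : Matrix m n ℝ) : MSmooth (fun _ : X => c) U := fun _ _ => contDiffOn_const

lemma MSmooth.mul [Fintype n] {N : X → Matrix n l ℝ} (h : MSmooth M U) (h' : MSmooth N U) : MSmooth (fun x => M x * N x)
    U := fun a b => by
  simp only [mul_apply]
  exact ContDiffOn.sum fun i _ => (h a i).mul (h' i b)

lemma MSmooth.sum {ι : Type*} {s : Finset ι} {F : ι → X → Matrix m n ℝ} (h : ∀ i ∈ s, MSmooth (F i) U) : MSmooth (fun x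
    => ∑ i ∈ s, F i x) U := fun a b => by
  simp only [Matrix.sum_apply]
  exact ContDiffOn.sum fun i hi => h i hi a b

lemma MSmooth.smul {f : X → ℝ} (hf : C∞ f U) (h : MSmooth M U) : MSmooth (fun x => f x • M x) U := fun a b => hf.mul (h
    a b)

lemma MSmooth.congr (h : MSmooth M U) (h' : ∀ x ∈ U, N x = M x) : MSmooth N U :=
  fun a b => (h a b).congr fun x hx => by rw [h' x hx]

lemma MSmooth.inv [Fintype n] [DecidableEq n] {M : X → Matrix n n ℝ} (h : MSmooth M U) (hdet : ∀ x ∈ U, IsUnit (M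
    x).det) : MSmooth (fun x => (M x)⁻¹) U := by
  have det_smooth : ∀ {K : X → Matrix n n ℝ}, MSmooth K U → C∞ (fun x => (K x).det) U := by
    intro K hK
    simp only [det_apply']
    exact ContDiffOn.sum fun σ _ => contDiffOn_const.mul (contDiffOn_prod fun i _ => hK _ _)
  intro a b
  have : ∀ x ∈ U, (M x)⁻¹ a b = ((M x).det)⁻¹ * ((M x).updateRow b (Pi.single a 1)).det := fun x hx => by
    rw [inv_def, Matrix.smul_apply, adjugate_apply, Ring.inverse_eq_inv', smul_eq_mul]
  refine ContDiffOn.congr ?_ this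
  refine ((det_smooth h).inv fun x hx => (hdet x hx).ne_zero).mul (det_smooth ?_)
  intro i j
  by_cases hi : i = b
  · subst hi
    simp only [updateRow_self]
    exact contDiffOn_const
  · simp only [updateRow_ne hi]
    exact h i j

section
variable (hU : IsOpen U) (hx : x ∈ U)
include hU hx

lemma mD_congr (h : ∀ y ∈ U, M y = N y) (v : X) : mD v M x = mD v N x := by
  ext a b
  exact dD_congr hU (fun y hy => by rw [h y hy]) hx v

lemma mD_add (h : MSmooth M U) (h' : MSmooth N U) (v : X) : mD v (fun y => M y + N y) x = mD v M x + mD v N x := by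
  ext a b
  exact dD_add (smooth_diffAt hU (h a b) hx) (smooth_diffAt hU (h' a b) hx) v

lemma mD_sub (h : MSmooth M U) (h' : MSmooth N U) (v : X) : mD v (fun y => M y - N y) x = mD v M x - mD v N x := by
  ext a b
  exact dD_sub (smooth_diffAt hU (h a b) hx) (smooth_diffAt hU (h' a b) hx) v

lemma mD_mul [Fintype n] {N : X → Matrix n l ℝ} (h : MSmooth M U) (h' : MSmooth N U) (v : X) : mD v (fun y => M y * N y)
    x = mD v M x * N x + M x * mD v N x := by
  ext a b
  simp only [mD_apply, Matrix.add_apply, mul_apply]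
  refine (dD_sum (fun i _ => (smooth_diffAt hU (h a i) hx).mul (smooth_diffAt hU (h' i b) hx)) v).trans ?_
  rw [← sum_add_distrib]
  exact sum_ext fun i => dD_mul (smooth_diffAt hU (h a i) hx) (smooth_diffAt hU (h' i b) hx) v

lemma mD_sum {ι : Type*} {s : Finset ι} {F : ι → X → Matrix m n ℝ} (h : ∀ i ∈ s, MSmooth (F i) U) (v : X) : mD v (fun y
    => ∑ i ∈ s, F i y) x = ∑ i ∈ s, mD v (F i) x := by
  ext a b
  simp only [mD_apply, Matrix.sum_apply]
  exact dD_sum (fun i hi => smooth_diffAt hU (h i hi a b) hx) v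

lemma mD_smul {f : X → ℝ} (hf : C∞ f U) (h : MSmooth M U) (v : X) : mD v (fun y => f y • M y) x = dD v f x • M x + f x •
    mD v M x := by
  ext a b
  exact dD_mul (smooth_diffAt hU hf hx) (smooth_diffAt hU (h a b) hx) v

lemma mD_comm (h : MSmooth M U) (v w : X) : mD v (mD w M) x = mD w (mD v M) x := by
  ext a b
  exact dD_comm hU (h a b) hx v w

end

lemma mD_const (c : Matrix m n ℝ) (v x : X) : mD v (fun _ => c) x = 0 := by
  ext a b
  exact dD_const v _ x

lemma mD_transpose (v x : X) : mD v (fun y => (M y)ᵀ) x = (mD v M x)ᵀ := rfl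

end Calculus

section Connection

/-- The connection matrix `(Γ^k_ij)_kj` of the metric `G` with respect to the directions `e`. -/
def conn (e : Fin n → X) (G : X → Mℝ n) (i : Fin n) (x : X) : Mℝ n := of fun k j => (1 / 2) * ∑ l, (G x)⁻¹ k l * (dD (e
    i) (fun z => G z j l) x + dD (e j) (fun z => G z i l) x - dD (e l) (fun z => G z i j) x)

/-- The curvature endomorphisms of a family of connection matrices. -/
def curvMat (e : Fin n → X) (A : Fin n → X → Mℝ n) (i j : Fin n) (x : X) : Mℝ n := mD (e i) (A j) x - mD (e j) (A i) x +
  (A i x * A j x - A j x * A i x)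

def riem (e : Fin n → X) (G : X → Mℝ n) (x : X) (i j k l : Fin n) : ℝ := (G x * curvMat e (conn e G) i j x) k l

def ric (e : Fin n → X) (G : X → Mℝ n) (x : X) : Mℝ n := of fun i j => ∑ k, ∑ l, (G x)⁻¹ k l * riem e G x i k j l

/-- `G` is a smooth field of nondegenerate symmetric matrices on the open set `U`. -/
structure IsMetric (G : X → Mℝ n) (U : Set X) : Prop where
  isOpen : IsOpen U
  smooth : MSmooth G U
  symm : ∀ x ∈ U, (G x)ᵀ = G x
  det : ∀ x ∈ U, IsUnit (G x).det

variable {e : Fin n → X} {G : X → Mℝ n} {U : Set X} {x : X}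

local notation "∇" => conn e G
local notation "Ω" => curvMat e (conn e G)

lemma IsMetric.inv_smooth (h : IsMetric G U) : MSmooth (fun x => (G x)⁻¹) U := h.smooth.inv h.det

lemma IsMetric.conn_smooth (h : IsMetric G U) (i : Fin n) : MSmooth (∇ i) U := fun k j => by
  refine contDiffOn_const.mul (ContDiffOn.sum fun l _ => (h.inv_smooth k l).mul ?_)
  exact ((smooth_dD h.isOpen (h.smooth _ _) _).add (smooth_dD h.isOpen (h.smooth _ _) _)).sub (smooth_dD h.isOpen
    (h.smooth _ _) _)

lemma IsMetric.curvMat_smooth (h : IsMetric G U) (i j : Fin n) : MSmooth (Ω i j) U := ((((h.conn_smooth j).mD h.isOpen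
  _).sub ((h.conn_smooth i).mD h.isOpen _)).add (((h.conn_smooth i).mul (h.conn_smooth j)).sub ((h.conn_smooth j).mul
    (h.conn_smooth i))))

lemma IsMetric.riem_smooth (h : IsMetric G U) (i j k l : Fin n) : C∞ (fun x => riem e G x i j k l) U := (h.smooth.mul
  (h.curvMat_smooth i j)) k l

lemma IsMetric.ric_smooth (h : IsMetric G U) : MSmooth (ric e G) U := fun i j => by
  simp only [ric, of_apply]
  exact ContDiffOn.sum fun k _ => ContDiffOn.sum fun l _ => (h.inv_smooth k l).mul (h.riem_smooth _ _ _ _)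

lemma IsMetric.symm_apply (h : IsMetric G U) (hx : x ∈ U) (a b : Fin n) : G x a b = G x b a := by
  conv_lhs => rw [← h.symm x hx]
  rfl

lemma IsMetric.dD_symm (h : IsMetric G U) (hx : x ∈ U) (v : X) (a b : Fin n) : dD v (fun z => G z a b) x = dD v (fun z
    => G z b a) x := dD_congr h.isOpen (fun _ hy => h.symm_apply hy a b) hx v

lemma IsMetric.conn_symm (h : IsMetric G U) (hx : x ∈ U) (i j k : Fin n) : ∇ i x k j = ∇ j x k i := by
  simp only [conn, of_apply]
  congr 1
  refine sum_ext fun l => ?_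
  rw [h.dD_symm hx (e l) i j]
  ring

lemma IsMetric.mul_conn (h : IsMetric G U) (hx : x ∈ U) (i l j : Fin n) : (G x * ∇ i x) l j = (1 / 2) * (dD (e i) (fun z
    => G z j l) x + dD (e j) (fun z => G z i l) x - dD (e l) (fun z => G z i j) x) := by
  have : ∇ i x = (G x)⁻¹ * of fun l j => (1 / 2) * (dD (e i) (fun z => G z j l) x + dD (e j) (fun z => G z i l) x - dD
      (e l) (fun z => G z i j) x) := by
    ext k j
    simp only [conn, of_apply, mul_apply, mul_sum]
    exact sum_ext fun l => by ring
  rw [this, mul_nonsing_inv_cancel_left _ _ (h.det x hx)]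
  rfl

lemma transpose_mul_apply_of_symm {A B : Mℝ n} (hB : Bᵀ = B) (a b : Fin n) : (Aᵀ * B) a b = (B * A) b a := by
  conv_lhs => rw [← hB, ← transpose_mul]
  rfl

lemma IsMetric.compat (h : IsMetric G U) (hx : x ∈ U) (i : Fin n) : mD (e i) G x = (∇ i x)ᵀ * G x + G x * ∇ i x := by
  ext a b
  rw [Matrix.add_apply, transpose_mul_apply_of_symm (h.symm x hx), h.mul_conn hx, h.mul_conn hx, mD_apply, h.dD_symm hx
    (e i) b a, h.dD_symm hx (e a) i b]
  ring

lemma IsMetric.conn_unique (h : IsMetric G U) (hx : x ∈ U) {B : Fin n → Mℝ n} (hB : ∀ i j k, B i k j = B j k i) (hc : ∀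
    i, mD (e i) G x = (B i)ᵀ * G x + G x * B i) (i : Fin n) : ∇ i x = B i := by
  have hs : ∀ i j l, (G x * B i) l j = (G x * B j) l i := fun i j l => by simp only [mul_apply, hB i j]
  have hd : ∀ i a b, dD (e i) (fun z => G z a b) x = (G x * B i) b a + (G x * B i) a b := fun i a b => by
    rw [← mD_apply, hc, Matrix.add_apply, transpose_mul_apply_of_symm (h.symm x hx)]
  have : G x * ∇ i x = G x * B i := by
    ext l j
    rw [h.mul_conn hx, hd, hd, hd, hs i l j, hs j l i, hs j i l]
    ring
  rw [← nonsing_inv_mul_cancel_left (A := G x) (∇ i x) (h.det x hx), this, nonsing_inv_mul_cancel_left _ _ (h.det x hx)]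

lemma curvMat_antisymm (A : Fin n → X → Mℝ n) (i j : Fin n) (x : X) : curvMat e A i j x = - curvMat e A j i x := by
  simp only [curvMat]; abel

lemma second_bianchi (hU : IsOpen U) (hx : x ∈ U) {A : Fin n → X → Mℝ n} (hA : ∀ i, MSmooth (A i) U) (m i j : Fin n) :
    (mD (e m) (curvMat e A i j) x + (A m x * curvMat e A i j x - curvMat e A i j x * A m x)) + (mD (e i) (curvMat e A j
    m) x + (A i x * curvMat e A j m x - curvMat e A j m x * A i x)) + (mD (e j) (curvMat e A m i) x + (A j x * curvMat e
    A m i x - curvMat e A m i x * A j x)) = 0 := by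
  have key : ∀ m i j, mD (e m) (curvMat e A i j) x = mD (e m) (mD (e i) (A j)) x - mD (e m) (mD (e j) (A i)) x + ((mD (e
        m) (A i) x * A j x + A i x * mD (e m) (A j) x) - (mD (e m) (A j) x * A i x + A j x * mD (e m) (A i) x)) := fun m
          i j => by
    have h1 := fun a b => (hA a).mD hU (e b)
    rw [show curvMat e A i j = fun x => (mD (e i) (A j) x - mD (e j) (A i) x) + (A i x * A j x - A j x * A i x) from
      rfl, mD_add hU hx ((h1 j i).sub (h1 i j)) (((hA i).mul (hA j)).sub ((hA j).mul (hA i))), mD_sub hU hx (h1 j i) (h1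
      i j), mD_sub hU hx ((hA i).mul (hA j)) ((hA j).mul (hA i)), mD_mul hU hx (hA i) (hA j), mD_mul hU hx (hA j) (hA
      i)]
  rw [key, key, key, mD_comm hU hx (hA j) (e i) (e m), mD_comm hU hx (hA m) (e i) (e j), mD_comm hU hx (hA i) (e j) (e
    m)]
  simp only [curvMat]
  noncomm_ring

lemma IsMetric.curv_compat (h : IsMetric G U) (hx : x ∈ U) (i j : Fin n) : (Ω i j x)ᵀ * G x + G x * Ω i j x = 0 := by
  have key : ∀ i j, mD (e i) (mD (e j) G) x = (mD (e i) (∇ j) x)ᵀ * G x + (∇ j x)ᵀ * mD (e i) G x + (mD (e i) G x * ∇ j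
      x + G x * mD (e i) (∇ j) x) := by
    intro i j
    have hA := h.conn_smooth (e := e) j
    rw [mD_congr h.isOpen hx (fun y hy => h.compat hy j), mD_add h.isOpen hx (hA.transpose.mul h.smooth) (h.smooth.mul
      hA), mD_mul h.isOpen hx hA.transpose h.smooth, mD_mul h.isOpen hx h.smooth hA]
    rfl
  have h1 := mD_comm h.isOpen hx h.smooth (e i) (e j)
  rw [key, key, h.compat hx, h.compat hx] at h1
  rw [← sub_eq_zero.2 h1]
  simp only [curvMat, transpose_add, transpose_sub, transpose_mul]
  noncomm_ring

lemma IsMetric.riem_antisymm (h : IsMetric G U) (hx : x ∈ U) (i j k l : Fin n) : riem e G x i j k l = - riem e G x i j l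
    k := by
  have := congr_fun₂ (h.curv_compat (e := e) hx i j) l k
  rw [Matrix.add_apply, transpose_mul_apply_of_symm (h.symm x hx)] at this
  simp only [riem]
  simp only [Matrix.zero_apply] at this
  linarith

lemma riem_antisymm' (i j k l : Fin n) : riem e G x i j k l = - riem e G x j i k l := by
  simp only [riem]
  rw [curvMat_antisymm, mul_neg, Matrix.neg_apply]

lemma IsMetric.riem_bianchi' (h : IsMetric G U) (hx : x ∈ U) (i j k l : Fin n) : riem e G x i j k l + riem e G x j l k i
    + riem e G x l i k j = 0 := by
  simp only [riem, mul_apply]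
  rw [← sum_add_distrib, ← sum_add_distrib]
  refine sum_eq_zero fun p _ => ?_
  have hd : ∀ i j l, mD (e i) (∇ j) x p l = mD (e i) (∇ l) x p j := fun i j l => dD_congr h.isOpen (fun y hy =>
    h.conn_symm hy j l p) hx _
  have : Ω i j x p l + Ω j l x p i + Ω l i x p j = 0 := by
    simp only [curvMat, Matrix.add_apply, Matrix.sub_apply, mul_apply]
    rw [hd i j l, hd j i l, hd l j i]
    have hs : ∀ i j l, ∑ q, ∇ i x p q * ∇ j x q l = ∑ q, ∇ i x p q * ∇ l x q j := fun i j l =>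
      sum_ext fun q => by rw [h.conn_symm hx j l q]
    rw [hs i j l, hs j i l, hs l j i]
    ring
  linear_combination G x k p * this

lemma IsMetric.isAlgCurvature (h : IsMetric G U) (hx : x ∈ U) : IsAlg (riem e G x) := by
  have h1 := fun i j k l => riem_antisymm' (e := e) (G := G) (x := x) i j k l
  have h2 := fun i j k l => h.riem_antisymm (e := e) hx i j k l
  have h3 := fun i j k l => h.riem_bianchi' (e := e) hx i j k l
  refine ⟨h1, fun i j k l => ?_, fun i j k l => ?_⟩
  · grind
  · linarith [h3 i j l k, h2 i j k l, h2 j k i l, h2 k i j l]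

end Connection

/-- The derivation action of an endomorphism on the four slots of a tensor. -/
def slot (B : Mℝ n) (R : Tℝ n) (i j k l : Fin n) : ℝ := ∑ q, (B q i * R q j k l + B q j * R i q k l + B q k * R i j q l
  + B q l * R i j k q)

/-- The Ricci contraction in an orthonormal basis. -/
def ricci (R : Tℝ n) : Mℝ n := of fun i j => ∑ q, R i q j q

/-- The quadratic reaction term in the evolution of the curvature tensor. -/
def quad (R : Tℝ n) (i j k l : Fin n) : ℝ := ∑ m, ∑ q, (R i j m q * R m q k l + 2 * (R i m k q * R j m l q - R j m k q *
    R i m l q))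

lemma slot_sub (B C : Mℝ n) (R : Tℝ n) (i j k l : Fin n) : slot (B - C) R i j k l = slot B R i j k l - slot C R i j k l
    := by
  simp only [slot, Matrix.sub_apply, ← sum_sub_distrib]
  exact sum_ext fun q => by ring

lemma slot_isAlgCurvature (hR : IsAlg R) (B : Mℝ n) : IsAlg (slot B R) := by
  refine ⟨fun i j k l => ?_, fun i j k l => ?_, fun i j k l => ?_⟩
  · simp only [slot, ← sum_neg_distrib]
    refine sum_ext fun q => ?_
    rw [hR.antisymm q j, hR.antisymm i q, hR.antisymm i j q l, hR.antisymm i j k q]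
    ring
  · simp only [slot]
    refine sum_ext fun q => ?_
    rw [hR.pair_symm q j, hR.pair_symm i q, hR.pair_symm i j q l, hR.pair_symm i j k q]
    ring
  · simp only [slot, ← sum_add_distrib]
    refine sum_eq_zero fun q _ => ?_
    linear_combination B q i * hR.bianchi q j k l + B q j * hR.bianchi i q k l + B q k * hR.bianchi i j q l + B q l *
      hR.bianchi i j k q

lemma IsAlgCurvature.antisymm' (hR : IsAlg R) (i j k l : Fin n) : R i j k l = - R i j l k := by
  rw [hR.pair_symm, hR.antisymm, hR.pair_symm]

lemma IsAlgCurvature.ricci_symm (hR : IsAlg R) : (ricci R)ᵀ = ricci R := by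
  ext i j
  simp only [ricci, transpose_apply, of_apply]
  exact sum_ext fun q => hR.pair_symm _ _ _ _

lemma evolution_algebra (hR : IsAlg R) {N : Fin n → Fin n → Tℝ n} (hN : ∀ p m, IsAlg (N p m)) (hN2 : ∀ p m i j k l, N p
    m i j k l + N p i j m k l + N p j m i k l = 0) (hN3 : ∀ p m i j k l, N p m i j k l - N m p i j k l = - slot (of fun
      q s => R p m q s) R i j k l) {c : Tℝ n} (hc : ∀ p m i j, c p m i j = -2 * ∑ q, N p m i q j q) (i j k l : Fin n) :
    (-2 * ∑ q, ricci R k q * R i j q l + (1 / 2) * (c i j l k + c i l j k - c i k j l - c j i l k - c j l i k + c j k i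
      l)) - ∑ m, N m m i j k l = quad R i j k l - slot (ricci R) R i j k l := by
  have hcs : ∀ p m i j, c p m i j = c p m j i := fun p m i j => by
    rw [hc, hc]
    congr 1
    exact sum_ext fun q => (hN p m).pair_symm _ _ _ _
  have s1 : ∑ m, N m m i j k l = ∑ m, N m i m j k l - ∑ m, N m j m i k l := by
    rw [← sum_sub_distrib]
    refine sum_ext fun m => ?_
    linarith [hN2 m m i j k l, (hN m i).antisymm j m k l]
  have s3 : ∀ i j, ∑ m, N i m m j k l = (1 / 2) * (c i l j k - c i k j l) := fun i j => by
    rw [hcs i l j k, hcs i k j l, hc, hc, ← mul_sub, ← sum_sub_distrib, ← mul_assoc, show (1 / 2 * -2 : ℝ) = -1 by norm_num, mul_sum]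
    refine sum_ext fun m => ?_
    linarith [(hN i m).pair_symm m j k l, hN2 i m k l m j, (hN i k).antisymm' l m m j, (hN i l).antisymm m k m j, (hN i
      l).antisymm' k m m j]
  have s2 : ∀ i j, ∑ m, N m i m j k l = (1 / 2) * (c i l j k - c i k j l) - ∑ m, slot (of fun q s => R m i q s) R m j k
      l := fun i j => by
    rw [← s3, ← sum_sub_distrib]
    refine sum_ext fun m => ?_
    linarith [hN3 m i m j k l]
  have s4 : c i j l k - c j i l k = 2 * ∑ q, (R i j q k * ricci R q l + R i j q l * ricci R k q) := by
    rw [hcs i j, hcs j i, hc, hc, ← mul_sub, ← sum_sub_distrib]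
    simp only [hN3, slot, of_apply]
    have : ∀ q, ∑ s, (R i j s k * R s q l q + R i j s q * R k s l q + R i j s l * R k q s q + R i j s q * R k q l s) = ∑
        s, (R i j s k * R s q l q + R i j s l * R k q s q) + ∑ s, (R i j s q * R k s l q + R i j s q * R k q l s) := fun
        q => by
      rw [← sum_add_distrib]
      exact sum_ext fun s => by ring
    simp only [this]
    rw [sum_neg_distrib, sum_add_distrib]
    have h0 : ∑ q, ∑ s, (R i j s q * R k s l q + R i j s q * R k q l s) = 0 := by
      have h1 : ∑ q, ∑ s, (R i j s q * R k s l q + R i j s q * R k q l s) = ∑ q, ∑ s, (R i j q s * R k q l s + R i j q s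
          * R k s l q) := sum_comm
      have h2 : ∑ q, ∑ s, (R i j q s * R k q l s + R i j q s * R k s l q) = - ∑ q, ∑ s, (R i j s q * R k s l q + R i j s
          q * R k q l s) := by
        rw [← sum_neg_distrib]
        refine sum_ext fun q => ?_
        rw [← sum_neg_distrib]
        refine sum_ext fun s => ?_
        rw [hR.antisymm' i j q s]
        ring
      linarith
    rw [h0, sum_comm]
    simp only [ricci, of_apply, mul_sum, ← sum_add_distrib]
    rw [add_zero, neg_mul_neg]
    simp only [mul_sum]
  have s5 : ∀ i j, ∑ m, slot (of fun q s => R m i q s) R m j k l = - ∑ q, ricci R q i * R q j k l + ∑ m, ∑ q, (R m i q j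
      * R m q k l + R m i q k * R m j q l + R m i q l * R m j k q) := fun i j => by
    simp only [slot, of_apply]
    have : ∀ m, ∑ q, (R m i q m * R q j k l + R m i q j * R m q k l + R m i q k * R m j q l + R m i q l * R m j k q) = ∑
        q, R m i q m * R q j k l + ∑ q, (R m i q j * R m q k l + R m i q k * R m j q l + R m i q l * R m j k q) := fun m
        => by
      rw [← sum_add_distrib]
      exact sum_ext fun s => by ring
    simp only [this]
    rw [sum_add_distrib, sum_comm]
    congr 1
    rw [← sum_neg_distrib]
    refine sum_ext fun q => ?_
    rw [← sum_mul, ← neg_mul, ricci, of_apply, ← sum_neg_distrib]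
    congr 1
    refine sum_ext fun m => ?_
    rw [hR.pair_symm m i q m, hR.antisymm' q m m i]
  have s6 : quad R i j k l = ∑ m, ∑ q, (R m i q j * R m q k l + R m i q k * R m j q l + R m i q l * R m j k q) - ∑ m, ∑
      q, (R m j q i * R m q k l + R m j q k * R m i q l + R m j q l * R m i k q) := by
    simp only [quad, ← sum_sub_distrib]
    refine sum_ext fun m => sum_ext fun q => ?_
    have h1 : R m i q j - R m j q i = R i j m q := by
      linarith [hR.bianchi m i q j, hR.pair_symm i q m j, hR.antisymm' m j i q,
        hR.pair_symm q m i j, hR.antisymm' i j q m]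
    have f : ∀ a b c d, R a b c d = R b a d c := fun a b c d => by rw [hR.antisymm, hR.antisymm', neg_neg]
    rw [f i m k q, f j m l q, f j m k q, f i m l q, hR.antisymm' m j k q, hR.antisymm' m i k q, ← h1]
    ring
  have s7 : slot (ricci R) R i j k l = ∑ q, ricci R q i * R q j k l - ∑ q, ricci R q j * R q i k l + ∑ q, (ricci R k q *
      R i j q l - R i j q k * ricci R q l) := by
    rw [← sum_sub_distrib, ← sum_add_distrib]
    refine sum_ext fun q => ?_
    have := congrFun (congrFun hR.ricci_symm k) q
    rw [transpose_apply] at this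
    rw [hR.antisymm i q, hR.antisymm' i j k q, this]
    ring
  have s8 : ∑ q, (R i j q k * ricci R q l + R i j q l * ricci R k q) = 2 * ∑ q, ricci R k q * R i j q l - ∑ q, (ricci R
        k q * R i j q l - R i j q k * ricci R q l) := by
    rw [mul_sum, ← sum_sub_distrib]
    exact sum_ext fun q => by ring
  rw [s1, s2, s2, s5, s5, s6, s7]
  linear_combination (1 / 2) * s4 + s8

/-- The components of the curvature tensor with respect to a frame. -/
def inFrame (R : Tℝ n) (E : Mℝ n) (a b c d : Fin n) : ℝ := ∑ i, ∑ j, ∑ k, ∑ l, R i j k l * E i a * E j b * E k c * E l d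

section Jets

variable {e : Fin n → X} {G : X → Mℝ n} {U : Set X} {x : X}

local notation "∇" => conn e G
local notation "Ω" => curvMat e (conn e G)

lemma isAlgCurvature_dD {R : X → Tℝ n} (hU : IsOpen U) (hR : ∀ y ∈ U, IsAlg (R y)) (hs : ∀ i j k l, C∞ (fun y => R y i j
    k l) U) (hx : x ∈ U) (v : X) : IsAlg (fun i j k l => dD v (fun y => R y i j k l) x) := by
  refine ⟨fun i j k l => ?_, fun i j k l => ?_, fun i j k l => ?_⟩
  · rw [← dD_neg]
    exact dD_congr hU (fun y hy => (hR y hy).antisymm i j k l) hx v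
  · exact dD_congr hU (fun y hy => (hR y hy).pair_symm i j k l) hx v
  · have d := fun i j k l => smooth_diffAt hU (hs i j k l) hx
    rw [← dD_add (d _ _ _ _) (d _ _ _ _), ← dD_add ((d _ _ _ _).fun_add (d _ _ _ _)) (d _ _ _ _), dD_congr hU (fun y hy
      => (hR y hy).bianchi i j k l) hx v, dD_const]

/-- The components of the second covariant derivative of the curvature tensor at a point where
the connection matrices vanish. -/
def hessRiem (e : Fin n → X) (G : X → Mℝ n) (x : X) (p m i j k l : Fin n) : ℝ := dD (e p) (dD (e m) (fun y => riem e G y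
  i j k l)) x - slot (mD (e p) (conn e G m) x) (riem e G x) i j k l

lemma IsAlgCurvature.sub {R S : Tℝ n} (hR : IsAlg R) (hS : IsAlg S) : IsAlg (fun i j k l => R i j k l - S i j k l) :=
  ⟨fun i j k l => by linarith [hR.antisymm i j k l, hS.antisymm i j k l],
    fun i j k l => by linarith [hR.pair_symm i j k l, hS.pair_symm i j k l],
    fun i j k l => by linarith [hR.bianchi i j k l, hS.bianchi i j k l]⟩

section Point

variable (h : IsMetric G U) (hx : x ∈ U) (hG : G x = 1) (hA : ∀ i, conn e G i x = 0)

include h hx in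
lemma hessRiem_isAlgCurvature (p m : Fin n) : IsAlg (hessRiem e G x p m) := (isAlgCurvature_dD h.isOpen (fun _ hy =>
  isAlgCurvature_dD h.isOpen (fun _ hz => h.isAlgCurvature hz) h.riem_smooth hy (e m)) (fun i j k l => smooth_dD
    h.isOpen (h.riem_smooth i j k l) _) hx (e p)).sub (slot_isAlgCurvature (h.isAlgCurvature hx) _)

include hG in
lemma riem_eq_curvMat (i j k l : Fin n) : riem e G x i j k l = Ω i j x k l := by rw [riem, hG, one_mul]

include hA in
lemma curvMat_eq (p m : Fin n) : Ω p m x = mD (e p) (∇ m) x - mD (e m) (∇ p) x := by rw [curvMat, hA, hA]; simp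

include h hx hA in
lemma mD_metric (i : Fin n) : mD (e i) G x = 0 := by rw [h.compat hx, hA]; simp

include h hx hG hA in
lemma mD_mD_metric (p m : Fin n) : mD (e p) (mD (e m) G) x = (mD (e p) (∇ m) x)ᵀ + mD (e p) (∇ m) x := by
  have hs := h.conn_smooth (e := e) m
  rw [mD_congr h.isOpen hx (fun y hy => h.compat hy m), mD_add h.isOpen hx (hs.transpose.mul h.smooth) (h.smooth.mul
    hs), mD_mul h.isOpen hx hs.transpose h.smooth, mD_mul h.isOpen hx h.smooth hs, mD_metric h hx hA, hG, mD_transpose]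
  simp

include h hx hG hA in
lemma hessRiem_eq (p m i j k l : Fin n) : hessRiem e G x p m i j k l = (mD (e p) (mD (e m) (Ω i j)) x + mD (e p) (∇ m) x
      * Ω i j x - Ω i j x * mD (e p) (∇ m) x) k l - ∑ q, (mD (e p) (∇ m) x q i * riem e G x q j k l + mD (e p) (∇ m) x q
        j * riem e G x i q k l) := by
  have ho := h.isOpen
  have hs := h.conn_smooth (e := e) m
  have hW := h.curvMat_smooth (e := e) i j
  have h1 : dD (e p) (dD (e m) (fun y => riem e G y i j k l)) x = mD (e p) (mD (e m) (fun y => G y * Ω i j y)) x k l :=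
      rfl
  rw [hessRiem, h1, mD_congr ho hx (fun y hy => mD_mul ho hy h.smooth hW (e m)), mD_add ho hx ((h.smooth.mD ho _).mul
    hW) (h.smooth.mul (hW.mD ho _)), mD_mul ho hx (h.smooth.mD ho _) hW, mD_mul ho hx h.smooth (hW.mD ho _), mD_metric h
    hx hA, mD_metric h hx hA, mD_mD_metric h hx hG hA, hG, slot]
  simp only [Matrix.add_apply, Matrix.sub_apply, add_zero, one_mul, mul_apply, Matrix.add_apply, transpose_apply,
    riem_eq_curvMat hG, Matrix.zero_apply, zero_mul, add_mul, sum_add_distrib]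
  have : ∑ q, mD (e p) (∇ m) x q l * Ω i j x k q = ∑ q, Ω i j x k q * mD (e p) (∇ m) x q l := sum_ext fun q => mul_comm
    _ _
  rw [this]
  ring

include h hx hG hA in
lemma hessRiem_bianchi (p m i j k l : Fin n) : hessRiem e G x p m i j k l
    + hessRiem e G x p i j m k l + hessRiem e G x p j m i k l = 0 := by
  have ho := h.isOpen
  have hs := fun m => h.conn_smooth (e := e) m
  have hW := fun i j => h.curvMat_smooth (e := e) i j
  have hB := mD_congr ho hx (fun y hy => second_bianchi (e := e) ho hy hs m i j) (e p)
  have hc : ∀ m i j, MSmooth (fun y => ∇ m y * Ω i j y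
      - Ω i j y * ∇ m y) U := fun m i j =>
    ((hs m).mul (hW i j)).sub ((hW i j).mul (hs m))
  have ht : ∀ m i j, MSmooth (fun y => mD (e m) (Ω i j) y
      + (∇ m y * Ω i j y
      - Ω i j y * ∇ m y)) U := fun m i j =>
    ((hW i j).mD ho _).add (hc m i j)
  have hd : ∀ m i j, mD (e p) (fun y => mD (e m) (Ω i j) y
      + (∇ m y * Ω i j y
      - Ω i j y * ∇ m y)) x
      = mD (e p) (mD (e m) (Ω i j)) x
      + mD (e p) (∇ m) x * Ω i j x
      - Ω i j x * mD (e p) (∇ m) x := by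
    intro m i j
    rw [mD_add ho hx ((hW i j).mD ho _) (hc m i j),
      mD_sub ho hx ((hs m).mul (hW i j)) ((hW i j).mul (hs m)),
      mD_mul ho hx (hs m) (hW i j), mD_mul ho hx (hW i j) (hs m), hA m]
    simp [add_sub_assoc]
  rw [mD_add ho hx ((ht m i j).add (ht i j m)) (ht j m i),
    mD_add ho hx (ht m i j) (ht i j m), hd, hd, hd, mD_const] at hB
  have hB' := congr_fun₂ hB k l
  simp only [Matrix.add_apply _ _ k l, Matrix.zero_apply] at hB'
  rw [hessRiem_eq h hx hG hA, hessRiem_eq h hx hG hA, hessRiem_eq h hx hG hA]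
  have sym : ∀ m i q, mD (e p) (∇ m) x q i = mD (e p) (∇ i) x q m :=
    fun m i q => dD_congr ho (fun y hy => h.conn_symm hy m i q) hx _
  have hz : ∑ q, (mD (e p) (∇ m) x q i * riem e G x q j k l
        + mD (e p) (∇ m) x q j * riem e G x i q k l)
      + ∑ q, (mD (e p) (∇ i) x q j * riem e G x q m k l
        + mD (e p) (∇ i) x q m * riem e G x j q k l)
      + ∑ q, (mD (e p) (∇ j) x q m * riem e G x q i k l
        + mD (e p) (∇ j) x q i * riem e G x m q k l) = 0 := by
    rw [← sum_add_distrib, ← sum_add_distrib]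
    refine sum_eq_zero fun q _ => ?_
    rw [sym i m, sym j m, sym j i, riem_antisymm' j q, riem_antisymm' i q, riem_antisymm' m q]
    ring
  linarith

include h hx hG hA in
lemma hessRiem_comm (p m i j k l : Fin n) : hessRiem e G x p m i j k l - hessRiem e G x m p i j k l = - slot (of fun q s
    => riem e G x p m q s) (riem e G x) i j k l := by
  have : (of fun q s => riem e G x p m q s) = mD (e p) (∇ m) x - mD (e m) (∇ p) x := by
    rw [← curvMat_eq hA]
    ext q s
    exact riem_eq_curvMat hG p m q s
  rw [this, slot_sub, hessRiem, hessRiem, dD_comm h.isOpen (h.riem_smooth i j k l) hx (e p)]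
  ring

include hG in
lemma ric_eq_ricci : ric e G x = ricci (riem e G x) := by
  ext i j
  simp [ric, ricci, hG, Matrix.one_apply]

include h hx hG hA in
lemma hess_ric (p m i j : Fin n) : dD (e p) (dD (e m) (fun y => ric e G y i j)) x - ∑ q, (mD (e p) (∇ m) x q i * ric e G
    x q j + ric e G x i q * mD (e p) (∇ m) x q j) = ∑ q, hessRiem e G x p m i q j q := by
  have ho := h.isOpen
  set α := mD (e p) (∇ m) x with hα
  have hI := h.inv_smooth
  have hR := h.riem_smooth (e := e)
  have hGI := fun y hy => mul_nonsing_inv _ (h.det y hy)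
  have hI1 : ∀ v, mD v (fun y => (G y)⁻¹) x = - mD v G x := fun v => by
    have := mD_congr ho hx hGI v
    rw [mD_mul ho hx h.smooth hI, mD_const, hG] at this
    simp only [inv_one, mul_one, one_mul] at this
    exact eq_neg_of_add_eq_zero_right this
  have hI2 : mD (e p) (mD (e m) (fun y => (G y)⁻¹)) x = - (αᵀ + α) := by
    have h1 := mD_congr ho hx (fun y hy => mD_congr ho hy hGI (e m)) (e p)
    rw [mD_congr ho hx (fun y hy => mD_mul ho hy h.smooth hI (e m)), mD_add ho hx ((h.smooth.mD ho _).mul hI)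
      (h.smooth.mul (hI.mD ho _)), mD_mul ho hx (h.smooth.mD ho _) hI, mD_mul ho hx h.smooth (hI.mD ho _), mD_mD_metric
      h hx hG hA, mD_metric h hx hA, mD_metric h hx hA, hG] at h1
    have h0 : mD (e p) (mD (e m) (fun _ : X => (1 : Mℝ n))) x = 0 := by
      rw [show mD (e m) (fun _ : X => (1 : Mℝ n)) = fun _ => 0 from funext fun y => mD_const _ _ _, mD_const]
    rw [h0] at h1
    simp only [inv_one, mul_one, one_mul, zero_mul, add_zero, zero_add] at h1
    exact eq_neg_of_add_eq_zero_right h1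
  have hI0 : (G x)⁻¹ = 1 := by rw [hG, inv_one]
  have e1 : ∀ y ∈ U, dD (e m) (fun y => ric e G y i j) y = ∑ k, ∑ l, (mD (e m) (fun y => (G y)⁻¹) y k l * riem e G y i k
      j l + (G y)⁻¹ k l * dD (e m) (fun y => riem e G y i k j l) y) := fun y hy => by
    have dI := fun k l => smooth_diffAt ho (hI k l) hy
    have dR := fun i j k l => smooth_diffAt ho (hR i j k l) hy
    simp only [ric, of_apply]
    rw [dD_sum fun k _ => DifferentiableAt.fun_sum fun l _ => (dI k l).fun_mul (dR i k j l)]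
    refine sum_ext fun k => ?_
    rw [dD_sum fun l _ => (dI k l).fun_mul (dR i k j l)]
    exact sum_ext fun l => dD_mul (dI k l) (dR i k j l) _
  have e2 : dD (e p) (dD (e m) (fun y => ric e G y i j)) x = ∑ k, ∑ l, (-(αᵀ + α) k l * riem e G x i k j l + (1 : Mℝ n)
      k l * dD (e p) (dD (e m) (fun y => riem e G y i k j l)) x) := by
    rw [dD_congr ho e1 hx]
    have dI := fun k l => smooth_diffAt ho (hI k l) hx
    have dR := fun i j k l => smooth_diffAt ho (hR i j k l) hx
    have dI' := fun k l => smooth_diffAt ho (hI.mD ho (e m) k l) hx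
    have dR' := fun i j k l => smooth_diffAt ho (smooth_dD ho (hR i j k l) (e m)) hx
    rw [dD_sum fun k _ => DifferentiableAt.fun_sum fun l _ => ((dI' k l).fun_mul (dR i k j l)).fun_add ((dI k l).fun_mul
      (dR' i k j l))]
    refine sum_ext fun k => ?_
    rw [dD_sum fun l _ => ((dI' k l).fun_mul (dR i k j l)).fun_add ((dI k l).fun_mul (dR' i k j l))]
    refine sum_ext fun l => ?_
    rw [dD_add ((dI' k l).fun_mul (dR i k j l)) ((dI k l).fun_mul (dR' i k j l)), dD_mul (dI' k l) (dR i k j l), dD_mul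
      (dI k l) (dR' i k j l), ← mD_apply, hI2, ← mD_apply (e p) (fun y => (G y)⁻¹), hI1, hI1, mD_metric h hx hA,
      mD_metric h hx hA]
    simp only [hI0]
    simp
  rw [e2, ric_eq_ricci hG]
  simp only [hessRiem, sum_sub_distrib, sum_add_distrib, slot]
  have z1 : ∑ k, ∑ l, (1 : Mℝ n) k l * dD (e p) (dD (e m) (fun y => riem e G y i k j l)) x = ∑ k, dD (e p) (dD (e m)
      (fun y => riem e G y i k j k)) x := by simp [Matrix.one_apply]
  have z2 : ∑ k, ∑ l, -(αᵀ + α) k l * riem e G x i k j l = - (∑ k, ∑ q, α q k * riem e G x i q j k) - ∑ k, ∑ q, α q k *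
      riem e G x i k j q := by
    rw [← sum_neg_distrib, sub_eq_add_neg, ← sum_neg_distrib, sum_comm]
    have : ∀ k l, -(αᵀ + α) k l * riem e G x i k j l = -(α l k * riem e G x i k j l) + -(α k l * riem e G x i k j l) :=
        fun k l => by
      simp only [Matrix.add_apply, transpose_apply]
      ring
    simp only [this, sum_add_distrib, sum_neg_distrib]
    rw [add_comm]
    congr 2
    exact sum_comm
  have z3 : ∑ q, α q i * ricci (riem e G x) q j = ∑ k, ∑ q, α q i * riem e G x q k j k := by
    simp only [ricci, of_apply, mul_sum]
    exact sum_comm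
  have z4 : ∑ q, ricci (riem e G x) i q * α q j = ∑ k, ∑ q, α q j * riem e G x i k q k := by
    simp only [ricci, of_apply, sum_mul]
    rw [sum_comm]
    exact sum_ext fun q => sum_ext fun k => mul_comm _ _
  rw [z1, z2, z3, z4, ← hα]
  ring

end Point
end Jets

section Evolution

variable {e : Fin n → X} {G : X → Mℝ n} {U : Set X} {x : X} (h : IsMetric G U) (hx : x ∈ U) (hG : G x = 1) (hA : ∀ i,
  conn e G i x = 0) {τ : X} (hτ : ∀ y ∈ U, mD τ G y = (-2 : ℝ) • ric e G y)

local notation "∇" => conn e G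
local notation "Ω" => curvMat e (conn e G)

include h hx hG hA hτ

lemma dD_conn_variation (i j k l : Fin n) {c : Tℝ n} (hc : ∀ p m i j, c p m i j = -2 * ∑ q, hessRiem e G x p m i q j q)
    : mD (e j) (mD τ (∇ i)) x k l = (1 / 2) * (c j i l k + c j l i k - c j k i l) := by
  have ho := h.isOpen
  have hs := fun i => h.conn_smooth (e := e) i
  have hric := h.ric_smooth (e := e)
  have hH := h.smooth.mD ho τ
  set b : Fin n → Mℝ n := fun i => mD (e j) (mD τ (∇ i)) x with hb
  have sym : ∀ i k l, b i k l = b l k i := fun i k l => dD_congr ho (fun y hy => dD_congr ho (fun z hz => h.conn_symm hz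
    i l k) hy _) hx _
  have e1 : ∀ i, ∀ y ∈ U, mD (e i) (mD τ G) y = ((mD τ (∇ i) y)ᵀ * G y + (∇ i y)ᵀ * mD τ G y) + (mD τ G y * ∇ i y + G y
        * mD τ (∇ i) y) := fun i y hy => by rw [mD_comm ho hy h.smooth, mD_congr ho hy (fun z hz => h.compat hz i),
      mD_add ho hy ((hs i).transpose.mul h.smooth) (h.smooth.mul (hs i)),
      mD_mul ho hy (hs i).transpose h.smooth, mD_mul ho hy h.smooth (hs i), mD_transpose]
  have e2 : ∀ i, mD (e j) (mD (e i) (mD τ G)) x = ((b i)ᵀ + (mD (e j) (∇ i) x)ᵀ * mD τ G x) + (mD τ G x * mD (e j) (∇ i)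
      x + b i) := fun i => by
    have ha := (hs i).mD ho τ
    rw [mD_congr ho hx (e1 i), mD_add ho hx ((ha.transpose.mul h.smooth).add ((hs i).transpose.mul hH)) ((hH.mul (hs
      i)).add (h.smooth.mul ha)), mD_add ho hx (ha.transpose.mul h.smooth) ((hs i).transpose.mul hH), mD_add ho hx
      (hH.mul (hs i)) (h.smooth.mul ha), mD_mul ho hx ha.transpose h.smooth, mD_mul ho hx (hs i).transpose hH, mD_mul ho
      hx hH (hs i), mD_mul ho hx h.smooth ha, mD_metric h hx hA, hA, hG, mD_transpose, mD_transpose]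
    simp [hb]
  have e3 : ∀ i a b, dD (e j) (dD (e i) (fun y => mD τ G y a b)) x = -2 * dD (e j) (dD (e i) (fun y => ric e G y a b)) x
      := fun i a b => by
    have : ∀ y ∈ U, dD (e i) (fun y => mD τ G y a b) y = -2 * dD (e i) (fun y => ric e G y a b) y := fun y hy => by
      rw [← dD_const_mul (smooth_diffAt ho (hric a b) hy)]
      exact dD_congr ho (fun z hz => by rw [hτ z hz]; rfl) hy _
    rw [dD_congr ho this hx, dD_const_mul (smooth_diffAt ho (smooth_dD ho (hric a b) _) hx)]
  have e4 : ∀ i a d, c j i a d = b i d a + b i a d := by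
    intro i a d
    have h1 := congr_fun₂ (e2 i) a d
    have h2 : mD (e j) (mD (e i) (mD τ G)) x a d = dD (e j) (dD (e i) (fun y => mD τ G y a d)) x := rfl
    rw [h2, e3, hτ x hx] at h1
    simp only [Matrix.add_apply, transpose_apply, mul_apply, Matrix.smul_apply, smul_eq_mul] at h1
    rw [hc, ← hess_ric h hx hG hA, sum_add_distrib]
    have p1 : ∑ q, mD (e j) (∇ i) x q a * (-2 * ric e G x q d) = -2 * ∑ q, mD (e j) (∇ i) x q a * ric e G x q d := by
      rw [mul_sum]
      exact sum_ext fun q => by ring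
    have p2 : ∑ q, -2 * ric e G x a q * mD (e j) (∇ i) x q d = -2 * ∑ q, ric e G x a q * mD (e j) (∇ i) x q d := by
      rw [mul_sum]
      exact sum_ext fun q => by ring
    rw [p1, p2] at h1
    linarith
  change b i k l = _
  rw [e4, e4, e4]
  linarith [sym i k l, sym l i k, sym k l i, sym i l k]

lemma riem_evolution (i j k l : Fin n) : dD τ (fun y => riem e G y i j k l) x - ∑ m, hessRiem e G x m m i j k l = quad
      (riem e G x) i j k l - slot (ricci (riem e G x)) (riem e G x) i j k l := by
  have ho := h.isOpen
  set c : Tℝ n := fun p m i j => -2 * ∑ q, hessRiem e G x p m i q j q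
  have hc : ∀ p m i j, c p m i j = -2 * ∑ q, hessRiem e G x p m i q j q := fun _ _ _ _ => rfl
  rw [← evolution_algebra (h.isAlgCurvature hx) (hessRiem_isAlgCurvature h hx) (hessRiem_bianchi h hx hG hA)
    (hessRiem_comm h hx hG hA) hc]
  congr 1
  have hs := fun i => h.conn_smooth (e := e) i
  have h1 : dD τ (fun y => riem e G y i j k l) x = mD τ (fun y => G y * Ω i j y) x k l := rfl
  have h2 : mD τ (Ω i j) x = mD (e i) (mD τ (∇ j)) x - mD (e j) (mD τ (∇ i)) x := by
    have d := fun i j => (hs j).mD ho (e i)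
    rw [show Ω i j = fun y => (mD (e i) (∇ j) y - mD (e j) (∇ i) y) + (∇ i y * ∇ j y - ∇ j y * ∇ i y) from rfl, mD_add
      ho hx ((d i j).sub (d j i)) (((hs i).mul (hs j)).sub ((hs j).mul (hs i))), mD_sub ho hx (d i j) (d j i), mD_sub ho
      hx ((hs i).mul (hs j)) ((hs j).mul (hs i)), mD_mul ho hx (hs i) (hs j), mD_mul ho hx (hs j) (hs i), hA, hA,
      mD_comm ho hx (hs j) τ, mD_comm ho hx (hs i) τ]
    simp
  rw [h1, mD_mul ho hx h.smooth (h.curvMat_smooth i j), hG, h2, hτ x hx, ric_eq_ricci hG, Matrix.add_apply, one_mul, Matrix.sub_apply, dD_conn_variation h hx hG hA hτ j i k l hc, dD_conn_variation h hx hG hA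
    hτ i j k l hc, smul_mul, Matrix.smul_apply, mul_apply, smul_eq_mul]
  simp only [riem_eq_curvMat hG]
  ring

omit h hx hG hA hτ

lemma dD_dD_sum_mul {ι : Type*} [Fintype ι] [DecidableEq ι] {f g : ι → X → ℝ} (hU : IsOpen U) (hx : x ∈ U) (hf : ∀ i, C∞
    (f i) U) (hg : ∀ i, C∞ (g i) U) {a : ι} (ha : ∀ i, g i x = if i = a then 1 else 0) {v : X} (hv : ∀ i, dD v (g i) x =
    0) : dD v (dD v (fun y => ∑ i, f i y * g i y)) x = dD v (dD v (f a)) x + ∑ i, f i x * dD v (dD v (g i)) x := by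
  have h1 : ∀ y ∈ U, dD v (fun y => ∑ i, f i y * g i y) y = ∑ i, (dD v (f i) y * g i y + f i y * dD v (g i) y) := fun y
      hy => by
    have df := fun i => smooth_diffAt hU (hf i) hy
    have dg := fun i => smooth_diffAt hU (hg i) hy
    rw [dD_sum fun i _ => (df i).fun_mul (dg i)]
    exact sum_ext fun i => dD_mul (df i) (dg i) _
  have df := fun i => smooth_diffAt hU (hf i) hx
  have dg := fun i => smooth_diffAt hU (hg i) hx
  have df' := fun i => smooth_diffAt hU (smooth_dD hU (hf i) v) hx
  have dg' := fun i => smooth_diffAt hU (smooth_dD hU (hg i) v) hx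
  rw [dD_congr hU h1 hx, dD_sum fun i _ => ((df' i).fun_mul (dg i)).fun_add ((df i).fun_mul (dg' i))]
  have h2 : ∀ i, dD v (fun y => dD v (f i) y * g i y + f i y * dD v (g i) y) x = dD v (dD v (f i)) x * (if i = a then 1
      else 0) + f i x * dD v (dD v (g i)) x := fun i => by
    rw [dD_add ((df' i).fun_mul (dg i)) ((df i).fun_mul (dg' i)), dD_mul (df' i) (dg i), dD_mul (df i) (dg' i), hv, ha]
    ring
  simp [h2, sum_add_distrib]

lemma dD_sum_mul {ι : Type*} [Fintype ι] [DecidableEq ι] {f g : ι → X → ℝ} (hU : IsOpen U) (hx : x ∈ U) (hf : ∀ i, C∞ (f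
    i) U) (hg : ∀ i, C∞ (g i) U) {a : ι} (ha : ∀ i, g i x = if i = a then 1 else 0) (v : X) : dD v (fun y => ∑ i, f i y
    * g i y) x = dD v (f a) x + ∑ i, f i x * dD v (g i) x := by
  have df := fun i => smooth_diffAt hU (hf i) hx
  have dg := fun i => smooth_diffAt hU (hg i) hx
  rw [dD_sum fun i _ => (df i).fun_mul (dg i)]
  have h2 : ∀ i, dD v (fun y => f i y * g i y) x = dD v (f i) x * (if i = a then 1 else 0) + f i x * dD v (g i) x := fun
      i => by rw [dD_mul (df i) (dg i), ha]
  simp [h2, sum_add_distrib]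

def heat (e : Fin n → X) (τ : X) (f : X → ℝ) (x : X) : ℝ := dD τ f x - ∑ m, dD (e m) (dD (e m) f) x

lemma heat_sum_mul {ι : Type*} [Fintype ι] [DecidableEq ι] {f g : ι → X → ℝ} (hU : IsOpen U) (hx : x ∈ U) (hf : ∀ i, C∞
    (f i) U) (hg : ∀ i, C∞ (g i) U) {a : ι} (ha : ∀ i, g i x = if i = a then 1 else 0) (hv : ∀ m i, dD (e m) (g i) x =
    0) : heat e τ (fun y => ∑ i, f i y * g i y) x = heat e τ (f a) x + ∑ i, f i x * heat e τ (g i) x := by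
  simp only [heat]
  rw [dD_sum_mul hU hx hf hg ha]
  simp only [dD_dD_sum_mul hU hx hf hg ha (hv _), sum_add_distrib, mul_sub, sum_sub_distrib, mul_sum]
  rw [sum_comm]
  ring

lemma heat_inFrame {R : X → Tℝ n} (hU : IsOpen U) (hx : x ∈ U) (hR : ∀ i j k l, C∞ (fun y => R y i j k l) U) {E : X → Mℝ
    n} (hE : MSmooth E U) (hE1 : E x = 1) (hE2 : ∀ m, mD (e m) E x = 0) (a b c d : Fin n) : heat e τ (fun y => inFrame
    (R y) (E y) a b c d) x = heat e τ (fun y => R y a b c d) x + slot (of fun i j => heat e τ (fun y => E y i j) x) (R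
        x) a b c d := by
  have hg1 : ∀ a i, (fun y => E y i a) x = if i = a then 1 else 0 := by
    intro a i
    simp [hE1, Matrix.one_apply]
  have hg2 : ∀ a m i, dD (e m) (fun y => E y i a) x = 0 := by
    intro a m i
    rw [← mD_apply, hE2]; rfl
  have key : ∀ (F : Fin n → X → ℝ) (_ : ∀ i, C∞ (F i) U) (a : Fin n), heat e τ (fun y => ∑ i, F i y * E y i a) x = heat
      e τ (F a) x + ∑ i, F i x * heat e τ (fun y => E y i a) x := fun F hF a => heat_sum_mul hU hx hF (fun i => hE i a)
    (hg1 a) (hg2 a)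
  have sm : ∀ (F : Fin n → X → ℝ) (_ : ∀ i, C∞ (F i) U) (a : Fin n), C∞ (fun y => ∑ i, F i y * E y i a) U := fun F hF a
      =>
    ContDiffOn.sum fun i _ => (hF i).mul (hE i a)
  have val : ∀ (F : Fin n → ℝ) (a : Fin n), ∑ i, F i * E x i a = F a := fun F a => by simp [hE1, Matrix.one_apply]
  have form : (fun y => inFrame (R y) (E y) a b c d) = fun y => ∑ l, (∑ k, (∑ j, (∑ i, R y i j k l * E y i a) * E y j b)
      * E y k c) * E y l d := by
    funext y
    simp only [inFrame, sum_mul]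
    calc _ = ∑ i, ∑ l, ∑ j, ∑ k, R y i j k l * E y i a * E y j b * E y k c * E y l d := by
            refine sum_ext fun i => ?_
            rw [sum_ext fun j => sum_comm, sum_comm]
      _ = ∑ l, ∑ i, ∑ k, ∑ j, R y i j k l * E y i a * E y j b * E y k c * E y l d := by
            rw [sum_comm]
            exact sum_ext fun l => sum_ext fun i => sum_comm
      _ = ∑ l, ∑ k, ∑ j, ∑ i, R y i j k l * E y i a * E y j b * E y k c * E y l d := by
            refine sum_ext fun l => ?_
            rw [sum_comm]
            exact sum_ext fun k => sum_comm
  have s1 := fun j k l => sm (fun i y => R y i j k l) (fun i => hR i j k l) a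
  have s2 := fun k l => sm (fun j y => ∑ i, R y i j k l * E y i a) (fun j => s1 j k l) b
  rw [form, key _ (fun l => sm (fun k y => ∑ j, (∑ i, R y i j k l * E y i a) * E y j b) (fun k => s2 k l) c), key _ fun k => s2 k d, key _ fun j => s1 j c d, key _ fun i => hR i b c d]
  simp only [val, slot, of_apply, sum_add_distrib, mul_comm (R _ _ _ _ _) (heat _ _ _ _)]
  ring

include h hx hG hA hτ in
lemma frame_evolution {E : X → Mℝ n} (hE : MSmooth E U) (hE1 : E x = 1) (hE2 : ∀ m, mD (e m) E x = 0) (hEG : ∀ y ∈ U, (E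
    y)ᵀ * G y * E y = 1) {Z : Mℝ n} (hZ : Z = mD τ E x - ∑ m, mD (e m) (mD (e m) E) x - ∑ m, mD (e m) (∇ m) x - ric e G
      x) : Zᵀ = -Z ∧ ∀ a b c d, heat e τ (fun y => inFrame (riem e G y) (E y) a b c d) x = quad (riem e G x) a b c d +
      slot Z (riem e G x) a b c d := by
  have ho := h.isOpen
  constructor
  · have hGE := h.smooth.mul hE
    have f1 : ∀ v, ∀ y ∈ U, mD v (fun y => (E y)ᵀ * G y * E y) y = (mD v E y)ᵀ * (G y * E y) + (E y)ᵀ * (mD v G y * E y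
        + G y * mD v E y) := fun v y hy => by
      rw [show (fun y => (E y)ᵀ * G y * E y) = fun y => (E y)ᵀ * (G y * E y) from
        funext fun y => mul_assoc _ _ _, mD_mul ho hy hE.transpose hGE, mD_mul ho hy h.smooth hE, mD_transpose]
    have f0 : ∀ v, ∀ y ∈ U, mD v (fun y => (E y)ᵀ * G y * E y) y = 0 := fun v y hy => by
      rw [mD_congr ho hy hEG, mD_const]
    have g1 : (mD τ E x)ᵀ + mD τ E x = (2 : ℝ) • ric e G x := by
      have := f0 τ x hx
      rw [f1 τ x hx, hE1, hG, hτ x hx] at this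
      simp only [mul_one, transpose_one, one_mul] at this
      rw [add_left_comm] at this
      rw [eq_neg_of_add_eq_zero_right this, neg_smul, neg_neg]
    have g2 : ∀ m, (mD (e m) (mD (e m) E) x)ᵀ + mD (e m) (mD (e m) E) x = -((mD (e m) (∇ m) x)ᵀ + mD (e m) (∇ m) x) :=
        fun m => by
      have d1 := hE.mD ho (e m)
      have d2 := h.smooth.mD ho (e m)
      have := mD_congr ho hx (fun y hy => (f1 (e m) y hy).symm.trans (f0 (e m) y hy)) (e m)
      rw [mD_const, mD_add ho hx (d1.transpose.mul hGE) (hE.transpose.mul ((d2.mul hE).add (h.smooth.mul d1))), mD_mul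
        ho hx d1.transpose hGE, mD_mul ho hx hE.transpose ((d2.mul hE).add (h.smooth.mul d1)), mD_add ho hx (d2.mul hE)
        (h.smooth.mul d1), mD_mul ho hx d2 hE, mD_mul ho hx h.smooth d1, mD_transpose, mD_transpose, hE1, hG, hE2,
        mD_mD_metric h hx hG hA, mD_metric h hx hA] at this
      simp only [mul_one, transpose_one, transpose_zero, one_mul, zero_mul, mul_zero, add_zero, zero_add] at this
      rw [add_left_comm] at this
      rw [eq_neg_of_add_eq_zero_right this]
    have g3 : (ric e G x)ᵀ = ric e G x := by rw [ric_eq_ricci hG, (h.isAlgCurvature hx).ricci_symm]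
    have g2' := sum_congr rfl fun m (_ : m ∈ Finset.univ) => g2 m
    rw [sum_neg_distrib, sum_add_distrib, sum_add_distrib] at g2'
    rw [hZ, transpose_sub, transpose_sub, transpose_sub, transpose_sum, transpose_sum, g3]
    rw [eq_sub_of_add_eq g1, eq_sub_of_add_eq g2', two_smul]
    abel
  · intro a b c d
    rw [heat_inFrame ho hx h.riem_smooth hE hE1 hE2]
    have h1 := riem_evolution h hx hG hA hτ a b c d
    have h2 : ∑ m, hessRiem e G x m m a b c d = ∑ m, dD (e m) (dD (e m) (fun y => riem e G y a b c d)) x - slot (∑ m, mD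
          (e m) (∇ m) x) (riem e G x) a b c d := by
      simp only [hessRiem, sum_sub_distrib]
      congr 1
      simp only [slot, Matrix.sum_apply]
      rw [sum_comm]
      simp only [sum_add_distrib, sum_mul]
    have h3 : (of fun i j => heat e τ (fun y => E y i j) x) = mD τ E x - ∑ m, mD (e m) (mD (e m) E) x := by
      ext i j
      simp only [of_apply, heat, Matrix.sub_apply, Matrix.sum_apply]
      rfl
    rw [h3, hZ, ric_eq_ricci hG]
    simp only [slot_sub]
    rw [h2] at h1
    simp only [heat]
    linarith

end Evolution

/-- A `4`-tensor as a bilinear form on matrices. -/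
def asMat (R : Tℝ n) : Matrix (Fin n × Fin n) (Fin n × Fin n) ℝ := of fun a b => R a.1 a.2 b.1 b.2

lemma asMat_inFrame (R : Tℝ n) (E : Mℝ n) : asMat (inFrame R E) = (E ⊗ₖ E)ᵀ * asMat R * (E ⊗ₖ E) := by
  ext ⟨a, b⟩ ⟨c, d⟩
  simp only [asMat, of_apply, mul_apply, sum_prod_type, inFrame, transpose_apply, kroneckerMap_apply, sum_mul]
  calc _ = ∑ i, ∑ k, ∑ l, ∑ j, R i j k l * E i a * E j b * E k c * E l d := by
          refine sum_ext fun i => ?_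
          rw [sum_comm]
          exact sum_ext fun k => sum_comm
    _ = ∑ k, ∑ l, ∑ i, ∑ j, R i j k l * E i a * E j b * E k c * E l d := by
          rw [sum_comm]
          exact sum_ext fun k => sum_comm
    _ = _ := by
          refine sum_ext fun k => sum_ext fun l => sum_ext fun i => sum_ext fun j => ?_
          ring

lemma asMat_injective : Function.Injective (asMat (n := n)) := by
  intro R S hRS
  funext i j k l
  exact congr_fun₂ hRS (i, j) (k, l)

lemma inFrame_inFrame (R : Tℝ n) (E F : Mℝ n) : inFrame (inFrame R E) F = inFrame R (E * F) := by
  apply asMat_injective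
  rw [asMat_inFrame, asMat_inFrame, asMat_inFrame, mul_kronecker_mul]
  simp only [transpose_mul, mul_assoc]

lemma inFrame_one (R : Tℝ n) : inFrame R 1 = R := by
  apply asMat_injective
  rw [asMat_inFrame, one_kronecker_one]
  simp

lemma frobenius_conj (W R J : Mℝ n) : ∑ k, ∑ l, W k l * (Jᵀ * R * J) k l = ∑ b, ∑ d, (J * W * Jᵀ) b d * R b d := by
  have tr : ∀ A B : Mℝ n, ∑ k, ∑ l, A k l * B k l = (A * Bᵀ).trace := by
    intro A B
    simp [trace, mul_apply]
  rw [tr, tr]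
  calc (W * (Jᵀ * R * J)ᵀ).trace = ((W * Jᵀ * Rᵀ) * J).trace := by
        simp only [transpose_mul, transpose_transpose, mul_assoc]
    _ = (J * (W * Jᵀ * Rᵀ)).trace := trace_mul_comm _ _
    _ = (J * W * Jᵀ * Rᵀ).trace := by simp only [mul_assoc]

lemma contract_inFrame (R : Tℝ n) (E W : Mℝ n) (i j : Fin n) : ∑ k, ∑ l, W k l * inFrame R E i k j l = ∑ a, ∑ c, E a i *
      E c j * ∑ b, ∑ d, (E * W * Eᵀ) b d * R a b c d := by
  have h1 : ∀ k l, inFrame R E i k j l = ∑ a, ∑ c, E a i * E c j * (Eᵀ * (of fun b d => R a b c d) * E) k l := fun k l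
      => by
    simp only [inFrame, mul_apply, transpose_apply, of_apply, sum_mul, mul_sum]
    refine sum_ext fun a => ?_
    rw [sum_comm]
    refine sum_ext fun c => ?_
    rw [sum_comm]
    refine sum_ext fun d => sum_ext fun b => ?_
    ring
  have h2 : ∀ a c, ∑ b, ∑ d, (E * W * Eᵀ) b d * R a b c d = ∑ k, ∑ l, W k l * (Eᵀ * (of fun b d => R a b c d) * E) k l
      := fun a c => (frobenius_conj W (of fun b d => R a b c d) E).symm
  simp only [h1, h2]
  simp only [mul_sum]
  calc _ = ∑ k, ∑ a, ∑ l, ∑ c, W k l * (E a i * E c j * (Eᵀ * (of fun b d => R a b c d) * E) k l) :=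
        sum_ext fun k => sum_comm
    _ = ∑ a, ∑ k, ∑ c, ∑ l, W k l * (E a i * E c j * (Eᵀ * (of fun b d => R a b c d) * E) k l) := by
        rw [sum_comm]
        exact sum_ext fun k => sum_ext fun l => sum_comm
    _ = ∑ a, ∑ c, ∑ k, ∑ l, W k l * (E a i * E c j * (Eᵀ * (of fun b d => R a b c d) * E) k l) := sum_ext fun k =>
        sum_comm
    _ = _ := by
        refine sum_ext fun _ => sum_ext fun _ => sum_ext fun _ => sum_ext fun _ => ?_
        ring

section CoordinateChange

variable {X X' : Type*} [NormedAddCommGroup X] [NormedSpace ℝ X] [NormedAddCommGroup X'] [NormedSpace ℝ X']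

/-- A smooth map `Ψ : V → U` whose derivative maps the directions `e` to combinations of the
directions `e'`, with invertible Jacobian matrix `J`. -/
structure CoordChange (e : Fin n → X) (e' : Fin n → X') (V : Set X) (U : Set X') (Ψ : X → X') (J : X → Mℝ n) : Prop
    where
  isOpen : IsOpen V
  isOpen' : IsOpen U
  mapsTo : ∀ z ∈ V, Ψ z ∈ U
  smooth : C∞ Ψ V
  smooth_jac : MSmooth J V
  fderiv : ∀ z ∈ V, ∀ i, fderiv ℝ Ψ z (e i) = ∑ a, J z a i • e' a
  symm : ∀ z ∈ V, ∀ i j a, dD (e j) (fun y => J y a i) z = dD (e i) (fun y => J y a j) z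
  det : ∀ z ∈ V, IsUnit (J z).det

variable {e : Fin n → X} {e' : Fin n → X'} {V : Set X} {U : Set X'} {Ψ : X → X'} {J : X → Mℝ n} (hΨ : CoordChange e e' V
  U Ψ J) {G : X' → Mℝ n} (hG : IsMetric G U) {z : X} (hz : z ∈ V)

/-- The pullback of a metric under a coordinate change. -/
def pullMetric (J : X → Mℝ n) (Ψ : X → X') (G : X' → Mℝ n) (z : X) : Mℝ n := (J z)ᵀ * (G (Ψ z) * J z)

include hΨ

lemma CoordChange.comp_smooth {f : X' → ℝ} (hf : C∞ f U) : C∞ (fun z => f (Ψ z)) V := hf.comp hΨ.smooth hΨ.mapsTo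

lemma CoordChange.comp_msmooth {M : X' → Mℝ n} (hM : MSmooth M U) : MSmooth (fun z => M (Ψ z)) V := fun a b =>
    hΨ.comp_smooth (hM a b)

include hz in
lemma CoordChange.dD_comp' {f : X' → ℝ} (hf : C∞ f U) (v : X) : dD v (fun z => f (Ψ z)) z = dD (_root_.fderiv ℝ Ψ z v) f
    (Ψ z) := by
  have h2 := (hΨ.smooth.contDiffAt (hΨ.isOpen.mem_nhds hz)).differentiableAt (by simp)
  simp only [dD]
  rw [show (fun z => f (Ψ z)) = f ∘ Ψ from rfl, fderiv_comp z (smooth_diffAt hΨ.isOpen' hf (hΨ.mapsTo z hz)) h2]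
  rfl

include hz in
lemma CoordChange.dD_comp {f : X' → ℝ} (hf : C∞ f U) (i : Fin n) : dD (e i) (fun z => f (Ψ z)) z = ∑ a, J z a i * dD (e'
    a) f (Ψ z) := by
  rw [hΨ.dD_comp' hz hf, hΨ.fderiv z hz]
  simp [dD]

include hz in
lemma CoordChange.mD_comp {M : X' → Mℝ n} (hM : MSmooth M U) (i : Fin n) : mD (e i) (fun z => M (Ψ z)) z = ∑ a, J z a i
    • mD (e' a) M (Ψ z) := by
  ext a b
  rw [mD_apply, hΨ.dD_comp hz (hM a b), Matrix.sum_apply]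
  rfl

def pullConn (e' : Fin n → X') (J : X → Mℝ n) (Ψ : X → X') (G : X' → Mℝ n) (i : Fin n) (z : X) : Mℝ n := ∑ a, J z a i •
  conn e' G a (Ψ z)

include hG

lemma CoordChange.isMetricOn : IsMetric (pullMetric J Ψ G) V where
  isOpen := hΨ.isOpen
  smooth := hΨ.smooth_jac.transpose.mul ((hΨ.comp_msmooth hG.smooth).mul hΨ.smooth_jac)
  symm z hz := by simp only [pullMetric, transpose_mul, transpose_transpose, hG.symm _ (hΨ.mapsTo z hz), mul_assoc]
  det z hz := by
    simp only [pullMetric, det_mul, det_transpose]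
    exact (hΨ.det z hz).mul ((hG.det _ (hΨ.mapsTo z hz)).mul (hΨ.det z hz))

lemma CoordChange.pullConn_smooth (i : Fin n) : MSmooth (pullConn e' J Ψ G i) V := MSmooth.sum fun a _ => MSmooth.smul
  (hΨ.smooth_jac a i) (hΨ.comp_msmooth (hG.conn_smooth a))

include hz

lemma CoordChange.conn_eq (i : Fin n) : conn e (pullMetric J Ψ G) i z = (J z)⁻¹ * (mD (e i) J z + pullConn e' J Ψ G i z
    * J z) := by
  have hz' := hΨ.mapsTo z hz
  refine (hΨ.isMetricOn hG).conn_unique hz (B := fun i => (J z)⁻¹ * (mD (e i) J z + pullConn e' J Ψ G i z * J z)) ?_ ?_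
    i
  · have hK : ∀ i j a, (mD (e i) J z + pullConn e' J Ψ G i z * J z) a j = (mD (e j) J z + pullConn e' J Ψ G j z * J z) a
        i := fun i j a => by
      rw [Matrix.add_apply, Matrix.add_apply, mD_apply, mD_apply, hΨ.symm z hz]
      congr 1
      simp only [pullConn, mul_apply, Matrix.sum_apply, Matrix.smul_apply, smul_eq_mul, Finset.sum_mul]
      rw [sum_comm]
      refine sum_ext fun c => sum_ext fun b => ?_
      rw [hG.conn_symm hz']
      ring
    intro i j k
    rw [mul_apply, mul_apply]
    exact sum_ext fun a => by rw [hK i j]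
  · intro i
    have h1 : mD (e i) (fun z => G (Ψ z)) z = (pullConn e' J Ψ G i z)ᵀ * G (Ψ z) + G (Ψ z) * pullConn e' J Ψ G i z := by
      rw [hΨ.mD_comp hz hG.smooth]
      simp only [hG.compat hz', pullConn, Matrix.transpose_sum, Matrix.transpose_smul, Finset.sum_mul, Finset.mul_sum,
        smul_add, sum_add_distrib, Matrix.smul_mul, Matrix.mul_smul]
    have hGs := hΨ.comp_msmooth hG.smooth
    have h2 : mD (e i) (pullMetric J Ψ G) z = (mD (e i) J z)ᵀ * (G (Ψ z) * J z) + (J z)ᵀ * (mD (e i) (fun z => G (Ψ z))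
        z * J z + G (Ψ z) * mD (e i) J z) := by rw [show pullMetric J Ψ G = fun z => (J z)ᵀ * (G (Ψ z) * J z) from rfl,
        mD_mul hΨ.isOpen hz hΨ.smooth_jac.transpose (hGs.mul hΨ.smooth_jac),
        mD_mul hΨ.isOpen hz hGs hΨ.smooth_jac, mD_transpose]
    set K := mD (e i) J z + pullConn e' J Ψ G i z * J z with hK
    have h3 : ((J z)⁻¹ * K)ᵀ * pullMetric J Ψ G z = Kᵀ * (G (Ψ z) * J z) := by
      rw [pullMetric, ← mul_assoc, ← Matrix.transpose_mul, Matrix.mul_nonsing_inv_cancel_left _ _ (hΨ.det z hz)]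
    have h4 : pullMetric J Ψ G z * ((J z)⁻¹ * K) = (J z)ᵀ * (G (Ψ z) * K) := by rw [pullMetric, mul_assoc, mul_assoc,
        Matrix.mul_nonsing_inv_cancel_left _ _ (hΨ.det z hz)]
    rw [h2, h1, h3, h4, hK, Matrix.transpose_add, Matrix.transpose_mul]
    noncomm_ring

lemma CoordChange.jac_mul_conn (i : Fin n) : J z * conn e (pullMetric J Ψ G) i z = mD (e i) J z + pullConn e' J Ψ G i z
    * J z := by rw [hΨ.conn_eq hG hz, mul_nonsing_inv_cancel_left _ _ (hΨ.det z hz)]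

lemma CoordChange.jac_mul_curvMat (i j : Fin n) : J z * curvMat e (conn e (pullMetric J Ψ G)) i j z = (∑ a, ∑ b, (J z a
      i * J z b j) • curvMat e' (conn e' G) a b (Ψ z)) * J z := by
  have ho := hΨ.isOpen
  have hM := hΨ.isMetricOn hG
  have hz' := hΨ.mapsTo z hz
  set A := conn e (pullMetric J Ψ G) with hA
  set B := pullConn e' J Ψ G with hB
  have hAs : ∀ i, MSmooth (A i) V := fun i => hM.conn_smooth i
  have hBs : ∀ i, MSmooth (B i) V := fun i => hΨ.pullConn_smooth hG i
  have hJ := hΨ.smooth_jac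
  have d : ∀ i j, mD (e j) J z * A i z + J z * mD (e j) (A i) z = mD (e j) (mD (e i) J) z + (mD (e j) (B i) z * J z + B
      i z * mD (e j) J z) := by
    intro i j
    have := mD_congr ho hz (fun y hy => hΨ.jac_mul_conn hG hy i) (e j)
    rwa [mD_mul ho hz hJ (hAs i), mD_add ho hz (hJ.mD ho _) ((hBs i).mul hJ), mD_mul ho hz (hBs i) hJ] at this
  have dB : ∀ i j, mD (e j) (B i) z = ∑ a, (dD (e j) (fun y => J y a i) z • conn e' G a (Ψ z) + J z a i • ∑ b, J z b j •
      mD (e' b) (conn e' G a) (Ψ z)) := by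
    intro i j
    rw [hB, show pullConn e' J Ψ G i = fun y => ∑ a, J y a i • conn e' G a (Ψ y) from rfl, mD_sum ho hz fun a _ =>
      MSmooth.smul (hJ a i) (hΨ.comp_msmooth (hG.conn_smooth a))]
    refine sum_ext fun a => ?_
    rw [mD_smul ho hz (hJ a i) (hΨ.comp_msmooth (hG.conn_smooth a)), hΨ.mD_comp hz (hG.conn_smooth a)]
  have hc : mD (e i) (B j) z - mD (e j) (B i) z + (B i z * B j z - B j z * B i z) = ∑ a, ∑ b, (J z a i * J z b j) •
      curvMat e' (conn e' G) a b (Ψ z) := by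
    have t1 : mD (e i) (B j) z - mD (e j) (B i) z = ∑ a, ∑ b, (J z a i * J z b j) • (mD (e' a) (conn e' G b) (Ψ z) - mD
        (e' b) (conn e' G a) (Ψ z)) := by
      rw [dB, dB, sum_add_distrib, sum_add_distrib]
      simp only [hΨ.symm z hz i j, add_sub_add_left_eq_sub, smul_sub, sum_sub_distrib, Finset.smul_sum, smul_smul]
      rw [sum_comm]
      simp only [mul_comm (J z _ j)]
    have t2 : B i z * B j z - B j z * B i z = ∑ a, ∑ b, (J z a i * J z b j) • (conn e' G a (Ψ z) * conn e' G b (Ψ z) -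
        conn e' G b (Ψ z) * conn e' G a (Ψ z)) := by
      simp only [hB, pullConn, Finset.sum_mul, Finset.mul_sum, Matrix.smul_mul, Matrix.mul_smul, smul_smul, smul_sub,
        sum_sub_distrib]
      congr 1
      · rw [sum_comm]
        simp only [mul_comm (J z _ j)]
    rw [t1, t2, ← sum_add_distrib]
    refine sum_ext fun a => ?_
    rw [← sum_add_distrib]
    exact sum_ext fun b => (smul_add _ _ _).symm
  rw [← hc]
  have ci := hΨ.jac_mul_conn hG hz i
  have cj := hΨ.jac_mul_conn hG hz j
  have d2 := d i j
  rw [mD_comm ho hz hJ] at d2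
  have e1 := eq_sub_of_add_eq' (d j i)
  have e2 := eq_sub_of_add_eq' d2
  have e3 : J z * curvMat e A i j z = J z * mD (e i) (A j) z - J z * mD (e j) (A i) z + (J z * A i z) * A j z - (J z * A
      j z) * A i z := by simp only [curvMat]; noncomm_ring
  have e4 : B i z * J z * A j z = B i z * mD (e j) J z + B i z * B j z * J z := by rw [mul_assoc, hA, cj]; noncomm_ring
  have e5 : B j z * J z * A i z = B j z * mD (e i) J z + B j z * B i z * J z := by rw [mul_assoc, hA, ci]; noncomm_ring
  rw [e3, e1, e2, hA, ci, cj, ← hA, add_mul, add_mul, e4, e5]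
  noncomm_ring

lemma CoordChange.riem_eq : riem e (pullMetric J Ψ G) z = inFrame (riem e' G (Ψ z)) (J z) := by
  funext i j k l
  have h1 : riem e (pullMetric J Ψ G) z i j k l = ((J z)ᵀ * (G (Ψ z) * (∑ a, ∑ b, (J z a i * J z b j) • curvMat e' (conn
      e' G) a b (Ψ z))) * J z) k l := by rw [riem, pullMetric, mul_assoc, mul_assoc, hΨ.jac_mul_curvMat hG hz,
      mul_assoc, mul_assoc]
  rw [h1]
  simp only [Matrix.mul_sum, Matrix.mul_smul, Matrix.sum_mul, Matrix.smul_mul, Matrix.sum_apply, Matrix.smul_apply,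
    inFrame, riem]
  refine sum_ext fun a => sum_ext fun b => ?_
  generalize G (Ψ z) * curvMat e' (conn e' G) a b (Ψ z) = Q
  simp only [mul_apply, Matrix.transpose_apply, smul_eq_mul, Finset.sum_mul, Finset.mul_sum]
  rw [sum_comm]
  refine sum_ext fun _ => sum_ext fun _ => ?_
  ring

omit hG in
lemma CoordChange.jac_inv_metric : J z * (pullMetric J Ψ G z)⁻¹ * (J z)ᵀ = (G (Ψ z))⁻¹ := by
  have hJ := hΨ.det z hz
  have hJt : IsUnit ((J z)ᵀ).det := by rwa [det_transpose]
  rw [pullMetric, Matrix.mul_inv_rev, Matrix.mul_inv_rev]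
  simp only [← mul_assoc]
  rw [mul_nonsing_inv _ hJ, one_mul, mul_assoc, nonsing_inv_mul _ hJt, mul_one]

lemma CoordChange.ric_eq : ric e (pullMetric J Ψ G) z = (J z)ᵀ * (ric e' G (Ψ z) * J z) := by
  ext i j
  have h1 : ric e (pullMetric J Ψ G) z i j = ∑ k, ∑ l, (pullMetric J Ψ G z)⁻¹ k l * inFrame (riem e' G (Ψ z)) (J z) i k
      j l := by rw [← hΨ.riem_eq hG hz]; rfl
  rw [h1, contract_inFrame, hΨ.jac_inv_metric hz]
  simp only [mul_apply, transpose_apply, ric, of_apply, mul_sum, sum_mul]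
  refine sum_ext fun a => sum_ext fun c => sum_ext fun b => sum_ext fun d => ?_
  ring

lemma CoordChange.flow {τ : X} {τ' : X'} (hτ : _root_.fderiv ℝ Ψ z τ = τ') (hJ : mD τ J z = 0) (hf : mD τ' G (Ψ z) = (-2
    : ℝ) • ric e' G (Ψ z)) : mD τ (pullMetric J Ψ G) z = (-2 : ℝ) • ric e (pullMetric J Ψ G) z := by
  have hGs := hΨ.comp_msmooth hG.smooth
  rw [show pullMetric J Ψ G = fun z => (J z)ᵀ * (G (Ψ z) * J z) from rfl, mD_mul hΨ.isOpen hz hΨ.smooth_jac.transpose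
    (hGs.mul hΨ.smooth_jac), mD_mul hΨ.isOpen hz hGs hΨ.smooth_jac, mD_transpose, hJ]
  have : mD τ (fun z => G (Ψ z)) z = mD τ' G (Ψ z) := by
    ext a b
    rw [mD_apply, hΨ.dD_comp' hz (hG.smooth a b), hτ]
    rfl
  rw [this, hf, show (fun z => (J z)ᵀ * (G (Ψ z) * J z)) = pullMetric J Ψ G from rfl, hΨ.ric_eq hG hz]
  simp

lemma CoordChange.laplace_eq (h1 : pullMetric J Ψ G z = 1) (h0 : ∀ i, conn e (pullMetric J Ψ G) i z = 0) {f : X' → ℝ}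
    (hf : C∞ f U) : ∑ m, dD (e m) (dD (e m) (fun y => f (Ψ y))) z = ∑ i, ∑ j, (G (Ψ z))⁻¹ i j * (dD (e' i) (dD (e' j) f)
      (Ψ z) - ∑ k, conn e' G i (Ψ z) k j * dD (e' k) f (Ψ z)) := by
  have hJ : ∀ i a j, dD (e i) (fun y => J y a j) z = - ∑ b, ∑ c, J z b i * conn e' G b (Ψ z) a c * J z c j := fun i a j
      => by
    have := hΨ.jac_mul_conn hG hz i
    rw [h0, mul_zero] at this
    have h2 := congr_fun₂ this a j
    rw [Matrix.zero_apply, Matrix.add_apply, mD_apply] at h2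
    rw [eq_neg_of_add_eq_zero_left h2.symm]
    congr 1
    simp only [pullConn, mul_apply, Matrix.sum_apply, Matrix.smul_apply, smul_eq_mul, sum_mul]
    exact sum_comm
  have hd : ∀ m, dD (e m) (dD (e m) (fun y => f (Ψ y))) z = ∑ i, ∑ j, J z i m * J z j m * (dD (e' i) (dD (e' j) f) (Ψ z)
      - ∑ k, conn e' G i (Ψ z) k j * dD (e' k) f (Ψ z)) := fun m => by
    have df := fun a => smooth_dD hΨ.isOpen' hf (e' a)
    have d1 := fun a => smooth_diffAt hΨ.isOpen (hΨ.smooth_jac a m) hz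
    have d2 := fun a => smooth_diffAt hΨ.isOpen (hΨ.comp_smooth (df a)) hz
    rw [dD_congr hΨ.isOpen (fun y hy => hΨ.dD_comp hy hf m) hz, dD_sum fun a _ => (d1 a).fun_mul (d2 a)]
    have t : ∀ a, dD (e m) (fun y => J y a m * dD (e' a) f (Ψ y)) z = (- ∑ b, ∑ c, J z b m * conn e' G b (Ψ z) a c * J z
        c m) * dD (e' a) f (Ψ z) + J z a m * ∑ b, J z b m * dD (e' b) (dD (e' a) f) (Ψ z) := fun a => by
      rw [dD_mul (d1 a) (d2 a), hJ, hΨ.dD_comp hz (df a)]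
    simp only [t, sum_add_distrib, mul_sub, sum_sub_distrib, mul_sum]
    rw [add_comm, sub_eq_add_neg]
    congr 1
    · rw [sum_comm]
      refine sum_ext fun _ => sum_ext fun _ => ?_
      ring
    · simp only [neg_mul, sum_neg_distrib, sum_mul]
      rw [sum_comm]
      congr 1
      refine sum_ext fun b => ?_
      rw [sum_comm]
      refine sum_ext fun _ => sum_ext fun _ => ?_
      ring
  have hGi : ∀ i j, (G (Ψ z))⁻¹ i j = ∑ m, J z i m * J z j m := fun i j => by
    rw [← hΨ.jac_inv_metric hz, h1]
    simp [mul_apply]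
  simp only [hd, hGi, sum_mul]
  rw [sum_comm]
  exact sum_ext fun i => sum_comm

lemma CoordChange.parallel {K : X' → Mℝ n} (hK : MSmooth K U) (hp : ∀ i, mD (e' i) K (Ψ z) + (conn e' G i (Ψ z) * K (Ψ
    z) - K (Ψ z) * conn e' G i (Ψ z)) = 0) (i : Fin n) : mD (e i) (fun y => (J y)⁻¹ * (K (Ψ y) * J y)) z + (conn e
      (pullMetric J Ψ G) i z * ((J z)⁻¹ * (K (Ψ z) * J z)) - (J z)⁻¹ * (K (Ψ z) * J z) * conn e (pullMetric J Ψ G) i z)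
        = 0 := by
  have hJ := hΨ.smooth_jac
  have hJi := hJ.inv hΨ.det
  have hKs := hΨ.comp_msmooth hK
  set K' := fun y => (J y)⁻¹ * (K (Ψ y) * J y) with hK'
  have hK's := hJi.mul (hKs.mul hJ)
  have h1 : ∀ y ∈ V, J y * K' y = K (Ψ y) * J y := fun y hy => Matrix.mul_nonsing_inv_cancel_left _ _ (hΨ.det y hy)
  have h2 := mD_congr hΨ.isOpen hz h1 (e i)
  rw [mD_mul hΨ.isOpen hz hJ hK's, mD_mul hΨ.isOpen hz hKs hJ, hΨ.mD_comp hz hK] at h2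
  have h3 : ∑ a, J z a i • mD (e' a) K (Ψ z) = K (Ψ z) * pullConn e' J Ψ G i z - pullConn e' J Ψ G i z * K (Ψ z) := by
    simp only [pullConn, Finset.mul_sum, Finset.sum_mul, Matrix.mul_smul, Matrix.smul_mul, ← sum_sub_distrib, ←
      smul_sub]
    refine sum_ext fun a => ?_
    rw [eq_neg_of_add_eq_zero_left (hp a), neg_sub]
  have h4 := hΨ.jac_mul_conn hG hz i
  set A := conn e (pullMetric J Ψ G) i z
  set B := pullConn e' J Ψ G i z
  have h5 : J z * (mD (e i) K' z + (A * K' z - K' z * A)) = 0 := by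
    have e1 := eq_sub_of_add_eq' h2
    have e2 : J z * (A * K' z) = mD (e i) J z * K' z + B * (K (Ψ z) * J z) := by
      rw [← mul_assoc, h4, Matrix.add_mul, mul_assoc B, h1 z hz]
    have e3 : J z * (K' z * A) = K (Ψ z) * mD (e i) J z + K (Ψ z) * (B * J z) := by
      rw [← mul_assoc, h1 z hz, mul_assoc, h4, Matrix.mul_add]
    rw [Matrix.mul_add, Matrix.mul_sub, e1, e2, e3, h3]
    noncomm_ring
  calc _ = (J z)⁻¹ * (J z * (mD (e i) K' z + (A * K' z - K' z * A))) := by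
        rw [Matrix.nonsing_inv_mul_cancel_left _ _ (hΨ.det z hz)]
    _ = 0 := by rw [h5, Matrix.mul_zero]

end CoordinateChange

open scoped Matrix.Norms.Operator in
lemma exists_matrix_sqrt (n : ℕ) : ∃ (r : Mℝ n → Mℝ n) (W O : Set Mℝ n), IsOpen W ∧ 1 ∈ W ∧ IsOpen O ∧ 1 ∈ O ∧ r 1 = 1 ∧
      (∀ M ∈ W, r M ∈ O ∧ r M * r M = M) ∧ InjOn (fun M => M * M) O ∧ ContinuousOn r W ∧ C∞ r W := by
  let f : Mℝ n → Mℝ n := fun M => M * M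
  let L : Mℝ n ≃L[ℝ] Mℝ n := ContinuousLinearEquiv.smulLeft (Units.mk0 (2 : ℝ) two_ne_zero)
  have hf : ContDiffAt ℝ ω f 1 := contDiffAt_id.mul contDiffAt_id
  have hf' : HasFDerivAt f (L : Mℝ n →L[ℝ] Mℝ n) 1 := by
    have := (hasFDerivAt_id (𝕜 := ℝ) (1 : Mℝ n)).mul' (hasFDerivAt_id 1)
    refine this.congr_fderiv ?_
    ext1 M
    change 1 * M + M * 1 = (2 : ℝ) • M
    rw [one_mul, mul_one, two_smul]
  have hω : (ω : WithTop ℕ∞) ≠ 0 := by simp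
  let Φ := hf.toOpenPartialHomeomorph f hf' hω
  have h1 : f 1 = 1 := one_mul 1
  have hr := hf.to_localInverse hf' hω
  rw [h1] at hr
  have hev := hr.eventually (by simp)
  obtain ⟨W, hW, hWo, hW1⟩ := eventually_nhds_iff.1 hev
  have ht : (1 : Mℝ n) ∈ Φ.target := by
    have := hf.image_mem_toOpenPartialHomeomorph_target hf' hω
    rwa [h1] at this
  have hd : C∞ Φ.symm (W ∩ Φ.target) := fun M hM => ((hW M hM.1).of_le le_top).contDiffWithinAt
  refine ⟨Φ.symm, W ∩ Φ.target, Φ.source, hWo.inter Φ.open_target, ⟨hW1, ht⟩, Φ.open_source,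
    hf.mem_toOpenPartialHomeomorph_source hf' hω, ?_, fun M hM => ⟨Φ.map_target hM.2, Φ.right_inv hM.2⟩, Φ.injOn,
      hd.continuousOn, hd⟩
  have := hf.localInverse_apply_image hf' hω
  rwa [h1] at this

open scoped Matrix.Norms.Operator in
lemma MSmooth.comp_contDiffOn {H : X → Mℝ n} {U : Set X} (hH : MSmooth H U) {r : Mℝ n → Mℝ n} {W : Set Mℝ n} (hr : C∞ r
    W) (hm : ∀ x ∈ U, H x ∈ W) : MSmooth (fun x => r (H x)) U := by
  have h1 : C∞ H U := by
    have : H = fun x => ∑ i, ∑ j, H x i j • single i j (1 : ℝ) := by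
      funext x
      conv_lhs => rw [matrix_eq_sum_single (H x)]
      refine sum_ext fun i => sum_ext fun j => ?_
      rw [smul_single, smul_eq_mul, mul_one]
    rw [this]
    exact ContDiffOn.sum fun i _ => ContDiffOn.sum fun j _ => (hH i j).smul contDiffOn_const
  intro a b
  exact (LinearMap.toContinuousLinearMap (entryLinearMap ℝ ℝ a b)).contDiff.comp_contDiffOn (hr.comp h1 hm)

lemma MSmooth.continuousOn {H : X → Mℝ n} {U : Set X} (hH : MSmooth H U) : ContinuousOn H U := continuousOn_pi.2 fun i
  => continuousOn_pi.2 fun j => (hH i j).continuousOn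

lemma exists_inv_sqrt {H : X → Mℝ n} {U : Set X} (hU : IsOpen U) (hH : MSmooth H U) {x : X} (hx : x ∈ U) (hHx : H x = 1)
    (hsym : ∀ y ∈ U, (H y)ᵀ = H y) {c : Mℝ n → Mℝ n} (hc : Continuous c) (hc1 : c 1 = 1) (hcm : ∀ M, c (M * M) = c M * c
    M) (hcH : ∀ y ∈ U, c (H y) = H y) : ∃ (V : Set X) (S : X → Mℝ n), IsOpen V ∧ x ∈ V ∧ V ⊆ U ∧ MSmooth S V ∧ S x = 1 ∧
      (∀ y ∈ V, (S y)ᵀ = S y) ∧ (∀ y ∈ V, S y * H y * S y = 1) ∧ ∀ y ∈ V, ∃ r, c r = r ∧ S y = r⁻¹ := by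
  obtain ⟨r, W, O, hW, hW1, hO, hO1, hr1, hr, hinj, hrc, hrs⟩ := exists_matrix_sqrt n
  have key : ∀ d : Mℝ n → Mℝ n, Continuous d → d 1 = 1 → (∀ M, d (M * M) = d M * d M) → ∃ W' ⊆ W, IsOpen W' ∧ 1 ∈ W' ∧ ∀
        M ∈ W', d M = M → d (r M) = r M := by
    intro d hd hd1 hdm
    refine ⟨W ∩ (fun M => d (r M)) ⁻¹' O, inter_subset_left, (hd.comp_continuousOn hrc).isOpen_inter_preimage hW hO,
      ⟨hW1, ?_⟩, ?_⟩
    · simpa [hr1, hd1] using hO1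
    · intro M hM hdM
      refine hinj hM.2 (hr M hM.1).1 ?_
      change d (r M) * d (r M) = r M * r M
      rw [← hdm, (hr M hM.1).2, hdM]
  obtain ⟨W1, hW1s, hW1o, hW11, hW1t⟩ := key transpose (continuous_id.matrix_transpose) transpose_one (fun M =>
    transpose_mul M M)
  obtain ⟨W2, hW2s, hW2o, hW21, hW2t⟩ := key c hc hc1 hcm
  have hHc := hH.continuousOn
  set V := U ∩ H ⁻¹' (W1 ∩ W2 ∩ {M | M.det ≠ 0}) with hV
  have hVo : IsOpen V := hHc.isOpen_inter_preimage hU ((hW1o.inter hW2o).inter (isOpen_ne.preimage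
    continuous_id.matrix_det))
  have hdet : ∀ y ∈ V, IsUnit (r (H y)).det := fun y hy => by
    have h1 := (hr (H y) (hW1s hy.2.1.1)).2
    have h2 : (H y).det ≠ 0 := hy.2.2
    rw [← h1, det_mul] at h2
    exact isUnit_iff_ne_zero.2 (left_ne_zero_of_mul h2)
  refine ⟨V, fun y => (r (H y))⁻¹, hVo, ⟨hx, ?_⟩, inter_subset_left, ?_, ?_, ?_, ?_, ?_⟩
  · rw [mem_preimage, hHx]
    exact ⟨⟨hW11, hW21⟩, by simp⟩
  · exact ((hH.mono inter_subset_left).comp_contDiffOn hrs fun y hy => hW1s hy.2.1.1).inv hdet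
  · simp [hHx, hr1]
  · intro y hy
    rw [transpose_nonsing_inv, hW1t _ hy.2.1.1 (hsym y hy.1)]
  · intro y hy
    have h1 := (hr (H y) (hW1s hy.2.1.1)).2
    have h2 := hdet y hy
    change (r (H y))⁻¹ * H y * (r (H y))⁻¹ = 1
    generalize r (H y) = R at h1 h2 ⊢
    rw [← h1, ← mul_assoc, nonsing_inv_mul _ h2, one_mul, mul_nonsing_inv _ h2]
  · intro y hy
    exact ⟨r (H y), hW2t _ hy.2.1.2 (hcH y hy.1), rfl⟩

section SpaceTime

/-- The coordinate directions of space in space-time. -/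
def sDir (i : Fin n) : Sℝ n := (EuclideanSpace.single i 1, 0)

local notation:max "Rm" G:max E:max y:max => inFrame (riem sDir G y) (E y)

def tDir (n : ℕ) : Sℝ n := (0, 1)

lemma dD_coord (v z : Sℝ n) (j : Fin n) : dD v (fun z => z.1 j) z = v.1 j := congrArg (fun L : Sℝ n →L[ℝ] ℝ => L v)
    (((EuclideanSpace.proj j : Eℝ n →L[ℝ] ℝ).comp (ContinuousLinearMap.fst ℝ Eℝ n ℝ)).fderiv)

lemma smooth_coord (j : Fin n) : ContDiff ℝ ∞ (fun z : Sℝ n => z.1 j) := ((EuclideanSpace.proj j : Eℝ n →L[ℝ] ℝ).comp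
    (ContinuousLinearMap.fst ℝ Eℝ n ℝ)).contDiff

lemma sDir_apply (i j : Fin n) : (sDir i).1 j = if j = i then 1 else 0 := by simp [sDir]

lemma sum_smul_sDir (c : Fin n → ℝ) (v : Sℝ n) (h1 : ∀ a, v.1 a = c a) (h2 : v.2 = 0) : v = ∑ a, c a • sDir a := by
  have e : (∑ a, c a • sDir a).1 = ∑ a, c a • (sDir a).1 := Prod.fst_sum
  have e' : (∑ a, c a • sDir a).2 = ∑ a, c a • (sDir a).2 := Prod.snd_sum
  refine Prod.ext ?_ ?_
  · rw [e]
    ext a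
    rw [h1]
    simp [sDir_apply]
  · rw [e', h2]
    simp [sDir]

/-- Quadratic coordinates of space-time centred at `y₀`. -/
def quadMap (y₀ : Eℝ n) (B : Mℝ n) (Γ : Fin n → Mℝ n) (z : Sℝ n) : Sℝ n := (WithLp.toLp 2 fun a => y₀ a + ∑ i, B a i *
  z.1 i - (1 / 2) * ∑ b, ∑ c, Γ b a c * ((∑ i, B b i * z.1 i) * (∑ i, B c i * z.1 i)), z.2)

def quadJac (B : Mℝ n) (Γ : Fin n → Mℝ n) (z : Sℝ n) : Mℝ n := B - ∑ b, (∑ i, B b i * z.1 i) • (Γ b * B)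

section QuadMap

variable (y₀ : Eℝ n) (B : Mℝ n) (Γ : Fin n → Mℝ n)

lemma smooth_lin (b : Fin n) : ContDiff ℝ ∞ (fun z : Sℝ n => ∑ i, B b i * z.1 i) := ContDiff.sum fun i _ =>
  contDiff_const.mul (smooth_coord i)

lemma dD_lin (b : Fin n) (v z : Sℝ n) : dD v (fun z => ∑ i, B b i * z.1 i) z = ∑ i, B b i * v.1 i := by
  have d := fun j : Fin n => (smooth_coord j).differentiable (by simp) z
  rw [dD_sum fun i _ => (d i).const_mul _]
  exact sum_ext fun i => by rw [dD_const_mul (d i), dD_coord]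

lemma smooth_quadMap_apply (a : Fin n) : ContDiff ℝ ∞ (fun z => (quadMap y₀ B Γ z).1 a) := (contDiff_const.add
  (smooth_lin B a)).sub (contDiff_const.mul (ContDiff.sum fun b _ => ContDiff.sum fun c _ => contDiff_const.mul
    ((smooth_lin B b).mul (smooth_lin B c))))

lemma smooth_quadMap : ContDiff ℝ ∞ (quadMap y₀ B Γ) := ContDiff.prodMk (contDiff_euclidean.2 fun a =>
  smooth_quadMap_apply y₀ B Γ a) contDiff_snd

lemma fderiv_quadMap_fst (v z : Sℝ n) (a : Fin n) : (fderiv ℝ (quadMap y₀ B Γ) z v).1 a = dD v (fun z => (quadMap y₀ B Γ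
    z).1 a) z := by
  have := (((EuclideanSpace.proj a : Eℝ n →L[ℝ] ℝ).comp (ContinuousLinearMap.fst ℝ Eℝ n ℝ)).hasFDerivAt).comp z
    (((smooth_quadMap y₀ B Γ).differentiable (by simp) z).hasFDerivAt)
  exact (congrArg (fun L : Sℝ n →L[ℝ] ℝ => L v) this.fderiv).symm

lemma fderiv_quadMap_snd (v z : Sℝ n) : (fderiv ℝ (quadMap y₀ B Γ) z v).2 = v.2 := by
  have h := ((smooth_quadMap y₀ B Γ).differentiable (by simp) z).hasFDerivAt
  have h1 := ((ContinuousLinearMap.snd ℝ Eℝ n ℝ).hasFDerivAt).comp z h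
  have h2 := (ContinuousLinearMap.snd ℝ Eℝ n ℝ).hasFDerivAt (x := z)
  exact congrArg (fun L : Sℝ n →L[ℝ] ℝ => L v) (h1.unique h2)

variable {Γ} (hΓ : ∀ a b c, Γ b a c = Γ c a b)

include hΓ in
lemma dD_quadMap (v z : Sℝ n) (a : Fin n) : dD v (fun z => (quadMap y₀ B Γ z).1 a) z = ∑ i, quadJac B Γ z a i * v.1 i :=
    by
  have d := fun b => (smooth_lin B b).differentiable (by simp) z
  have e1 : dD v (fun z => (quadMap y₀ B Γ z).1 a) z = ∑ i, B a i * v.1 i - (1 / 2) * ∑ b, ∑ c, Γ b a c * ((∑ i, B b i *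
      v.1 i) * (∑ i, B c i * z.1 i) + (∑ i, B b i * z.1 i) * (∑ i, B c i * v.1 i)) := by
    simp only [quadMap]
    rw [dD_sub ((d a).const_add _) ((DifferentiableAt.fun_sum fun b _ => DifferentiableAt.fun_sum fun c _ => ((d
      b).fun_mul (d c)).const_mul _).const_mul _), dD_add (differentiableAt_const _) (d a), dD_const, dD_lin, zero_add,
      dD_const_mul (DifferentiableAt.fun_sum fun b _ => DifferentiableAt.fun_sum fun c _ => ((d b).fun_mul (d
      c)).const_mul _), dD_sum fun b _ => DifferentiableAt.fun_sum fun c _ => ((d b).fun_mul (d c)).const_mul _]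
    congr 2
    refine sum_ext fun b => ?_
    rw [dD_sum fun c _ => ((d b).fun_mul (d c)).const_mul _]
    refine sum_ext fun c => ?_
    rw [dD_const_mul ((d b).fun_mul (d c)), dD_mul (d b) (d c), dD_lin, dD_lin]
  have e2 : ∑ b, ∑ c, Γ b a c * ((∑ i, B b i * v.1 i) * (∑ i, B c i * z.1 i) + (∑ i, B b i * z.1 i) * (∑ i, B c i * v.1
        i)) = 2 * ∑ b, ∑ c, Γ b a c * ((∑ i, B b i * z.1 i) * (∑ i, B c i * v.1 i)) := by
    simp only [mul_add, sum_add_distrib]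
    have : ∑ b, ∑ c, Γ b a c * ((∑ i, B b i * v.1 i) * (∑ i, B c i * z.1 i)) = ∑ b, ∑ c, Γ b a c * ((∑ i, B b i * z.1 i)
        * (∑ i, B c i * v.1 i)) := by
      rw [sum_comm]
      refine sum_ext fun b => sum_ext fun c => ?_
      rw [hΓ a c b]
      ring
    rw [this]; ring
  have e3 : ∑ i, quadJac B Γ z a i * v.1 i = ∑ i, B a i * v.1 i - ∑ b, ∑ c, Γ b a c * ((∑ i, B b i * z.1 i) * (∑ i, B c
      i * v.1 i)) := by
    simp only [quadJac, Matrix.sub_apply, sub_mul, sum_sub_distrib, Matrix.sum_apply, Matrix.smul_apply, smul_eq_mul]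
    congr 1
    calc _ = ∑ b, ∑ i, (∑ i, B b i * z.1 i) * (Γ b * B) a i * v.1 i := by
          rw [sum_comm]
          exact sum_ext fun i => sum_mul _ _ _
      _ = _ := by
          refine sum_ext fun b => ?_
          generalize ∑ i, B b i * z.1 i = w
          simp only [mul_apply, mul_sum, sum_mul]
          rw [sum_comm]
          refine sum_ext fun _ => sum_ext fun _ => ?_
          ring
  rw [e1, e2, e3]; ring

lemma quadJac_smooth (U : Set Sℝ n) : MSmooth (quadJac B Γ) U := (MSmooth.const B).sub (MSmooth.sum fun b _ =>
    MSmooth.smul (smooth_lin B b).contDiffOn (MSmooth.const _))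

lemma mD_quadJac (v z : Sℝ n) : mD v (quadJac B Γ) z = - ∑ b, (∑ i, B b i * v.1 i) • (Γ b * B) := by
  have s : ∀ b, MSmooth (fun z : Sℝ n => (∑ i, B b i * z.1 i) • (Γ b * B)) univ := fun b => MSmooth.smul (smooth_lin B
    b).contDiffOn (MSmooth.const _)
  rw [show quadJac B Γ = fun z => B - ∑ b, (∑ i, B b i * z.1 i) • (Γ b * B) from rfl, mD_sub isOpen_univ (mem_univ z)
    (MSmooth.const B) (MSmooth.sum fun b _ => s b), mD_const, mD_sum isOpen_univ (mem_univ z) fun b _ => s b, zero_sub]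
  congr 1
  refine sum_ext fun b => ?_
  rw [mD_smul isOpen_univ (mem_univ z) (smooth_lin B b).contDiffOn (MSmooth.const _), mD_const, dD_lin, smul_zero,
    add_zero]

include hΓ in
lemma quadMap_isCoordChange {V U : Set Sℝ n} (hV : IsOpen V) (hU : IsOpen U) (hVU : ∀ z ∈ V, quadMap y₀ B Γ z ∈ U) (hdet
    : ∀ z ∈ V, IsUnit (quadJac B Γ z).det) : CoordChange sDir sDir V U (quadMap y₀ B Γ) (quadJac B Γ) where
  isOpen := hV
  isOpen' := hU
  mapsTo := hVU
  smooth := (smooth_quadMap y₀ B Γ).contDiffOn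
  smooth_jac := quadJac_smooth B V
  fderiv z _ i := by
    refine sum_smul_sDir _ _ (fun a => ?_) ?_
    · rw [fderiv_quadMap_fst, dD_quadMap y₀ B hΓ]
      simp [sDir_apply]
    · rw [fderiv_quadMap_snd]; rfl
  symm z _ i j a := by
    have key : ∀ i j, dD (sDir j) (fun y => quadJac B Γ y a i) z = - ∑ b, ∑ c, Γ b a c * B b j * B c i := fun i j => by
      rw [← mD_apply, mD_quadJac]
      simp only [sDir_apply, Matrix.neg_apply, Matrix.sum_apply, Matrix.smul_apply, mul_apply, smul_eq_mul, mul_ite,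
        mul_one, mul_zero, sum_ite_eq', Finset.mem_univ, if_true, mul_sum]
      congr 1
      refine sum_ext fun _ => sum_ext fun _ => ?_
      ring
    rw [key, key, sum_comm]
    congr 1
    refine sum_ext fun b => sum_ext fun c => ?_
    rw [hΓ a c b]; ring
  det := hdet

include hΓ in
lemma fderiv_quadMap_time (z : Sℝ n) : fderiv ℝ (quadMap y₀ B Γ) z (tDir n) = tDir n := by
  refine Prod.ext ?_ ?_
  · ext a
    rw [fderiv_quadMap_fst, dD_quadMap y₀ B hΓ]
    simp [tDir]
  · rw [fderiv_quadMap_snd]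

lemma mD_quadJac_time (z : Sℝ n) : mD (tDir n) (quadJac B Γ) z = 0 := by rw [mD_quadJac]; simp [tDir]

lemma mD_quadJac_space (z : Sℝ n) (i : Fin n) : mD (sDir i) (quadJac B Γ) z = - ∑ b, B b i • (Γ b * B) := by
  rw [mD_quadJac]; simp [sDir_apply]

lemma quadMap_zero (t : ℝ) : quadMap y₀ B Γ (0, t) = (y₀, t) := by
  refine Prod.ext ?_ rfl
  ext a
  simp [quadMap]

lemma quadJac_zero (t : ℝ) : quadJac B Γ (0, t) = B := by simp [quadJac]

end QuadMap

/-- The Laplacian of a function on space-time with respect to the metric `G`. -/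
def laplaceST (G : Sℝ n → Mℝ n) (f : Sℝ n → ℝ) (x : Sℝ n) : ℝ := ∑ i, ∑ j, (G x)⁻¹ i j * (dD (sDir i) (dD (sDir j) f) x
    - ∑ k, conn sDir G i x k j * dD (sDir k) f x)

variable {G : Sℝ n → Mℝ n} {U : Set Sℝ n} {x : Sℝ n}

lemma curvMat_comm_parallel {e : Fin n → X} {G K : X → Mℝ n} {U : Set X} {x : X} (h : IsMetric G U) (hx : x ∈ U) (hK :
    MSmooth K U) (hp : ∀ y ∈ U, ∀ i, mD (e i) K y + (conn e G i y * K y - K y * conn e G i y) = 0) (i j : Fin n) :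
    curvMat e (conn e G) i j x * K x = K x * curvMat e (conn e G) i j x := by
  have hA := fun i => h.conn_smooth (e := e) i
  have h1 : ∀ y ∈ U, ∀ i, mD (e i) K y = K y * conn e G i y - conn e G i y * K y := fun y hy i => by
    rw [eq_neg_of_add_eq_zero_left (hp y hy i), neg_sub]
  have h2 : ∀ i j, mD (e j) (mD (e i) K) x = (mD (e j) K x * conn e G i x + K x * mD (e j) (conn e G i) x) - (mD (e j)
        (conn e G i) x * K x + conn e G i x * mD (e j) K x) := fun i j => by
    rw [mD_congr h.isOpen hx (fun y hy => h1 y hy i), mD_sub h.isOpen hx (hK.mul (hA i))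
      ((hA i).mul hK), mD_mul h.isOpen hx hK (hA i), mD_mul h.isOpen hx (hA i) hK]
  have h3 := mD_comm h.isOpen hx hK (e i) (e j)
  rw [h2, h2, h1 x hx, h1 x hx] at h3
  rw [← sub_eq_zero] at h3 ⊢
  rw [← neg_eq_zero, ← h3]
  simp only [curvMat]
  noncomm_ring

/-- Evolution of the curvature components in an orthonormal frame that is parallel to first order
at the point `x` of space-time. -/
lemma evolution_in_frame (hG : IsMetric G U) (hx : x ∈ U) (hflow : ∀ y ∈ U, mD (tDir n) G y = (-2 : ℝ) • ric sDir G y)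
    {E : Sℝ n → Mℝ n} (hE : MSmooth E U) (hEG : ∀ y ∈ U, (E y)ᵀ * G y * E y = 1) (hpar : ∀ i, mD (sDir i) E x = - (conn
    sDir G i x * E x)) : ∃ Z : Mℝ n, Zᵀ = -Z ∧ (∀ (K : Sℝ n → Mℝ n) (J₀ : Mℝ n), MSmooth K U → (∀ y ∈ U, mD (tDir n) K y
        = 0) → (∀ y ∈ U, ∀ i, mD (sDir i) K y + (conn sDir G i y * K y - K y * conn sDir G i y) = 0) → (∀ y ∈ U, K y * E
        y = E y * J₀) → (ricci (Rm G E x) * J₀ = J₀ * ricci (Rm G E x)) → Z * J₀ = J₀ * Z) ∧ ∀ a b c d, dD (tDir n) (fun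
      y => Rm G E y a b c d) x - laplaceST G (fun y => Rm G E y a b c d) x = quad (Rm G E x) a b c d + slot Z (Rm G E x)
          a b c d := by
  obtain ⟨y₀, t⟩ := x
  set x : Sℝ n := (y₀, t) with hxdef
  set B := E x with hB
  set Γ : Fin n → Mℝ n := fun i => conn sDir G i x with hΓdef
  have hΓ : ∀ a b c, Γ b a c = Γ c a b := fun a b c => hG.conn_symm hx b c a
  set Ψ := quadMap y₀ B Γ with hΨdef
  set J := quadJac B Γ with hJdef
  have hBdet : IsUnit B.det := by
    have := congrArg det (hEG x hx)
    rw [det_mul, det_one] at this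
    exact IsUnit.of_mul_eq_one_right _ this
  have hJc : Continuous fun z => (J z).det := Continuous.matrix_det (continuousOn_univ.1 (quadJac_smooth B
    univ).continuousOn)
  set V : Set Sℝ n := Ψ ⁻¹' U ∩ {z | (J z).det ≠ 0} with hV
  have hVo : IsOpen V := (hG.isOpen.preimage (smooth_quadMap y₀ B Γ).continuous).inter (isOpen_ne.preimage hJc)
  have hΨ : CoordChange sDir sDir V U Ψ J := quadMap_isCoordChange y₀ B hΓ hVo hG.isOpen (fun z hz => hz.1) (fun z hz =>
    isUnit_iff_ne_zero.2 hz.2)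
  set z : Sℝ n := (0, t) with hzdef
  have hΨz : Ψ z = x := quadMap_zero y₀ B t
  have hJz : J z = B := quadJac_zero B t
  have hz : z ∈ V := by
    refine ⟨?_, ?_⟩
    · rw [mem_preimage, hΨz]; exact hx
    · rw [mem_ofPred_eq, hJz]; exact hBdet.ne_zero
  set G' := pullMetric J Ψ G with hG'
  have hM : IsMetric G' V := hΨ.isMetricOn hG
  have hG1 : G' z = 1 := by
    rw [hG', pullMetric, hΨz, hJz, ← mul_assoc]
    exact hEG x hx
  have hA0 : ∀ i, conn sDir G' i z = 0 := by
    intro i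
    rw [hG', hΨ.conn_eq hG hz, hJdef, mD_quadJac_space, pullConn, ← hJdef, hJz, hΨz, sum_mul]
    simp [hΓdef]
  have hflow' : ∀ y ∈ V, mD (tDir n) G' y = (-2 : ℝ) • ric sDir G' y := fun y hy => hΨ.flow hG hy (fderiv_quadMap_time
    y₀ B hΓ y) (mD_quadJac_time B y) (hflow _ (hΨ.mapsTo y hy))
  have hEΨ := hΨ.comp_msmooth hE
  have hJs := hΨ.smooth_jac
  set E' : Sℝ n → Mℝ n := fun y => (J y)⁻¹ * E (Ψ y) with hE'
  have hE's : MSmooth E' V := (hJs.inv hΨ.det).mul hEΨ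
  have hJE : ∀ y ∈ V, J y * E' y = E (Ψ y) := fun y hy => mul_nonsing_inv_cancel_left _ _ (hΨ.det y hy)
  have hE'1 : E' z = 1 := by simp only [hE', hΨz, hJz, ← hB, nonsing_inv_mul _ hBdet]
  have hE'2 : ∀ i, mD (sDir i) E' z = 0 := by
    intro i
    have h1 := mD_congr hVo hz hJE (sDir i)
    rw [mD_mul hVo hz hJs hE's, hΨ.mD_comp hz hE, hE'1, hΨz, hJz, hJdef, mD_quadJac_space] at h1
    simp only [hpar, smul_neg, sum_neg_distrib, mul_one] at h1
    have h2 : B * mD (sDir i) E' z = 0 := by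
      have := add_left_cancel (h1.trans (add_zero _).symm)
      exact this
    rw [← nonsing_inv_mul_cancel_left (A := B) (mD (sDir i) E' z) hBdet, h2, mul_zero]
  have hE'G : ∀ y ∈ V, (E' y)ᵀ * G' y * E' y = 1 := by
    intro y hy
    rw [← hEG _ (hΨ.mapsTo y hy), ← hJE y hy, hG', pullMetric, transpose_mul (J y)]
    simp only [mul_assoc]
  have hframe : ∀ y ∈ V, Rm G' E' y = Rm G E (Ψ y) := by
    intro y hy
    rw [hΨ.riem_eq hG hy, inFrame_inFrame, hJE y hy]
  have hRz : riem sDir G' z = Rm G E x := by rw [← hΨz, ← hframe z hz, hE'1, inFrame_one]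
  obtain ⟨hZ1, hZ2⟩ := frame_evolution hM hz hG1 hA0 hflow' hE's hE'1 hE'2 hE'G rfl
  refine ⟨_, hZ1, ?_, ?_⟩
  · intro K J₀ hK hKt hKp hKE hRJ
    have hKΨ := hΨ.comp_msmooth hK
    set K' : Sℝ n → Mℝ n := fun y => (J y)⁻¹ * (K (Ψ y) * J y) with hK'
    have hK's : MSmooth K' V := (hJs.inv hΨ.det).mul (hKΨ.mul hJs)
    have hK'p : ∀ y ∈ V, ∀ i, mD (sDir i) K' y + (conn sDir G' i y * K' y - K' y * conn sDir G' i y) = 0 := fun y hy i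
        =>
      hΨ.parallel hG hy hK (hKp _ (hΨ.mapsTo y hy)) i
    have hK'E : ∀ y ∈ V, K' y * E' y = E' y * J₀ := by
      intro y hy
      simp only [hK', hE', mul_assoc]
      rw [mul_nonsing_inv_cancel_left _ _ (hΨ.det y hy), hKE _ (hΨ.mapsTo y hy)]
    have hK'z : K' z = J₀ := by
      have := hK'E z hz
      rwa [hE'1, mul_one, one_mul] at this
    have hA := fun i => hM.conn_smooth (e := sDir) i
    have hK'i : ∀ y ∈ V, ∀ i, mD (sDir i) K' y = K' y * conn sDir G' i y - conn sDir G' i y * K' y := by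
      intro y hy i
      rw [eq_neg_of_add_eq_zero_left (hK'p y hy i), neg_sub]
    have hK'0 : ∀ i, mD (sDir i) K' z = 0 := by
      intro i
      rw [hK'i z hz, hA0]; simp
    have k1 : ∀ i, mD (sDir i) (mD (sDir i) K') z = J₀ * mD (sDir i) (conn sDir G' i) z - mD (sDir i) (conn sDir G' i) z
        * J₀ := by
      intro i
      rw [mD_congr hVo hz (fun y hy => hK'i y hy i), mD_sub hVo hz (hK's.mul (hA i)) ((hA i).mul hK's), mD_mul hVo hz
        hK's (hA i), mD_mul hVo hz (hA i) hK's, hK'0, hK'z]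
      simp
    have k2 : ∀ i, mD (sDir i) (mD (sDir i) K') z + J₀ * mD (sDir i) (mD (sDir i) E') z = mD (sDir i) (mD (sDir i) E') z
        * J₀ := by
      intro i
      have f1 : ∀ y ∈ V, mD (sDir i) K' y * E' y + K' y * mD (sDir i) E' y = mD (sDir i) E' y * J₀ := by
        intro y hy
        rw [← mD_mul hVo hy hK's hE's, mD_congr hVo hy hK'E, mD_mul hVo hy hE's (MSmooth.const J₀), mD_const, mul_zero,
          add_zero]
      have f2 := mD_congr hVo hz f1 (sDir i)
      have d1 := hK's.mD hVo (sDir i)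
      have d2 := hE's.mD hVo (sDir i)
      rw [mD_add hVo hz (d1.mul hE's) (hK's.mul d2), mD_mul hVo hz d1 hE's, mD_mul hVo hz hK's d2, mD_mul hVo hz d2
        (MSmooth.const J₀), mD_const, hE'1, hE'2, hK'z] at f2
      simpa using f2
    have k3 : J₀ * mD (tDir n) E' z = mD (tDir n) E' z * J₀ := by
      have f2 := mD_congr hVo hz hK'E (tDir n)
      have f3 : mD (tDir n) K' z = 0 := by
        have g1 : ∀ y ∈ V, J y * K' y = K (Ψ y) * J y := fun y hy => mul_nonsing_inv_cancel_left _ _ (hΨ.det y hy)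
        have g2 := mD_congr hVo hz g1 (tDir n)
        have g3 : mD (tDir n) (fun y => K (Ψ y)) z = 0 := by
          ext a b
          rw [mD_apply, hΨ.dD_comp' hz (hK a b), fderiv_quadMap_time y₀ B hΓ, ← mD_apply, hKt _ (hΨ.mapsTo z hz)]
        rw [mD_mul hVo hz hJs hK's, mD_mul hVo hz hKΨ hJs, g3, hJdef, mD_quadJac_time] at g2
        simp only [zero_mul, zero_add, mul_zero] at g2
        rw [← nonsing_inv_mul_cancel_left (A := quadJac B Γ z) (mD (tDir n) K' z) (hΨ.det z hz), g2, mul_zero]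
      rw [mD_mul hVo hz hK's hE's, mD_mul hVo hz hE's (MSmooth.const J₀), mD_const, f3, hK'z] at f2
      simpa using f2
    have k4 : ric sDir G' z * J₀ = J₀ * ric sDir G' z := by rw [ric_eq_ricci hG1, hRz]; exact hRJ
    have k5 : (∑ m, mD (sDir m) (mD (sDir m) E') z + ∑ m, mD (sDir m) (conn sDir G' m) z) * J₀ = J₀ * (∑ m, mD (sDir m)
        (mD (sDir m) E') z + ∑ m, mD (sDir m) (conn sDir G' m) z) := by
      rw [← sum_add_distrib, sum_mul, mul_sum]
      refine sum_ext fun m => ?_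
      have := k2 m
      rw [k1] at this
      rw [add_mul, mul_add, ← this]
      abel
    have k6 : ∀ P Q S T : Mℝ n, P - Q - S - T = P - (Q + S) - T := by intro P Q S T; abel
    rw [k6, sub_mul, sub_mul, mul_sub, mul_sub, k3, k4, k5]
  · intro a b c d
    have hfs : C∞ (fun y => Rm G E y a b c d) U := ContDiffOn.sum fun i _ => ContDiffOn.sum fun j _ => ContDiffOn.sum
      fun k _ => ContDiffOn.sum fun l _ => ((((hG.riem_smooth i j k l).mul (hE i a)).mul (hE j b)).mul (hE k c)).mul (hE
          l d)
    have hev := hZ2 a b c d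
    rw [hRz] at hev
    rw [← hev, heat]
    have c1 : ∀ y ∈ V, Rm G' E' y a b c d = Rm G E (Ψ y) a b c d := fun y hy => by rw [hframe y hy]
    rw [dD_congr hVo c1 hz]
    have c2 : ∀ m, dD (sDir m) (dD (sDir m) fun y => Rm G' E' y a b c d) z = dD (sDir m) (dD (sDir m) fun y => Rm G E (Ψ
        y) a b c d) z := fun m => dD_congr hVo (fun y hy => dD_congr hVo c1 hy _) hz _
    simp only [c2]
    rw [hΨ.laplace_eq hG hz hG1 hA0 hfs, hΨ.dD_comp' hz hfs, fderiv_quadMap_time y₀ B hΓ, hΨz]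
    rfl

end SpaceTime

local notation:max "Rm" G:max E:max y:max => inFrame (riem sDir G y) (E y)

section Frames

variable {G : Sℝ n → Mℝ n} {U : Set Sℝ n} {x : Sℝ n}

lemma IsMetric.exists_orthonormalization (hG : IsMetric G U) (hx : x ∈ U) {F : Sℝ n → Mℝ n} (hF : MSmooth F U) (hF1 : (F
    x)ᵀ * G x * F x = 1) (hpar : ∀ i, mD (sDir i) F x = -(conn sDir G i x * F x)) {c : Mℝ n → Mℝ n} (hc : Continuous c)
    (hc1 : c 1 = 1) (hcm : ∀ M, c (M * M) = c M * c M) (hcH : ∀ y ∈ U, c ((F y)ᵀ * G y * F y) = (F y)ᵀ * G y * F y) : ∃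
    (V : Set Sℝ n) (S : Sℝ n → Mℝ n), IsOpen V ∧ x ∈ V ∧ V ⊆ U ∧ MSmooth S V ∧ S x = 1 ∧ (∀ y ∈ V, (F y * S y)ᵀ * G y *
      (F y * S y) = 1) ∧ (∀ i, mD (sDir i) (fun y => F y * S y) x = -(conn sDir G i x * F x)) ∧ ∀ y ∈ V, ∃ r, c r = r ∧
      S y = r⁻¹ := by
  have hHs := (hF.transpose.mul hG.smooth).mul hF
  obtain ⟨V, S, hV, hxV, hVU, hS, hS1, hSt, hSH, hSc⟩ := exists_inv_sqrt hG.isOpen hHs hx hF1 (fun y hy => by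
      rw [transpose_mul, transpose_mul, transpose_transpose, hG.symm y hy, mul_assoc]) hc hc1 hcm hcH
  have hSi : ∀ i, mD (sDir i) S x = 0 := fun i => by
    have hH0 : mD (sDir i) (fun y => (F y)ᵀ * G y * F y) x = 0 := by
      rw [mD_mul hG.isOpen hx (hF.transpose.mul hG.smooth) hF, mD_mul hG.isOpen hx hF.transpose hG.smooth, mD_transpose,
        hpar, hG.compat hx]
      simp only [transpose_neg, transpose_mul]
      noncomm_ring
    have h1 := mD_congr hV hxV hSH (sDir i)
    have hH' := hHs.mono hVU
    rw [mD_mul hV hxV (hS.mul hH') hS, mD_mul hV hxV hS hH', hH0, mD_const, hS1, hF1] at h1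
    simp only [mul_one, mul_zero, add_zero, one_mul] at h1
    ext a b
    have := congr_fun₂ h1 a b
    simp only [Matrix.add_apply, Matrix.zero_apply] at this ⊢
    linarith
  refine ⟨V, S, hV, hxV, hVU, hS, hS1, fun y hy => ?_, fun i => ?_, hSc⟩
  · rw [← hSH y hy, transpose_mul, hSt y hy]
    simp only [mul_assoc]
  · rw [mD_mul hV hxV (hF.mono hVU) hS, hSi, hS1, hpar]
    simp

/-- The frame with value `B` at `x` and covariant derivative zero at `x`, affine in the space
variables. -/
def affineFrame (G : Sℝ n → Mℝ n) (x : Sℝ n) (B : Mℝ n) (y : Sℝ n) : Mℝ n := B - ∑ i, (y.1 i - x.1 i) • (conn sDir G i x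
  * B)

lemma affineFrame_self (B : Mℝ n) : affineFrame G x B x = B := by simp [affineFrame]

lemma affineFrame_smooth (B : Mℝ n) (U : Set Sℝ n) : MSmooth (affineFrame G x B) U := (MSmooth.const B).sub (MSmooth.sum
  fun i _ => MSmooth.smul ((smooth_coord i).sub contDiff_const).contDiffOn (MSmooth.const _))

lemma mD_affineFrame (B : Mℝ n) (i : Fin n) (y : Sℝ n) : mD (sDir i) (affineFrame G x B) y = -(conn sDir G i x * B) :=
    by
  have s : ∀ i, ContDiff ℝ ∞ (fun y : Sℝ n => y.1 i - x.1 i) := fun i => (smooth_coord i).sub contDiff_const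
  have s' : ∀ i, MSmooth (fun y : Sℝ n => (y.1 i - x.1 i) • (conn sDir G i x * B)) univ := fun i => MSmooth.smul (s
    i).contDiffOn (MSmooth.const _)
  rw [show affineFrame G x B = fun y => B - ∑ i, (y.1 i - x.1 i) • (conn sDir G i x * B) from rfl, mD_sub isOpen_univ
    (mem_univ y) (MSmooth.const B) (MSmooth.sum fun i _ => s' i), mD_const, mD_sum isOpen_univ (mem_univ y) fun i _ =>
    s' i, zero_sub]
  congr 1
  rw [sum_eq_single i]
  · rw [mD_smul isOpen_univ (mem_univ y) (s i).contDiffOn (MSmooth.const _), mD_const, smul_zero, add_zero, dD_sub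
      ((smooth_coord i).differentiable (by simp) y) (differentiableAt_const _), dD_coord, dD_const, sDir_apply]
    simp
  · intro j _ hj
    rw [mD_smul isOpen_univ (mem_univ y) (s j).contDiffOn (MSmooth.const _), mD_const, smul_zero, add_zero, dD_sub
      ((smooth_coord j).differentiable (by simp) y) (differentiableAt_const _), dD_coord, dD_const, sDir_apply]
    simp [hj]
  · simp

lemma IsMetric.exists_frame (hG : IsMetric G U) (hx : x ∈ U) {B : Mℝ n} (hB : Bᵀ * G x * B = 1) : ∃ (V : Set Sℝ n) (E :
      Sℝ n → Mℝ n), IsOpen V ∧ x ∈ V ∧ V ⊆ U ∧ MSmooth E V ∧ E x = B ∧ (∀ y ∈ V, (E y)ᵀ * G y * E y = 1) ∧ ∀ i, mD (sDir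
      i) E x = -(conn sDir G i x * E x) := by
  have hF := affineFrame_smooth (G := G) (x := x) B U
  obtain ⟨V, S, hV, hxV, hVU, hS, hS1, h1, h2, -⟩ := hG.exists_orthonormalization hx hF (by rw [affineFrame_self, hB])
    (fun i => by rw [mD_affineFrame, affineFrame_self]) continuous_id rfl (fun _ => rfl) (fun _ _ => rfl)
  have hE : affineFrame G x B x * S x = B := by rw [hS1, affineFrame_self, mul_one]
  refine ⟨V, fun y => affineFrame G x B y * S y, hV, hxV, hVU, (hF.mono hVU).mul hS, hE, h1, fun i => ?_⟩
  simp only [hE]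
  rw [h2, affineFrame_self]

lemma transpose_mul_of_orthogonal {A K : Mℝ n} (hK2 : K * K = -1) (hKo : Kᵀ * A * K = A) : Kᵀ * A = -(A * K) := by
  have h := congrArg (fun M => M * K) hKo
  simp only [mul_assoc, hK2, mul_neg, mul_one] at h
  rw [← h, neg_neg]

lemma complexStructure_in_frame {A B K J₀ : Mℝ n} (hA : Aᵀ = A) (hB : Bᵀ * A * B = 1) (hK2 : K * K = -1) (hKo : Kᵀ * A *
    K = A) (hJ : K * B = B * J₀) : J₀ᵀ = -J₀ ∧ J₀ * J₀ = -1 := by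
  have hJ0 : J₀ = Bᵀ * A * (K * B) := by rw [hJ, ← mul_assoc, hB, one_mul]
  constructor
  · rw [hJ0, transpose_mul, transpose_mul, transpose_mul, transpose_transpose, hA, mul_assoc, ← mul_assoc _ _ B,
      transpose_mul_of_orthogonal hK2 hKo]
    simp only [mul_assoc, neg_mul, mul_neg]
  · have : B * (J₀ * J₀) = -B := by rw [← mul_assoc, ← hJ, mul_assoc, ← hJ, ← mul_assoc, hK2, neg_one_mul]
    calc J₀ * J₀ = (Bᵀ * A * B) * (J₀ * J₀) := by rw [hB, one_mul]
      _ = _ := by rw [mul_assoc, this, mul_neg, hB]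

lemma IsMetric.exists_unitary_frame (hG : IsMetric G U) (hx : x ∈ U) {B : Mℝ n} (hB : Bᵀ * G x * B = 1) {K : Sℝ n → Mℝ
    n} (hK : MSmooth K U) (hKp : ∀ i, mD (sDir i) K x + (conn sDir G i x * K x - K x * conn sDir G i x) = 0) (hK2 : ∀ y
    ∈ U, K y * K y = -1) (hKo : ∀ y ∈ U, (K y)ᵀ * G y * K y = G y) {J₀ : Mℝ n} (hJ : K x * B = B * J₀) : ∃ (V : Set Sℝ
    n) (E : Sℝ n → Mℝ n), IsOpen V ∧ x ∈ V ∧ V ⊆ U ∧ MSmooth E V ∧ E x = B ∧ (∀ y ∈ V, (E y)ᵀ * G y * E y = 1) ∧ (∀ i,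
      mD (sDir i) E x = -(conn sDir G i x * E x)) ∧ ∀ y ∈ V, K y * E y = E y * J₀ := by
  obtain ⟨hJt, hJ2⟩ := complexStructure_in_frame (hG.symm x hx) hB (hK2 x hx) (hKo x hx) hJ
  have hKs : ∀ y ∈ U, (K y)ᵀ * G y = -(G y * K y) := fun y hy => transpose_mul_of_orthogonal (hK2 y hy) (hKo y hy)
  have hF0 := affineFrame_smooth (G := G) (x := x) B U
  have hKF := (hK.mul hF0).mul (MSmooth.const J₀)
  set F : Sℝ n → Mℝ n := fun y => (1 / 2 : ℝ) • (affineFrame G x B y - K y * affineFrame G x B y * J₀) with hFdef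
  have hF : MSmooth F U := MSmooth.smul contDiffOn_const (hF0.sub hKF)
  have hFx : F x = B := by
    simp only [hFdef, affineFrame_self]
    rw [hJ, mul_assoc, hJ2, mul_neg, mul_one, sub_neg_eq_add, ← two_smul ℝ B, smul_smul]
    norm_num
  have hFK : ∀ y ∈ U, K y * F y = F y * J₀ := by
    intro y hy
    simp only [hFdef, Matrix.mul_smul, Matrix.smul_mul, Matrix.mul_sub, Matrix.sub_mul]
    congr 1
    simp only [mul_assoc, hJ2]
    rw [← mul_assoc (K y) (K y), hK2 y hy]
    simp only [neg_mul, one_mul, mul_neg, mul_one, sub_neg_eq_add]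
    abel
  have hFp : ∀ i, mD (sDir i) F x = -(conn sDir G i x * F x) := by
    intro i
    rw [hFx, hFdef, mD_smul hG.isOpen hx contDiffOn_const (hF0.sub hKF), dD_const, zero_smul, zero_add, mD_sub hG.isOpen
      hx hF0 hKF, mD_mul hG.isOpen hx (hK.mul hF0) (MSmooth.const J₀), mD_const, mD_mul hG.isOpen hx hK hF0,
      mD_affineFrame, affineFrame_self, mul_zero, add_zero, eq_neg_of_add_eq_zero_left (hKp i)]
    have h3 : conn sDir G i x * K x * B * J₀ = -(conn sDir G i x * B) := by
      rw [mul_assoc (conn sDir G i x), hJ, mul_assoc, mul_assoc, hJ2, mul_neg, mul_one, mul_neg]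
    have h4 : -(conn sDir G i x * B) - (-(conn sDir G i x * K x - K x * conn sDir G i x) * B + K x * -(conn sDir G i x *
        B)) * J₀ = (2 : ℝ) • (-(conn sDir G i x * B)) := by
      rw [two_smul]
      nth_rewrite 3 [← h3]
      noncomm_ring
    rw [h4, smul_smul]
    norm_num
  have hinv : J₀⁻¹ = -J₀ := Matrix.inv_eq_right_inv (by rw [mul_neg, hJ2, neg_neg])
  obtain ⟨V, S, hV, hxV, hVU, hS, hS1, h1, h2, h3⟩ := hG.exists_orthonormalization hx hF (by rw [hFx, hB]) hFp (c := fun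
    M => -(J₀ * M * J₀)) ((continuous_const.matrix_mul continuous_id).matrix_mul continuous_const).neg (by rw [mul_one,
    hJ2, neg_neg]) (fun M => by
      rw [neg_mul_neg]
      simp only [mul_assoc]
      rw [← mul_assoc J₀ J₀ (M * J₀), hJ2]
      simp only [neg_mul, one_mul, mul_neg])
    (fun y hy => by
      have e1 : (F y)ᵀ * G y * F y * J₀ = J₀ * ((F y)ᵀ * G y * F y) := by
        have e2 : J₀ᵀ * (F y)ᵀ = (F y)ᵀ * (K y)ᵀ := by rw [← Matrix.transpose_mul, ← Matrix.transpose_mul, hFK y hy]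
        rw [mul_assoc, ← hFK y hy, ← neg_neg J₀, ← hJt, neg_mul, ← mul_assoc, ← mul_assoc J₀ᵀ, ← mul_assoc J₀ᵀ, e2,
          mul_assoc _ _ (G y), hKs y hy]
        noncomm_ring
      rw [mul_assoc, e1, ← mul_assoc, hJ2]
      simp)
  have hE : F x * S x = B := by rw [hS1, hFx, mul_one]
  refine ⟨V, fun y => F y * S y, hV, hxV, hVU, (hF.mono hVU).mul hS, hE, h1, fun i => ?_, fun y hy => ?_⟩
  · simp only [hE]
    rw [h2, hFx]
  · obtain ⟨r, hr, hSr⟩ := h3 y hy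
    have e1 : r * J₀ = J₀ * r := by
      nth_rewrite 1 [← hr]
      simp only [mul_assoc, hJ2, neg_mul, mul_neg, mul_one, neg_neg]
    have e2 : S y * J₀ = J₀ * S y := by
      have := congrArg (fun M => M⁻¹) e1
      simp only [Matrix.mul_inv_rev, hinv, ← hSr, neg_mul, mul_neg, neg_inj] at this
      exact this.symm
    rw [← mul_assoc, hFK y (hVU hy), mul_assoc, ← e2, mul_assoc]

end Frames

lemma IsLocalMin.deriv_deriv_nonneg {f : ℝ → ℝ} {x : ℝ} (h : IsLocalMin f x) (hf : ContinuousAt f x) : 0 ≤ deriv (deriv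
    f) x := by
  by_contra! hlt
  have hc : f =ᶠ[nhds x] fun _ => f x := by
    filter_upwards [h, isLocalMax_of_deriv_deriv_neg hlt h.deriv_eq_zero hf] with y hy hy'
    exact le_antisymm hy' hy
  have := hc.deriv.deriv_eq
  simp only [deriv_const', deriv_const] at this
  exact hlt.ne this

/-- Conjugation by the one-parameter group generated by `w`. -/
def conjExp (w u : Mℂ n) (s : ℝ) : Mℂ n := NormedSpace.exp (s • w) * u * NormedSpace.exp (-(s • w))

lemma conjExp_zero (w u : Mℂ n) : conjExp w u 0 = u := by simp [conjExp]

open scoped Matrix.Norms.Operator in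
lemma exp_mul_exp_neg (w : Mℂ n) (s : ℝ) : NormedSpace.exp (s • w) * NormedSpace.exp (-(s • w)) = 1 := by
  rw [← exp_add_of_commute _ _ ((Commute.refl (s • w)).neg_right), add_neg_cancel, NormedSpace.exp_zero]

open scoped Matrix.Norms.Operator in
lemma hasDerivAt_conjExp (w u : Mℂ n) (s : ℝ) (i j : Fin n) : HasDerivAt (fun s => conjExp w u s i j) (conjExp w (w * u
    - u * w) s i j) s := by
  have h3 := ((hasDerivAt_exp_smul_const (𝕂 := ℝ) w s).mul_const u).mul (hasDerivAt_exp_smul_const' (𝕂 := ℝ) (-w) s)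
  refine ((((LinearMap.toContinuousLinearMap (entryLinearMap ℝ ℂ i j : Mℂ n →ₗ[ℝ] ℂ)).hasFDerivAt).comp_hasDerivAt s h3).congr_deriv ?_).congr_of_eventuallyEq (Filter.Eventually.of_forall fun s => ?_)
  · have e : ∀ X Y : Mℂ n, X = Y → LinearMap.toContinuousLinearMap (entryLinearMap ℝ ℂ i j : Mℂ n →ₗ[ℝ] ℂ) X = Y i j :=
        by rintro X Y rfl; rfl
    refine e _ _ ?_
    simp only [conjExp, smul_neg]
    noncomm_ring
  · simp only [conjExp, smul_neg]
    rfl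

/-- The sesquilinear form of a curvature tensor. -/
def herm (R : Tℝ n) (v w : Mℂ n) : ℝ := (ℛ R v (w.map conj)).re

local notation:max "Herm" R:max v:max => herm R v v

lemma hasDerivAt_herm (R : Tℝ n) {v w : ℝ → Mℂ n} {v' w' : Mℂ n} {s : ℝ} (hv : ∀ i j, HasDerivAt (fun s => v s i j) (v'
    i j) s) (hw : ∀ i j, HasDerivAt (fun s => w s i j) (w' i j) s) : HasDerivAt (fun s => herm R (v s) (w s)) (herm R v'
    (w s) + herm R (v s) w') s := by
  have h : HasDerivAt (fun s => ℛ R (v s) ((w s).map conj)) (ℛ R v' ((w s).map conj) + ℛ R (v s) (w'.map conj)) s := by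
    have e : ℛ R v' ((w s).map conj) + ℛ R (v s) (w'.map conj) = (1 / 4 : ℂ) * ∑ i, ∑ j, ∑ k, ∑ l, ((R i j k l : ℂ) * v'
        i j * conj (w s k l) + (R i j k l : ℂ) * v s i j * conj (w' k l)) := by
      simp only [curvForm, ← mul_add, ← sum_add_distrib, map_apply]
    rw [e]
    refine HasDerivAt.const_mul _ (HasDerivAt.fun_sum fun i _ => HasDerivAt.fun_sum fun j _ => HasDerivAt.fun_sum fun k
      _ => HasDerivAt.fun_sum fun l _ => ?_)
    exact ((hv i j).const_mul _).mul ((hw k l).star)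
  exact (Complex.reCLM.hasFDerivAt).comp_hasDerivAt s h

lemma variation_of_zero {S : Set Mℂ n} (hR : ∀ v ∈ S, 0 ≤ Herm R v) (hv : Herm R v = 0) (hw : ∀ s, conjExp w v s ∈ S) :
    herm R (w * v - v * w) v + herm R v (w * v - v * w) = 0 ∧ 0 ≤ herm R (w * (w * v - v * w) - (w * v - v * w) * w) v +
      2 * Herm R (w * v - v * w) + herm R v (w * (w * v - v * w) - (w * v - v * w) * w) := by
  set f : ℝ → ℝ := fun s => Herm R (conjExp w v s) with hf
  set u := w * v - v * w with hu
  have h1 := fun s => hasDerivAt_herm R (hasDerivAt_conjExp w v s) (hasDerivAt_conjExp w v s)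
  have h2 := (hasDerivAt_herm R (hasDerivAt_conjExp w u 0) (hasDerivAt_conjExp w v 0)).add (hasDerivAt_herm R
      (hasDerivAt_conjExp w v 0) (hasDerivAt_conjExp w u 0))
  have h3 : deriv f = (fun s => herm R (conjExp w u s) (conjExp w v s)) + fun s => herm R (conjExp w v s) (conjExp w u
      s) := funext fun s => (h1 s).deriv
  rw [← h3] at h2
  have hmin : IsLocalMin f 0 := Filter.Eventually.of_forall fun s => by
    simp only [hf, conjExp_zero, hv]
    exact hR _ (hw s)
  have e1 := hmin.deriv_eq_zero
  have e2 := hmin.deriv_deriv_nonneg (h1 0).continuousAt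
  rw [(h1 0).deriv] at e1
  rw [h2.deriv] at e2
  simp only [conjExp_zero] at e1 e2
  exact ⟨e1, by linarith⟩

lemma curvForm_smul_left (R : Tℝ n) (c : ℂ) (v w : Mℂ n) : ℛ R (c • v) w = c * ℛ R v w := by
  simp only [curvForm, Matrix.smul_apply, smul_eq_mul, mul_sum]
  refine sum_ext fun i => sum_ext fun j => sum_congr rfl fun k _ => sum_ext fun l => ?_
  ring

lemma curvForm_smul_right (R : Tℝ n) (c : ℂ) (v w : Mℂ n) : ℛ R v (c • w) = c * ℛ R v w := by
  simp only [curvForm, Matrix.smul_apply, smul_eq_mul, mul_sum]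
  refine sum_ext fun i => sum_ext fun j => sum_congr rfl fun k _ => sum_ext fun l => ?_
  ring

lemma map_conj_smul (c : ℂ) (v : Mℂ n) : (c • v).map conj = conj c • v.map conj := by
  ext i j
  simp

/-- The second variation inequality, in the directions of a complex vector space. -/
lemma second_variation {S : Set Mℂ n} (hR : ∀ v ∈ S, 0 ≤ Herm R v) (hv : Herm R v = 0) (hw : ∀ (c : ℂ) s, conjExp (c •
    w) v s ∈ S) : 0 ≤ Herm R (w * v - v * w) := by
  have h1 := (variation_of_zero hR hv (by simpa using hw 1)).2
  have h2 := (variation_of_zero hR hv (hw I)).2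
  have e1 : I • w * v - v * I • w = I • (w * v - v * w) := by rw [smul_mul_assoc, mul_smul_comm, smul_sub]
  have e2 : ∀ u : Mℂ n, I • w * I • u - I • u * I • w = (-1 : ℂ) • (w * u - u * w) := by
    intro u
    simp only [smul_mul_assoc, mul_smul_comm, smul_sub, smul_smul, I_mul_I]
  rw [e1, e2] at h2
  simp only [herm, map_conj_smul, curvForm_smul_left, curvForm_smul_right, ← mul_assoc] at h1 h2 ⊢
  simp only [conj_I, map_neg, map_one, I_mul_I, neg_neg, one_mul, Complex.neg_re, neg_mul] at h2
  linarith

open scoped ComplexOrder in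
lemma trace_mul_nonneg_of_posSemidef {ι : Type*} [Fintype ι] [DecidableEq ι] {R D : Matrix ι ι ℂ} (hR : Rᵀ = R) (hD : Dᵀ
    = -D) (hP : (Dᴴ * R * D).PosSemidef) : 0 ≤ ((Dᴴ * R * D) * R).trace.re := by
  set P := Dᴴ * R * D with hPdef
  have hH := hP.isHermitian
  set V := (hH.eigenvectorUnitary : Matrix ι ι ℂ) with hV
  have hsp : P = V * Matrix.diagonal (RCLike.ofReal ∘ hH.eigenvalues) * Vᴴ := by
    conv_lhs => rw [hH.spectral_theorem, Unitary.conjStarAlgAut_apply]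
    rfl
  have htr : (P * R).trace = ∑ a, (hH.eigenvalues a : ℂ) * (Vᴴ * R * V) a a := by
    conv_lhs => rw [hsp]
    rw [mul_assoc, mul_assoc, trace_mul_comm, mul_assoc, trace]
    simp only [diag_apply, diagonal_mul, Function.comp]
    rfl
  rw [htr, re_sum]
  refine sum_nonneg fun a _ => ?_
  rw [re_ofReal_mul]
  rcases (hP.eigenvalues_nonneg a).eq_or_lt with h0 | hpos
  · exact (by rw [← h0, zero_mul])
  refine mul_nonneg hpos.le ?_
  set u := fun i => V i a with hu
  have hPu : P *ᵥ u = (hH.eigenvalues a : ℂ) • u := hH.mulVec_eigenvectorBasis a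
  set z : ι → ℂ := ((hH.eigenvalues a : ℂ))⁻¹ • (R *ᵥ (D *ᵥ u)) with hz
  have hne : (hH.eigenvalues a : ℂ) ≠ 0 := by exact_mod_cast hpos.ne'
  have huz : Dᴴ *ᵥ z = u := by rw [hz, mulVec_smul, mulVec_mulVec, mulVec_mulVec,
      ← hPdef, hPu, smul_smul, inv_mul_cancel₀ hne, one_smul]
  have hstar : star u = -(D *ᵥ star z) := by rw [← huz, star_mulVec, conjTranspose_conjTranspose, ← mulVec_transpose,
      hD, neg_mulVec]
  have hu' : u = -star (D *ᵥ star z) := by rw [← star_star u, hstar, star_neg]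
  have h1 : (Vᴴ * R * V) a a = star u ⬝ᵥ (R *ᵥ u) := by
    rw [mul_assoc, mul_apply]
    rfl
  have h2 : star u ⬝ᵥ (R *ᵥ u) = star (star z) ⬝ᵥ (P *ᵥ star z) := by
    calc star u ⬝ᵥ (R *ᵥ u) = (D *ᵥ star z) ⬝ᵥ (R *ᵥ star (D *ᵥ star z)) := by
          rw [hstar, hu', mulVec_neg, neg_dotProduct_neg]
      _ = star (D *ᵥ star z) ⬝ᵥ (R *ᵥ (D *ᵥ star z)) := by
          rw [dotProduct_mulVec, ← mulVec_transpose, hR, dotProduct_comm]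
      _ = _ := by rw [star_mulVec D, ← dotProduct_mulVec, mulVec_mulVec, mulVec_mulVec]
  rw [h1, h2]
  exact (Complex.le_def.1 (hP.dotProduct_mulVec_nonneg (star z))).1

section CurvForm

variable {R S : Tℝ n}

lemma curvForm_add_left (R : Tℝ n) (v v' w : Mℂ n) : ℛ R (v + v') w = ℛ R v w + ℛ R v' w := by
  simp only [curvForm, Matrix.add_apply, mul_add, add_mul, sum_add_distrib]

lemma curvForm_add_right (R : Tℝ n) (v w w' : Mℂ n) : ℛ R v (w + w') = ℛ R v w + ℛ R v w' := by
  simp only [curvForm, Matrix.add_apply, mul_add, sum_add_distrib]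

lemma curvForm_add_mul (R S : Tℝ n) (c : ℝ) (v w : Mℂ n) : ℛ (fun i j k l => R i j k l + c * S i j k l) v w = ℛ R v w +
      c * ℛ S v w := by
  simp only [curvForm, ofReal_add, ofReal_mul, add_mul, sum_add_distrib, mul_add, mul_sum]
  congr 1
  refine sum_ext fun i => sum_ext fun j => sum_congr rfl fun k _ => sum_ext fun l => ?_
  ring

lemma sum_comm_pairs {ι κ : Type*} [Fintype ι] [Fintype κ] {M : Type*} [AddCommMonoid M] (f : ι → ι → κ → κ → M) : ∑ i,
    ∑ j, ∑ k, ∑ l, f i j k l = ∑ k, ∑ l, ∑ i, ∑ j, f i j k l := by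
  have h := sum_comm (s := (Finset.univ : Finset (ι × ι))) (t := (Finset.univ : Finset (κ × κ))) (f := fun p q => f p.1
    p.2 q.1 q.2)
  simpa only [sum_prod_type] using h

lemma curvForm_comm (hR : IsAlg R) (v w : Mℂ n) : ℛ R v w = ℛ R w v := by
  simp only [curvForm]
  rw [sum_comm_pairs]
  congr 1
  refine sum_ext fun i => sum_ext fun j => sum_congr rfl fun k _ => sum_ext fun l => ?_
  rw [hR.pair_symm]; ring

lemma curvForm_conj (R : Tℝ n) (v w : Mℂ n) : conj (ℛ R v w) = ℛ R (v.map conj) (w.map conj) := by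
  simp only [curvForm, map_mul, map_sum, conj_ofReal, map_apply, map_div₀, map_one, map_ofNat]

lemma map_conj_map_conj (v : Mℂ n) : (v.map conj).map conj = v := by ext i j; simp

lemma curvForm_conj_self (hR : IsAlg R) (v : Mℂ n) : ℛ R v (v.map conj) = (Herm R v : ℂ) := by
  refine (Complex.conj_eq_iff_re.1 ?_).symm
  rw [curvForm_conj, map_conj_map_conj, curvForm_comm hR]

lemma curvForm_transpose_left (R : Tℝ n) (v w : Mℂ n) : ℛ R vᵀ w = ℛ (fun i j k l => R j i k l) v w := by
  simp only [curvForm, transpose_apply]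
  rw [sum_comm]

lemma curvForm_neg_left (R : Tℝ n) (v w : Mℂ n) : ℛ R (-v) w = -ℛ R v w := by
  rw [← neg_one_smul ℂ v, curvForm_smul_left, neg_one_mul]

lemma curvForm_neg_right (R : Tℝ n) (v w : Mℂ n) : ℛ R v (-w) = -ℛ R v w := by
  rw [← neg_one_smul ℂ w, curvForm_smul_right, neg_one_mul]

lemma curvForm_neg (R : Tℝ n) (v w : Mℂ n) : ℛ (fun i j k l => -R i j k l) v w = -ℛ R v w := by
  simp only [curvForm, Complex.ofReal_neg, neg_mul, sum_neg_distrib, mul_neg]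

lemma curvForm_eq_zero_of_symm (hR : IsAlg R) (hv : vᵀ = v) (w : Mℂ n) : ℛ R v w = 0 := by
  have h := curvForm_transpose_left R v w
  rw [hv, show (fun i j k l => R j i k l) = fun i j k l => -R i j k l from by
    funext i j k l; exact hR.antisymm j i k l, curvForm_neg] at h
  exact self_eq_neg.1 h

lemma herm_add_symm (hR : IsAlg R) (v : Mℂ n) {u : Mℂ n} (hu : uᵀ = u) : Herm R (v + u) = Herm R v := by
  have h1 : (u.map conj)ᵀ = u.map conj := by rw [← transpose_map, hu]
  rw [herm, Matrix.map_add _ (map_add _), curvForm_add_left, curvForm_eq_zero_of_symm hR hu, add_zero,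
    curvForm_add_right, curvForm_comm hR v (u.map _), curvForm_eq_zero_of_symm hR h1, add_zero, herm]

def pairVec (v : Matrix (Fin n) (Fin n) ℂ) : Fin n × Fin n → ℂ := fun p => v p.1 p.2

/-- A curvature tensor as a complex matrix indexed by pairs. -/
def cMat (R : Tℝ n) : Matrix (Fin n × Fin n) (Fin n × Fin n) ℂ := of fun p q => (R p.1 p.2 q.1 q.2 : ℂ)

lemma curvForm_eq_dot (R : Tℝ n) (v w : Mℂ n) : ℛ R v w = (1 / 4 : ℂ) * (pairVec v ⬝ᵥ (cMat R *ᵥ pairVec w)) := by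
  simp only [curvForm, dotProduct, mulVec, sum_prod_type, cMat, pairVec, of_apply, mul_sum]
  refine sum_ext fun i => sum_ext fun j => sum_congr rfl fun k _ => sum_ext fun l => ?_
  ring

lemma kronecker_pairVec (A B v : Mℂ n) : (A ⊗ₖ B) *ᵥ pairVec v = pairVec (A * v * Bᵀ) := by
  funext p
  simp only [mulVec, dotProduct, sum_prod_type, pairVec, kroneckerMap_apply, mul_apply, transpose_apply, sum_mul]
  rw [sum_comm]
  refine sum_ext fun i => sum_ext fun j => ?_
  ring

theorem pairVec_add (v w : Matrix (Fin n) (Fin n) ℂ) : pairVec (v + w) = pairVec v + pairVec w := rfl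

lemma cMat_slot (R : Tℝ n) (Z : Mℝ n) : cMat (slot Z R) = ((Z.map ofReal) ⊗ₖ 1 + 1 ⊗ₖ (Z.map ofReal))ᵀ * cMat R + cMat R
      * ((Z.map ofReal) ⊗ₖ 1 + 1 ⊗ₖ (Z.map ofReal)) := by
  ext ⟨i, j⟩ ⟨k, l⟩
  simp only [Matrix.add_apply, mul_apply, transpose_apply, sum_prod_type, kroneckerMap_apply, map_apply,
    Matrix.one_apply, cMat, of_apply, add_mul, mul_add, sum_add_distrib, mul_ite, mul_one, mul_zero, ite_mul, zero_mul,
    one_mul, sum_ite_eq', Finset.mem_univ, if_true]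
  rw [sum_comm]
  simp only [sum_ite_eq', Finset.mem_univ, if_true]
  rw [sum_comm]
  simp only [sum_ite_eq', Finset.mem_univ, if_true, ← sum_add_distrib, slot]
  push_cast
  refine sum_ext fun q => ?_
  ring

lemma curvForm_slot (R : Tℝ n) (Z : Mℝ n) (v w : Mℂ n) : ℛ (slot Z R) v w = ℛ R (Z.map ofReal * v + v * (Z.map ofReal)ᵀ)
      w + ℛ R v (Z.map ofReal * w + w * (Z.map ofReal)ᵀ) := by
  have e : ∀ v, ((Z.map ofReal) ⊗ₖ 1 + 1 ⊗ₖ (Z.map ofReal)) *ᵥ pairVec v = pairVec (Z.map Complex.ofReal * v + v *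
      (Z.map Complex.ofReal)ᵀ) := fun v => by rw [add_mulVec, kronecker_pairVec, kronecker_pairVec, pairVec_add,
      transpose_one, mul_one, one_mul]
  rw [curvForm_eq_dot, cMat_slot, add_mulVec, dotProduct_add, mul_add, ← mulVec_mulVec, ← mulVec_mulVec,
    dotProduct_mulVec _ _ᵀ, vecMul_transpose, e, e, ← curvForm_eq_dot, ← curvForm_eq_dot]

lemma slot_eq_zero_of_zero {S : Set Mℂ n} (hR : ∀ v ∈ S, 0 ≤ Herm R v) (hv : Herm R v = 0) {Z : Mℝ n} (hZ : Zᵀ = -Z) (hw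
    : ∀ s, conjExp (Z.map ofReal) v s ∈ S) : Herm (slot Z R) v = 0 := by
  have hZ' : (Z.map ofReal)ᵀ = -Z.map ofReal := by
    rw [← transpose_map, hZ]
    ext i j; simp
  have hZc : (Z.map ofReal).map conj = Z.map ofReal := by ext i j; simp
  rw [herm, curvForm_slot, hZ', mul_neg, mul_neg, ← sub_eq_add_neg, ← sub_eq_add_neg, add_re, ← (variation_of_zero hR hv
    hw).1, herm, herm]
  congr 3
  rw [Matrix.map_sub _ (map_sub _), Matrix.map_mul, Matrix.map_mul, hZc]

/-- The off-diagonal part of the quadratic reaction term, polarized. -/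
def hashT (R S : Tℝ n) (i j k l : Fin n) : ℝ := ∑ m, ∑ q, R i m k q * S j m l q

lemma curvForm_swap_of_skew (T : Tℝ n) (hv : vᵀ = -v) (w : Mℂ n) : ℛ (fun i j k l => T j i k l) v w = -ℛ T v w := by
  rw [← curvForm_transpose_left, hv, curvForm_neg_left]

lemma herm_quad_ge (hR : IsAlg R) (hv : vᵀ = -v) : 4 * Herm (hashT R R) v ≤ Herm (quad R) v := by
  set sq := fun i j k l => ∑ m, ∑ q, R i j m q * R m q k l
  have e1 : quad R = fun i j k l => (sq i j k l + 2 * hashT R R i j k l) + (-2) * hashT R R j i k l := by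
    funext i j k l
    simp only [quad, sq, hashT, mul_sum, ← sum_add_distrib]
    refine sum_ext fun m => sum_ext fun q => ?_
    ring
  have e2 : cMat sq = (cMat R)ᴴ * cMat R := by
    ext p q
    simp only [cMat, sq, mul_apply, sum_prod_type, conjTranspose_apply, of_apply, ofReal_sum, ofReal_mul, star_def,
      conj_ofReal]
    refine sum_ext fun m => sum_ext fun q => ?_
    rw [hR.pair_symm p.1]
  have e3 : 0 ≤ Herm sq v := by
    rw [herm, curvForm_eq_dot, e2, ← Matrix.mulVec_mulVec, Matrix.dotProduct_mulVec]
    have : pairVec v ᵥ* (cMat R)ᴴ = star (cMat R *ᵥ pairVec (v.map conj)) := by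
      rw [star_mulVec]
      congr 1
      funext p
      simp [pairVec]
    rw [this]
    set u := cMat R *ᵥ pairVec (v.map conj)
    have : (1 / 4 : ℂ) * (star u ⬝ᵥ u) = (((1 / 4 : ℝ) * ∑ p, ‖u p‖ ^ 2 : ℝ) : ℂ) := by
      push_cast
      congr 1
      refine sum_ext fun p => ?_
      rw [Pi.star_apply, star_def, conj_mul']
    rw [this, ofReal_re]
    positivity
  have e4 : ℛ (quad R) v (v.map conj) = ℛ sq v (v.map conj) + 4 * ℛ (hashT R R) v (v.map conj) := by
    rw [e1, curvForm_add_mul, curvForm_add_mul, curvForm_swap_of_skew (hashT R R) hv]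
    push_cast
    ring
  have e5 := congrArg re e4
  rw [add_re, show (4 : ℂ) = ((4 : ℝ) : ℂ) by norm_num, re_ofReal_mul] at e5
  rw [herm] at e3 ⊢
  rw [herm, e5]
  linarith

lemma cMat_transpose (hR : IsAlg R) : (cMat R)ᵀ = cMat R := by
  ext p q
  simp only [cMat, transpose_apply, of_apply]
  rw [hR.pair_symm]

lemma cMat_conjTranspose (hR : IsAlg R) : (cMat R)ᴴ = cMat R := by
  ext p q
  simp only [cMat, conjTranspose_apply, of_apply, star_def, conj_ofReal]
  rw [hR.pair_symm]

lemma one_kronecker_mul_apply {ι : Type*} (a : Mℂ n) (X : Matrix (Fin n × Fin n) ι ℂ) (i j : Fin n) (p : ι) : (((1 : Mℂ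
    n) ⊗ₖ a) * X) (i, j) p = ∑ l, a j l * X (i, l) p := by
  simp only [mul_apply, sum_prod_type, kroneckerMap_apply, Matrix.one_apply, ite_mul, one_mul, zero_mul]
  rw [sum_comm]
  simp

lemma kronecker_one_mul_apply {ι : Type*} (a : Mℂ n) (X : Matrix (Fin n × Fin n) ι ℂ) (i j : Fin n) (p : ι) : ((a ⊗ₖ (1
    : Mℂ n)) * X) (i, j) p = ∑ l, a i l * X (l, j) p := by
  simp only [mul_apply, sum_prod_type, kroneckerMap_apply, Matrix.one_apply, mul_ite, ite_mul, mul_one, zero_mul,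
    mul_zero]
  simp

lemma cMat_mul_swap (hR : IsAlg R) {ι : Type*} (X : Matrix (Fin n × Fin n) ι ℂ) (i j : Fin n) (p : ι) : (cMat R * X) (i,
    j) p = -(cMat R * X) (j, i) p := by
  simp only [mul_apply, ← sum_neg_distrib, cMat, of_apply]
  refine sum_ext fun q => ?_
  rw [hR.antisymm]
  push_cast; ring

lemma mul_cMat_swap (hR : IsAlg R) {ι : Type*} (X : Matrix ι (Fin n × Fin n) ℂ) (i j : Fin n) (p : ι) : (X * cMat R) p
    (i, j) = -(X * cMat R) p (j, i) := by
  simp only [mul_apply, ← sum_neg_distrib, cMat, of_apply]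
  refine sum_ext fun q => ?_
  rw [hR.antisymm']
  push_cast; ring

lemma trace_one_kronecker (hR : IsAlg R) (a : Mℂ n) (B : Matrix (Fin n × Fin n) (Fin n × Fin n) ℂ) : (((1 : Mℂ n) ⊗ₖ a)
    * cMat R * B * cMat R).trace = ((a ⊗ₖ (1 : Mℂ n)) * cMat R * B * cMat R).trace := by
  simp only [mul_assoc, trace, diag_apply, sum_prod_type, one_kronecker_mul_apply, kronecker_one_mul_apply]
  rw [sum_comm]
  refine sum_ext fun i => sum_ext fun j => sum_congr rfl fun l _ => ?_
  rw [cMat_mul_swap hR, ← mul_assoc (cMat R), mul_cMat_swap hR, neg_neg]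

lemma curvForm_hashT (hR : IsAlg R) (v w : Mℂ n) : 4 * ℛ (hashT R R) v w = ((wᵀ ⊗ₖ (1 : Mℂ n)) * cMat R * (v ⊗ₖ (1 : Mℂ
    n)) * cMat R).trace := by
  have e : ((wᵀ ⊗ₖ (1 : Mℂ n)) * cMat R * (v ⊗ₖ (1 : Mℂ n)) * cMat R).trace = ∑ i, ∑ j, ∑ p, ∑ q, ∑ k, ∑ r, (w k i * (R
        k j p q : ℂ)) * (v p r * (R r q i j : ℂ)) := by
    rw [mul_assoc]
    simp only [trace, diag_apply, sum_prod_type]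
    refine sum_ext fun i => sum_ext fun j => ?_
    rw [mul_apply, sum_prod_type]
    refine sum_ext fun p => sum_ext fun q => ?_
    rw [kronecker_one_mul_apply, kronecker_one_mul_apply, sum_mul_sum]
    rfl
  have e' : 4 * ℛ (hashT R R) v w = ∑ p, ∑ r, ∑ k, ∑ i, ∑ q, ∑ j, (w k i * (R k j p q : ℂ)) * (v p r * (R r q i j : ℂ))
        := by
    rw [curvForm, ← mul_assoc, show (4 * (1 / 4) : ℂ) = 1 by norm_num, one_mul]
    simp only [hashT, ofReal_sum, ofReal_mul, sum_mul]
    refine sum_ext fun p => sum_ext fun r => sum_congr rfl fun k _ => sum_ext fun i => sum_ext fun q => sum_ext fun j =>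
        ?_
    rw [hR.pair_symm k j p q]
    ring
  rw [e, e']
  have key : ∀ f : (Fin n × Fin n × Fin n) × (Fin n × Fin n × Fin n) → ℂ, ∑ x, f x = ∑ a, ∑ b, ∑ c, ∑ d, ∑ s, ∑ t, f
      ((a, b, c), (d, s, t)) := fun f => by simp only [sum_prod_type]
  let F : Fin n → Fin n → Fin n → Fin n → Fin n → Vℂ n := fun p r k i q j => (w k i * (R k j p q : ℂ)) * (v p r * (R r q
    i j : ℂ))
  refine (key fun x => F x.1.1 x.1.2.1 x.1.2.2 x.2.1 x.2.2.1 x.2.2.2).symm.trans (Eq.trans ?_ (key fun x => F x.1.2.2 x.2.2.2 x.2.2.1 x.1.1 x.2.1 x.1.2.1))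
  exact Fintype.sum_equiv ⟨fun x => ((x.2.1, x.2.2.2, x.1.1), (x.2.2.1, x.1.2.2, x.1.2.1)), fun y => ((y.1.2.2, y.2.2.2,
    y.2.2.1), (y.1.1, y.2.1, y.1.2.1)), fun _ => rfl, fun _ => rfl⟩ _ _ fun _ => rfl

open scoped ComplexOrder in
lemma herm_hashT_nonneg (hR : IsAlg R) (hv : vᵀ = -v) (h : ∀ w : Mℂ n, wᵀ = -w → 0 ≤ Herm R (w * v - v * w)) : 0 ≤ Herm
      (hashT R R) v := by
  set D := -(1 ⊗ₖ v + v ⊗ₖ 1) with hD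
  have hDt : Dᵀ = -D := by
    rw [hD, transpose_neg, transpose_add, ← kroneckerMap_transpose, ← kroneckerMap_transpose, hv, transpose_one]
    have n1 : ∀ A B : Mℂ n, (-A) ⊗ₖ B = -(A ⊗ₖ B) := fun A B => by ext; simp
    have n2 : ∀ A B : Mℂ n, A ⊗ₖ (-B) = -(A ⊗ₖ B) := fun A B => by ext; simp
    rw [n1, n2]
    abel
  have hall : ∀ w : Mℂ n, 0 ≤ Herm R (w * v - v * w) := fun w => by
    set w₁ := (1 / 2 : ℂ) • (w - wᵀ) with hw₁
    set w₂ := (1 / 2 : ℂ) • (w + wᵀ) with hw₂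
    have hw : w = w₁ + w₂ := by
      rw [hw₁, hw₂, ← smul_add, sub_add_add_cancel, ← two_smul ℂ w, smul_smul]
      norm_num
    have t1 : w₁ᵀ = -w₁ := by rw [hw₁, transpose_smul, transpose_sub, transpose_transpose, ← smul_neg, neg_sub]
    have t2 : w₂ᵀ = w₂ := by rw [hw₂, transpose_smul, transpose_add, transpose_transpose, add_comm]
    have e : w * v - v * w = (w₁ * v - v * w₁) + (w₂ * v - v * w₂) := by rw [hw]; noncomm_ring
    rw [e, herm_add_symm hR]
    · exact h w₁ t1
    · rw [transpose_sub, transpose_mul, transpose_mul, t2, hv]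
      noncomm_ring
  have hP : (Dᴴ * cMat R * D).PosSemidef := by
    refine posSemidef_iff_dotProduct_mulVec.2 ⟨?_, fun x => ?_⟩
    · rw [Matrix.IsHermitian, conjTranspose_mul, conjTranspose_mul, cMat_conjTranspose hR, conjTranspose_conjTranspose,
        mul_assoc]
    · set w := of fun i j => x (i, j) with hw
      have hx : x = pairVec w := rfl
      have hDx : D *ᵥ x = pairVec (w * v - v * w) := by
        rw [hD, hx, neg_mulVec, add_mulVec, kronecker_pairVec, kronecker_pairVec, ← pairVec_add, hv, transpose_one]
        have : -pairVec (1 * w * -v + v * w * 1) = pairVec (-(1 * w * -v + v * w * 1)) := rfl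
        rw [this]
        congr 1
        noncomm_ring
      rw [← mulVec_mulVec, ← mulVec_mulVec, dotProduct_mulVec, ← star_mulVec, hDx]
      have e : star (pairVec (w * v - v * w)) ⬝ᵥ (cMat R *ᵥ pairVec (w * v - v * w)) = ((4 * Herm R (w * v - v * w) : ℝ)
          : ℂ) := by
        rw [ofReal_mul, ← curvForm_conj_self hR, curvForm_comm hR, curvForm_eq_dot]
        push_cast
        rw [← mul_assoc, show (4 * (1 / 4) : ℂ) = 1 by norm_num, one_mul]
        rfl
      rw [e]
      exact_mod_cast mul_nonneg (by norm_num) (hall w)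
  have htr := trace_mul_nonneg_of_posSemidef (cMat_transpose hR) hDt hP
  have e1 : (Dᴴ * cMat R * D * cMat R).trace = 16 * ℛ (hashT R R) v (v.map conj) := by
    have hDc : Dᴴ = -(1 ⊗ₖ vᴴ + vᴴ ⊗ₖ 1) := by rw [hD, conjTranspose_neg, conjTranspose_add, conjTranspose_kronecker,
        conjTranspose_kronecker, conjTranspose_one]
    have c1 : ∀ A B : Matrix (Fin n × Fin n) (Fin n × Fin n) ℂ, (A * cMat R * B * cMat R).trace = (B * cMat R * A * cMat
        R).trace := fun A B => by rw [mul_assoc, trace_mul_comm, ← mul_assoc]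
    have c2 : ∀ A : Matrix (Fin n × Fin n) (Fin n × Fin n) ℂ, (A * cMat R * ((1 : Mℂ n) ⊗ₖ v) * cMat R).trace = (A *
        cMat R * (v ⊗ₖ (1 : Mℂ n)) * cMat R).trace := fun A => by rw [c1, trace_one_kronecker hR, c1]
    have c3 := curvForm_hashT hR v (v.map conj)
    rw [show (v.map conj)ᵀ = vᴴ from rfl] at c3
    rw [hDc, hD]
    simp only [neg_mul, mul_neg, neg_add_rev, neg_neg, add_mul, mul_add, trace_add]
    rw [c2, c2, trace_one_kronecker hR, ← c3]
    ring
  rw [e1, show (16 : ℂ) = ((16 : ℝ) : ℂ) by norm_num, re_ofReal_mul] at htr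
  rw [herm]
  linarith

end CurvForm

section Contractions

variable {R S : Tℝ n}

/-- The bilinear contraction `∑ R_abcd N_ac N'_bd`. -/
def ctr (R : Tℝ n) : Mℂ n →ₗ[ℂ] Mℂ n →ₗ[ℂ] ℂ := LinearMap.mk₂ ℂ (fun N N' => ∑ a, ∑ b, ∑ c, ∑ d, (R a b c d : ℂ) * N a c
  * N' b d) (fun N₁ N₂ N' => by simp only [Matrix.add_apply, mul_add, add_mul, sum_add_distrib]) (fun c N N' => by
      simp only [Matrix.smul_apply, smul_eq_mul, mul_sum]
      refine sum_ext fun _ => sum_ext fun _ => sum_ext fun _ => sum_ext fun _ => ?_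
      ring)
    (fun N N₁ N₂ => by simp only [Matrix.add_apply, mul_add, sum_add_distrib])
    (fun c N N' => by
      simp only [Matrix.smul_apply, smul_eq_mul, mul_sum]
      refine sum_ext fun _ => sum_ext fun _ => sum_ext fun _ => sum_ext fun _ => ?_
      ring)

lemma ctr_apply (R : Tℝ n) (N N' : Mℂ n) : ctr R N N' = ∑ a, ∑ b, ∑ c, ∑ d, (R a b c d : ℂ) * N a c * N' b d := rfl

lemma sum_comm_first_pair {ι M : Type*} [Fintype ι] [AddCommMonoid M] (f : ι → ι → ι → ι → M) : ∑ a, ∑ b, ∑ c, ∑ d, f a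
    b c d = ∑ b, ∑ a, ∑ d, ∑ c, f a b c d := by
  rw [sum_comm]
  exact sum_ext fun _ => sum_ext fun _ => sum_comm

lemma sum_comm_last_two {ι M : Type*} [Fintype ι] [AddCommMonoid M] (f : ι → ι → ι → ι → M) : ∑ a, ∑ b, ∑ c, ∑ d, f a b
    c d = ∑ a, ∑ b, ∑ d, ∑ c, f a b c d := sum_ext fun _ => sum_ext fun _ => sum_comm

lemma sum_comm_mid {ι M : Type*} [Fintype ι] [AddCommMonoid M] (f : ι → ι → ι → ι → M) : ∑ a, ∑ b, ∑ c, ∑ d, f a b c d =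
    ∑ a, ∑ c, ∑ b, ∑ d, f a b c d := sum_ext fun _ => sum_comm

lemma sum4_congr {ι M : Type*} [Fintype ι] [AddCommMonoid M] {f g : ι → ι → ι → ι → M} (h : ∀ a b c d, f a b c d = g a b
    c d) : ∑ a, ∑ b, ∑ c, ∑ d, f a b c d = ∑ a, ∑ b, ∑ c, ∑ d, g a b c d := sum_ext fun a => sum_ext fun b => sum_ext
    fun c => sum_ext fun d => h a b c d

lemma ctr_comm (hR : IsAlg R) (N N' : Mℂ n) : ctr R N N' = ctr R N' N := by
  rw [ctr_apply, ctr_apply, sum_comm_first_pair]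
  refine sum4_congr fun a b c d => ?_
  rw [hR.antisymm, hR.antisymm', neg_neg]; ring

lemma ctr_eq_curvForm (hR : IsAlg R) (hv : vᵀ = -v) : ctr R v w = 2 * ℛ R v w := by
  have e1 : ctr R v w = ∑ a, ∑ c, ∑ b, ∑ d, (R a b c d : ℂ) * v a c * w b d := by rw [ctr_apply, sum_comm_mid]
  have e2 : ctr R v w = ∑ a, ∑ c, ∑ b, ∑ d, -((R c b a d : ℂ) * v a c * w b d) := by
    rw [e1, sum_comm]
    refine sum4_congr fun a c b d => ?_
    have := congr_fun₂ hv c a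
    rw [transpose_apply, Matrix.neg_apply] at this
    rw [this]; ring
  have e3 : 2 * ctr R v w = 4 * ℛ R v w := by
    rw [two_mul]
    nth_rewrite 1 [e1]
    rw [e2, curvForm, ← mul_assoc, show (4 * (1 / 4) : ℂ) = 1 by norm_num, one_mul]
    simp only [← sum_add_distrib]
    refine sum4_congr fun a c b d => ?_
    have h : R a b c d - R c b a d = R a c b d := by
      linarith [hR.bianchi a b c d, hR.antisymm b c a d, hR.antisymm c a b d]
    rw [← h]
    push_cast; ring
  linear_combination (1 / 2 : ℂ) * e3

/-- The pairing `∑ Ric_ij N_ij` of the Ricci tensor with a matrix. -/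
def ricPair (R : Tℝ n) (N : Mℂ n) : ℂ := ∑ i, ∑ j, (ricci R i j : ℂ) * N i j

lemma ctr_one_right (R : Tℝ n) (N : Mℂ n) : ctr R N 1 = ricPair R N := by
  rw [ctr_apply, ricPair]
  simp only [Matrix.one_apply, mul_ite, mul_one, mul_zero, sum_ite_eq, Finset.mem_univ, if_true, ricci, of_apply,
    ofReal_sum, sum_mul]
  exact sum_ext fun _ => sum_comm

/-- The scalar contraction in an orthonormal basis. -/
def scal (R : Tℝ n) : ℝ := (ricci R).trace

lemma ricPair_one (R : Tℝ n) : ricPair R 1 = (scal R : ℂ) := by simp [ricPair, Matrix.one_apply, scal, trace]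

lemma ricci_add_mul (R S : Tℝ n) (c : ℝ) : ricci (fun i j k l => R i j k l + c * S i j k l) = ricci R + c • ricci S :=
    by
  ext i j
  simp [ricci, sum_add_distrib, mul_sum]

lemma scal_add_mul (R S : Tℝ n) (c : ℝ) : scal (fun i j k l => R i j k l + c * S i j k l) = scal R + c * scal S := by
  rw [scal, ricci_add_mul, trace_add, trace_smul, smul_eq_mul, scal, scal]

lemma hashT_add_mul (R S T : Tℝ n) (c : ℝ) : hashT R (fun i j k l => S i j k l + c * T i j k l) = fun i j k l => hashT R
      S i j k l + c * hashT R T i j k l := by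
  funext i j k l
  simp only [hashT, mul_sum, ← sum_add_distrib]
  exact sum_ext fun _ => sum_ext fun _ => by ring

lemma curvForm_hashT_comm (R S : Tℝ n) (hv : vᵀ = -v) (hw : wᵀ = -w) : ℛ (hashT R S) v w = ℛ (hashT S R) v w := by
  simp only [curvForm]
  congr 1
  rw [sum_comm_first_pair]
  refine (sum4_congr fun b a d c => ?_)
  have h1 := congr_fun₂ hv b a
  have h2 := congr_fun₂ hw d c
  rw [transpose_apply, Matrix.neg_apply] at h1 h2
  rw [h1, h2, show hashT R S a b c d = hashT S R b a d c from sum_ext fun _ => sum_ext fun _ => mul_comm _ _]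
  ring

lemma curvForm_hashT_self (R S : Tℝ n) (c : ℝ) (hv : vᵀ = -v) (hw : wᵀ = -w) : ℛ (hashT (fun i j k l => R i j k l + c *
    S i j k l) (fun i j k l => R i j k l + c * S i j k l)) v w = ℛ (hashT R R) v w + 2 * c * ℛ (hashT R S) v w + c ^ 2 *
        ℛ (hashT S S) v w := by
  rw [hashT_add_mul, curvForm_add_mul, curvForm_hashT_comm _ R hv hw, curvForm_hashT_comm _ S hv hw, hashT_add_mul,
    hashT_add_mul, curvForm_add_mul, curvForm_add_mul, curvForm_hashT_comm S R hv hw]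
  ring

lemma reaction_bound {I₀ : Tℝ n} (hR : IsAlg R) {ℓ : ℝ} (hℓ : 0 ≤ ℓ) (hv : vᵀ = -v) (h0 : Herm (fun i j k l => R i j k l
    + ℓ * I₀ i j k l) v = 0) (h1 : 0 ≤ Herm (hashT (fun i j k l => R i j k l + ℓ * I₀ i j k l) (fun i j k l => R i j k l
      + ℓ * I₀ i j k l)) v) (h2 : 4 * Herm (hashT (fun i j k l => R i j k l + ℓ * I₀ i j k l) I₀) v = (ricPair (fun i j
      k l => R i j k l + ℓ * I₀ i j k l) (v * vᴴ)).re - 2 * Herm (fun i j k l => R i j k l + ℓ * I₀ i j k l) v) (h3 : 4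
    * Herm (hashT I₀ I₀) v = (ricPair I₀ (v * vᴴ)).re - 2 * Herm I₀ v) (h4 : 0 ≤ (ricPair I₀ (v * vᴴ)).re) (h5 : 2 *
    (ricPair (fun i j k l => R i j k l + ℓ * I₀ i j k l) (v * vᴴ)).re ≤ scal (fun i j k l => R i j k l + ℓ * I₀ i j k l)
      * Herm I₀ v) : -Herm (quad R) v ≤ (scal R * ℓ + (scal I₀ + 2) * ℓ ^ 2) * Herm I₀ v := by
  set T : Tℝ n := fun i j k l => R i j k l + ℓ * I₀ i j k l with hT
  have hRT : R = fun i j k l => T i j k l + (-ℓ) * I₀ i j k l := by funext i j k l; simp [hT]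
  have hvc : (v.map conj)ᵀ = -v.map conj := by
    rw [← transpose_map, hv]
    ext i j; simp
  have e : Herm (hashT R R) v = Herm (hashT T T) v - 2 * ℓ * Herm (hashT T I₀) v + ℓ ^ 2 * Herm (hashT I₀ I₀) v := by
    have c : ℛ (hashT R R) v (v.map conj) = ℛ (hashT T T) v (v.map conj) + ((-2 * ℓ : ℝ) : ℂ) * ℛ (hashT T I₀) v (v.map
          conj) + ((ℓ ^ 2 : ℝ) : ℂ) * ℛ (hashT I₀ I₀) v (v.map conj) := by
      conv_lhs => rw [hRT]
      rw [curvForm_hashT_self T I₀ (-ℓ) hv hvc]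
      push_cast; ring
    have := congrArg re c
    rw [add_re, add_re, re_ofReal_mul, re_ofReal_mul] at this
    rw [herm, this]
    simp only [herm]
    ring
  have h6 := herm_quad_ge hR hv
  have h7 := scal_add_mul R I₀ ℓ
  rw [h7] at h5
  have h8 := mul_le_mul_of_nonneg_left h5 hℓ
  have h9 : 0 ≤ ℓ ^ 2 * (ricPair I₀ (v * vᴴ)).re := mul_nonneg (sq_nonneg _) h4
  rw [h0] at h2
  have h10 := congrArg (fun t => ℓ * t) h2
  have h11 := congrArg (fun t => ℓ ^ 2 * t) h3
  nlinarith

lemma four_curvForm (T : Tℝ n) (v w : Mℂ n) : 4 * ℛ T v w = ∑ i, ∑ j, ∑ k, ∑ l, (T i j k l : ℂ) * v i j * w k l := by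
  rw [curvForm, ← mul_assoc, show (4 * (1 / 4) : ℂ) = 1 by norm_num, one_mul]

lemma ricPair_mul (R : Tℝ n) (v w : Mℂ n) : ricPair R (v * w) = ∑ i, ∑ j, ∑ k, (ricci R i k : ℂ) * v i j * w j k := by
  simp only [ricPair, mul_apply, mul_sum]
  refine sum_ext fun i => ?_
  rw [sum_comm]
  exact sum_ext fun _ => sum_ext fun _ => by ring

lemma four_curvForm_hashT_sphere (R : Tℝ n) (hR : IsAlg R) (v w : Mℂ n) : 4 * ℛ (hashT R 𝕊 n) v w = ricPair R (v * wᵀ) +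
    ctr R v wᵀ := by
  have e1 : ∀ i j k l, hashT R 𝕊 n i j k l = (if j = l then ∑ m, R i m k m else 0) - R i l k j := fun i j k l => by
    simp only [hashT, sphereCurv, mul_sub, sum_sub_distrib]
    congr 1
    · split_ifs with h
      · simp
      · simp
    · rw [sum_eq_single l]
      · simp
      · intro m _ hm; simp [hm]
      · simp
  rw [four_curvForm]
  simp only [e1, Complex.ofReal_sub, sub_mul, sum_sub_distrib]
  rw [sub_eq_add_neg]
  congr 1
  · rw [ricPair_mul]
    refine sum_ext fun i => sum_ext fun j => sum_congr rfl fun k _ => ?_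
    rw [sum_eq_single j]
    · simp [ricci]
    · intro l _ hl; simp [hl.symm]
    · simp
  · rw [ctr_apply]
    simp only [← sum_neg_distrib]
    refine sum_ext fun i => ?_
    conv_rhs => rw [sum_comm]
    refine sum_ext fun j => ?_
    conv_rhs => rw [sum_comm]
    refine sum_ext fun k => sum_ext fun l => ?_
    rw [hR.antisymm' i l k j, transpose_apply]
    push_cast; ring

lemma conj_skew (hv : vᵀ = -v) : (v.map conj)ᵀ = -v.map conj := by
  rw [← transpose_map, hv]
  ext i j; simp

lemma herm_hashT_sphere (hR : IsAlg R) (hv : vᵀ = -v) : 4 * Herm (hashT R 𝕊 n) v = (ricPair R (v * vᴴ)).re - 2 * Herm R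
      v := by
  have h := four_curvForm_hashT_sphere R hR v (v.map conj)
  have h' : (v.map conj)ᵀ = vᴴ := rfl
  rw [h', ← h', conj_skew hv, map_neg, ctr_eq_curvForm hR hv, ← sub_eq_add_neg, ← conj_skew hv, h'] at h
  have := congrArg re h
  rwa [sub_re, show (4 : ℂ) = ((4 : ℝ) : ℂ) by norm_num, show (2 : ℂ) = ((2 : ℝ) : ℂ) by
    norm_num, re_ofReal_mul, re_ofReal_mul] at this

lemma isAlg_sphere (n : ℕ) : IsAlg 𝕊 n := by
  have s : ∀ a b : Fin n, (if a = b then (1 : ℝ) else 0) = if b = a then 1 else 0 := fun a b => by simp only [eq_comm]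
  refine ⟨fun i j k l => ?_, fun i j k l => ?_, fun i j k l => ?_⟩
  · simp only [sphereCurv]; ring
  · simp only [sphereCurv]
    rw [s k i, s l j, s k j, s l i]; ring
  · simp only [sphereCurv]
    rw [s j i, s k i, s k j]; ring

lemma ricci_sphereCurv (n : ℕ) : ricci 𝕊 n = ((n : ℝ) - 1) • 1 := by
  ext i j
  simp only [ricci, sphereCurv, of_apply, Matrix.smul_apply, smul_eq_mul, sum_sub_distrib, Matrix.one_apply]
  rw [sum_eq_single i (f := fun q => (if i = q then (1 : ℝ) else 0) * if q = j then 1 else 0)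
    (fun q _ hq => by simp [hq.symm]) (by simp)]
  by_cases h : i = j <;> simp [h]

lemma scal_sphereCurv (n : ℕ) : scal 𝕊 n = n * ((n : ℝ) - 1) := by
  rw [scal, ricci_sphereCurv]
  simp [mul_comm]

lemma ricPair_of_smul_one {c : ℝ} (h : ricci R = c • 1) (N : Mℂ n) : ricPair R N = c * N.trace := by
  simp [ricPair, h, Matrix.one_apply, trace, mul_sum, apply_ite ofReal]

lemma trace_mul_conjTranspose (v : Mℂ n) : (v * vᴴ).trace = ((∑ i, ∑ j, ‖v i j‖ ^ 2 : ℝ) : ℂ) := by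
  simp only [trace, diag_apply, mul_apply, conjTranspose_apply]
  push_cast
  exact sum_ext fun i => sum_ext fun j => mul_conj' _

lemma curvForm_sphere (hv : vᵀ = -v) (w : Mℂ n) : 2 * ℛ 𝕊 n v w = (v * wᵀ).trace := by
  have e : 4 * ℛ 𝕊 n v w = 2 * (v * wᵀ).trace := by
    have s1 : ∀ i j, ∑ k, ∑ l, (sphereCurv n i j k l : ℂ) * v i j * w k l = v i j * w i j - v i j * w j i := fun i j =>
        by
      simp only [sphereCurv, Complex.ofReal_sub, sub_mul, sum_sub_distrib]
      congr 1
      · rw [sum_eq_single i (fun k _ hk => by simp [hk.symm]) (by simp),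
          sum_eq_single j (fun k _ hk => by simp [hk.symm]) (by simp)]
        simp
      · rw [sum_eq_single j (fun k _ hk => by simp [hk.symm]) (by simp),
          sum_eq_single i (fun k _ hk => by simp [hk.symm]) (by simp)]
        simp
    rw [four_curvForm]
    simp only [s1, sum_sub_distrib, trace, diag_apply, mul_apply, transpose_apply]
    have s2 : ∑ i, ∑ j, v i j * w j i = -∑ i, ∑ j, v i j * w i j := by
      rw [sum_comm, ← sum_neg_distrib]
      refine sum_ext fun i => ?_
      rw [← sum_neg_distrib]
      refine sum_ext fun j => ?_
      rw [show v j i = -v i j from congr_fun₂ hv i j, neg_mul]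
    rw [s2]
    ring
  linear_combination (1 / 2 : ℂ) * e

lemma two_herm_sphere (hv : vᵀ = -v) : 2 * Herm 𝕊 n v = ∑ i, ∑ j, ‖v i j‖ ^ 2 := by
  have h := curvForm_sphere hv (v.map conj)
  rw [show (v.map conj)ᵀ = vᴴ from rfl, trace_mul_conjTranspose] at h
  have := congrArg re h
  rwa [show (2 : ℂ) = ((2 : ℝ) : ℂ) by norm_num, re_ofReal_mul, ofReal_re] at this

lemma slot_sphereCurv {Z : Mℝ n} (hZ : Zᵀ = -Z) (i j k l : Fin n) : slot Z 𝕊 n i j k l = 0 := by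
  have s2 : ∀ i j, Z j i = - Z i j := fun i j => congr_fun₂ hZ i j
  simp only [slot, sphereCurv, sum_add_distrib, mul_sub, sum_sub_distrib, mul_ite, mul_one, mul_zero, sum_ite_eq,
    sum_ite_eq', Finset.mem_univ, if_true, Finset.sum_ite_irrel, sum_const_zero]
  rw [s2 i k, s2 i l, s2 j k, s2 j l]
  split_ifs <;> ring

end Contractions

/-- The Kähler curvature tensor of constant holomorphic sectional curvature `2` in an orthonormal
basis in which the complex structure has the matrix `K`. -/
def kaehlerCurv (K : Mℝ n) (i j k l : Fin n) : ℝ := (1 / 2) * (sphereCurv n i j k l + K i k * K j l - K i l * K j k + 2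
  * K i j * K k l)

/-- Infinitesimal invariance of the first two slots of a tensor. -/
def SlotInv (K : Mℝ n) (R : Tℝ n) : Prop := ∀ a b c d, ∑ q, (K q a * R q b c d + K q b * R a q c d) = 0

lemma skew_apply {v : Mℝ n} (hv : vᵀ = -v) (i j : Fin n) : v j i = -v i j := congr_fun₂ hv i j

lemma isAlg_kaehler (hK : Kᵀ = -K) : IsAlg (kaehlerCurv K) := by
  have h := isAlg_sphere n
  refine ⟨fun i j k l => ?_, fun i j k l => ?_, fun i j k l => ?_⟩
  · simp only [kaehlerCurv]
    rw [h.antisymm i j, skew_apply hK i j]; ring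
  · simp only [kaehlerCurv]
    rw [h.pair_symm i j, skew_apply hK i k, skew_apply hK j l, skew_apply hK j k, skew_apply hK i l]; ring
  · simp only [kaehlerCurv]
    have := h.bianchi i j k l
    rw [skew_apply hK i j, skew_apply hK i k, skew_apply hK j k]
    linear_combination (1 / 2) * this

lemma sum_mul_apply (hK2 : K * K = -1) (a b : Fin n) : ∑ q, K a q * K q b = if a = b then -1 else 0 := by
  have := congr_fun₂ hK2 a b
  rw [mul_apply, Matrix.neg_apply, Matrix.one_apply] at this
  rw [this]
  split_ifs <;> simp

lemma slot_kaehlerCurv {Z : Mℝ n} (hZ : Zᵀ = -Z) (hc : Z * K = K * Z) (i j k l : Fin n) : slot Z (kaehlerCurv K) i j k l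
    = 0 := by
  have e : ∀ a b, ∑ q, Z q a * K q b = -∑ q, Z q b * K a q := fun a b => by
    have h := congr_fun₂ hc a b
    rw [mul_apply, mul_apply] at h
    have h1 : ∑ q, Z q a * K q b = -∑ q, Z a q * K q b := by
      rw [← sum_neg_distrib]
      exact sum_ext fun q => by rw [skew_apply hZ a q]; ring
    rw [h1, h]
    congr 1
    exact sum_ext fun q => mul_comm _ _
  have e1 : slot Z (kaehlerCurv K) i j k l = (1 / 2) * (slot Z 𝕊 n i j k l + K j l * (∑ q, Z q i * K q k + ∑ q, Z q k *
      K i q) + K i k * (∑ q, Z q j * K q l + ∑ q, Z q l * K j q) - K j k * (∑ q, Z q i * K q l + ∑ q, Z q l * K i q) - K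
      i l * (∑ q, Z q j * K q k + ∑ q, Z q k * K j q) + 2 * K k l * (∑ q, Z q i * K q j + ∑ q, Z q j * K i q) + 2 * K i
      j * (∑ q, Z q k * K q l + ∑ q, Z q l * K k q)) := by
    simp only [slot, kaehlerCurv, mul_sum, ← sum_add_distrib, ← sum_sub_distrib]
    exact sum_ext fun q => by ring
  rw [e1, slot_sphereCurv hZ i j k l, e, e, e, e, e, e]
  ring

lemma kaehlerCurv_slotInvariant (hK : Kᵀ = -K) (hK2 : K * K = -1) : SlotInv K (kaehlerCurv K) := fun a b c d => by
  have e1 : ∀ x y, ∑ q, K q x * K q y = if x = y then 1 else 0 := fun x y => by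
    have : ∑ q, K q x * K q y = -∑ q, K x q * K q y := by
      rw [← sum_neg_distrib]
      exact sum_ext fun q => by rw [skew_apply hK x q]; ring
    rw [this, sum_mul_apply hK2]
    split_ifs <;> simp
  have e3 : ∀ x y, ∑ q, K q x * K y q = -if x = y then 1 else 0 := fun x y => by
    rw [← e1, ← sum_neg_distrib]
    exact sum_ext fun q => by rw [skew_apply hK q y]; ring
  have e4 : ∀ x y (f : ℝ), ∑ q, K q x * ((if q = y then 1 else 0) * f) = K y x * f := fun x y f => by simp
  have e5 : ∀ x y (f : ℝ), ∑ q, K q x * (f * (if q = y then 1 else 0)) = K y x * f := fun x y f => by simp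
  have e2 : ∑ q, (K q a * kaehlerCurv K q b c d + K q b * kaehlerCurv K a q c d) = (1 / 2) * (∑ q, K q a * ((if q = c
      then 1 else 0) * (if b = d then 1 else 0)) - ∑ q, K q a * ((if q = d then 1 else 0) * (if b = c then 1 else 0)) +
        ∑ q, K q b * ((if a = c then 1 else 0) * (if q = d then 1 else 0)) - ∑ q, K q b * ((if a = d then 1 else 0) *
        (if q = c then 1 else 0)) + K b d * ∑ q, K q a * K q c - K b c * ∑ q, K q a * K q d + K a c * ∑ q, K q b * K q d
        - K a d * ∑ q, K q b * K q c + 2 * K c d * (∑ q, K q a * K q b + ∑ q, K q b * K a q)) := by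
    simp only [kaehlerCurv, sphereCurv, mul_sum, ← sum_add_distrib, ← sum_sub_distrib]
    exact sum_ext fun q => by ring
  rw [e2, e4, e4, e5, e5, e1, e1, e1, e1, e1, e3, skew_apply hK a c, skew_apply hK a d, skew_apply hK b d, skew_apply hK
    b c, show (if b = a then (1 : ℝ) else 0) = if a = b then 1 else 0 by simp only [eq_comm]]
  ring

lemma ricci_kaehlerCurv (hK : Kᵀ = -K) (hK2 : K * K = -1) : ricci (kaehlerCurv K) = (((n : ℝ) + 2) / 2) • 1 := by
  have hd := fun q => self_eq_neg.1 (skew_apply hK q q)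
  ext i j
  have h := congr_fun₂ (ricci_sphereCurv n) i j
  simp only [ricci, of_apply] at h
  simp only [ricci, of_apply]
  have e : ∑ q, kaehlerCurv K i q j q = (1 / 2) * (∑ q, sphereCurv n i q j q - 3 * ∑ q, K i q * K q j) := by
    simp only [kaehlerCurv, mul_sum, ← sum_sub_distrib]
    refine sum_ext fun q => ?_
    rw [hd, skew_apply hK q j]; ring
  rw [e, h, sum_mul_apply hK2]
  simp only [Matrix.smul_apply, Matrix.one_apply, smul_eq_mul]
  split_ifs <;> ring

lemma scal_kaehlerCurv (hK : Kᵀ = -K) (hK2 : K * K = -1) : scal (kaehlerCurv K) = n * (((n : ℝ) + 2) / 2) := by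
  rw [scal, ricci_kaehlerCurv hK hK2]
  simp [mul_comm]

variable (K) in
/-- The complex matrix of the complex structure. -/
abbrev cK : Mℂ n := K.map ofReal

lemma cK_apply (i j : Fin n) : cK K i j = (K i j : ℂ) := rfl

lemma cK_transpose (hK : Kᵀ = -K) : (cK K)ᵀ = -cK K := by
  rw [cK, ← transpose_map, hK]
  ext i j; simp

lemma cK_mul_self (hK2 : K * K = -1) : cK K * cK K = -1 := by
  have : cK K * cK K = (K * K).map ofRealHom := (Matrix.map_mul (f := ofRealHom)).symm
  rw [this, hK2]
  ext i j
  by_cases h : i = j <;> simp [h]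

lemma cK_map_conj : (cK K).map conj = cK K := by ext i j; simp

/-- A curvature tensor as a complex matrix pairing the first with the third index. -/
def cMat' (R : Tℝ n) : Matrix (Fin n × Fin n) (Fin n × Fin n) ℂ := of fun p q => (R p.1 q.1 p.2 q.2 : ℂ)

lemma ctr_eq_dotProduct (R : Tℝ n) (N N' : Mℂ n) : ctr R N N' = pairVec N ⬝ᵥ (cMat' R *ᵥ pairVec N') := by
  rw [ctr_apply, sum_comm_mid]
  simp only [dotProduct, mulVec, sum_prod_type, cMat', pairVec, of_apply, mul_sum]
  refine sum4_congr fun a b c d => ?_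
  ring

lemma ctr_mul_left (hR : SlotInv K R) (N N' : Mℂ n) : ctr R (cK K * N) N' = -ctr R N (cK K * N') := by
  have e : ∀ N, (cK K ⊗ₖ (1 : Mℂ n)) *ᵥ pairVec N = pairVec (cK K * N) := fun N => by
    rw [kronecker_pairVec, transpose_one, mul_one]
  have h : (cK K ⊗ₖ (1 : Mℂ n))ᵀ * cMat' R + cMat' R * (cK K ⊗ₖ (1 : Mℂ n)) = 0 := by
    ext ⟨a, c⟩ ⟨b, d⟩
    have := hR a b c d
    simp only [Matrix.add_apply, mul_apply, transpose_apply, sum_prod_type, kroneckerMap_apply, map_apply,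
      Matrix.one_apply, cMat', of_apply, mul_ite, mul_one, mul_zero, ite_mul, zero_mul, sum_ite_eq', Finset.mem_univ,
      if_true, Matrix.zero_apply, ← sum_add_distrib]
    have h2 := congrArg ofReal this
    push_cast at h2
    rw [← h2]
    exact sum_ext fun q => by ring
  rw [ctr_eq_dotProduct, ctr_eq_dotProduct, ← e, ← e, mulVec_mulVec, ← vecMul_transpose, ← dotProduct_mulVec,
    mulVec_mulVec, eq_neg_of_add_eq_zero_left h, neg_mulVec, dotProduct_neg]

lemma curvForm_cK (hR : SlotInv K R) (v w : Mℂ n) : ℛ R (cK K * v + v * (cK K)ᵀ) w = 0 := by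
  have e : ((cK K) ⊗ₖ (1 : Mℂ n) + (1 : Mℂ n) ⊗ₖ (cK K)) *ᵥ pairVec v = pairVec (cK K * v + v * (cK K)ᵀ) := by
    rw [add_mulVec, kronecker_pairVec, kronecker_pairVec, pairVec_add, transpose_one, mul_one, one_mul]
  have h : ((cK K) ⊗ₖ (1 : Mℂ n) + (1 : Mℂ n) ⊗ₖ (cK K))ᵀ * cMat R = 0 := by
    ext ⟨a, b⟩ ⟨c, d⟩
    simp only [Matrix.add_apply, mul_apply, transpose_apply, sum_prod_type, kroneckerMap_apply, map_apply,
      Matrix.one_apply, cMat, of_apply, add_mul, sum_add_distrib, mul_ite, mul_one, mul_zero, ite_mul, zero_mul,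
      one_mul, sum_ite_eq', Finset.mem_univ, if_true]
    rw [sum_comm]
    simp only [sum_ite_eq', Finset.mem_univ, if_true, ← sum_add_distrib]
    have h2 := congrArg ofReal (hR a b c d)
    push_cast at h2
    exact h2
  rw [curvForm_eq_dot, ← e, ← vecMul_transpose, ← dotProduct_mulVec, mulVec_mulVec, h, zero_mulVec, dotProduct_zero,
    mul_zero]

lemma curvForm_eq_zero_of_anticomm (hR : SlotInv K R) (hK : Kᵀ = -K) (hK2 : K * K = -1) {u : Mℂ n} (hu : cK K * u = -(u
    * cK K)) (w : Mℂ n) : ℛ R u w = 0 := by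
  have h := curvForm_cK hR (cK K * u) w
  have e : cK K * (cK K * u) + cK K * u * (cK K)ᵀ = (-2 : ℂ) • u := by
    rw [cK_transpose hK, mul_neg, ← sub_eq_add_neg, ← mul_assoc, cK_mul_self hK2, hu, neg_one_mul, neg_mul, mul_assoc,
      cK_mul_self hK2, neg_smul, two_smul]
    simp only [mul_neg, mul_one, neg_neg]
    abel
  rw [e, curvForm_smul_left] at h
  simpa using h

lemma herm_add_null (hR : IsAlg R) (v : Mℂ n) {u : Mℂ n} (hu : ∀ w, curvForm R u w = 0) (hu' : ∀ w, curvForm R (u.map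
    conj) w = 0) : Herm R (v + u) = Herm R v := by rw [herm, Matrix.map_add _ (map_add _), curvForm_add_left, hu,
    add_zero, curvForm_add_right, curvForm_comm hR v (u.map _), hu', add_zero, herm]

lemma herm_bracket_nonneg (hR : IsAlg R) (hRK : SlotInv K R) (hK : Kᵀ = -K) (hK2 : K * K = -1) (hv : cK K * v = v * cK
    K) (h : ∀ w : Mℂ n, wᵀ = -w → cK K * w = w * cK K → 0 ≤ Herm R (w * v - v * w)) (hw : wᵀ = -w) : 0 ≤ Herm R (w * v -
    v * w) := by
  have hJ := cK_mul_self hK2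
  set J := cK K with hJdef
  have hJt := cK_transpose hK
  set w₁ := (1 / 2 : ℂ) • (w - J * w * J) with hw₁
  set w₂ := (1 / 2 : ℂ) • (w + J * w * J) with hw₂
  have hJJ : ∀ X : Mℂ n, J * (J * X) = -X := by intro X; rw [← mul_assoc, hJ, neg_one_mul]
  have t0 : w = w₁ + w₂ := by
    rw [hw₁, hw₂, ← smul_add, sub_add_add_cancel, ← two_smul ℂ w, smul_smul]
    norm_num
  have t1 : w₁ᵀ = -w₁ := by
    rw [hw₁, transpose_smul, transpose_sub, transpose_mul, transpose_mul, hJt, hw, ← smul_neg]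
    congr 1
    noncomm_ring
  have t2 : J * w₁ = w₁ * J := by
    rw [hw₁, Matrix.mul_smul, Matrix.smul_mul, Matrix.mul_sub, Matrix.sub_mul, mul_assoc J w J, hJJ, mul_assoc J,
      mul_assoc w J J, hJ]
    congr 1
    noncomm_ring
  have t3 : J * w₂ = -(w₂ * J) := by
    rw [hw₂, Matrix.mul_smul, Matrix.smul_mul, Matrix.mul_add, Matrix.add_mul, mul_assoc J w J, hJJ, mul_assoc J,
      mul_assoc w J J, hJ, ← smul_neg]
    congr 1
    noncomm_ring
  have e : w * v - v * w = (w₁ * v - v * w₁) + (w₂ * v - v * w₂) := by rw [t0]; noncomm_ring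
  have t4 : J * (w₂ * v - v * w₂) = -((w₂ * v - v * w₂) * J) := by
    rw [mul_sub, sub_mul, ← mul_assoc, t3, ← mul_assoc, hv, mul_assoc v J, t3, mul_assoc w₂ v, ← hv, neg_mul, ←
      mul_assoc w₂, mul_assoc v]
    noncomm_ring
  have t5 : J * (w₂ * v - v * w₂).map conj = -((w₂ * v - v * w₂).map conj * J) := by
    have := congrArg (fun M => M.map conj) t4
    rwa [Matrix.map_mul, cK_map_conj, Matrix.map_neg _ (map_neg _), Matrix.map_mul, cK_map_conj] at this
  rw [e, herm_add_null hR _ (curvForm_eq_zero_of_anticomm hRK hK hK2 t4) (curvForm_eq_zero_of_anticomm hRK hK hK2 t5)]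
  exact h w₁ t1 t2

lemma sum6_equiv {ι M : Type*} [Fintype ι] [AddCommMonoid M] (e : (ι × ι × ι) × (ι × ι × ι) ≃ (ι × ι × ι) × (ι × ι × ι))
    (f : (ι × ι × ι) × (ι × ι × ι) → M) : ∑ a, ∑ b, ∑ c, ∑ d, ∑ s, ∑ t, f (e ((a, b, c), (d, s, t))) = ∑ a, ∑ b, ∑ c, ∑
      d, ∑ s, ∑ t, f ((a, b, c), (d, s, t)) := by
  have := Fintype.sum_equiv e (fun x => f (e x)) f fun _ => rfl
  simpa only [sum_prod_type] using this

lemma sum6_congr {ι M : Type*} [Fintype ι] [AddCommMonoid M] {f g : ι → ι → ι → ι → ι → ι → M} (h : ∀ a b c d s t, f a b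
    c d s t = g a b c d s t) : ∑ a, ∑ b, ∑ c, ∑ d, ∑ s, ∑ t, f a b c d s t = ∑ a, ∑ b, ∑ c, ∑ d, ∑ s, ∑ t, g a b c d s t
    := sum4_congr fun a b c d => sum_ext fun s => sum_ext fun t => h a b c d s t

lemma four_curvForm_hashT (R S : Tℝ n) (v w : Mℂ n) : 4 * ℛ (hashT R S) v w = ∑ i, ∑ j, ∑ k, ∑ l, ∑ m, ∑ q, (R i m k q :
      ℂ) * S j m l q * v i j * w k l := by
  rw [four_curvForm]
  refine sum4_congr fun i j k l => ?_
  simp only [hashT, ofReal_sum, ofReal_mul, sum_mul]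

lemma four_curvForm_hashT_kaehler (hR : IsAlg R) (v w : Mℂ n) : 4 * ℛ (hashT R (kaehlerCurv K)) v w = (1 / 2 : ℂ) * (4 *
      ℛ (hashT R 𝕊 n) v w + ctr R (v * cK K * wᵀ) (cK K) + ctr R (v * cK K) (cK K * wᵀ) + 2 * (4 * ℛ R (v * cK K) (w *
        cK K))) := by
  have e2 : ∑ i, ∑ j, ∑ k, ∑ l, ∑ m, ∑ q, (R i m k q : ℂ) * (K j l * K m q) * v i j * w k l = ctr R (v * cK K * wᵀ) (cK
      K) := by
    have h : ctr R (v * cK K * wᵀ) (cK K) = ∑ i, ∑ m, ∑ k, ∑ q, ∑ l, ∑ j, (R i m k q : ℂ) * (K j l * K m q) * v i j * w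
        k l := by
      rw [ctr_apply]
      refine sum4_congr fun i m k q => ?_
      simp only [mul_apply, mul_sum, sum_mul, transpose_apply, map_apply]
      exact sum_ext fun _ => sum_ext fun _ => by ring
    rw [h]
    exact sum6_equiv ⟨fun x => ((x.1.1, x.2.2.1, x.1.2.2), (x.2.2.2, x.2.1, x.1.2.1)), fun x => ((x.1.1, x.2.2.2,
      x.1.2.2), (x.2.2.1, x.1.2.1, x.2.1)), fun _ => rfl, fun _ => rfl⟩ fun x => (R x.1.1 x.1.2.1 x.1.2.2 x.2.1 : ℂ) *
      (K x.2.2.2 x.2.2.1 * K x.1.2.1 x.2.1) * v x.1.1 x.2.2.2 * w x.1.2.2 x.2.2.1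
  have e3 : ∑ i, ∑ j, ∑ k, ∑ l, ∑ m, ∑ q, -((R i m k q : ℂ) * (K j q * K m l) * v i j * w k l) = ctr R (v * cK K) (cK K
      * wᵀ) := by
    have h : ctr R (v * cK K) (cK K * wᵀ) = ∑ i, ∑ m, ∑ q, ∑ k, ∑ j, ∑ l, -((R i m k q : ℂ) * (K j q * K m l) * v i j *
        w k l) := by
      rw [ctr_apply]
      refine sum4_congr fun i m q k => ?_
      rw [mul_apply, mul_apply, mul_assoc, sum_mul_sum, mul_sum]
      refine sum_ext fun j => ?_
      rw [mul_sum]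
      refine sum_ext fun l => ?_
      rw [hR.antisymm' i m q k, transpose_apply, cK_apply, cK_apply]
      push_cast; ring
    rw [h]
    exact sum6_equiv ⟨fun x => ((x.1.1, x.2.2.1, x.2.2.2), (x.1.2.2, x.1.2.1, x.2.1)), fun x => ((x.1.1, x.2.2.1,
      x.2.1), (x.2.2.2, x.1.2.1, x.1.2.2)), fun _ => rfl, fun _ => rfl⟩ fun x => -((R x.1.1 x.1.2.1 x.2.1 x.1.2.2 : ℂ) *
      (K x.2.2.1 x.1.2.2 * K x.1.2.1 x.2.2.2) * v x.1.1 x.2.2.1 * w x.2.1 x.2.2.2)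
  have e4 : ∑ i, ∑ j, ∑ k, ∑ l, ∑ m, ∑ q, (R i m k q : ℂ) * (K j m * K l q) * v i j * w k l = 4 * ℛ R (v * cK K) (w * cK
      K) := by
    have h : 4 * ℛ R (v * cK K) (w * cK K) = ∑ i, ∑ m, ∑ k, ∑ q, ∑ j, ∑ l, (R i m k q : ℂ) * (K j m * K l q) * v i j * w
        k l := by
      rw [four_curvForm]
      refine sum4_congr fun i m k q => ?_
      rw [mul_apply, mul_apply, mul_assoc, sum_mul_sum, mul_sum]
      refine sum_ext fun j => ?_
      rw [mul_sum]
      refine sum_ext fun l => ?_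
      rw [cK_apply, cK_apply]
      ring
    rw [h]
    exact sum6_equiv ⟨fun x => ((x.1.1, x.2.2.1, x.1.2.2), (x.2.2.2, x.1.2.1, x.2.1)), fun x => ((x.1.1, x.2.2.1,
      x.1.2.2), (x.2.2.2, x.1.2.1, x.2.1)), fun _ => rfl, fun _ => rfl⟩ fun x => (R x.1.1 x.1.2.1 x.1.2.2 x.2.1 : ℂ) *
      (K x.2.2.1 x.1.2.1 * K x.2.2.2 x.2.1) * v x.1.1 x.2.2.1 * w x.1.2.2 x.2.2.2
  rw [← e2, ← e3, ← e4, four_curvForm_hashT, four_curvForm_hashT]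
  simp only [mul_sum, ← sum_add_distrib]
  refine sum6_congr fun i j k l m q => ?_
  simp only [kaehlerCurv]
  push_cast
  ring

lemma herm_hashT_kaehler (hR : IsAlg R) (hRK : SlotInv K R) (hK : Kᵀ = -K) (hK2 : K * K = -1) (hv : vᵀ = -v) (hc : cK K
    * v = v * cK K) : 4 * Herm (hashT R (kaehlerCurv K)) v = (ricPair R (v * vᴴ)).re - 2 * Herm R v := by
  have h := four_curvForm_hashT_kaehler (K := K) hR v (v.map conj)
  have h' : (v.map conj)ᵀ = vᴴ := rfl
  have hw := conj_skew hv
  rw [h'] at hw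
  have h1 : ctr R (v * cK K * vᴴ) (cK K) = ricPair R (v * vᴴ) := by
    have := ctr_mul_left hRK (v * vᴴ) (cK K * 1)
    rw [← hc, mul_assoc, ← mul_one (cK K), mul_assoc (cK K) 1, one_mul, this, ← mul_assoc, cK_mul_self hK2, mul_one,
      map_neg, neg_neg, ctr_one_right]
  have h2 : ctr R (v * cK K) (cK K * vᴴ) = ctr R v vᴴ := by
    rw [← hc, ctr_mul_left hRK, ← mul_assoc, cK_mul_self hK2, neg_one_mul, map_neg, neg_neg]
  have h3 : ℛ R (v * cK K) (v.map conj * cK K) = 0 := by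
    refine curvForm_eq_zero_of_symm hR ?_ _
    rw [transpose_mul, cK_transpose hK, hv, neg_mul_neg, hc]
  rw [four_curvForm_hashT_sphere R hR, h', h1, h2, h3, hw, map_neg, ctr_eq_curvForm hR hv, ← hw] at h
  have h4 : 4 * ℛ (hashT R (kaehlerCurv K)) v (v.map conj) = ricPair R (v * vᴴ) - 2 * ℛ R v (v.map conj) := by
    rw [h]; ring
  have := congrArg re h4
  rwa [sub_re, show (4 : ℂ) = ((4 : ℝ) : ℂ) by norm_num, show (2 : ℂ) = ((2 : ℝ) : ℂ) by
    norm_num, re_ofReal_mul, re_ofReal_mul] at this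

local notation:max "TraceIneq" R:max S:max v:max =>
  2 * Complex.re (ricPair R (v * vᴴ)) ≤ scal R * Herm S v

def wedge (x y : Vℂ n) : Mℂ n := vecMulVec x y - vecMulVec y x

def pr (x : Vℂ n) : Mℂ n := vecMulVec x (star x)

lemma pr_apply (x : Vℂ n) (i j : Fin n) : pr x i j = x i * conj (x j) := rfl

lemma wedge_apply (x y : Vℂ n) (i j : Fin n) : wedge x y i j = x i * y j - y i * x j := rfl

lemma wedge_transpose (x y : Vℂ n) : (wedge x y)ᵀ = -wedge x y := by
  ext i j
  simp only [transpose_apply, Matrix.neg_apply, wedge_apply]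
  ring

lemma wedge_map_conj (x y : Vℂ n) : (wedge x y).map conj = wedge (star x) (star y) := by
  ext i j
  simp [wedge_apply]

lemma curvForm_wedge (hR : IsAlg R) (p q p' q' : Vℂ n) : ℛ R (wedge p q) (wedge p' q') = ctr R (vecMulVec p p')
    (vecMulVec q q') := by
  have h1 : ∀ v w, curvForm R vᵀ w = -ℛ R v w := fun v w => by
    rw [curvForm_transpose_left, show (fun i j k l => R j i k l) = fun i j k l => -R i j k l from by
      funext i j k l; exact hR.antisymm j i k l, curvForm_neg]
  have h2 : ∀ v w, curvForm R v wᵀ = -ℛ R v w := fun v w => by rw [curvForm_comm hR, h1, curvForm_comm hR]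
  have e : ∀ x y : Vℂ n, wedge x y = vecMulVec x y + -(vecMulVec x y)ᵀ := fun x y => by
    rw [wedge, sub_eq_add_neg, transpose_vecMulVec]
  rw [e, e, curvForm_add_left, curvForm_add_right, curvForm_add_right, curvForm_neg_left, curvForm_neg_left,
    curvForm_neg_right, curvForm_neg_right, h1, h1, h2]
  have h3 : 4 * ℛ R (vecMulVec p q) (vecMulVec p' q') = ctr R (vecMulVec p p') (vecMulVec q q') := by
    rw [four_curvForm, ctr_apply]
    refine sum4_congr fun a b c d => ?_
    simp only [vecMulVec_apply]
    ring
  rw [← h3]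
  ring

lemma herm_wedge (hR : IsAlg R) (p q : Vℂ n) : Herm R (wedge p q) = (ctr R (pr p) (pr q)).re := by
  rw [herm, wedge_map_conj, curvForm_wedge hR, pr, pr]

lemma herm_smul (R : Tℝ n) (c : ℂ) (v : Mℂ n) : Herm R (c • v) = ‖c‖ ^ 2 * Herm R v := by
  rw [herm, map_conj_smul, curvForm_smul_left, curvForm_smul_right, ← mul_assoc,
    mul_conj', ← ofReal_pow, re_ofReal_mul, herm]

lemma ricPair_smul (c : ℂ) (N : Mℂ n) : ricPair R (c • N) = c * ricPair R N := by
  rw [← ctr_one_right, ← ctr_one_right, map_smul, LinearMap.smul_apply, smul_eq_mul]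

lemma ricPair_add (N N' : Mℂ n) : ricPair R (N + N') = ricPair R N + ricPair R N' := by
  rw [← ctr_one_right, ← ctr_one_right, ← ctr_one_right, map_add, LinearMap.add_apply]

lemma smul_mul_conjTranspose (c : ℂ) (v : Mℂ n) : (c • v) * (c • v)ᴴ = ((‖c‖ ^ 2 : ℝ) : ℂ) • (v * vᴴ) := by
  rw [Matrix.conjTranspose_smul, Matrix.smul_mul, Matrix.mul_smul, smul_smul, star_def, mul_conj', ofReal_pow]

lemma trace_ineq_smul {I₀ : Tℝ n} (c : ℂ) (h : TraceIneq R I₀ v) : TraceIneq R I₀ (c • v) := by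
  rw [smul_mul_conjTranspose, ricPair_smul, re_ofReal_mul, herm_smul]
  nlinarith [sq_nonneg ‖c‖]

lemma wedge_mulVec (x y z : Vℂ n) : wedge x y *ᵥ z = (y ⬝ᵥ z) • x - (x ⬝ᵥ z) • y := by
  funext i
  simp only [wedge, sub_mulVec, vecMulVec_mulVec, Pi.sub_apply, Pi.smul_apply, smul_eq_mul,
    MulOpposite.smul_eq_mul_unop, MulOpposite.unop_op]
  ring

lemma wedge_mul_conjTranspose (hx : star x ⬝ᵥ x = 1) (hy : star y ⬝ᵥ y = 1) (hxy : star x ⬝ᵥ y = 0) : wedge x y * (wedge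
    x y)ᴴ = pr x + pr y := by
  have hyx : star y ⬝ᵥ x = 0 := by
    have := congrArg star hxy
    rwa [star_dotProduct, star_star, star_zero] at this
  rw [wedge, conjTranspose_sub, conjTranspose_vecMulVec, conjTranspose_vecMulVec, mul_sub, sub_mul, sub_mul]
  simp only [vecMulVec_mul_vecMulVec]
  rw [dotProduct_comm y (star y), dotProduct_comm x (star x), dotProduct_comm y (star x), dotProduct_comm x (star y),
    hx, hy, hxy, hyx, pr, pr]
  simp

lemma rank_wedge (hx : star x ⬝ᵥ x ≠ 0) (hy : star y ⬝ᵥ y ≠ 0) (hxy : star x ⬝ᵥ y = 0) : (wedge x y).rank = 2 := by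
  have hyx : star y ⬝ᵥ x = 0 := by
    have := congrArg star hxy
    rwa [star_dotProduct, star_star, star_zero] at this
  apply le_antisymm
  · have hle : LinearMap.range (wedge x y).mulVecLin ≤ Submodule.span ℂ (Set.range ![x, y]) := by
      rintro _ ⟨z, rfl⟩
      rw [mulVecLin_apply, wedge_mulVec]
      exact sub_mem (Submodule.smul_mem _ _ (Submodule.subset_span ⟨0, rfl⟩)) (Submodule.smul_mem _ _
        (Submodule.subset_span ⟨1, rfl⟩))
    exact (Submodule.finrank_mono hle).trans (by simpa [Set.finrank] using finrank_range_le_card ![x, y])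
  · have hli : LinearIndependent ℂ ![x, y] := by
      rw [LinearIndependent.pair_iff]
      intro s t h
      have h1 := congrArg (fun z => star x ⬝ᵥ z) h
      have h2 := congrArg (fun z => star y ⬝ᵥ z) h
      simp only [dotProduct_add, dotProduct_smul, hxy, hyx, smul_eq_mul, mul_zero, add_zero, zero_add, dotProduct_zero,
        mul_eq_zero, hx, hy, or_false] at h1 h2
      exact ⟨h1, h2⟩
    have hr : ∀ i, ![x, y] i ∈ LinearMap.range (wedge x y).mulVecLin := fun i => by
      fin_cases i
      · refine ⟨(star y ⬝ᵥ y)⁻¹ • star y, ?_⟩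
        rw [mulVecLin_apply, mulVec_smul, wedge_mulVec, dotProduct_comm y, dotProduct_comm x, hyx, zero_smul, sub_zero,
          smul_smul, inv_mul_cancel₀ hy, one_smul]
        rfl
      · refine ⟨-(star x ⬝ᵥ x)⁻¹ • star x, ?_⟩
        rw [mulVecLin_apply, mulVec_smul, wedge_mulVec, dotProduct_comm y, dotProduct_comm x, hxy, zero_smul, zero_sub,
          smul_neg, neg_smul, neg_neg, smul_smul, inv_mul_cancel₀ hx, one_smul]
        rfl
    have h3 := finrank_span_eq_card hli
    rw [Fintype.card_fin] at h3
    refine h3.symm.le.trans ?_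
    exact Submodule.finrank_mono (Submodule.span_le.2 (by rintro _ ⟨i, rfl⟩; exact hr i))

lemma exists_orthonormal_pair_of_finrank_two {V : Submodule ℂ Eℂ n} (hV : Module.finrank ℂ V = 2) : ∃ x y : Vℂ n, star x
    ⬝ᵥ x = 1 ∧ star y ⬝ᵥ y = 1 ∧ star x ⬝ᵥ y = 0 ∧ ∀ z : Vℂ n, WithLp.toLp 2 z ∈ V → (star x ⬝ᵥ z) • x + (star y ⬝ᵥ z) •
        y = z := by
  let b : OrthonormalBasis (Fin 2) ℂ V := (stdOrthonormalBasis ℂ V).reindex (finCongr hV)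
  have hin : ∀ z w : Eℂ n, inner ℂ z w = star (WithLp.ofLp z) ⬝ᵥ WithLp.ofLp w :=
    fun z w => by rw [EuclideanSpace.inner_eq_star_dotProduct, dotProduct_comm]
  have hb : ∀ i j, star (WithLp.ofLp (b i : Eℂ n)) ⬝ᵥ WithLp.ofLp (b j : Eℂ n) = if i = j then 1 else 0 := fun i j => by
    rw [← hin, ← Submodule.coe_inner]
    exact orthonormal_iff_ite.1 b.orthonormal i j
  refine ⟨WithLp.ofLp (b 0 : Eℂ n), WithLp.ofLp (b 1 : Eℂ n), by simpa using hb 0 0, by simpa using hb 1 1,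
    by simpa using hb 0 1, fun z hz => ?_⟩
  have hs := b.sum_repr' ⟨_, hz⟩
  rw [Fin.sum_univ_two] at hs
  simpa only [Submodule.coe_inner, hin, Submodule.coe_add, Submodule.coe_smul, WithLp.ofLp_add, WithLp.ofLp_smul] using
    (congrArg (fun t : V => WithLp.ofLp (t : Eℂ n)) hs)

lemma exists_wedge_of_rank_two (hv : vᵀ = -v) (hr : v.rank = 2) : ∃ (c : ℂ) (x y : Vℂ n), star x ⬝ᵥ x = 1 ∧ star y ⬝ᵥ y
    = 1 ∧ star x ⬝ᵥ y = 0 ∧ v = c • wedge x y := by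
  let V : Submodule ℂ Eℂ n := LinearMap.range (toEuclideanLin v)
  have hfr : Module.finrank ℂ V = 2 := by
    rw [← hr, rank_eq_finrank_range_toLin v (PiLp.basisFun 2 ℂ (Fin n)) (PiLp.basisFun 2 ℂ (Fin n))]
    rfl
  obtain ⟨x, y, h1, h2, h3, h4⟩ := exists_orthonormal_pair_of_finrank_two hfr
  have hP : (pr x + pr y) * v = v := by
    refine ext_of_mulVec_single fun k => ?_
    set z := v *ᵥ Pi.single k 1 with hz
    have hzV : (WithLp.toLp 2 z : Eℂ n) ∈ V := ⟨WithLp.toLp 2 (Pi.single k 1), rfl⟩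
    rw [← mulVec_mulVec, ← hz, add_mulVec, pr, pr, vecMulVec_mulVec, vecMulVec_mulVec]
    simpa using h4 _ hzV
  have hP' : v * (pr x + pr y)ᵀ = v := by
    have := congrArg transpose hP
    rw [transpose_mul, hv, neg_mul] at this
    exact neg_inj.1 this
  have hz : ∀ z : Vℂ n, z ⬝ᵥ (v *ᵥ z) = 0 := fun z => by
    have : z ⬝ᵥ (v *ᵥ z) = -(z ⬝ᵥ (v *ᵥ z)) := by conv_lhs => rw [dotProduct_mulVec, ← mulVec_transpose, hv, neg_mulVec,
        neg_dotProduct, dotProduct_comm]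
    exact self_eq_neg.1 this
  have hz2 : star y ⬝ᵥ (v *ᵥ star x) = -(star x ⬝ᵥ (v *ᵥ star y)) := by
    rw [dotProduct_mulVec, ← mulVec_transpose, hv, neg_mulVec, neg_dotProduct, dotProduct_comm]
  refine ⟨star x ⬝ᵥ (v *ᵥ star y), x, y, h1, h2, h3, ?_⟩
  have e : ∀ p q : Vℂ n, pr p * v * (pr q)ᵀ = (star p ⬝ᵥ (v *ᵥ star q)) • vecMulVec p q := fun p q => by
    rw [pr, pr, transpose_vecMulVec, vecMulVec_mul, vecMulVec_mul_vecMulVec, dotProduct_mulVec, vecMulVec_smul]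
  calc v = (pr x + pr y) * v * (pr x + pr y)ᵀ := by rw [hP, hP']
    _ = _ := by rw [transpose_add, add_mul, mul_add, add_mul, add_mul,
        e, e, e, e, hz, hz, hz2, wedge, zero_smul, zero_smul, zero_add, add_zero, neg_smul,
        smul_sub, sub_eq_add_neg, add_comm]

/-- The value of a curvature tensor on a decomposable two-vector. -/
def biCurv (R : Tℝ n) (p q : Vℂ n) : ℝ := (ctr R (pr p) (pr q)).re

lemma biCurv_comm (hR : IsAlg R) (p q : Vℂ n) : biCurv R p q = biCurv R q p := by rw [biCurv, ctr_comm hR, biCurv]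

lemma herm_wedge' (hR : IsAlg R) (p q : Vℂ n) : Herm R (wedge p q) = biCurv R p q := herm_wedge hR p q

lemma biCurv_self (hR : IsAlg R) (p : Vℂ n) : biCurv R p p = 0 := by
  rw [← herm_wedge' hR, wedge, sub_self, herm, curvForm]
  simp

lemma biCurv_star (hR : IsAlg R) (p q : Vℂ n) : biCurv R (star p) (star q) = biCurv R p q := by
  rw [← herm_wedge' hR, ← herm_wedge' hR, ← wedge_map_conj, herm, map_conj_map_conj, curvForm_comm hR, herm]

lemma biCurv_star_left (hR : IsAlg R) (p : Vℂ n) {q : Vℂ n} (hq : star q = q) : biCurv R (star p) q = biCurv R p q := by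
  rw [← biCurv_star hR p q, hq]

lemma pr_smul (c : ℂ) (p : Vℂ n) : pr (c • p) = ((‖c‖ ^ 2 : ℝ) : ℂ) • pr p := by
  ext i j
  simp only [pr_apply, Pi.smul_apply, smul_eq_mul, map_mul, Matrix.smul_apply]
  rw [ofReal_pow, ← mul_conj']
  ring

lemma pr_add_pr_sub (p q : Vℂ n) : pr (p + q) + pr (p - q) = (2 : ℂ) • (pr p + pr q) := by
  ext i j
  simp only [pr_apply, Pi.add_apply, Pi.sub_apply, smul_eq_mul, map_add, map_sub, Matrix.smul_apply, Matrix.add_apply]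
  ring

lemma biCurv_smul_left (c : ℂ) (p q : Vℂ n) : biCurv R (c • p) q = ‖c‖ ^ 2 * biCurv R p q := by
  rw [biCurv, pr_smul, map_smul, LinearMap.smul_apply, smul_eq_mul, re_ofReal_mul, biCurv]

lemma biCurv_smul_right (c : ℂ) (p q : Vℂ n) : biCurv R p (c • q) = ‖c‖ ^ 2 * biCurv R p q := by
  rw [biCurv, pr_smul, map_smul, smul_eq_mul, re_ofReal_mul, biCurv]

lemma biCurv_add_sub_left (p q r : Vℂ n) : biCurv R (p + q) r + biCurv R (p - q) r = 2 * (biCurv R p r + biCurv R q r)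
    := by
  simp only [biCurv]
  rw [← add_re, ← LinearMap.add_apply, ← map_add, pr_add_pr_sub, map_smul, LinearMap.smul_apply, map_add,
    LinearMap.add_apply, smul_eq_mul, ← add_re]
  simp

lemma biCurv_add_sub_right (p q r : Vℂ n) : biCurv R r (p + q) + biCurv R r (p - q) = 2 * (biCurv R r p + biCurv R r q)
    := by
  simp only [biCurv]
  rw [← add_re, ← map_add, pr_add_pr_sub, map_smul, map_add, smul_eq_mul, ← add_re]
  simp

lemma herm_sphere_wedge (hx : star x ⬝ᵥ x = 1) (hy : star y ⬝ᵥ y = 1) (hxy : star x ⬝ᵥ y = 0) : Herm 𝕊 n (wedge x y) = 1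
    := by
  have h := curvForm_sphere (wedge_transpose x y) ((wedge x y).map conj)
  have e : ((wedge x y).map conj)ᵀ = (wedge x y)ᴴ := rfl
  have t : ∀ z : Vℂ n, (pr z).trace = star z ⬝ᵥ z := fun z => by rw [pr, trace_vecMulVec, dotProduct_comm]
  rw [e, wedge_mul_conjTranspose hx hy hxy, trace_add, t, t, hx, hy] at h
  have h2 : ℛ 𝕊 n (wedge x y) ((wedge x y).map conj) = 1 := by linear_combination h / 2
  rw [herm, h2, Complex.one_re]

lemma trace_ineq_wedge (hR : IsAlg R) (hx : star x ⬝ᵥ x = 1) (hy : star y ⬝ᵥ y = 1) (hxy : star x ⬝ᵥ y = 0) (h0 : biCurv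
    R x y = 0) {P : Mℂ n} (hP : P + pr x + pr y = 1) (h : 0 ≤ (ctr R P P).re) : TraceIneq R 𝕊 n (wedge x y) := by
  have e : ctr R P P = scal R - 2 * ricPair R (pr x + pr y) + (ctr R (pr x) (pr x) + 2 * ctr R (pr x) (pr y) + ctr R (pr
      y) (pr y)) := by
    rw [show P = 1 - (pr x + pr y) by rw [← hP]; abel, ← ricPair_one, ← ctr_one_right, ← ctr_one_right]
    simp only [map_sub, map_add, LinearMap.sub_apply, LinearMap.add_apply]
    rw [ctr_comm hR 1 (pr x), ctr_comm hR 1 (pr y), ctr_comm hR (pr y) (pr x)]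
    ring
  have h' := congrArg re e
  simp only [add_re, sub_re, ofReal_re, Complex.mul_re, Complex.re_ofNat, Complex.im_ofNat, zero_mul, sub_zero] at h'
  have h1 := biCurv_self hR x
  have h2 := biCurv_self hR y
  rw [biCurv] at h0 h1 h2
  rw [herm_sphere_wedge hx hy hxy, wedge_mul_conjTranspose hx hy hxy]
  linarith

lemma ctr_sum_sum {ι : Type*} (s : Finset ι) (p : ι → Vℂ n) : (ctr R (∑ i ∈ s, pr (p i)) (∑ i ∈ s, pr (p i))).re = ∑ i ∈
      s, ∑ j ∈ s, biCurv R (p i) (p j) := by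
  rw [map_sum (ctr R), LinearMap.sum_apply, re_sum]
  refine Finset.sum_congr rfl fun i _ => ?_
  rw [map_sum, re_sum]
  rfl

open scoped ComplexOrder in
lemma eq_zero_of_star_dot (h : star x ⬝ᵥ x = 0) : x = 0 := dotProduct_star_self_eq_zero.1 h

lemma wedge_eq_zero_or_rank (p q : Vℂ n) : wedge p q = 0 ∨ (wedge p q).rank = 2 := by
  by_cases hp : star p ⬝ᵥ p = 0
  · left
    rw [eq_zero_of_star_dot hp]
    ext i j; simp [wedge_apply]
  have e : wedge p q = wedge p (q - ((star p ⬝ᵥ q) / (star p ⬝ᵥ p)) • p) := by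
    ext i j
    simp only [wedge_apply, Pi.sub_apply, Pi.smul_apply, smul_eq_mul]
    ring
  rw [e]
  set q' := q - ((star p ⬝ᵥ q) / (star p ⬝ᵥ p)) • p with hq'
  have ho : star p ⬝ᵥ q' = 0 := by
    rw [hq', dotProduct_sub, dotProduct_smul, smul_eq_mul, div_mul_cancel₀ _ hp, sub_self]
  by_cases hq : star q' ⬝ᵥ q' = 0
  · left
    rw [eq_zero_of_star_dot hq]
    ext i j; simp [wedge_apply]
  · exact Or.inr (rank_wedge hp hq ho)

lemma herm_zero : Herm R 0 = 0 := by simp [herm, curvForm]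

lemma biCurv_nonneg_of_picTwo (hR : IsAlg R) (h : ∀ v ∈ picTwo.gen n, 0 ≤ Herm R v) (p q : Vℂ n) : 0 ≤ biCurv R p q :=
    by
  rw [← herm_wedge' hR]
  rcases wedge_eq_zero_or_rank p q with h0 | h2
  · rw [h0, herm_zero]
  · exact h _ ⟨(mem_so _ _ _).2 (wedge_transpose p q), h2⟩

lemma pr_mul_pr (x y : Vℂ n) : pr x * pr y = (star x ⬝ᵥ y) • vecMulVec x (star y) := by
  rw [pr, pr, vecMulVec_mul_vecMulVec, vecMulVec_smul]

lemma pr_conjTranspose (x : Vℂ n) : (pr x)ᴴ = pr x := by rw [pr, conjTranspose_vecMulVec, star_star]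

lemma star_dotProduct_eq_zero (h : star x ⬝ᵥ y = 0) : star y ⬝ᵥ x = 0 := by
  have := congrArg star h
  rwa [star_dotProduct, star_star, star_zero] at this

lemma trace_ineq_picTwo (hR : IsAlg R) (h : ∀ v ∈ picTwo.gen n, 0 ≤ Herm R v) (hv : v ∈ picTwo.gen n) (h0 : Herm R v =
    0) : TraceIneq R 𝕊 n v := by
  obtain ⟨c, x, y, hx, hy, hxy, rfl⟩ := exists_wedge_of_rank_two ((mem_so _ _ _).1 hv.1) hv.2
  have hc : c ≠ 0 := by
    rintro rfl
    have := hv.2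
    rw [zero_smul, rank_zero] at this
    omega
  refine trace_ineq_smul c ?_
  rw [herm_smul, herm_wedge' hR, mul_eq_zero] at h0
  replace h0 := h0.resolve_left (by positivity)
  set P : Mℂ n := 1 - (pr x + pr y) with hP
  have hPP : P * Pᴴ = P := by
    have hyx := star_dotProduct_eq_zero hxy
    rw [hP, conjTranspose_sub, conjTranspose_add, pr_conjTranspose, pr_conjTranspose, conjTranspose_one, sub_mul,
      one_mul, mul_sub, mul_one, mul_add, add_mul, add_mul]
    simp only [pr_mul_pr, hx, hy, hxy, hyx, zero_smul, one_smul]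
    simp only [pr]
    abel
  have hs : P = ∑ k, pr (fun i => P i k) := by
    conv_lhs => rw [← hPP]
    ext i j
    rw [Matrix.sum_apply, mul_apply]
    rfl
  refine trace_ineq_wedge hR hx hy hxy h0 (P := P) (by rw [hP]; abel) ?_
  rw [hs, ctr_sum_sum]
  exact sum_nonneg fun i _ => sum_nonneg fun j _ => biCurv_nonneg_of_picTwo hR h _ _

def cx (e : Eℝ n) : Vℂ n := fun i => (e i : ℂ)

def reV (z : Vℂ n) : Eℝ n := WithLp.toLp 2 fun i => (z i).re

def imV (z : Vℂ n) : Eℝ n := WithLp.toLp 2 fun i => (z i).im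

lemma cx_smul (a : ℝ) (e : Eℝ n) : cx (a • e) = (a : ℂ) • cx e := by funext i; simp [cx]

lemma star_cx (e : Eℝ n) : star (cx e) = cx e := by funext i; simp [cx]

lemma cx_dotProduct_cx (e f : Eℝ n) : cx e ⬝ᵥ cx f = (⟪e, f⟫ : ℂ) := by
  simp [cx, dotProduct, PiLp.inner_apply, mul_comm]

lemma cx_reV_add (z : Vℂ n) : cx (reV z) + I • cx (imV z) = z := by
  funext i
  simp [cx, reV, imV, mul_comm I, Complex.re_add_im]

lemma cx_reV_sub (z : Vℂ n) : cx (reV z) - I • cx (imV z) = star z := by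
  funext i
  apply Complex.ext <;> simp [cx, reV, imV]

lemma pr_add_pr_star (z : Vℂ n) : pr z + pr (star z) = (2 : ℂ) • (pr (cx (reV z)) + pr (cx (imV z))) := by
  conv_lhs => rw [← cx_reV_sub z, ← cx_reV_add z]
  have h := pr_add_pr_sub (cx (reV z)) (I • cx (imV z))
  rw [pr_smul I] at h
  simpa [reV, imV, cx] using h

lemma biCurv_cx_left (hR : IsAlg R) (z : Vℂ n) (f : Eℝ n) : biCurv R z (cx f) = biCurv R (cx (reV z)) (cx f) + biCurv R
    (cx (imV z)) (cx f) := by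
  have h := biCurv_add_sub_left (R := R) (cx (reV z)) (I • cx (imV z)) (cx f)
  rw [cx_reV_add, cx_reV_sub, biCurv_star_left hR z (star_cx f), biCurv_smul_left] at h
  simp at h
  linarith

lemma reV_add_I_smul (e f : Eℝ n) : reV (cx e + I • cx f) = e ∧ imV (cx e + I • cx f) = f := by
  constructor <;> ext i <;> simp [reV, imV, cx]

/-- The sum of the sectional curvatures over all pairs of a finite set of vectors. -/
def pairSum (R : Tℝ n) (s : Finset Eℝ n) : ℝ := ∑ e ∈ s, ∑ f ∈ s, biCurv R (cx e) (cx f)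

def OrthoSet (s : Finset Eℝ n) : Prop := ∀ e ∈ s, ∀ f ∈ s, ⟪e, f⟫ = if e = f then (1 : ℝ) else 0

lemma OrthoSet.mono {s t : Finset Eℝ n} (hs : OrthoSet s) (h : t ⊆ s) : OrthoSet t := fun e he f hf => hs e (h he) f (h
    hf)

lemma OrthoSet.insert {s : Finset Eℝ n} (hs : OrthoSet s) {e : Eℝ n} (he : ⟪e, e⟫ = 1) (h : ∀ f ∈ s, ⟪e, f⟫ = 0) :
    OrthoSet (insert e s) ∧ e ∉ s := by
  have hes := fun hm => by rw [h e hm] at he; exact zero_ne_one he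
  refine ⟨fun a ha b hb => ?_, hes⟩
  rw [Finset.mem_insert] at ha hb
  rcases ha with rfl | ha <;> rcases hb with rfl | hb
  · rw [he, if_pos rfl]
  · rw [h b hb, if_neg (by rintro rfl; exact hes hb)]
  · rw [real_inner_comm, h a ha, if_neg (by rintro rfl; exact hes ha)]
  · exact hs a ha b hb

lemma pairSum_insert (hR : IsAlg R) {s : Finset Eℝ n} {e : Eℝ n} (he : e ∉ s) : pairSum R (insert e s) = pairSum R s + 2
    * ∑ f ∈ s, biCurv R (cx e) (cx f) := by
  rw [pairSum, sum_insert he, sum_insert he, biCurv_self hR]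
  have : ∀ f ∈ s, ∑ g ∈ insert e s, biCurv R (cx f) (cx g) = biCurv R (cx e) (cx f) + ∑ g ∈ s, biCurv R (cx f) (cx g) :=
      fun f _ => by rw [sum_insert he, biCurv_comm hR]
  rw [sum_congr rfl this, sum_add_distrib, pairSum]
  ring

lemma pairSum_of_card_le_one (hR : IsAlg R) {s : Finset Eℝ n} (hs : s.card ≤ 1) : pairSum R s = 0 := by
  refine sum_eq_zero fun e he => sum_eq_zero fun f hf => ?_
  rw [Finset.card_le_one.1 hs e he f hf, biCurv_self hR]

lemma pairSum_nonneg_of_card (hR : IsAlg R) {m : ℕ} (hm : 2 ≤ m)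
    (h : ∀ s : Finset Eℝ n, OrthoSet s → s.card = m → 0 ≤ pairSum R s) :
    ∀ k, ∀ s : Finset Eℝ n, OrthoSet s → s.card = m + k → 0 ≤ pairSum R s := fun k => by
  induction k with
  | zero => exact fun s hs hc => h s hs hc
  | succ k ih =>
    intro s hs hc
    have h1 : ∀ e ∈ s, pairSum R s
        = pairSum R (s.erase e) + 2 * ∑ f ∈ s, biCurv R (cx e) (cx f) := fun e he => by
      conv_lhs => rw [← Finset.insert_erase he, pairSum_insert hR (Finset.notMem_erase e s)]
      rw [Finset.sum_erase s (biCurv_self hR _)]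
    have h2 : ∑ e ∈ s, pairSum R (s.erase e) = ((s.card : ℝ) - 2) * pairSum R s := by
      have h3 := sum_congr rfl h1
      rw [Finset.sum_const, nsmul_eq_mul, sum_add_distrib, ← mul_sum] at h3
      have h4 : ∑ e ∈ s, ∑ f ∈ s, biCurv R (cx e) (cx f) = pairSum R s := rfl
      rw [h4] at h3
      linarith
    have h5 := sum_nonneg fun e he =>
      ih _ (hs.mono (Finset.erase_subset e s)) (by rw [Finset.card_erase_of_mem he, hc]; omega)
    rw [h2, hc] at h5
    refine nonneg_of_mul_nonneg_right h5 ?_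
    have : (2 : ℝ) ≤ m := by exact_mod_cast hm
    push_cast
    have := Nat.cast_nonneg (α := ℝ) k
    linarith

lemma exists_orthonormal_complement {k : ℕ} {e : Fin k → Eℝ n} (he : Orthonormal ℝ e) : ∃ r : Finset Eℝ n, r.card + k =
    n ∧ OrthoSet r ∧ (∀ i, ∀ f ∈ r, ⟪e i, f⟫ = 0) ∧ ∑ i, pr (cx (e i)) + ∑ f ∈ r, pr (cx f) = 1 := by
  classical
  obtain ⟨u, b, hu, hb⟩ := he.toSubtypeRange.exists_orthonormalBasis_extension
  have hinj := he.linearIndependent.injective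
  have hsub : Finset.univ.image e ⊆ u := fun x hx => by
    obtain ⟨i, -, rfl⟩ := Finset.mem_image.1 hx
    exact hu ⟨i, rfl⟩
  have ho : OrthoSet u := fun x hx y hy => by
    have := orthonormal_iff_ite.1 b.orthonormal ⟨x, hx⟩ ⟨y, hy⟩
    rw [hb] at this
    simpa using this
  have hcard : u.card = n := by
    have := Module.finrank_eq_card_basis b.toBasis
    simpa using this.symm
  have hsum : ∑ f ∈ u, pr (cx f) = 1 := by
    refine ext_of_mulVec_single fun j => ?_
    have h1 := b.sum_repr' (EuclideanSpace.single j (1 : ℝ))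
    rw [hb, Finset.sum_coe_sort u fun f => ⟪f, EuclideanSpace.single j (1 : ℝ)⟫ • f] at h1
    funext i
    have h2 := congrArg (fun z : Eℝ n => z i) h1
    simp only [PiLp.inner_apply, PiLp.single_apply, RCLike.inner_apply, conj_trivial, ite_mul, one_mul, zero_mul,
      sum_ite_eq', Finset.mem_univ, if_true, WithLp.ofLp_sum, WithLp.ofLp_smul, Finset.sum_apply, Pi.smul_apply,
      smul_eq_mul] at h2
    rw [mulVec_single_one, col_apply, Matrix.sum_apply, one_mulVec, Pi.single_apply]
    simp only [pr_apply, cx, conj_ofReal]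
    rw [← ofReal_one, ← ofReal_zero, ← apply_ite ofReal, ← h2]
    push_cast
    exact Finset.sum_congr rfl fun f _ => mul_comm _ _
  refine ⟨u \ Finset.univ.image e, ?_, ho.mono Finset.sdiff_subset, ?_, ?_⟩
  · have := Finset.card_sdiff_add_card_eq_card hsub
    rwa [Finset.card_image_of_injective _ hinj, Finset.card_univ, Fintype.card_fin, hcard] at this
  · intro i f hf
    rw [Finset.mem_sdiff] at hf
    rw [ho _ (hsub (Finset.mem_image_of_mem e (Finset.mem_univ i))) f hf.1, if_neg]
    rintro rfl
    exact hf.2 (Finset.mem_image_of_mem e (Finset.mem_univ i))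
  · rw [← hsum, ← Finset.sum_sdiff hsub, Finset.sum_image fun a _ b _ h => hinj h, add_comm]

lemma dotProduct_of_reV_imV (x y : Vℂ n) : x ⬝ᵥ y = ((⟪reV x, reV y⟫ - ⟪imV x, imV y⟫ : ℝ) : ℂ) + ((⟪reV x, imV y⟫ +
      ⟪imV x, reV y⟫ : ℝ) : ℂ) * I := by
  conv_lhs => rw [← cx_reV_add x, ← cx_reV_add y]
  simp only [add_dotProduct, dotProduct_add, smul_dotProduct, dotProduct_smul, cx_dotProduct_cx, smul_eq_mul]
  push_cast
  linear_combination (⟪imV x, imV y⟫ : ℂ) * I_mul_I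

lemma star_dotProduct_of_reV_imV (x y : Vℂ n) : star x ⬝ᵥ y = ((⟪reV x, reV y⟫ + ⟪imV x, imV y⟫ : ℝ) : ℂ) + ((⟪reV x,
      imV y⟫ - ⟪imV x, reV y⟫ : ℝ) : ℂ) * I := by
  conv_lhs => rw [← cx_reV_sub x, ← cx_reV_add y]
  simp only [dotProduct_add, sub_dotProduct, smul_dotProduct, dotProduct_smul, cx_dotProduct_cx, smul_eq_mul]
  push_cast
  linear_combination -(⟪imV x, imV y⟫ : ℂ) * I_mul_I

lemma re_im_eq {a b a' b' : ℝ} (h : (a : ℂ) + (b : ℂ) * I = (a' : ℂ) + (b' : ℂ) * I) : a = a' ∧ b = b' := by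
  have h1 := congrArg re h
  have h2 := congrArg im h
  simp at h1 h2
  exact ⟨h1, h2⟩

lemma isotropic_reV_imV (hx : star x ⬝ᵥ x = 1) (hxx : x ⬝ᵥ x = 0) : ⟪reV x, reV x⟫ = (1 / 2 : ℝ) ∧ ⟪imV x, imV x⟫ = (1 /
    2 : ℝ) ∧ ⟪reV x, imV x⟫ = 0 := by
  rw [star_dotProduct_of_reV_imV] at hx
  rw [dotProduct_of_reV_imV] at hxx
  have h1 := re_im_eq (a' := 1) (b' := 0) (hx.trans (by simp))
  have h2 := re_im_eq (a' := 0) (b' := 0) (hxx.trans (by simp))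
  rw [real_inner_comm (reV x) (imV x)] at *
  refine ⟨by linarith [h1.1, h2.1], by linarith [h1.1, h2.1], by linarith [h2.2]⟩

lemma orthogonal_reV_imV (h : star x ⬝ᵥ y = 0) (h' : x ⬝ᵥ y = 0) : ⟪reV x, reV y⟫ = 0 ∧ ⟪imV x, imV y⟫ = 0 ∧ ⟪reV x, imV
      y⟫ = 0 ∧ ⟪imV x, reV y⟫ = 0 := by
  rw [star_dotProduct_of_reV_imV] at h
  rw [dotProduct_of_reV_imV] at h'
  have h1 := re_im_eq (a' := 0) (b' := 0) (h.trans (by simp))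
  have h2 := re_im_eq (a' := 0) (b' := 0) (h'.trans (by simp))
  refine ⟨by linarith [h1.1, h2.1], by linarith [h1.1, h2.1], by linarith [h1.2, h2.2], by linarith [h1.2, h2.2]⟩

abbrev IsoNonneg (R : Tℝ n) : Prop := ∀ p q, p ⬝ᵥ p = 0 → p ⬝ᵥ q = 0 → 0 ≤ biCurv R p q

lemma wedge_mul_wedge (x y : Vℂ n) : wedge x y * wedge x y = (x ⬝ᵥ y) • (vecMulVec x y + vecMulVec y x) - (y ⬝ᵥ y) •
    vecMulVec x x - (x ⬝ᵥ x) • vecMulVec y y := by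
  simp only [wedge, mul_sub, sub_mul, vecMulVec_mul_vecMulVec, vecMulVec_smul, smul_add, dotProduct_comm y x]
  abel

lemma wedge_cube (x y : Vℂ n) : wedge x y * wedge x y * wedge x y = ((x ⬝ᵥ y) ^ 2 - (x ⬝ᵥ x) * (y ⬝ᵥ y)) • wedge x y :=
    by
  rw [wedge_mul_wedge]
  ext i j
  simp only [wedge, mul_sub, sub_mul, add_mul, smul_mul, vecMulVec_mul_vecMulVec, vecMulVec_smul, dotProduct_comm y x,
    Matrix.sub_apply, Matrix.add_apply, Matrix.smul_apply, vecMulVec_apply, smul_eq_mul]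
  ring

lemma biCurv_nonneg_of_pic (hR : IsAlg R) (h : ∀ v ∈ pic.gen n, 0 ≤ Herm R v) {p q : Vℂ n} (hp : p ⬝ᵥ p = 0) (hpq : p ⬝ᵥ
    q = 0) (hq : q ⬝ᵥ q = 0) : 0 ≤ biCurv R p q := by
  rw [← herm_wedge' hR]
  rcases wedge_eq_zero_or_rank p q with h0 | h2
  · rw [h0, herm_zero]
  · refine h _ ⟨(mem_so _ _ _).2 (wedge_transpose p q), h2, ?_⟩
    rw [pow_two, wedge_mul_wedge, hp, hpq, hq]
    simp

lemma biCurv_nonneg_of_picOne (hR : IsAlg R) (h : ∀ v ∈ picOne.gen n, 0 ≤ Herm R v) {p q : Vℂ n} (hp : p ⬝ᵥ p = 0) (hpq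
    : p ⬝ᵥ q = 0) : 0 ≤ biCurv R p q := by
  rw [← herm_wedge' hR]
  rcases wedge_eq_zero_or_rank p q with h0 | h2
  · rw [h0, herm_zero]
  · refine h _ ⟨(mem_so _ _ _).2 (wedge_transpose p q), h2, ?_⟩
    rw [pow_succ, pow_two, wedge_cube, hp, hpq]
    simp

lemma null_dotProduct {e f : Eℝ n} (he : ⟪e, e⟫ = 1) (hf : ⟪f, f⟫ = 1) (hef : ⟪e, f⟫ = 0) : (cx e + I • cx f) ⬝ᵥ (cx e +
    I • cx f) = 0 := by
  rw [dotProduct_of_reV_imV, (reV_add_I_smul e f).1, (reV_add_I_smul e f).2, real_inner_comm e f, he, hf, hef]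
  simp

lemma biCurv_pair_nonneg (hR : IsAlg R) (hN : IsoNonneg R) {e f g : Eℝ n} (he : ⟪e, e⟫ = 1) (hf : ⟪f, f⟫ = 1) (hef : ⟪e,
    f⟫ = 0) (heg : ⟪e, g⟫ = 0) (hfg : ⟪f, g⟫ = 0) : 0 ≤ biCurv R (cx e) (cx g) + biCurv R (cx f) (cx g) := by
  have h := hN (cx e + I • cx f) (cx g) (null_dotProduct he hf hef) (by
    rw [add_dotProduct, smul_dotProduct, cx_dotProduct_cx, cx_dotProduct_cx, heg, hfg]; simp)
  rwa [biCurv_cx_left hR, (reV_add_I_smul e f).1, (reV_add_I_smul e f).2] at h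

lemma pairSum_nonneg_of_picOne (hR : IsAlg R) (hN : IsoNonneg R) {s : Finset Eℝ n} (hs : OrthoSet s) (hc : 3 ≤ s.card) :
    0 ≤ pairSum R s := by
  obtain ⟨k, hk⟩ := Nat.exists_eq_add_of_le hc
  refine pairSum_nonneg_of_card hR (by norm_num) (fun s hs hc => ?_) k s hs hk
  classical
  obtain ⟨a, b, c, hab, hac, hbc, rfl⟩ := Finset.card_eq_three.1 hc
  rw [pairSum_insert hR (by simp [hab, hac]), pairSum_insert hR (by simpa using hbc), pairSum_of_card_le_one hR (by
    simp)]
  have ha := hs a (by simp) a (by simp)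
  have hb := hs b (by simp) b (by simp)
  have hc := hs c (by simp) c (by simp)
  have h1 := hs a (by simp) b (by simp)
  have h2 := hs a (by simp) c (by simp)
  have h3 := hs b (by simp) c (by simp)
  rw [if_pos rfl] at ha hb hc
  rw [if_neg hab] at h1
  rw [if_neg hac] at h2
  rw [if_neg hbc] at h3
  have e1 := biCurv_pair_nonneg hR hN ha hb h1 h2 h3
  have e2 := biCurv_pair_nonneg hR hN ha hc h2 h1 (by rwa [real_inner_comm])
  have e3 := biCurv_pair_nonneg hR hN hb hc h3 (by rwa [real_inner_comm]) (by rwa [real_inner_comm])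
  rw [sum_insert (by simpa using hbc), sum_singleton, sum_singleton]
  rw [biCurv_comm hR (cx c) (cx b)] at e2
  rw [biCurv_comm hR (cx c) (cx a), biCurv_comm hR (cx b) (cx a)] at e3
  linarith

lemma biCurv_quad_nonneg (hR : IsAlg R) (hN : ∀ p q : Vℂ n, p ⬝ᵥ p = 0 → p ⬝ᵥ q = 0 → q ⬝ᵥ q = 0 → 0 ≤ biCurv R p q) {a
    b c d : Eℝ n} (ha : ⟪a, a⟫ = 1) (hb : ⟪b, b⟫ = 1) (hc : ⟪c, c⟫ = 1) (hd : ⟪d, d⟫ = 1) (hab : ⟪a, b⟫ = 0) (hac : ⟪a,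
    c⟫ = 0) (had : ⟪a, d⟫ = 0) (hbc : ⟪b, c⟫ = 0) (hbd : ⟪b, d⟫ = 0) (hcd : ⟪c, d⟫ = 0) : 0 ≤ biCurv R (cx a) (cx c) +
    biCurv R (cx a) (cx d) + biCurv R (cx b) (cx c) + biCurv R (cx b) (cx d) := by
  set p := cx a + I • cx b with hp
  have hpp := null_dotProduct ha hb hab
  have h : ∀ d : Eℝ n, ⟪d, d⟫ = 1 → ⟪a, d⟫ = 0 → ⟪b, d⟫ = 0 → ⟪c, d⟫ = 0 → 0 ≤ biCurv R p (cx c + I • cx d) := fun d hd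
      had hbd hcd => by
    refine hN _ _ hpp ?_ (null_dotProduct hc hd hcd)
    simp only [hp, add_dotProduct, dotProduct_add, smul_dotProduct, dotProduct_smul, cx_dotProduct_cx, hac, had, hbc,
      hbd]
    simp
  have h1 := h d hd had hbd hcd
  have h2 := h (-d) (by simpa using hd) (by simpa using had) (by simpa using hbd) (by simpa using hcd)
  have e := biCurv_add_sub_right (R := R) (cx c) (I • cx d) p
  rw [biCurv_smul_right, biCurv_cx_left hR p c, biCurv_cx_left hR p d, (reV_add_I_smul a b).1, (reV_add_I_smul a b).2,
    Complex.norm_I] at e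
  have e2 : cx c + I • cx (-d) = cx c - I • cx d := by funext i; simp [cx, sub_eq_add_neg]
  rw [e2] at h2
  linarith

lemma pairSum_nonneg_of_pic (hR : IsAlg R) (hN : ∀ p q : Vℂ n, p ⬝ᵥ p = 0 → p ⬝ᵥ q = 0 → q ⬝ᵥ q = 0 → 0 ≤ biCurv R p q)
    {s : Finset Eℝ n} (hs : OrthoSet s) (hc : 4 ≤ s.card) : 0 ≤ pairSum R s := by
  obtain ⟨k, hk⟩ := Nat.exists_eq_add_of_le hc
  refine pairSum_nonneg_of_card hR (by norm_num) (fun s hs hc => ?_) k s hs hk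
  classical
  obtain ⟨a, t, hat, rfl, ht⟩ := Finset.card_eq_succ.1 hc
  obtain ⟨b, c, d, hbc, hbd, hcd, rfl⟩ := Finset.card_eq_three.1 ht
  have hat' := hat
  simp only [Finset.mem_insert, Finset.mem_singleton, not_or] at hat
  obtain ⟨hab, hac, had⟩ := hat
  rw [pairSum_insert hR hat', pairSum_insert hR (by simp [hbc, hbd]), pairSum_insert hR (by simpa using hcd),
    pairSum_of_card_le_one hR (by simp)]
  have ha := hs a (by simp) a (by simp)
  have hb := hs b (by simp) b (by simp)
  have hc := hs c (by simp) c (by simp)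
  have hd := hs d (by simp) d (by simp)
  have h1 := hs a (by simp) b (by simp)
  have h2 := hs a (by simp) c (by simp)
  have h3 := hs a (by simp) d (by simp)
  have h4 := hs b (by simp) c (by simp)
  have h5 := hs b (by simp) d (by simp)
  have h6 := hs c (by simp) d (by simp)
  rw [if_pos rfl] at ha hb hc hd
  rw [if_neg hab] at h1
  rw [if_neg hac] at h2
  rw [if_neg had] at h3
  rw [if_neg hbc] at h4
  rw [if_neg hbd] at h5
  rw [if_neg hcd] at h6
  have h4' := h4
  have h5' := h5
  rw [real_inner_comm] at h4' h5'
  have e1 := biCurv_quad_nonneg hR hN ha hb hc hd h1 h2 h3 h4 h5 h6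
  have e2 := biCurv_quad_nonneg hR hN ha hc hb hd h2 h1 h3 h4' h6 h5
  have h6' := h6
  rw [real_inner_comm] at h6'
  have e3 := biCurv_quad_nonneg hR hN ha hd hb hc h3 h1 h2 h5' h6' h4
  have hcd' : c ∉ ({d} : Finset Eℝ n) := by simpa using hcd
  have hbcd : b ∉ ({c, d} : Finset Eℝ n) := by simp [hbc, hbd]
  simp only [sum_insert hbcd, sum_insert hcd', sum_singleton]
  rw [biCurv_comm hR (cx c) (cx b)] at e2
  rw [biCurv_comm hR (cx d) (cx b), biCurv_comm hR (cx d) (cx c)] at e3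
  linarith

lemma bracket_wedge (hw : wᵀ = -w) (x y : Vℂ n) : w * wedge x y - wedge x y * w = wedge (w *ᵥ x) y + wedge x (w *ᵥ y) :=
    by
  have h : ∀ a : Vℂ n, a ᵥ* w = -(w *ᵥ a) := fun a => by rw [← mulVec_transpose, hw, neg_mulVec]
  simp only [wedge, mul_sub, sub_mul, mul_vecMulVec, vecMulVec_mul, h, vecMulVec_neg]
  abel

lemma biCurv_tangent_nonneg (hR : IsAlg R) {x y b : Vℂ n} (hy : star y ⬝ᵥ y = 1) (hyx : star y ⬝ᵥ x = 0) (hbx : b ⬝ᵥ x =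
    0) (hby : b ⬝ᵥ y = 0) (hB : ∀ w : Mℂ n, wᵀ = -w → 0 ≤ Herm R (w * wedge x y - wedge x y * w)) : 0 ≤ biCurv R x b :=
    by
  have h := hB _ (wedge_transpose b (star y))
  rw [bracket_wedge (wedge_transpose b (star y)), wedge_mulVec, wedge_mulVec, hyx, hbx, hy, hby] at h
  simp only [zero_smul, sub_zero, one_smul] at h
  rwa [show wedge 0 y = 0 by ext i j; simp [wedge_apply], zero_add, herm_wedge' hR] at h

lemma wedge_swap (x y : Vℂ n) : wedge x y = -wedge y x := by rw [wedge, wedge, neg_sub]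

lemma herm_neg' (v : Mℂ n) : Herm R (-v) = Herm R v := by
  have := herm_smul R (-1) v
  simpa using this

lemma bracket_nonneg_of_smul {c : ℂ} (hc : c ≠ 0) (hB : ∀ w : Mℂ n, wᵀ = -w → 0 ≤ Herm R (w * (c • v) - c • v * w)) (hw
    : wᵀ = -w) : 0 ≤ Herm R (w * v - v * w) := by
  have h := hB w hw
  rw [Matrix.mul_smul, Matrix.smul_mul, ← smul_sub, herm_smul] at h
  exact nonneg_of_mul_nonneg_right h (by positivity)

lemma pr_sqrt_two_smul (e : Eℝ n) : pr (cx (√2 • e)) = (2 : ℂ) • pr (cx e) := by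
  rw [cx_smul, pr_smul]
  simp

lemma biCurv_sqrt_two_smul (e : Eℝ n) (q : Vℂ n) : biCurv R (cx (√2 • e)) q = 2 * biCurv R (cx e) q := by
  rw [cx_smul, biCurv_smul_left]
  simp

lemma inner_sqrt_two_smul (e f : Eℝ n) : ⟪√2 • e, √2 • f⟫ = 2 * ⟪e, f⟫ := by
  rw [real_inner_smul_left, real_inner_smul_right, ← mul_assoc, mul_self_sqrt (by norm_num)]

lemma dotProduct_cx_eq_zero {f : Eℝ n} (h : ⟪reV x, f⟫ = 0) (h' : ⟪imV x, f⟫ = 0) : cx f ⬝ᵥ x = 0 := by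
  rw [dotProduct_comm]
  conv_lhs => rw [← cx_reV_add x]
  rw [add_dotProduct, smul_dotProduct, cx_dotProduct_cx, cx_dotProduct_cx, h, h']
  simp

lemma inner_sqrt_two {e f : Eℝ n} (h : ⟪√2 • e, f⟫ = 0) : ⟪e, f⟫ = 0 := by
  rw [real_inner_smul_left] at h
  exact (mul_eq_zero.1 h).resolve_left (by positivity)

lemma orthonormal_four {a b c d : Eℝ n} (ha : ⟪a, a⟫ = 1) (hb : ⟪b, b⟫ = 1) (hc : ⟪c, c⟫ = 1) (hd : ⟪d, d⟫ = 1) (hab :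
    ⟪a, b⟫ = 0) (hac : ⟪a, c⟫ = 0) (had : ⟪a, d⟫ = 0) (hbc : ⟪b, c⟫ = 0) (hbd : ⟪b, d⟫ = 0) (hcd : ⟪c, d⟫ = 0) :
    Orthonormal ℝ ![a, b, c, d] := by
  rw [orthonormal_iff_ite]
  intro i j
  fin_cases i <;> fin_cases j <;> simp [-inner_self_eq_norm_sq_to_K, ha, hb, hc, hd, hab, hac, had, hbc, hbd, hcd,
      real_inner_comm a b, real_inner_comm a c, real_inner_comm a d, real_inner_comm b c, real_inner_comm b d,
      real_inner_comm c d]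

lemma trace_ineq_pic (hn : n ≠ 6) (hR : IsAlg R) (h : ∀ v ∈ pic.gen n, 0 ≤ Herm R v) (hv : v ∈ pic.gen n) (h0 : Herm R v
    = 0) (hB : ∀ w : Mℂ n, wᵀ = -w → 0 ≤ Herm R (w * v - v * w)) : TraceIneq R 𝕊 n v := by
  classical
  obtain ⟨c, x, y, hx, hy, hxy, rfl⟩ := exists_wedge_of_rank_two ((mem_so _ _ _).1 hv.1) hv.2.1
  have hc : c ≠ 0 := by
    rintro rfl
    have := hv.2.1
    rw [zero_smul, rank_zero] at this
    omega
  refine trace_ineq_smul c ?_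
  rw [herm_smul, herm_wedge' hR, mul_eq_zero] at h0
  replace h0 := h0.resolve_left (by positivity)
  replace hB := fun w hw => bracket_nonneg_of_smul (R := R) hc hB (w := w) hw
  have hyx := star_dotProduct_eq_zero hxy
  have hsq := hv.2.2
  rw [pow_two, Matrix.smul_mul, Matrix.mul_smul, smul_smul, smul_eq_zero] at hsq
  replace hsq := hsq.resolve_left (by simp [hc])
  rw [wedge_mul_wedge] at hsq
  have hM : ∀ a b : Vℂ n, a ⬝ᵥ (((x ⬝ᵥ y) • (vecMulVec x y + vecMulVec y x) - (y ⬝ᵥ y) • vecMulVec x x - (x ⬝ᵥ x) •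
      vecMulVec y y) *ᵥ b) = 0 := fun a b => by rw [hsq]; simp
  simp only [sub_mulVec, smul_mulVec, add_mulVec, vecMulVec_mulVec, dotProduct_sub, dotProduct_smul, dotProduct_add,
    smul_eq_mul, MulOpposite.smul_eq_mul_unop, MulOpposite.unop_op] at hM
  have hx' := hx
  have hy' := hy
  have hxy' := hxy
  have hyx' := hyx
  rw [dotProduct_comm] at hx' hy' hxy' hyx'
  have hyy : y ⬝ᵥ y = 0 := by
    have := hM (star x) (star x)
    simpa [hx, hxy, hx', hxy'] using this
  have hxx : x ⬝ᵥ x = 0 := by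
    have := hM (star y) (star y)
    simpa [hy, hyx, hy', hyx'] using this
  have hdxy : x ⬝ᵥ y = 0 := by
    have := hM (star x) (star y)
    simpa [hx, hxy, hyx', hy'] using this
  obtain ⟨x1, x2, x3⟩ := isotropic_reV_imV hx hxx
  obtain ⟨y1, y2, y3⟩ := isotropic_reV_imV hy hyy
  obtain ⟨z1, z2, z3, z4⟩ := orthogonal_reV_imV hxy hdxy
  set e : Fin 4 → Eℝ n := ![√2 • reV x, √2 • imV x, √2 • reV y, √2 • imV y] with he
  have ho : Orthonormal ℝ e := by refine orthonormal_four ?_ ?_ ?_ ?_ ?_ ?_ ?_ ?_ ?_ ?_ <;> rw [inner_sqrt_two_smul] <;>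
      simp only [x1, x2, x3, y1, y2, y3, z1, z2, z3, z4, mul_zero] <;> norm_num
  obtain ⟨r, hcard, hor, her, hsum⟩ := exists_orthonormal_complement ho
  have hN := fun p q hp hpq hq => biCurv_nonneg_of_pic (p := p) (q := q) hR h hp hpq hq
  have hxb : ∀ f ∈ r, 0 ≤ biCurv R x (cx f) := fun f hf => biCurv_tangent_nonneg hR hy hyx (dotProduct_cx_eq_zero
      (inner_sqrt_two (her 0 f hf)) (inner_sqrt_two (her 1 f hf))) (dotProduct_cx_eq_zero (inner_sqrt_two (her 2 f hf))
        (inner_sqrt_two (her 3 f hf))) hB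
  have hyb : ∀ f ∈ r, 0 ≤ biCurv R y (cx f) := fun f hf => biCurv_tangent_nonneg hR hx hxy (dotProduct_cx_eq_zero
      (inner_sqrt_two (her 2 f hf)) (inner_sqrt_two (her 3 f hf))) (dotProduct_cx_eq_zero (inner_sqrt_two (her 0 f hf))
        (inner_sqrt_two (her 1 f hf))) (fun w hw => by
        have := hB w hw
        rwa [wedge_swap x y, mul_neg, neg_mul, sub_neg_eq_add, neg_add_eq_sub, ← neg_sub, herm_neg'] at this)
  have hfour : ∀ f, biCurv R (cx (e 0)) (cx f) + biCurv R (cx (e 1)) (cx f) + biCurv R (cx (e 2)) (cx f) + biCurv R (cx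
      (e 3)) (cx f) = 2 * (biCurv R x (cx f) + biCurv R y (cx f)) := by
    intro f
    rw [biCurv_cx_left hR x, biCurv_cx_left hR y]
    simp only [he, cons_val, biCurv_sqrt_two_smul]
    ring
  set X := ∑ f ∈ r, (biCurv R x (cx f) + biCurv R y (cx f)) with hX
  have hX0 : 0 ≤ X := sum_nonneg fun f hf => add_nonneg (hxb f hf) (hyb f hf)
  have hD : 0 ≤ 2 * X + pairSum R r := by
    have hcases : r.card ≤ 1 ∨ r.card = 3 ∨ 4 ≤ r.card := by omega
    rcases hcases with hr | hr | hr
    · rw [pairSum_of_card_le_one hR hr]; linarith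
    · have hi : ∀ i, 0 ≤ pairSum R r + 2 * ∑ f ∈ r, biCurv R (cx (e i)) (cx f) := by
        intro i
        have h1 := hor.insert (e := e i) (by have := orthonormal_iff_ite.1 ho i i; rwa [if_pos rfl] at this) (her i)
        rw [← pairSum_insert hR h1.2]
        exact pairSum_nonneg_of_pic hR hN h1.1 (by rw [card_insert_of_notMem h1.2, hr])
      have hs : ∑ f ∈ r, biCurv R (cx (e 0)) (cx f) + ∑ f ∈ r, biCurv R (cx (e 1)) (cx f) + ∑ f ∈ r, biCurv R (cx (e 2))
          (cx f) + ∑ f ∈ r, biCurv R (cx (e 3)) (cx f) = 2 * X := by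
        rw [hX, mul_sum, ← sum_add_distrib, ← sum_add_distrib, ← sum_add_distrib]
        exact Finset.sum_congr rfl fun f _ => hfour f
      linarith [hi 0, hi 1, hi 2, hi 3]
    · have := pairSum_nonneg_of_pic hR hN hor hr
      linarith
  refine trace_ineq_wedge hR hx hy hxy h0 (P := pr (star x) + pr (star y) + ∑ f ∈ r, pr (cx f)) ?_ ?_
  · rw [← hsum, Fin.sum_univ_four]
    simp only [he, cons_val, pr_sqrt_two_smul]
    rw [← smul_add, add_assoc ((2 : ℂ) • (pr (cx (reV x)) + _)), ← smul_add, ← pr_add_pr_star, ← pr_add_pr_star]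
    abel
  · have e1 : ∀ z, (ctr R (pr (star z)) (∑ f ∈ r, pr (cx f))).re = ∑ f ∈ r, biCurv R z (cx f) := fun z => by
      rw [map_sum, re_sum]
      exact Finset.sum_congr rfl fun f _ => biCurv_star_left hR z (star_cx f)
    have e2 : (ctr R (pr (star x)) (pr (star y))).re = 0 := (biCurv_star hR x y).trans h0
    have e3 := biCurv_self hR (star x)
    have e4 := biCurv_self hR (star y)
    have e5 := ctr_sum_sum (R := R) r cx
    rw [biCurv] at e3 e4
    simp only [map_add, LinearMap.add_apply, add_re]
    rw [ctr_comm hR (∑ f ∈ r, pr (cx f)) (pr (star x)), ctr_comm hR (∑ f ∈ r, pr (cx f)) (pr (star y)), ctr_comm hR (pr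
      (star y)) (pr (star x)), e1, e1, e2, e3, e4, e5]
    have : X = ∑ f ∈ r, biCurv R x (cx f) + ∑ f ∈ r, biCurv R y (cx f) := sum_add_distrib
    rw [pairSum] at hD
    linarith

lemma exists_unit_kernel {a b d : ℂ} (h : b ^ 2 - a * d = 0) : ∃ α β : ℂ, star α * α + star β * β = 1 ∧ a * α + b * β =
    0 ∧ b * α + d * β = 0 := by
  obtain ⟨α, β, hne, h1, h2⟩ : ∃ α β : ℂ, (α ≠ 0 ∨ β ≠ 0) ∧ a * α + b * β = 0 ∧ b * α + d * β = 0 := by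
    by_cases ha : a = 0
    · have hb : b = 0 := by simpa [ha] using h
      exact ⟨1, 0, by simp, by simp [ha], by simp [hb]⟩
    · exact ⟨-b, a, Or.inr ha, by ring, by linear_combination -h⟩
  have hN : 0 < ‖α‖ ^ 2 + ‖β‖ ^ 2 := by
    rcases hne with h | h
    · have := norm_pos_iff.2 h; positivity
    · have := norm_pos_iff.2 h; positivity
  set N := √(‖α‖ ^ 2 + ‖β‖ ^ 2) with hNd
  have hNs : (N : ℂ) ^ 2 = ‖α‖ ^ 2 + ‖β‖ ^ 2 := by
    have := sq_sqrt hN.le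
    exact_mod_cast this
  have hN0 := ofReal_ne_zero.2 (Real.sqrt_ne_zero'.2 hN)
  refine ⟨α / N, β / N, ?_, ?_, ?_⟩
  · simp only [star_def, map_div₀, conj_ofReal]
    rw [div_mul_div_comm, div_mul_div_comm, conj_mul', conj_mul', ← add_div, ← hNs, ← pow_two, div_self (pow_ne_zero 2
      hN0)]
  · rw [← mul_div_assoc, ← mul_div_assoc, ← add_div, h1, zero_div]
  · rw [← mul_div_assoc, ← mul_div_assoc, ← add_div, h2, zero_div]

lemma exists_phase (z : ℂ) : ∃ θ : ℂ, star θ * θ = 1 ∧ θ * θ * z = (‖z‖ : ℂ) := by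
  refine ⟨Complex.exp (-(z.arg / 2 : ℝ) * I), ?_, ?_⟩
  · rw [star_def, conj_mul', ← Complex.ofReal_neg, Complex.norm_exp_ofReal_mul_I]
    simp
  · calc _ = Complex.exp (-(z.arg / 2 : ℝ) * I) * Complex.exp (-(z.arg / 2 : ℝ) * I)
          * (‖z‖ * Complex.exp (z.arg * I)) := by rw [Complex.norm_mul_exp_arg_mul_I z]
      _ = _ := by rw [← Complex.exp_add, mul_left_comm, ← Complex.exp_add,
          show -((z.arg / 2 : ℝ) : ℂ) * I + -((z.arg / 2 : ℝ) : ℂ) * I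
            + z.arg * I = 0 by push_cast; ring, Complex.exp_zero, mul_one]

lemma exists_isotropic_pair {x₀ y₀ : Vℂ n} (hx : star x₀ ⬝ᵥ x₀ = 1) (hy : star y₀ ⬝ᵥ y₀ = 1) (hxy : star x₀ ⬝ᵥ y₀ = 0)
    (h : (x₀ ⬝ᵥ y₀) ^ 2 - (x₀ ⬝ᵥ x₀) * (y₀ ⬝ᵥ y₀) = 0) : ∃ (c : ℂ) (x y : Vℂ n), wedge x₀ y₀ = c • wedge x y ∧ star x ⬝ᵥ
    x = 1 ∧ star y ⬝ᵥ y = 1 ∧ star x ⬝ᵥ y = 0 ∧ x ⬝ᵥ x = 0 ∧ x ⬝ᵥ y = 0 ∧ ∃ ρ : ℝ, 0 ≤ ρ ∧ y ⬝ᵥ y = ρ := by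
  have hyx := star_dotProduct_eq_zero hxy
  obtain ⟨α, β, hn, h1, h2⟩ := exists_unit_kernel h
  set x := α • x₀ + β • y₀ with hxd
  set y₁ := -star β • x₀ + star α • y₀ with hyd
  obtain ⟨θ, hθ, hθ'⟩ := exists_phase (y₁ ⬝ᵥ y₁)
  have hsx : star x = star α • star x₀ + star β • star y₀ := by rw [hxd, star_add, star_smul, star_smul]
  have hsy : star y₁ = -β • star x₀ + α • star y₀ := by
    rw [hyd, star_add, star_smul, star_smul, star_neg, star_star, star_star]
  refine ⟨star θ, x, θ • y₁, ?_, ?_, ?_, ?_, ?_, ?_, ‖y₁ ⬝ᵥ y₁‖, norm_nonneg _, ?_⟩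
  · ext i j
    simp only [wedge_apply, hxd, hyd, Pi.add_apply, Pi.smul_apply, smul_eq_mul, Matrix.smul_apply]
    linear_combination -(x₀ i * y₀ j - y₀ i * x₀ j) * ((star α * α + star β * β) * hθ + hn)
  · rw [hsx]
    simp only [hxd, add_dotProduct, dotProduct_add, smul_dotProduct, dotProduct_smul, hx, hy, hxy, hyx, smul_eq_mul]
    linear_combination hn
  · rw [star_smul, smul_dotProduct, dotProduct_smul, hsy]
    simp only [hyd, add_dotProduct, dotProduct_add, smul_dotProduct, dotProduct_smul, hx, hy, hxy, hyx, smul_eq_mul]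
    linear_combination hθ + star θ * θ * hn
  · rw [dotProduct_smul, hsx]
    simp only [hyd, add_dotProduct, dotProduct_add, smul_dotProduct, dotProduct_smul, hx, hy, hxy, hyx, smul_eq_mul]
    ring
  · simp only [hxd, add_dotProduct, dotProduct_add, smul_dotProduct, dotProduct_smul, smul_eq_mul, dotProduct_comm y₀
      x₀]
    linear_combination α * h1 + β * h2
  · rw [dotProduct_smul]
    simp only [hxd, hyd, add_dotProduct, dotProduct_add, smul_dotProduct, dotProduct_smul, smul_eq_mul, dotProduct_comm
      y₀ x₀]
    linear_combination θ * (-star β * h1 + star α * h2)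
  · rw [dotProduct_smul, smul_dotProduct, smul_eq_mul, smul_eq_mul, ← mul_assoc, hθ']

lemma orthonormal_three {a b c : Eℝ n} (ha : ⟪a, a⟫ = 1) (hb : ⟪b, b⟫ = 1) (hc : ⟪c, c⟫ = 1) (hab : ⟪a, b⟫ = 0) (hac :
    ⟪a, c⟫ = 0) (hbc : ⟪b, c⟫ = 0) : Orthonormal ℝ ![a, b, c] := by
  rw [orthonormal_iff_ite]
  intro i j
  fin_cases i <;> fin_cases j <;> simp [-inner_self_eq_norm_sq_to_K, ha, hb, hc, hab, hac, hbc, real_inner_comm a b,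
      real_inner_comm a c, real_inner_comm b c]

lemma insert_pairSum_nonneg (hR : IsAlg R) (hN : IsoNonneg R) {r : Finset Eℝ n} (hr : OrthoSet r) (hc : 2 ≤ r.card) {e :
    Eℝ n} (he : ⟪e, e⟫ = 1) (her : ∀ f ∈ r, ⟪e, f⟫ = 0) : 0 ≤ pairSum R r + 2 * ∑ f ∈ r, biCurv R (cx e) (cx f) := by
  classical
  have h1 := hr.insert he her
  rw [← pairSum_insert hR h1.2]
  exact pairSum_nonneg_of_picOne hR hN h1.1 (by rw [card_insert_of_notMem h1.2]; omega)

lemma biCurv_isotropic (hR : IsAlg R) (x : Vℂ n) (f : Eℝ n) : 2 * biCurv R x (cx f) = biCurv R (cx (√2 • reV x)) (cx f)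
      + biCurv R (cx (√2 • imV x)) (cx f) := by
  rw [biCurv_cx_left hR x, biCurv_sqrt_two_smul, biCurv_sqrt_two_smul]
  ring

lemma ctr_sum_right (z : Vℂ n) (r : Finset Eℝ n) : (ctr R (pr z) (∑ f ∈ r, pr (cx f))).re = ∑ f ∈ r, biCurv R z (cx f)
    := by
  rw [map_sum, re_sum]
  rfl

lemma trace_ineq_picOne_real (hR : IsAlg R) (hN : IsoNonneg R) (hx : star x ⬝ᵥ x = 1) (hy : star y ⬝ᵥ y = 1) (hxy : star
    x ⬝ᵥ y = 0) (hxx : x ⬝ᵥ x = 0) (hdxy : x ⬝ᵥ y = 0) (h0 : biCurv R x y = 0) (hI : imV y = 0) (hI1 : ⟪reV y, reV y⟫ =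
    1) : TraceIneq R 𝕊 n (wedge x y) := by
  obtain ⟨x1, x2, x3⟩ := isotropic_reV_imV hx hxx
  obtain ⟨z1, -, -, z4⟩ := orthogonal_reV_imV hxy hdxy
  have ho : Orthonormal ℝ ![√2 • reV x, √2 • imV x, reV y] := by refine orthonormal_three ?_ ?_ ?_ ?_ ?_ ?_ <;>
      (try rw [inner_sqrt_two_smul]) <;> simp only [real_inner_smul_left, x1, x2, x3, z1, z4, hI1, mul_zero] <;>
      norm_num
  obtain ⟨r, -, hor, her, hsum⟩ := exists_orthonormal_complement ho
  have hxf : ∀ f ∈ r, 0 ≤ biCurv R x (cx f) := fun f hf => hN _ _ hxx (by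
    rw [dotProduct_comm]
    exact dotProduct_cx_eq_zero (inner_sqrt_two (her 0 f hf)) (inner_sqrt_two (her 1 f hf)))
  have hD : 0 ≤ 2 * ∑ f ∈ r, biCurv R x (cx f) + pairSum R r := by
    rcases Nat.lt_or_ge r.card 2 with hr | hr
    · rw [pairSum_of_card_le_one hR (by omega)]
      have := sum_nonneg hxf
      linarith
    · have hi : ∀ i, 0 ≤ pairSum R r + 2 * ∑ f ∈ r, biCurv R (cx (![√2 • reV x, √2 • imV x, reV y] i)) (cx f) := fun i
          =>
        insert_pairSum_nonneg hR hN hor hr (by have := orthonormal_iff_ite.1 ho i i; rwa [if_pos rfl] at this) (her i)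
      have h1 := hi 0
      have h2 := hi 1
      simp only [cons_val] at h1 h2
      have h3 : 2 * ∑ f ∈ r, biCurv R x (cx f) = ∑ f ∈ r, biCurv R (cx (√2 • reV x)) (cx f) + ∑ f ∈ r, biCurv R (cx (√2
          • imV x)) (cx f) := by
        rw [mul_sum, ← sum_add_distrib]
        exact Finset.sum_congr rfl fun f _ => biCurv_isotropic hR x f
      linarith
  have hyr : y = cx (reV y) := by
    conv_lhs => rw [← cx_reV_add y, hI]
    funext i; simp [cx]
  refine trace_ineq_wedge hR hx hy hxy h0 (P := pr (star x) + ∑ f ∈ r, pr (cx f)) ?_ ?_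
  · rw [← hsum, Fin.sum_univ_three]
    simp only [cons_val, pr_sqrt_two_smul]
    rw [← smul_add, ← pr_add_pr_star, ← hyr]
    abel
  · have e3 := biCurv_self hR (star x)
    have e5 := ctr_sum_sum (R := R) r cx
    rw [biCurv] at e3
    simp only [map_add, LinearMap.add_apply, add_re]
    rw [ctr_comm hR (∑ f ∈ r, pr (cx f)) (pr (star x)), e3, e5, ctr_sum_right, Finset.sum_congr rfl fun f _ =>
      biCurv_star_left hR x (star_cx f)]
    rw [pairSum] at hD
    linarith

lemma trace_ineq_picOne_complex (hR : IsAlg R) (hN : IsoNonneg R) {a b : Eℝ n} {c d : ℝ} (hcd : c ^ 2 + d ^ 2 = 1) (ha :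
    ⟪a, a⟫ = 1) (hb : ⟪b, b⟫ = 1) (hab : ⟪a, b⟫ = 0) (hx : star x ⬝ᵥ x = 1) (hxx : x ⬝ᵥ x = 0) (z1 : ⟪reV x, a⟫ = 0) (z2
    : ⟪imV x, b⟫ = 0) (z3 : ⟪reV x, b⟫ = 0) (z4 : ⟪imV x, a⟫ = 0) (hyd : y = cx (c • a) + I • cx (d • b)) (hy : star y
    ⬝ᵥ y = 1) (hxy : star x ⬝ᵥ y = 0) (h0 : biCurv R x y = 0) : TraceIneq R 𝕊 n (wedge x y) := by
  obtain ⟨x1, x2, x3⟩ := isotropic_reV_imV hx hxx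
  set e : Fin 4 → Eℝ n := ![√2 • reV x, √2 • imV x, a, b] with he
  have ho : Orthonormal ℝ e := by refine orthonormal_four ?_ ?_ ?_ ?_ ?_ ?_ ?_ ?_ ?_ ?_ <;>
      (try rw [inner_sqrt_two_smul]) <;> simp only [real_inner_smul_left, x1, x2, x3, z1, z2, z3, z4, ha, hb, hab,
        mul_zero] <;> norm_num
  obtain ⟨r, -, hor, her, hsum⟩ := exists_orthonormal_complement ho
  set u := cx (c • b) + I • cx (d • a) with hu
  have hxf : ∀ f ∈ r, 0 ≤ biCurv R x (cx f) := fun f hf => hN _ _ hxx (by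
    rw [dotProduct_comm]
    exact dotProduct_cx_eq_zero (inner_sqrt_two (her 0 f hf)) (inner_sqrt_two (her 1 f hf)))
  have huf : ∀ f, biCurv R u (cx f) = c ^ 2 * biCurv R (cx b) (cx f) + d ^ 2 * biCurv R (cx a) (cx f) := fun f => by
    rw [biCurv_cx_left hR u, (reV_add_I_smul _ _).1, (reV_add_I_smul _ _).2, cx_smul, cx_smul,
      biCurv_smul_left, biCurv_smul_left, norm_real, norm_real, norm_eq_abs, norm_eq_abs, sq_abs, sq_abs]
  have hxu : 0 ≤ biCurv R (star x) u := by
    refine hN _ _ ?_ ?_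
    · have := congrArg star hxx
      rwa [← star_dotProduct_star, star_zero] at this
    · rw [← cx_reV_sub x, hu]
      simp only [dotProduct_add, sub_dotProduct, smul_dotProduct, dotProduct_smul, cx_dotProduct_cx,
        real_inner_smul_right, z1, z2, z3, z4]
      simp
  have hei : ∀ i, ⟪e i, e i⟫ = 1 := fun i => by have := orthonormal_iff_ite.1 ho i i; rwa [if_pos rfl] at this
  have h3 : ∑ f ∈ r, biCurv R u (cx f) = c ^ 2 * ∑ f ∈ r, biCurv R (cx b) (cx f) + d ^ 2 * ∑ f ∈ r, biCurv R (cx a) (cx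
      f) := by
    rw [mul_sum, mul_sum, ← sum_add_distrib]
    exact Finset.sum_congr rfl fun f _ => huf f
  have hD : 0 ≤ 2 * (∑ f ∈ r, biCurv R x (cx f) + ∑ f ∈ r, biCurv R u (cx f)) + pairSum R r := by
    rcases Nat.lt_or_ge r.card 2 with hr | hr
    · rw [pairSum_of_card_le_one hR (by omega), ← sum_add_distrib]
      have : 0 ≤ ∑ f ∈ r, (biCurv R x (cx f) + biCurv R u (cx f)) := by
        refine sum_nonneg fun f hf => ?_
        have h4 := biCurv_isotropic hR x f
        rw [huf]
        have hp : ∀ i j, i ≠ j → 0 ≤ biCurv R (cx (e i)) (cx f) + biCurv R (cx (e j)) (cx f) := fun i j hij =>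
          biCurv_pair_nonneg hR hN (hei i) (hei j) (ho.2 hij) (her i f hf) (her j f hf)
        have p1 := hp 0 2 (by decide)
        have p2 := hp 0 3 (by decide)
        have p3 := hp 1 2 (by decide)
        have p4 := hp 1 3 (by decide)
        simp only [he, cons_val] at p1 p2 p3 p4
        have q1 := mul_nonneg (sq_nonneg d) (add_nonneg p1 p3)
        have q2 := mul_nonneg (sq_nonneg c) (add_nonneg p2 p4)
        have h5 : biCurv R x (cx f) = (c ^ 2 + d ^ 2) * biCurv R x (cx f) := by rw [hcd, one_mul]
        rw [h5]
        nlinarith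
      linarith
    · have h1 := insert_pairSum_nonneg hR hN hor hr ha (her 2)
      have h2 := insert_pairSum_nonneg hR hN hor hr hb (her 3)
      have h4 := sum_nonneg hxf
      have h5 : pairSum R r = (c ^ 2 + d ^ 2) * pairSum R r := by rw [hcd, one_mul]
      rw [h3, h5]
      nlinarith [mul_nonneg (sq_nonneg d) h1, mul_nonneg (sq_nonneg c) h2]
  have hyu : pr y + pr u = pr (cx a) + pr (cx b) := by
    ext i j
    have hcd' : (c : ℂ) ^ 2 + (d : ℂ) ^ 2 = 1 := by exact_mod_cast hcd
    simp only [hyd, hu, cx_smul, Matrix.add_apply, pr_apply, Pi.add_apply, Pi.smul_apply, smul_eq_mul, map_add, map_mul,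
      conj_I, conj_ofReal]
    simp only [cx, conj_ofReal]
    linear_combination ((a i : ℂ) * a j + (b i : ℂ) * b j) * (hcd' - (d : ℂ) ^ 2 * Complex.I_sq)
  refine trace_ineq_wedge hR hx hy hxy h0 (P := pr (star x) + pr u + ∑ f ∈ r, pr (cx f)) ?_ ?_
  · rw [← hsum, Fin.sum_univ_four]
    simp only [he, cons_val, pr_sqrt_two_smul]
    rw [← smul_add, ← pr_add_pr_star, add_assoc (pr x + pr (star x)), ← hyu]
    abel
  · have e3 := biCurv_self hR (star x)
    have e4 := biCurv_self hR u
    have e5 := ctr_sum_sum (R := R) r cx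
    rw [biCurv] at e3 e4 hxu
    simp only [map_add, LinearMap.add_apply, add_re]
    rw [ctr_comm hR (∑ f ∈ r, pr (cx f)) (pr (star x)), ctr_comm hR (∑ f ∈ r, pr (cx f)) (pr u), ctr_comm hR (pr u) (pr
      (star x)), e3, e4, e5, ctr_sum_right, ctr_sum_right, Finset.sum_congr rfl fun f _ => biCurv_star_left hR x
      (star_cx f)]
    rw [pairSum] at hD
    linarith

lemma trace_ineq_picOne (hR : IsAlg R) (h : ∀ v ∈ picOne.gen n, 0 ≤ Herm R v) (hv : v ∈ picOne.gen n) (h0 : Herm R v =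
    0) : TraceIneq R 𝕊 n v := by
  have hN := fun p q hp hpq => biCurv_nonneg_of_picOne (p := p) (q := q) hR h hp hpq
  obtain ⟨c₀, x₀, y₀, hx₀, hy₀, hxy₀, rfl⟩ := exists_wedge_of_rank_two ((mem_so _ _ _).1 hv.1) hv.2.1
  have hne : c₀ • wedge x₀ y₀ ≠ 0 := by
    intro h
    have := hv.2.1
    rw [h, rank_zero] at this
    omega
  have hc₀ : c₀ ≠ 0 := fun h => hne (by rw [h, zero_smul])
  have hw₀ : wedge x₀ y₀ ≠ 0 := fun h => hne (by rw [h, smul_zero])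
  have hcube := hv.2.2
  rw [smul_pow, smul_eq_zero] at hcube
  replace hcube := hcube.resolve_left (pow_ne_zero 3 hc₀)
  rw [pow_succ, pow_two, wedge_cube, smul_eq_zero] at hcube
  replace hcube := hcube.resolve_right hw₀
  obtain ⟨c, x, y, e, hx, hy, hxy, hxx, hdxy, ρ, hρ, hyy⟩ := exists_isotropic_pair hx₀ hy₀ hxy₀ hcube
  have hc : c ≠ 0 := fun h => hw₀ (by rw [e, h, zero_smul])
  refine trace_ineq_smul c₀ ?_
  rw [herm_smul, mul_eq_zero] at h0
  replace h0 := h0.resolve_left (by positivity)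
  rw [e] at h0 ⊢
  refine trace_ineq_smul c ?_
  rw [herm_smul, herm_wedge' hR, mul_eq_zero] at h0
  replace h0 := h0.resolve_left (by positivity)
  have hy' := hy
  rw [star_dotProduct_of_reV_imV] at hy'
  rw [dotProduct_of_reV_imV] at hyy
  have h1 := re_im_eq (a' := 1) (b' := 0) (hy'.trans (by simp))
  have h2 := re_im_eq (a' := ρ) (b' := 0) (hyy.trans (by simp))
  obtain ⟨z1, z2, z3, z4⟩ := orthogonal_reV_imV hxy hdxy
  by_cases hI : imV y = 0
  · refine trace_ineq_picOne_real hR hN hx hy hxy hxx hdxy h0 hI ?_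
    have := h1.1
    rw [hI, inner_zero_left, add_zero] at this
    exact this
  · have hs : 0 < ‖imV y‖ := norm_pos_iff.2 hI
    have hr : 0 < ‖reV y‖ := by
      have e1 := real_inner_self_eq_norm_sq (imV y)
      have e2 := real_inner_self_eq_norm_sq (reV y)
      have : 0 < ‖reV y‖ ^ 2 := by nlinarith [h2.1]
      exact norm_pos_iff.2 (fun h => by rw [h] at this; simp at this)
    have hre : reV y = ‖reV y‖ • (‖reV y‖⁻¹ • reV y) := by rw [smul_smul, mul_inv_cancel₀ hr.ne', one_smul]
    have him : imV y = ‖imV y‖ • (‖imV y‖⁻¹ • imV y) := by rw [smul_smul, mul_inv_cancel₀ hs.ne', one_smul]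
    refine trace_ineq_picOne_complex hR hN (c := ‖reV y‖) (d := ‖imV y‖) (a := ‖reV y‖⁻¹ • reV y) (b := ‖imV y‖⁻¹ • imV
      y) ?_ ?_ ?_ ?_ hx hxx ?_ ?_ ?_ ?_ ?_ hy hxy h0
    · rw [← real_inner_self_eq_norm_sq, ← real_inner_self_eq_norm_sq]; exact h1.1
    · rw [real_inner_smul_left, real_inner_smul_right, real_inner_self_eq_norm_sq]; field_simp
    · rw [real_inner_smul_left, real_inner_smul_right, real_inner_self_eq_norm_sq]; field_simp
    · have h3 := h2.2
      rw [real_inner_comm (reV y) (imV y)] at h3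
      rw [real_inner_smul_left, real_inner_smul_right, show ⟪reV y, imV y⟫ = 0 by linarith, mul_zero, mul_zero]
    · rw [real_inner_smul_right, z1, mul_zero]
    · rw [real_inner_smul_right, z2, mul_zero]
    · rw [real_inner_smul_right, z3, mul_zero]
    · rw [real_inner_smul_right, z4, mul_zero]
    · rw [← hre, ← him, cx_reV_add]

section FourVec

variable {T : Tℝ n}

/-- The two-vectors obtained by contracting `v ∧ (·)` with coordinate four-planes. -/
def fourVec (v : Mℂ n) (a b c d : Fin n) : Mℂ n := v a b • wedge (Pi.single c 1) (Pi.single d 1) + -v a c • wedge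
  (Pi.single b 1) (Pi.single d 1) + v a d • wedge (Pi.single b 1) (Pi.single c 1) + v b c • wedge (Pi.single a 1)
    (Pi.single d 1) + -v b d • wedge (Pi.single a 1) (Pi.single c 1) + v c d • wedge (Pi.single a 1) (Pi.single b 1)

lemma fourVec_transpose (v : Mℂ n) (a b c d : Fin n) : (fourVec v a b c d)ᵀ = -fourVec v a b c d := by
  simp only [fourVec, transpose_add, transpose_smul, wedge_transpose, smul_neg, neg_add]

lemma fourVec_map_conj (v : Mℂ n) (a b c d : Fin n) : (fourVec v a b c d).map conj = fourVec (v.map conj) a b c d := by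
  have e : ∀ i, star (Pi.single i 1 : Vℂ n) = Pi.single i 1 := fun i => by rw [← Pi.single_star, star_one]
  simp only [fourVec, Matrix.map_add _ (map_add conj), map_conj_smul, wedge_map_conj, e, map_apply, map_neg]

lemma curvForm_single (hA : ∀ i j k l, T i j k l = -T j i k l) (hP : ∀ i j k l, T i j k l = T k l i j) (a b c d : Fin n)
    : ℛ T (wedge (Pi.single a 1) (Pi.single b 1)) (wedge (Pi.single c 1) (Pi.single d 1)) = T a b c d := by
  have hA' : ∀ i j k l, T i j k l = -T i j l k := fun i j k l => by rw [hP, hA, hP]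
  rw [curvForm]
  simp only [wedge_apply, Pi.single_apply, mul_sub, mul_ite, mul_one, mul_zero, sum_sub_distrib, sum_ite_eq',
    Finset.mem_univ, if_true]
  rw [hA' a b d c, hA b a c d, hA b a d c, hA' a b d c]
  push_cast
  ring

lemma sum_fourVec (hA : ∀ i j k l, T i j k l = -T j i k l) (hP : ∀ i j k l, T i j k l = T k l i j) (hv : vᵀ = -v) (hw :
    wᵀ = -w) : ∑ a, ∑ b, ∑ c, ∑ d, curvForm T (fourVec v a b c d) (fourVec w a b c d) = 6 * (scal T * (v * wᵀ).trace - 4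
      * ricPair T (v * wᵀ) + 4 * ℛ T v w) := by
  have hA' : ∀ i j k l, T i j k l = -T i j l k := fun i j k l => by rw [hP, hA, hP]
  have sv : ∀ i j, v j i = -v i j := fun i j => congr_fun₂ hv i j
  have sw : ∀ i j, w j i = -w i j := fun i j => congr_fun₂ hw i j
  have cA : ∀ i j k l, (T i j k l : ℂ) = -(T j i k l : ℂ) := fun i j k l => by rw [hA]; push_cast; rfl
  have cA' : ∀ i j k l, (T i j k l : ℂ) = -(T i j l k : ℂ) := fun i j k l => by rw [hA']; push_cast; rfl
  set F : Fin n → Fin n → Fin n → Fin n → Fin n → Vℂ n := fun a b c d k l => v a b * T c d k l - v a c * T b d k l + v a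
    d * T b c k l + v b c * T a d k l - v b d * T a c k l + v c d * T a b k l with hF
  set f : Fin n → Fin n → Fin n → Vℂ n := fun a b c d => w a b * F a b c d c d with hf
  have e1 : ∀ a b c d, curvForm T (fourVec v a b c d) (fourVec w a b c d) = f a b c d + f a c b d + f a d b c + f b c a
      d + f b d a c + f c d a b := fun a b c d => by
    simp only [fourVec, curvForm_add_left, curvForm_add_right, curvForm_smul_left, curvForm_smul_right, curvForm_single
      hA hP, hf, hF, sv b c, sv b d, sv c d, sv a b, sv a c, sv a d, cA c b, cA d b, cA d c, cA b a, cA c a, cA d a]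
    ring
  have r1 : ∀ h : Fin n → Fin n → Fin n → Vℂ n, ∑ a, ∑ b, ∑ c, ∑ d, h b a c d = ∑ a, ∑ b, ∑ c, ∑ d, h a b c d := fun h
      => sum_comm
  have r2 : ∀ h : Fin n → Fin n → Fin n → Vℂ n, ∑ a, ∑ b, ∑ c, ∑ d, h a c b d = ∑ a, ∑ b, ∑ c, ∑ d, h a b c d := fun h
      =>
    sum_comm_mid fun a b c d => h a c b d
  have r3 : ∀ h : Fin n → Fin n → Fin n → Vℂ n, ∑ a, ∑ b, ∑ c, ∑ d, h a b d c = ∑ a, ∑ b, ∑ c, ∑ d, h a b c d := fun h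
      =>
    sum_comm_last_two fun a b c d => h a b d c
  have e2 : ∑ a, ∑ b, ∑ c, ∑ d, curvForm T (fourVec v a b c d) (fourVec w a b c d) = 6 * ∑ a, ∑ b, ∑ c, ∑ d, f a b c d
      := by
    simp only [e1, sum_add_distrib]
    have t3 : ∑ a, ∑ b, ∑ c, ∑ d, f a d b c = ∑ a, ∑ b, ∑ c, ∑ d, f a b c d := (r3 fun a b c d => f a c b d).trans (r2
      f)
    have t4 := (r1 fun a b c d => f a c b d).trans (r2 f)
    have t5 := (r1 fun a b c d => f a d b c).trans t3
    have t6 := sum_comm_pairs fun a b c d => f c d a b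
    rw [r2 f, t3, t4, t5, t6]
    ring
  set H := fun i j k q => T i q j q * (v i k * w j k) with hH
  have e3 : ∀ a b c d, f a b c d = v a b * w a b * T c d c d - H c b a d - H d b a c - H c a b d - H d a b c + T c d a b
      * v c d * w a b := fun a b c d => by
    simp only [hf, hF, hH]
    rw [hP a b c d, hP b d c d, hP a d c d, cA' b c c d, cA' a c c d, hP b c d c, hP a c d c, sv b c, sv b d, sv a c, sv
      a d, sw a b]
    ring
  have hG : ∑ i, ∑ j, ∑ k, ∑ q, H i j k q = ricPair T (v * wᵀ) := by
    simp only [hH, ricPair, mul_apply, transpose_apply, ricci, of_apply, ofReal_sum, sum_mul, mul_sum]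
  have u1 := (r2 fun a b c d => H b a c d).trans (r1 H)
  have u2 := (r1 fun a b c d => H c a b d).trans u1
  have u3 := (r3 fun a b c d => H c a b d).trans u1
  have u4 := (r1 fun a b c d => H d a b c).trans u3
  have u5 : ∑ a, ∑ b, ∑ c, ∑ d, v a b * w a b * (T c d c d : ℂ) = scal T * (v * wᵀ).trace := by
    simp only [← mul_sum, ← sum_mul]
    rw [mul_comm]
    simp [scal, trace, ricci, mul_apply]
  have u6 : ∑ a, ∑ b, ∑ c, ∑ d, (T c d a b : ℂ) * v c d * w a b = 4 * ℛ T v w := by rw [four_curvForm, sum_comm_pairs]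
  rw [e2]
  simp only [e3, sum_add_distrib, sum_sub_distrib]
  rw [u1, u2, u3, u4, u5, u6, hG]
  ring

lemma sum_herm_fourVec (hA : ∀ i j k l, T i j k l = -T j i k l) (hP : ∀ i j k l, T i j k l = T k l i j) (hv : vᵀ = -v) :
    ∑ a, ∑ b, ∑ c, ∑ d, Herm T (fourVec v a b c d) = 12 * (scal T * Herm 𝕊 n v - 2 * (ricPair T (v * vᴴ)).re + 2 * Herm
        T v) := by
  have hv' : (v.map conj)ᵀ = -v.map conj := conj_skew hv
  have h := congrArg re (sum_fourVec hA hP hv hv')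
  simp only [re_sum, ← fourVec_map_conj] at h
  have e : (v.map conj)ᵀ = vᴴ := rfl
  have h2 := two_herm_sphere hv
  simp only [herm] at *
  rw [h, e, trace_mul_conjTranspose, ← h2, ← ofReal_mul]
  simp only [add_re, sub_re, Complex.mul_re, Complex.re_ofNat, Complex.im_ofNat, zero_mul, sub_zero, ofReal_re]
  ring

lemma trace_ineq_nonneg (hR : IsAlg R) (h : ∀ v ∈ nonneg.gen n, 0 ≤ Herm R v) (hv : v ∈ nonneg.gen n) (h0 : Herm R v =
    0) : TraceIneq R 𝕊 n v := by
  have h1 := sum_herm_fourVec hR.antisymm hR.pair_symm ((mem_so _ _ _).1 hv)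
  have h2 : 0 ≤ ∑ a, ∑ b, ∑ c, ∑ d, Herm R (fourVec v a b c d) := sum_nonneg fun a _ => sum_nonneg fun b _ => sum_nonneg
    fun c _ => sum_nonneg fun d _ => h _ ((mem_so _ _ _).2 (fourVec_transpose v a b c d))
  rw [h1, h0] at h2
  linarith

end FourVec

/-- A curvature tensor as a real bilinear form on matrices. -/
def rForm (R : Tℝ n) : Mℝ n →ₗ[ℝ] Mℝ n →ₗ[ℝ] ℝ := LinearMap.mk₂ ℝ (fun x y => (1 / 4) * ∑ i, ∑ j, ∑ k, ∑ l, R i j k l *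
  x i j * y k l) (fun x₁ x₂ y => by simp only [Matrix.add_apply, mul_add, add_mul, sum_add_distrib]) (fun c x y => by
      simp only [Matrix.smul_apply, smul_eq_mul, mul_sum]
      exact sum4_congr fun a b c d => by ring)
    (fun x y₁ y₂ => by simp only [Matrix.add_apply, mul_add, sum_add_distrib])
    (fun c x y => by
      simp only [Matrix.smul_apply, smul_eq_mul, mul_sum]
      exact sum4_congr fun a b c d => by ring)

lemma rForm_apply (R : Tℝ n) (x y : Mℝ n) : rForm R x y = (1 / 4) * ∑ i, ∑ j, ∑ k, ∑ l, R i j k l * x i j * y k l := rfl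

lemma rForm_comm (hP : ∀ i j k l, R i j k l = R k l i j) (x y : Mℝ n) : rForm R x y = rForm R y x := by
  rw [rForm_apply, rForm_apply, sum_comm_pairs]
  congr 1
  refine sum4_congr fun a b c d => ?_
  rw [hP]; ring

lemma curvForm_map_ofReal (R : Tℝ n) (x y : Mℝ n) : ℛ R (x.map ofReal) (y.map ofReal) = (rForm R x y : ℂ) := by
  rw [curvForm, rForm_apply]
  push_cast
  rfl

lemma eq_re_add_im (v : Mℂ n) : v = (v.map re).map ofReal + I • (v.map im).map ofReal := by
  ext i j
  simp [mul_comm I, Complex.re_add_im]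

lemma conj_eq_re_sub_im (v : Mℂ n) : v.map conj = (v.map re).map ofReal + (-I) • (v.map im).map ofReal := by
  ext i j
  apply Complex.ext <;> simp

lemma herm_eq_rForm (R : Tℝ n) (v : Mℂ n) : Herm R v = rForm R (v.map re) (v.map re) + rForm R (v.map im) (v.map im) :=
        by
  rw [herm, conj_eq_re_sub_im]
  conv_lhs => enter [1, 2]; rw [eq_re_add_im v]
  simp only [curvForm_add_left, curvForm_add_right, curvForm_smul_left, curvForm_smul_right, curvForm_map_ofReal]
  simp

lemma curvForm_self_eq_rForm (hP : ∀ i j k l, R i j k l = R k l i j) (v : Mℂ n) : ℛ R v v = ((rForm R (v.map re) (v.map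
      re) - rForm R (v.map im) (v.map im) : ℝ) : ℂ) + ((2 * rForm R (v.map re) (v.map im) : ℝ) : ℂ) * I := by
  conv_lhs => rw [eq_re_add_im v]
  simp only [curvForm_add_left, curvForm_add_right, curvForm_smul_left, curvForm_smul_right, curvForm_map_ofReal,
    rForm_comm hP (v.map im) (v.map re)]
  push_cast
  linear_combination (rForm R (v.map im) (v.map im) : ℂ) * I_mul_I

lemma re_im_transpose (hv : vᵀ = -v) : (v.map re)ᵀ = -v.map re ∧ (v.map im)ᵀ = -v.map im := by
  constructor <;> rw [← transpose_map, hv] <;> ext i j <;> simp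

lemma trace_sq_of_skew (hv : vᵀ = -v) : (v ^ 2).trace = -2 * ℛ 𝕊 n v v := by
  have h := curvForm_sphere hv v
  rw [hv, mul_neg, trace_neg] at h
  rw [pow_two]
  linear_combination h

lemma rForm_sphere {x : Mℝ n} (hx : xᵀ = -x) (y : Mℝ n) : rForm 𝕊 n x y = (1 / 2) * ∑ i, ∑ j, x i j * y i j := by
  have h := curvForm_sphere (v := x.map ofReal) (by rw [← transpose_map, hx]; ext i j; simp) (y.map ofReal)
  rw [curvForm_map_ofReal] at h
  have h2 : ((x.map ofReal) * (y.map ofReal)ᵀ).trace = ((∑ i, ∑ j, x i j * y i j : ℝ) : ℂ) := by simp [trace, mul_apply]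
  rw [h2] at h
  have h3 : 2 * rForm 𝕊 n x y = ∑ i, ∑ j, x i j * y i j := by exact_mod_cast h
  linarith

lemma rForm_sphere_self_nonneg {x : Mℝ n} (hx : xᵀ = -x) : 0 ≤ rForm 𝕊 n x x := by
  rw [rForm_sphere hx]
  exact mul_nonneg (by norm_num) (sum_nonneg fun i _ => sum_nonneg fun j _ => mul_self_nonneg _)

lemma eq_zero_of_forall_quadratic_nonneg {A B : ℝ} (h : ∀ t : ℝ, 0 ≤ 2 * t * A + t ^ 2 * B) : A = 0 := by
  have hB : 0 < |B| + 1 := by positivity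
  have h1 := h (-A / (|B| + 1))
  have e : 2 * (-A / (|B| + 1)) * A + (-A / (|B| + 1)) ^ 2 * B
      = A ^ 2 * (B - 2 * (|B| + 1)) / (|B| + 1) ^ 2 := by field_simp; ring
  rw [e] at h1
  have h3 : B - 2 * (|B| + 1) < 0 := by have := le_abs_self B; linarith
  have h4 : A ^ 2 ≤ 0 := by nlinarith [((div_nonneg_iff.1 h1).resolve_right (by rintro ⟨-, h⟩; exact absurd h (not_le.2 (by positivity)))).1, sq_nonneg A]
  exact pow_eq_zero_iff (two_ne_zero) |>.1 (le_antisymm h4 (sq_nonneg A))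

lemma rForm_of_min (hP : ∀ i j k l, R i j k l = R k l i j)
    (h : ∀ x y : Mℝ n, xᵀ = -x → yᵀ = -y →
      rForm 𝕊 n x x = rForm 𝕊 n y y → rForm 𝕊 n x y = 0 →
      0 ≤ rForm R x x + rForm R y y) {a b : Mℝ n} (ha : aᵀ = -a)
    (hb : bᵀ = -b) (haa : rForm 𝕊 n a a = 1) (hbb : rForm 𝕊 n b b = 1)
    (hab : rForm 𝕊 n a b = 0) {μ : ℝ} (h1 : rForm R a a = -μ) (h2 : rForm R b b = μ)
    (h3 : rForm R a b = 0) {z : Mℝ n} (hz : zᵀ = -z)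
    (haz : rForm 𝕊 n a z = 0) :
    rForm R a z = 0 ∧ μ * rForm 𝕊 n z z ≤ rForm R z z := by
  have hS := (isAlg_sphere n).pair_symm
  have hsm : ∀ (c : ℝ) {x : Mℝ n}, xᵀ = -x → (c • x)ᵀ = -(c • x) :=
    fun c x hx => by rw [transpose_smul, hx, smul_neg]
  constructor
  · set s := rForm 𝕊 n b z with hs
    set z' := z - s • b with hz'
    have hzt : z'ᵀ = -z' := by rw [hz', transpose_sub, hz, hsm s hb]; abel
    have hbz : rForm 𝕊 n b z' = 0 := by
      rw [hz', map_sub, map_smul, hbb, smul_eq_mul, mul_one, ← hs, sub_self]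
    have haz' : rForm 𝕊 n a z' = 0 := by
      rw [hz', map_sub, map_smul, hab, haz, smul_zero, sub_zero]
    have e : rForm R a z = rForm R a z' := by
      rw [hz', map_sub, map_smul, h3, smul_zero, sub_zero]
    rw [e]
    have hI := rForm_sphere_self_nonneg hzt
    refine eq_zero_of_forall_quadratic_nonneg
      (B := rForm R z' z' + μ * rForm 𝕊 n z' z') fun t => ?_
    set q := √(1 + t ^ 2 * rForm 𝕊 n z' z') with hq
    have hq2 : q * q = 1 + t ^ 2 * rForm 𝕊 n z' z' :=
      mul_self_sqrt (by positivity)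
    have hat : (a + t • z')ᵀ = -(a + t • z') := by
      rw [transpose_add, ha, hsm t hzt, neg_add]
    have := h (a + t • z') (q • b) hat (hsm q hb) (by
      simp only [map_add, map_smul, LinearMap.add_apply, LinearMap.smul_apply, smul_eq_mul, haa,
        hbb, haz', rForm_comm hS z' a]
      linear_combination -hq2) (by
      simp only [map_add, map_smul, LinearMap.add_apply, LinearMap.smul_apply, smul_eq_mul, hab,
        rForm_comm hS z' b, hbz]
      ring)
    simp only [map_add, map_smul, LinearMap.add_apply, LinearMap.smul_apply, smul_eq_mul, h1, h2,
      rForm_comm hP z' a] at this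
    rw [← mul_assoc q, hq2] at this
    linarith
  · have hI := rForm_sphere_self_nonneg hz
    set q := √(rForm 𝕊 n z z) with hq
    have hq2 : q * q = rForm 𝕊 n z z := mul_self_sqrt hI
    have := h (q • a) z (hsm q ha) hz (by
      simp only [map_smul, LinearMap.smul_apply, smul_eq_mul, haa]
      linear_combination hq2) (by
      simp only [map_smul, LinearMap.smul_apply, smul_eq_mul, haz, mul_zero])
    simp only [map_smul, LinearMap.smul_apply, smul_eq_mul, h1] at this
    rw [← mul_assoc q, hq2] at this
    linarith

lemma rForm_add_mul (R S : Tℝ n) (c : ℝ) (x y : Mℝ n) : rForm (fun i j k l => R i j k l + c * S i j k l) x y = rForm R x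
    y + c * rForm S x y := by
  simp only [rForm_apply, mul_sum, ← sum_add_distrib]
  exact sum4_congr fun a b c d => by ring

lemma rForm_tensor {a : Mℝ n} (ha : aᵀ = -a) (x y : Mℝ n) : rForm (fun i j k l => a i j * a k l) x y = rForm 𝕊 n a x *
      rForm 𝕊 n a y := by
  rw [rForm_sphere ha, rForm_sphere ha, rForm_apply, mul_mul_mul_comm]
  simp only [sum_mul]
  simp only [mul_sum]
  exact sum4_congr fun i j k l => by ring

lemma ricPair_add_mul (R S : Tℝ n) (c : ℝ) (N : Mℂ n) : ricPair (fun i j k l => R i j k l + c * S i j k l) N = ricPair R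
    N + c * ricPair S N := by simp only [ricPair, ricci_add_mul, Matrix.add_apply, Matrix.smul_apply, smul_eq_mul,
    ofReal_add, ofReal_mul, add_mul, sum_add_distrib, mul_sum, mul_assoc]

lemma ricPair_tensor_nonneg (a : Mℝ n) (v : Mℂ n) : 0 ≤ (ricPair (fun i j k l => a i j * a k l) (v * vᴴ)).re := by
  have e : ricPair (fun i j k l => a i j * a k l) (v * vᴴ) = ((∑ q, ∑ m, ‖∑ i, (a i q : ℂ) * v i m‖ ^ 2 : ℝ) : ℂ) := by
    have h : ∀ q m, ((‖∑ i, (a i q : ℂ) * v i m‖ ^ 2 : ℝ) : ℂ) = ∑ i, ∑ j, (a i q : ℂ) * v i m * ((a j q : ℂ) * conj (v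
        j m)) := fun q m => by
      rw [ofReal_pow, ← mul_conj', map_sum, sum_mul]
      refine sum_ext fun i => ?_
      rw [mul_sum]
      exact sum_ext fun j => by rw [map_mul, conj_ofReal]
    rw [ofReal_sum]
    simp only [ofReal_sum, h, ricPair, ricci, of_apply, mul_apply, conjTranspose_apply, ofReal_sum, sum_mul, mul_sum]
    rw [sum_comm_pairs, sum_comm]
    refine sum4_congr fun i j k l => ?_
    push_cast
    rw [star_def]
    ring
  rw [e, ofReal_re]
  positivity

lemma rForm_nonneg_of_twoNonneg (h : ∀ v ∈ twoNonneg.gen n, 0 ≤ Herm R v) (x y : Mℝ n) (hx : xᵀ = -x) (hy : yᵀ = -y)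
    (hxy : rForm 𝕊 n x x = rForm 𝕊 n y y) (h0 : rForm 𝕊 n x y = 0) : 0 ≤ rForm R x x + rForm R y y := by
  set v := x.map ofReal + I • y.map ofReal with hv
  have hre : v.map re = x := by ext i j; simp [hv]
  have him : v.map im = y := by ext i j; simp [hv]
  have hvt : vᵀ = -v := by
    rw [hv, transpose_add, transpose_smul, ← transpose_map, ← transpose_map, hx, hy]
    ext i j; simp; ring
  have := h v ⟨(mem_so _ _ _).2 hvt, by
    rw [trace_sq_of_skew hvt, curvForm_self_eq_rForm (isAlg_sphere n).pair_symm, hre, him, hxy, h0]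
    simp⟩
  rwa [herm_eq_rForm, hre, him] at this

lemma twoNonneg_min_bound (hn : 5 ≤ n) (hR : IsAlg R) (h : ∀ v ∈ twoNonneg.gen n, 0 ≤ Herm R v) (hv : vᵀ = -v) (h0 :
    Herm R v = 0) (hS : Herm 𝕊 n v = 2) (hS0 : ℛ 𝕊 n v v = 0) {ρ : ℝ} (hρ : 0 ≤ ρ) (hρ' : ℛ R v v = -(ρ : ℂ)) :
    TraceIneq R 𝕊 n v := by
  have hPS := (isAlg_sphere n).pair_symm
  set a := v.map re with ha
  set b := v.map im with hb
  obtain ⟨hat, hbt⟩ := re_im_transpose hv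
  rw [← ha] at hat
  rw [← hb] at hbt
  have q1 := herm_eq_rForm R v
  have q2 := herm_eq_rForm 𝕊 n v
  have q3 := curvForm_self_eq_rForm hR.pair_symm v
  have q4 := curvForm_self_eq_rForm hPS v
  rw [← ha, ← hb] at q1 q2 q3 q4
  rw [h0] at q1
  rw [hS] at q2
  have q3' := re_im_eq (a := -ρ) (b := 0) (by rw [← q3, hρ']; simp)
  have q4' := re_im_eq (a := 0) (b := 0) (by rw [← q4, hS0]; simp)
  have key := fun z hz haz => rForm_of_min (μ := ρ / 2) (z := z) hR.pair_symm (rForm_nonneg_of_twoNonneg h) hat hbt (by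
    linarith [q4'.1]) (by linarith [q4'.1]) (by linarith [q4'.2]) (by linarith [q3'.1]) (by linarith [q3'.1]) (by
    linarith [q3'.2]) hz haz
  have haa : rForm 𝕊 n a a = 1 := by linarith [q4'.1]
  have hRaa : rForm R a a = -(ρ / 2) := by linarith [q3'.1]
  have hab : rForm 𝕊 n a b = 0 := by linarith [q4'.2]
  set T : Tℝ n := fun i j k l => (R i j k l + (-(ρ / 2)) * sphereCurv n i j k l) + ρ * (a i j * a k l) with hT
  have hA : ∀ i j, a i j = -a j i := fun i j => by
    have := congr_fun₂ hat j i
    exact this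
  have hTA : ∀ i j k l, T i j k l = -T j i k l := fun i j k l => by
    simp only [hT]
    rw [hR.antisymm, (isAlg_sphere n).antisymm, hA i j]; ring
  have hTP : ∀ i j k l, T i j k l = T k l i j := fun i j k l => by
    simp only [hT]
    rw [hR.pair_symm, hPS]; ring
  have hTr : ∀ x y, rForm T x y = rForm R x y + (-(ρ / 2)) * rForm 𝕊 n x y + ρ * (rForm 𝕊 n a x * rForm 𝕊 n a y) := fun
      x y => by rw [hT, rForm_add_mul (fun i j k l => R i j k l + (-(ρ / 2)) * sphereCurv n i j k l)
      (fun i j k l => a i j * a k l), rForm_add_mul, rForm_tensor hat]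
  have hpos : ∀ y : Mℝ n, yᵀ = -y → 0 ≤ rForm T y y := by
    intro y hy
    set s := rForm 𝕊 n a y with hs
    set z := y - s • a with hz
    have hzt : zᵀ = -z := by rw [hz, transpose_sub, transpose_smul, hy, hat, smul_neg]; abel
    have haz : rForm 𝕊 n a z = 0 := by rw [hz, map_sub, map_smul, haa, smul_eq_mul, mul_one, ← hs, sub_self]
    obtain ⟨k1, k2⟩ := key z hzt haz
    have hyz : y = s • a + z := by rw [hz]; abel
    have e1 : rForm R y y = s * s * (-(ρ / 2)) + rForm R z z := by
      conv_lhs => rw [hyz]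
      simp only [map_add, map_smul, LinearMap.add_apply, LinearMap.smul_apply, smul_eq_mul, hRaa, k1, rForm_comm
        hR.pair_symm z a]
      ring
    have e2 : rForm 𝕊 n y y = s * s + rForm 𝕊 n z z := by
      conv_lhs => rw [hyz]
      simp only [map_add, map_smul, LinearMap.add_apply, LinearMap.smul_apply, smul_eq_mul, haa, haz, rForm_comm hPS z
        a]
      ring
    rw [hTr, e1, e2, ← hs]
    linarith
  have hsum0 : 0 ≤ ∑ a, ∑ b, ∑ c, ∑ d, Herm T (fourVec v a b c d) := by
    refine sum_nonneg fun a _ => sum_nonneg fun b _ => sum_nonneg fun c _ => sum_nonneg fun d _ => ?_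
    rw [herm_eq_rForm]
    have := re_im_transpose (fourVec_transpose v a b c d)
    exact add_nonneg (hpos _ this.1) (hpos _ this.2)
  have hTv : Herm T v = 0 := by
    rw [herm_eq_rForm, ← ha, ← hb, hTr, hTr, haa, hab, hRaa,
      show rForm 𝕊 n b b = 1 by linarith, show rForm R b b = ρ / 2 by linarith]
    ring
  have hfro := two_herm_sphere hv
  rw [hS] at hfro
  have hsa : scal (fun i j k l => a i j * a k l) = 2 := by
    have := rForm_sphere hat a
    rw [haa] at this
    simp only [scal, trace, diag_apply, ricci, of_apply]
    linarith
  have hscal : scal T = scal R + (-(ρ / 2)) * (n * ((n : ℝ) - 1)) + ρ * 2 := by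
    rw [hT, scal_add_mul (fun i j k l => R i j k l + (-(ρ / 2)) * sphereCurv n i j k l)
      (fun i j k l => a i j * a k l), scal_add_mul, scal_sphereCurv, hsa]
  have hric : (ricPair T (v * vᴴ)).re = (ricPair R (v * vᴴ)).re + (-(ρ / 2)) * (((n : ℝ) - 1) * 4) + ρ * (ricPair (fun i
      j k l => a i j * a k l) (v * vᴴ)).re := by
    rw [hT, ricPair_add_mul (fun i j k l => R i j k l + (-(ρ / 2)) * sphereCurv n i j k l) (fun i j k l => a i j * a k
      l), ricPair_add_mul, ricPair_of_smul_one (ricci_sphereCurv n), trace_mul_conjTranspose, ← hfro, add_re, add_re,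
      re_ofReal_mul, re_ofReal_mul, re_ofReal_mul]
    norm_num
  rw [sum_herm_fourVec hTA hTP hv, hTv, hS, hscal, hric] at hsum0
  rw [hS]
  have hn' : (5 : ℝ) ≤ n := by exact_mod_cast hn
  have hp : 0 ≤ ρ * (((n : ℝ) - 5) * n) := mul_nonneg hρ (mul_nonneg (by linarith) (by linarith))
  have hq := mul_nonneg hρ (ricPair_tensor_nonneg a v)
  nlinarith

lemma wedge_single_swap (i j : Fin n) : wedge (Pi.single j 1) (Pi.single i 1) = -wedge (Pi.single i 1) (Pi.single j 1)
    := wedge_swap _ _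

lemma wedge_self (x : Vℂ n) : wedge x x = 0 := sub_self _

lemma fourVec_eq_zero (hv : vᵀ = -v) {a b c d : Fin n} (h : a = b ∨ a = c ∨ a = d ∨ b = c ∨ b = d ∨ c = d) : fourVec v a
    b c d = 0 := by
  have sv : ∀ i j, v j i = -v i j := fun i j => congr_fun₂ hv i j
  have s0 : ∀ i, v i i = 0 := fun i => self_eq_neg.1 (sv i i)
  rcases h with rfl | rfl | rfl | rfl | rfl | rfl
  · simp only [fourVec, s0, wedge_self, zero_smul, smul_zero]; module
  · simp only [fourVec, s0, wedge_self, zero_smul, smul_zero, wedge_single_swap a b, sv a b]; module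
  · simp only [fourVec, s0, wedge_self, zero_smul, smul_zero, wedge_single_swap a b, wedge_single_swap a c, sv a b, sv a
      c]; module
  · simp only [fourVec, s0, wedge_self, zero_smul, smul_zero]; module
  · simp only [fourVec, s0, wedge_self, zero_smul, smul_zero, wedge_single_swap b c, sv b c]; module
  · simp only [fourVec, s0, wedge_self, zero_smul, smul_zero]; module

lemma trace_fourVec_sq (hn : n ≤ 4) (hv : vᵀ = -v)
    (htr : (v ^ 2).trace = 0) (a b c d : Fin n) : ((fourVec v a b c d) ^ 2).trace = 0 := by
  by_cases hdeg : a = b ∨ a = c ∨ a = d ∨ b = c ∨ b = d ∨ c = d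
  · rw [fourVec_eq_zero hv hdeg]; simp
  push Not at hdeg
  obtain ⟨hab, hac, had, hbc, hbd, hcd⟩ := hdeg
  have sv : ∀ i j, v j i = -v i j := fun i j => congr_fun₂ hv i j
  have s0 := fun i => self_eq_neg.1 (sv i i)
  have ha : a ∉ ({b, c, d} : Finset (Fin n)) := by simp [hab, hac, had]
  have hb : b ∉ ({c, d} : Finset (Fin n)) := by simp [hbc, hbd]
  have hc : c ∉ ({d} : Finset (Fin n)) := by simpa using hcd
  have hu : ({a, b, c, d} : Finset (Fin n)) = Finset.univ := by
    apply Finset.eq_univ_of_card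
    have h1 : ({a, b, c, d} : Finset (Fin n)).card = 4 := by
      rw [card_insert_of_notMem ha, card_insert_of_notMem hb,
        card_insert_of_notMem hc, Finset.card_singleton]
    have h2 := Finset.card_le_univ ({a, b, c, d} : Finset (Fin n))
    rw [Fintype.card_fin] at h2 ⊢
    omega
  have hsum : ∀ f : Vℂ n, ∑ i, f i = f a + (f b + (f c + f d)) := fun f => by
    rw [← hu, sum_insert ha, sum_insert hb, sum_insert hc,
      sum_singleton]
  rw [trace_sq_of_skew (fourVec_transpose v a b c d)]
  rw [trace_sq_of_skew hv] at htr
  have h1 := curvForm_sphere hv v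
  simp only [trace, diag_apply, mul_apply, transpose_apply, hsum,
    s0, sv a b, sv a c, sv a d, sv b c, sv b d, sv c d] at h1
  simp only [fourVec, curvForm_add_left, curvForm_add_right, curvForm_smul_left,
      curvForm_smul_right, curvForm_single ((isAlg_sphere n).antisymm) ((isAlg_sphere n).pair_symm), sphereCurv, hab, hac, had, hbc, hbd, hcd,
      hab.symm, hac.symm, had.symm, hbc.symm, hbd.symm, hcd.symm, if_true, if_false]
  push_cast
  linear_combination htr + h1

lemma trace_ineq_twoNonneg (hR : IsAlg R) (h : ∀ v ∈ twoNonneg.gen n, 0 ≤ Herm R v) (hv : v ∈ twoNonneg.gen n) (h0 :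
    Herm R v = 0) : TraceIneq R 𝕊 n v := by
  have hvt := (mem_so _ _ _).1 hv.1
  rcases Nat.lt_or_ge n 5 with hn | hn
  · have h1 := sum_herm_fourVec hR.antisymm hR.pair_symm hvt
    have h2 : 0 ≤ ∑ a, ∑ b, ∑ c, ∑ d, Herm R (fourVec v a b c d) := sum_nonneg fun a _ => sum_nonneg fun b _ =>
      sum_nonneg fun c _ => sum_nonneg fun d _ => h _ ⟨(mem_so _ _ _).2 (fourVec_transpose v a b c d), trace_fourVec_sq
            (by omega) hvt hv.2 a b c d⟩
    rw [h1, h0] at h2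
    linarith
  · have hfro := two_herm_sphere hvt
    by_cases hz : Herm 𝕊 n v = 0
    · have hv0 : v = 0 := by
        rw [hz, mul_zero] at hfro
        ext i j
        have h1 := (Finset.sum_eq_zero_iff_of_nonneg fun i _ => sum_nonneg fun j _ => sq_nonneg _).1 hfro.symm i
          (Finset.mem_univ i)
        have h2 := (Finset.sum_eq_zero_iff_of_nonneg fun j _ => sq_nonneg _).1 h1 j (Finset.mem_univ j)
        simpa using h2
      rw [hz, hv0]
      simp [ricPair]
    · have hpos : 0 < Herm 𝕊 n v := by
        refine lt_of_le_of_ne ?_ (Ne.symm hz)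
        have : 0 ≤ ∑ i, ∑ j, ‖v i j‖ ^ 2 := by positivity
        linarith
      obtain ⟨θ, hθ, hθ'⟩ := exists_phase (ℛ R v v)
      have hθn : ‖θ‖ ^ 2 = 1 := by
        rw [star_def, conj_mul'] at hθ
        exact_mod_cast hθ
      set N := Herm 𝕊 n v with hN
      set k := √(2 / N) with hk
      have hk2 : k ^ 2 = 2 / N := sq_sqrt (by positivity)
      have hk0 : 0 < k := sqrt_pos.2 (by positivity)
      set c : ℂ := k * (I * θ) with hc
      have hcn : ‖c‖ ^ 2 = 2 / N := by rw [hc, norm_mul, norm_mul, Complex.norm_I, one_mul, mul_pow, hθn, norm_real,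
          norm_eq_abs, sq_abs, hk2, mul_one]
      have hc0 : c ≠ 0 := by
        rintro h
        rw [h, norm_zero] at hcn
        have : 0 < 2 / N := by positivity
        rw [← hcn] at this
        simp at this
      have hcv : (c • v)ᵀ = -(c • v) := by rw [transpose_smul, hvt, smul_neg]
      have htr := trace_sq_of_skew hvt
      rw [hv.2] at htr
      have h1 := twoNonneg_min_bound hn hR h hcv (by rw [herm_smul, h0, mul_zero]) (by rw [herm_smul, hcn, ← hN,
        div_mul_cancel₀ _ hpos.ne']) (by rw [curvForm_smul_left, curvForm_smul_right]; linear_combination (c * c / 2) *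
        htr) (ρ := k ^ 2 * ‖ℛ R v v‖) (by positivity) (by
          rw [curvForm_smul_left, curvForm_smul_right, hc]
          push_cast
          linear_combination (k : ℂ) ^ 2 * (I_mul_I * θ * θ * ℛ R v v) - k ^ 2 * hθ')
      have h2 := trace_ineq_smul c⁻¹ h1
      rwa [smul_smul, inv_mul_cancel₀ hc0, one_smul] at h2

def IsT10 (K : Mℝ n) (x : Vℂ n) : Prop := cK K *ᵥ x = I • x

lemma ctr_conj (R : Tℝ n) (N N' : Mℂ n) : conj (ctr R N N') = ctr R (N.map conj) (N'.map conj) := by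
  simp only [ctr_apply, map_sum, map_mul, conj_ofReal, map_apply]

/-- The hermitian pairing of hermitian forms induced by a curvature tensor. -/
def bF (R : Tℝ n) (N N' : Mℂ n) : ℝ := (ctr R N (N'.map conj)).re

lemma bF_comm (hR : IsAlg R) (N N' : Mℂ n) : bF R N N' = bF R N' N := by
  rw [bF, bF, ← Complex.conj_re (ctr R N' _), ctr_conj, map_conj_map_conj, ctr_comm hR]

lemma bF_add_left (N₁ N₂ N' : Mℂ n) : bF R (N₁ + N₂) N' = bF R N₁ N' + bF R N₂ N' := by
  rw [bF, map_add, LinearMap.add_apply, add_re, bF, bF]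

lemma bF_smul_left (c : ℝ) (N N' : Mℂ n) : bF R ((c : ℂ) • N) N' = c * bF R N N' := by
  rw [bF, map_smul, LinearMap.smul_apply, smul_eq_mul, re_ofReal_mul, bF]

lemma pr_map_conj (x : Vℂ n) : (pr x).map conj = pr (star x) := by ext i j; simp [pr_apply]

lemma bF_pr_pr (hR : IsAlg R) (x y : Vℂ n) : bF R (pr x) (pr y) = Herm R (wedge x (star y)) := by
  rw [bF, pr_map_conj, herm_wedge hR]

lemma eq_sum_pr {P : Mℂ n} (hP : P * Pᴴ = P) : P = ∑ k, pr (fun i => P i k) := by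
  conv_lhs => rw [← hP]
  ext i j
  rw [Matrix.sum_apply, mul_apply]
  rfl

lemma bF_sum_left {ι : Type*} (s : Finset ι) (N : ι → Mℂ n) (N' : Mℂ n) : bF R (∑ i ∈ s, N i) N' = ∑ i ∈ s, bF R (N i)
    N' := by
  rw [bF, map_sum, LinearMap.sum_apply, re_sum]
  rfl

lemma IsT10.vecMul (hK : Kᵀ = -K) (hx : IsT10 K x) : x ᵥ* cK K = -I • x := by
  rw [← mulVec_transpose, cK_transpose hK, neg_mulVec, hx, neg_smul]

lemma IsT10.star_mulVec (hx : IsT10 K x) : cK K *ᵥ star x = -I • star x := by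
  have h := congrArg star hx
  rw [star_smul, Matrix.star_mulVec, ← Matrix.mulVec_transpose] at h
  have e : (cK K)ᴴᵀ = cK K := by
    ext i j
    simp [cK_apply]
  rw [e] at h
  simpa using h

lemma IsT10.dotProduct_eq_zero (hK : Kᵀ = -K) (hx : IsT10 K x) (hy : IsT10 K y) : x ⬝ᵥ y = 0 := by
  have h1 : x ⬝ᵥ (cK K *ᵥ y) = I * (x ⬝ᵥ y) := by rw [hy, dotProduct_smul, smul_eq_mul]
  have h2 : x ⬝ᵥ (cK K *ᵥ y) = -I * (x ⬝ᵥ y) := by rw [dotProduct_mulVec, hx.vecMul hK, smul_dotProduct, smul_eq_mul]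
  have h3 : 2 * I * (x ⬝ᵥ y) = 0 := by linear_combination h2 - h1
  simpa using h3

lemma wedge_commute (hK : Kᵀ = -K) (hx : IsT10 K x) (hy : IsT10 K y) : cK K * wedge x (star y) = wedge x (star y) * cK K
    := by
  have h1 : star y ᵥ* cK K = I • star y := by
    rw [← mulVec_transpose, cK_transpose hK, neg_mulVec, hy.star_mulVec, neg_smul, neg_neg]
  rw [wedge, mul_sub, sub_mul, mul_vecMulVec, mul_vecMulVec, vecMulVec_mul, vecMulVec_mul, h1, hx.vecMul hK, hx,
    hy.star_mulVec]
  simp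

lemma wedge_mul_conjTranspose' (hxy : star x ⬝ᵥ y = 0) : wedge x y * (wedge x y)ᴴ = (star y ⬝ᵥ y) • pr x + (star x ⬝ᵥ x)
    • pr y := by
  rw [wedge, conjTranspose_sub, conjTranspose_vecMulVec, conjTranspose_vecMulVec, mul_sub, sub_mul, sub_mul]
  simp only [vecMulVec_mul_vecMulVec]
  rw [dotProduct_comm y (star y), dotProduct_comm x (star x), dotProduct_comm y (star x), dotProduct_comm x (star y),
    hxy, star_dotProduct_eq_zero hxy, pr, pr]
  simp [vecMulVec_smul]

lemma curvForm_kaehlerCurv (hK : Kᵀ = -K) (hK2 : K * K = -1) (hv : vᵀ = -v) (hwt : wᵀ = -w) (hw : cK K * w = w * cK K) :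
    ℛ (kaehlerCurv K) v w = ℛ 𝕊 n v w + (1 / 4) * (∑ i, ∑ j, cK K i j * v i j) * (∑ i, ∑ j, cK K i j * w i j) := by
  have e : ∀ i j, ∑ k, ∑ l, cK K i k * cK K j l * w k l = w i j := fun i j => by
    have h : cK K * w * (cK K)ᵀ = w := by
      rw [cK_transpose hK, hw, mul_neg, mul_assoc, cK_mul_self hK2]
      simp
    conv_rhs => rw [← h]
    rw [sum_comm]
    simp only [transpose_apply, mul_apply, sum_mul]
    exact sum_ext fun l => sum_ext fun k => by ring
  have h1 : ∑ i, ∑ j, ∑ k, ∑ l, cK K i k * cK K j l * v i j * w k l = 2 * ℛ 𝕊 n v w := by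
    rw [curvForm_sphere hv, trace]
    simp only [diag_apply, mul_apply, transpose_apply]
    refine sum_ext fun i => sum_ext fun j => ?_
    conv_rhs => rw [← e i j]
    simp only [mul_sum]
    exact sum_ext fun k => sum_ext fun l => by ring
  have h2 : ∑ i, ∑ j, ∑ k, ∑ l, cK K i l * cK K j k * v i j * w k l = -(2 * ℛ 𝕊 n v w) := by
    rw [← h1, sum_comm_last_two]
    simp only [← sum_neg_distrib]
    refine sum4_congr fun i j k l => ?_
    have : w l k = -w k l := congr_fun₂ hwt k l
    rw [this]
    ring
  have h3 : ∑ i, ∑ j, ∑ k, ∑ l, cK K i j * cK K k l * v i j * w k l = (∑ i, ∑ j, cK K i j * v i j) * (∑ i, ∑ j, cK K i j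
      * w i j) := by
    simp only [sum_mul]
    simp only [mul_sum]
    exact sum4_congr fun i j k l => by ring
  have h4 : 4 * ℛ (kaehlerCurv K) v w = (1 / 2) * (4 * ℛ 𝕊 n v w + ∑ i, ∑ j, ∑ k, ∑ l, cK K i k * cK K j l * v i j * w k
      l - ∑ i, ∑ j, ∑ k, ∑ l, cK K i l * cK K j k * v i j * w k l + 2 * ∑ i, ∑ j, ∑ k, ∑ l, cK K i j * cK K k l * v i j
      * w k l) := by
    rw [four_curvForm, four_curvForm]
    simp only [mul_sum, ← sum_add_distrib, ← sum_sub_distrib]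
    refine sum4_congr fun i j k l => ?_
    simp only [kaehlerCurv, cK_apply]
    push_cast
    ring
  rw [h1, h2, h3] at h4
  linear_combination h4 / 4

lemma sum_cK_wedge (hK : Kᵀ = -K) (x y : Vℂ n) : ∑ i, ∑ j, cK K i j * wedge x y i j = 2 * (x ⬝ᵥ (cK K *ᵥ y)) := by
  have h1 : ∑ i, ∑ j, cK K i j * (x i * y j) = x ⬝ᵥ (cK K *ᵥ y) := by
    simp only [dotProduct, mulVec, mul_sum]
    exact sum_ext fun i => sum_ext fun j => by ring
  have h2 : ∑ i, ∑ j, cK K i j * (y i * x j) = -(x ⬝ᵥ (cK K *ᵥ y)) := by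
    rw [← h1, sum_comm]
    simp only [← sum_neg_distrib]
    refine sum_ext fun i => sum_ext fun j => ?_
    have : cK K j i = -cK K i j := congr_fun₂ (cK_transpose hK) i j
    rw [this]; ring
  simp only [wedge_apply, mul_sub, sum_sub_distrib]
  rw [h1, h2]; ring

lemma star_dot_self (x : Vℂ n) : star x ⬝ᵥ x = ((∑ i, ‖x i‖ ^ 2 : ℝ) : ℂ) := by
  simp only [dotProduct, Pi.star_apply, star_def, conj_mul']
  push_cast
  rfl

lemma herm_kaehlerCurv_wedge (hK : Kᵀ = -K) (hK2 : K * K = -1) (hx : IsT10 K x) (hy : IsT10 K y) : Herm (kaehlerCurv K)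
    (wedge x (star y)) = (∑ i, ‖x i‖ ^ 2) * (∑ i, ‖y i‖ ^ 2) + ‖star x ⬝ᵥ y‖ ^ 2 := by
  have hvt := wedge_transpose x (star y)
  have hwc : cK K * (wedge x (star y)).map conj = (wedge x (star y)).map conj * cK K := by
    have := congrArg (fun M : Mℂ n => M.map conj) (wedge_commute hK hx hy)
    simp only [Matrix.map_mul, cK_map_conj] at this
    exact this
  have h := curvForm_kaehlerCurv hK hK2 hvt (conj_skew hvt) hwc
  have hxy : star x ⬝ᵥ star y = 0 := by rw [star_dotProduct_star, hy.dotProduct_eq_zero hK hx, star_zero]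
  have e1 := curvForm_sphere hvt ((wedge x (star y)).map conj)
  have t : ∀ z : Vℂ n, (pr z).trace = star z ⬝ᵥ z := fun z => by rw [pr, trace_vecMulVec, dotProduct_comm]
  rw [show ((wedge x (star y)).map conj)ᵀ = (wedge x (star y))ᴴ from rfl, wedge_mul_conjTranspose' hxy, trace_add,
    trace_smul, trace_smul, t, t, star_star, dotProduct_comm y (star y), star_dot_self, star_dot_self] at e1
  have e2 : ∑ i, ∑ j, cK K i j * wedge x (star y) i j = -(2 * I * conj (star x ⬝ᵥ y)) := by
    rw [sum_cK_wedge hK, hy.star_mulVec, dotProduct_smul, smul_eq_mul]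
    have : x ⬝ᵥ star y = conj (star x ⬝ᵥ y) := by
      have := star_dotProduct x y
      rw [← star_def, this, star_star, dotProduct_comm]
    rw [this]; ring
  have e3 : ∑ i, ∑ j, cK K i j * (wedge x (star y)).map conj i j = 2 * I * (star x ⬝ᵥ y) := by
    rw [wedge_map_conj, star_star, sum_cK_wedge hK, hy, dotProduct_smul, smul_eq_mul]
    ring
  rw [e2, e3] at h
  have h5 : ℛ (kaehlerCurv K) (wedge x (star y)) ((wedge x (star y)).map conj) = (((∑ i, ‖x i‖ ^ 2) * (∑ i, ‖y i‖ ^ 2) +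
      ‖star x ⬝ᵥ y‖ ^ 2 : ℝ) : ℂ) := by
    rw [h]
    simp only [smul_eq_mul] at e1
    push_cast at e1 ⊢
    linear_combination e1 / 2 + (conj_mul' (star x ⬝ᵥ y)) - conj (star x ⬝ᵥ y) * (star x ⬝ᵥ y) * I_mul_I
  rw [herm, h5, ofReal_re]

/-- The projection to the vectors of type `(1,0)`. -/
def pV (K : Mℝ n) : Mℂ n := (1 / 2 : ℂ) • (1 - I • cK K)

lemma cK_mul_pV (hK2 : K * K = -1) : cK K * pV K = I • pV K := by
  rw [pV, Matrix.mul_smul, Matrix.mul_sub, Matrix.mul_one, Matrix.mul_smul, cK_mul_self hK2]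
  ext i j
  simp only [Matrix.smul_apply, Matrix.sub_apply, Matrix.neg_apply, smul_eq_mul]
  linear_combination (1 / 2) * cK K i j * I_mul_I

lemma pV_conjTranspose (hK : Kᵀ = -K) : (pV K)ᴴ = pV K := by
  have e : (cK K)ᴴ = -cK K := by
    rw [← cK_transpose hK]
    ext i j; simp
  rw [pV, conjTranspose_smul, conjTranspose_sub, conjTranspose_smul, e]
  simp

lemma pV_mul {N : Mℂ n} (hN : cK K * N = I • N) : pV K * N = N := by
  rw [pV, smul_mul, sub_mul, smul_mul, hN, smul_smul, I_mul_I, one_mul]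
  module

lemma pV_add_conj : pV K + (pV K).map conj = 1 := by
  ext i j
  simp only [pV, Matrix.add_apply, map_apply, Matrix.smul_apply, Matrix.sub_apply, cK_apply, smul_eq_mul, map_mul,
    map_sub, conj_I, conj_ofReal, map_div₀, map_one, map_ofNat]
  rw [Matrix.one_apply]
  split_ifs <;> simp <;> ring

lemma IsT10.mul_pr (hx : IsT10 K x) : cK K * pr x = I • pr x := by rw [pr, mul_vecMulVec, hx, smul_vecMulVec]

lemma ctr_eq_zero_of_typeOneZero (hR : SlotInv K R) {N N' : Mℂ n} (hN : cK K * N = I • N) (hN' : cK K * N' = I • N') :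
    ctr R N N' = 0 := by
  have h := ctr_mul_left hR N N'
  rw [hN, hN', map_smul, map_smul, LinearMap.smul_apply, smul_eq_mul] at h
  have h2 : 2 * I * ctr R N N' = 0 := by linear_combination h
  simpa using h2

lemma ctr_conj_eq_zero_of_typeOneZero (hR : SlotInv K R) {N N' : Mℂ n} (hN : cK K * N = I • N) (hN' : cK K * N' = I •
    N') : ctr R (N.map conj) (N'.map conj) = 0 := by rw [← ctr_conj, ctr_eq_zero_of_typeOneZero hR hN hN', map_zero]

lemma ricPair_pr (hRK : SlotInv K R) (hK2 : K * K = -1) (hx : IsT10 K x) : (ricPair R (pr x)).re = bF R (pr x) (pV K) :=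
    by rw [← ctr_one_right, ← pV_add_conj, map_add,
    ctr_eq_zero_of_typeOneZero hRK hx.mul_pr (cK_mul_pV hK2), zero_add, bF]

lemma ricPair_pr_star (hRK : SlotInv K R) (hK2 : K * K = -1) (hx : IsT10 K x) : (ricPair R (pr (star x))).re = bF R (pr
    x) (pV K) := by rw [← ctr_one_right, ← pr_map_conj, ← pV_add_conj, map_add,
    ctr_conj_eq_zero_of_typeOneZero hRK hx.mul_pr (cK_mul_pV hK2), add_zero, bF,
    ← Complex.conj_re (ctr R (pr x) _), ctr_conj, map_conj_map_conj]

lemma scal_eq_bF (hR : IsAlg R) (hRK : SlotInv K R) (hK2 : K * K = -1) : scal R = 2 * bF R (pV K) (pV K) := by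
  have h : (scal R : ℂ) = 2 * ctr R (pV K) ((pV K).map conj) := by
    rw [← ricPair_one, ← ctr_one_right, ← pV_add_conj, map_add (ctr R), LinearMap.add_apply, map_add, map_add,
      ctr_eq_zero_of_typeOneZero hRK (cK_mul_pV hK2) (cK_mul_pV hK2), ctr_conj_eq_zero_of_typeOneZero hRK (cK_mul_pV
      hK2) (cK_mul_pV hK2), ctr_comm hR ((pV K).map _)]
    ring
  have := congrArg re h
  rw [bF]
  simpa using this

lemma typeOneZero_col {P : Mℂ n} (hP : cK K * P = I • P) (k : Fin n) : IsT10 K fun i => P i k := by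
  funext i
  exact congr_fun₂ hP i k

lemma bF_nonneg_right (hR : IsAlg R) {N P : Mℂ n} (h : ∀ y, IsT10 K y → 0 ≤ bF R N (pr y)) (hP : P * Pᴴ = P) (hPK : cK K
    * P = I • P) : 0 ≤ bF R N P := by
  rw [bF_comm hR, eq_sum_pr hP, bF_sum_left]
  refine sum_nonneg fun k _ => ?_
  rw [bF_comm hR]
  exact h _ (typeOneZero_col hPK k)

lemma bF_pr_le (hR : IsAlg R) (h : ∀ x y, IsT10 K x → IsT10 K y → 0 ≤ Herm R (wedge x (star y))) {p q : Vℂ n} (hp :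
    IsT10 K p) (hq : IsT10 K q) (h0 : Herm R (wedge (p + q) (star (p - q))) = 0) : bF R (pr p) (pr p) ≤ bF R (pr q) (pr
    q) := by
  set X := wedge p (star p) with hX
  set Y := wedge q (star p) - wedge p (star q) with hY
  set Z := wedge q (star q) with hZ
  have cX : X.map conj = -X := by rw [hX, wedge_map_conj, star_star, wedge_swap]
  have cZ : Z.map conj = -Z := by rw [hZ, wedge_map_conj, star_star, wedge_swap]
  have cY : Y.map conj = Y := by
    rw [hY, Matrix.map_sub _ (map_sub conj), wedge_map_conj, wedge_map_conj, star_star, star_star, wedge_swap (star q),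
      wedge_swap (star p)]
    abel
  have hw : ∀ t : ℝ, wedge (p + (t : ℂ) • q) (star (p - (t : ℂ) • q)) = X + ((t : ℂ) • Y + (-(t : ℂ) ^ 2) • Z) := by
    intro t
    ext i j
    simp only [wedge_apply, hX, hY, hZ, Pi.add_apply, Pi.smul_apply, Pi.star_apply, Pi.sub_apply, smul_eq_mul,
      Matrix.add_apply, Matrix.sub_apply, Matrix.smul_apply, star_def, map_sub, map_mul, conj_ofReal]
    ring
  have hf : ∀ t : ℝ, Herm R (wedge (p + (t : ℂ) • q) (star (p - (t : ℂ) • q))) = Herm R X + t ^ 2 * (ℛ R Y Y + 2 * ℛ R X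
      Z).re + (t ^ 2) ^ 2 * Herm R Z := by
    intro t
    rw [hw, herm, Matrix.map_add _ (map_add conj), Matrix.map_add _ (map_add conj), map_conj_smul, map_conj_smul, cX,
      cY, cZ, herm, herm, cX, cZ, ← re_ofReal_mul, ← re_ofReal_mul, ← add_re, ← add_re]
    congr 1
    simp only [curvForm_add_left, curvForm_add_right, curvForm_smul_left, curvForm_smul_right, curvForm_neg_right,
      curvForm_comm hR Y X, curvForm_comm hR Z X, curvForm_comm hR Z Y, map_neg, map_pow, conj_ofReal]
    push_cast
    ring
  have hTp : ∀ (a b : ℂ), IsT10 K (a • p + b • q) := fun a b => by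
    rw [IsT10, mulVec_add, mulVec_smul, mulVec_smul, hp, hq, smul_add, smul_comm a, smul_comm b]
  have hnn : ∀ t : ℝ, 0 ≤ Herm R X + t ^ 2 * (ℛ R Y Y + 2 * ℛ R X Z).re + (t ^ 2) ^ 2 * Herm R Z := fun t => by
    rw [← hf]
    refine h _ _ ?_ ?_
    · have := hTp 1 t; rwa [one_smul] at this
    · have := hTp 1 (-t); rwa [one_smul, neg_smul, ← sub_eq_add_neg] at this
  have h1 := hf 1
  rw [ofReal_one, one_smul, h0] at h1
  rw [bF_pr_pr hR, bF_pr_pr hR, ← hX, ← hZ]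
  set a := Herm R X
  set b := Herm R Z
  have hb : 0 ≤ b := h q q hq hq
  by_contra hab
  push Not at hab
  set δ := (a - b) / (2 * (b + 1)) with hδ
  have hδ0 : 0 < δ := div_pos (by linarith) (by linarith)
  have hδb : δ * (2 * (b + 1)) = a - b := div_mul_cancel₀ _ (by positivity)
  have h2 := hnn √(1 + δ)
  rw [sq_sqrt (by linarith)] at h2
  nlinarith

lemma bF_smul_right (hR : IsAlg R) (c : ℝ) (N N' : Mℂ n) : bF R N ((c : ℂ) • N') = c * bF R N N' := by
  rw [bF_comm hR, bF_smul_left, bF_comm hR]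

lemma bF_add_right (hR : IsAlg R) (N N₁ N₂ : Mℂ n) : bF R N (N₁ + N₂) = bF R N N₁ + bF R N N₂ := by
  rw [bF_comm hR, bF_add_left, bF_comm hR, bF_comm hR N₂]

lemma pr_mul_self (x : Vℂ n) : pr x * pr x = ((∑ i, ‖x i‖ ^ 2 : ℝ) : ℂ) • pr x := by rw [pr_mul_pr, star_dot_self, pr]

lemma inv_smul_pr_mul_self (x : Vℂ n) {c : ℝ} (hc : c = ∑ i, ‖x i‖ ^ 2) : ((c⁻¹ : ℝ) : ℂ) • pr x * ((c⁻¹ : ℝ) : ℂ) • pr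
    x = ((c⁻¹ : ℝ) : ℂ) • pr x := by
  rw [Matrix.smul_mul, Matrix.mul_smul, pr_mul_self, ← hc, smul_smul, smul_smul]
  congr 1
  by_cases h : c = 0
  · simp [h]
  · rw [← ofReal_mul, ← ofReal_mul]
    congr 1
    field_simp

lemma two_term_ineq {P Q a b c c₁ c₂ c₃ : ℝ} (hPQ : Q ≤ P) (hQ : 0 < Q) (ha : 0 ≤ a) (hc : 0 ≤ c) (h₁ : 0 ≤ c₁) (h₂ : 0
    ≤ c₂) (h₃ : 0 ≤ c₃) (hle : a ≤ b) : (P + Q) * (P⁻¹ * a + Q⁻¹ * c + c₁ + (P⁻¹ * c + Q⁻¹ * b + c₂)) ≤ (P ^ 2 + Q ^ 2)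
      * (P⁻¹ * (P⁻¹ * a + Q⁻¹ * c + c₁) + Q⁻¹ * (P⁻¹ * c + Q⁻¹ * b + c₂) + (P⁻¹ * c₁ + Q⁻¹ * c₂ + c₃)) := by
  have hP := hQ.trans_le hPQ
  rw [← sub_nonneg]
  have e : (P ^ 2 + Q ^ 2) * (P⁻¹ * (P⁻¹ * a + Q⁻¹ * c + c₁) + Q⁻¹ * (P⁻¹ * c + Q⁻¹ * b + c₂) + (P⁻¹ * c₁ + Q⁻¹ * c₂ +
      c₃)) - (P + Q) * (P⁻¹ * a + Q⁻¹ * c + c₁ + (P⁻¹ * c + Q⁻¹ * b + c₂)) = ((P - Q) * (b * (P ^ 3 - Q ^ 3) + (b - a) *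
      Q ^ 3) + P * Q * (P - Q) ^ 2 * c + P * Q ^ 2 * ((P - Q) ^ 2 + P * Q + Q ^ 2) * c₁ + P ^ 2 * Q * ((P - Q) ^ 2 + P *
        Q + P ^ 2) * c₂ + P ^ 2 * Q ^ 2 * (P ^ 2 + Q ^ 2) * c₃) / (P ^ 2 * Q ^ 2) := by
    field_simp
    ring
  rw [e]
  have h1 : 0 ≤ P - Q := by linarith
  have h3 := sub_nonneg.2 (pow_le_pow_left₀ hQ.le hPQ 3)
  have h4 : 0 ≤ b - a := by linarith
  have h5 : 0 ≤ b := by linarith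
  generalize P - Q = d at *
  generalize P ^ 3 - Q ^ 3 = d₃ at *
  generalize b - a = d' at *
  positivity

lemma bF_projection_ineq (hR : IsAlg R) (hK : Kᵀ = -K) (hK2 : K * K = -1)
    (h : ∀ x y, IsT10 K x → IsT10 K y →
      0 ≤ Herm R (wedge x (star y)))
    {p q : Vℂ n} (hp : IsT10 K p) (hq : IsT10 K q) (hpq : star p ⬝ᵥ q = 0)
    (h0 : Herm R (wedge (p + q) (star (p - q))) = 0)
    {P Q : ℝ} (hP : P = ∑ i, ‖p i‖ ^ 2) (hQ : Q = ∑ i, ‖q i‖ ^ 2) (hPQ : Q ≤ P) (hP0 : 0 < P) :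
    (P + Q) * (bF R (pr p) (pV K) + bF R (pr q) (pV K))
      ≤ (P ^ 2 + Q ^ 2) * bF R (pV K) (pV K) := by
  have hnn : ∀ x y, IsT10 K x → IsT10 K y → 0 ≤ bF R (pr x) (pr y) := fun x y hx hy =>
    by rw [bF_pr_pr hR]; exact h x y hx hy
  set A := ((P⁻¹ : ℝ) : ℂ) • pr p with hA
  set B := ((Q⁻¹ : ℝ) : ℂ) • pr q with hB
  set W := pV K - A - B with hW
  have hAh : Aᴴ = A := by
    rw [hA, conjTranspose_smul, pr_conjTranspose, star_def, conj_ofReal]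
  have hBh : Bᴴ = B := by
    rw [hB, conjTranspose_smul, pr_conjTranspose, star_def, conj_ofReal]
  have hAK : cK K * A = I • A := by rw [hA, Matrix.mul_smul, hp.mul_pr, smul_comm]
  have hBK : cK K * B = I • B := by rw [hB, Matrix.mul_smul, hq.mul_pr, smul_comm]
  have hEh := pV_conjTranspose hK
  have hAE : A * pV K = A := by
    have := congrArg conjTranspose (pV_mul hAK)
    rwa [conjTranspose_mul, hAh, hEh] at this
  have hBE : B * pV K = B := by
    have := congrArg conjTranspose (pV_mul hBK)
    rwa [conjTranspose_mul, hBh, hEh] at this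
  have hAB : A * B = 0 := by
    rw [hA, hB, Matrix.smul_mul, Matrix.mul_smul, pr_mul_pr, hpq]; simp
  have hBA : B * A = 0 := by
    rw [hA, hB, Matrix.smul_mul, Matrix.mul_smul, pr_mul_pr, star_dotProduct_eq_zero hpq]; simp
  have hWW : W * Wᴴ = W := by
    rw [hW, conjTranspose_sub, conjTranspose_sub, hEh, hAh, hBh]
    simp only [sub_mul, mul_sub, pV_mul (cK_mul_pV hK2), pV_mul hAK, pV_mul hBK, hAE,
      hBE, hAB, hBA]
    rw [show A * A = A from inv_smul_pr_mul_self p hP, show B * B = B from inv_smul_pr_mul_self q hQ]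
    abel
  have hWK : cK K * W = I • W := by
    rw [hW, mul_sub, mul_sub, cK_mul_pV hK2, hAK, hBK, smul_sub, smul_sub]
  have hc1 := bF_nonneg_right hR (fun y hy => hnn p y hp hy) hWW hWK
  have hc2 := bF_nonneg_right hR (fun y hy => hnn q y hq hy) hWW hWK
  have hc3 := bF_nonneg_right hR (fun y hy => by
    rw [bF_comm hR]
    exact bF_nonneg_right hR (fun z hz => hnn y z hy hz) hWW hWK) hWW hWK
  have hE : pV K = A + B + W := by rw [hW]; abel
  have e1 : bF R (pr p) (pV K) = P⁻¹ * bF R (pr p) (pr p) + Q⁻¹ * bF R (pr p) (pr q)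
      + bF R (pr p) W := by
    rw [hE, bF_add_right hR, bF_add_right hR, hA, hB, bF_smul_right hR, bF_smul_right hR]
  have e2 : bF R (pr q) (pV K) = P⁻¹ * bF R (pr p) (pr q) + Q⁻¹ * bF R (pr q) (pr q)
      + bF R (pr q) W := by
    rw [hE, bF_add_right hR, bF_add_right hR, hA, hB, bF_smul_right hR, bF_smul_right hR,
      bF_comm hR (pr q) (pr p)]
  have e3 : bF R (pV K) (pV K) = P⁻¹ * bF R (pr p) (pV K) + Q⁻¹ * bF R (pr q) (pV K)
      + (P⁻¹ * bF R (pr p) W + Q⁻¹ * bF R (pr q) W + bF R W W) := by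
    conv_lhs => enter [2]; rw [hE]
    rw [bF_add_left, bF_add_left, hA, hB, bF_smul_left, bF_smul_left, bF_comm hR W]
    congr 1
    rw [hE, bF_add_left, bF_add_left, hA, hB, bF_smul_left, bF_smul_left]
  rw [e3, e1, e2]
  have hQ0 : 0 ≤ Q := by rw [hQ]; positivity
  rcases hQ0.eq_or_lt with hQz | hQp
  · have hz : ∀ N, bF R (pr q) N = 0 := fun N => by
      rw [eq_zero_of_star_dot (x := q)
        (by rw [star_dot_self, ← hQ, ← hQz, ofReal_zero]),
        show pr (0 : Vℂ n) = 0 by ext i j; simp [pr_apply], bF, map_zero]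
      simp
    rw [bF_comm hR (pr p) (pr q), hz, hz, hz, ← hQz]
    generalize bF R (pr p) (pr p) = a at *
    generalize bF R (pr p) W = c₁ at *
    generalize bF R W W = c₃ at *
    rw [← sub_nonneg, show (P ^ 2 + 0 ^ 2) * (P⁻¹ * (P⁻¹ * a + 0⁻¹ * 0 + c₁)
        + 0⁻¹ * (P⁻¹ * 0 + 0⁻¹ * 0 + 0) + (P⁻¹ * c₁ + 0⁻¹ * 0 + c₃))
        - (P + 0) * (P⁻¹ * a + 0⁻¹ * 0 + c₁ + (P⁻¹ * 0 + 0⁻¹ * 0 + 0)) = P * c₁ + P ^ 2 * c₃ by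
      simp only [mul_zero, add_zero]
      field_simp
      ring]
    positivity
  · exact two_term_ineq hPQ hQp (hnn p p hp hp) (hnn p q hp hq) hc1 hc2 hc3 (bF_pr_le hR h hp hq h0)

lemma sum_sq_of_star_dot {a : ℝ} (h : star x ⬝ᵥ x = a) : ∑ i, ‖x i‖ ^ 2 = a := by
  rw [star_dot_self] at h; exact_mod_cast h

lemma trace_ineq_kaehler (hR : IsAlg R) (hRK : SlotInv K R) (hK : Kᵀ = -K) (hK2 : K * K = -1) (h : ∀ x y, IsT10 K x →
    IsT10 K y → 0 ≤ Herm R (wedge x (star y))) (hx : IsT10 K x) (hy : IsT10 K y) (h0 : Herm R (wedge x (star y)) = 0) :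
    TraceIneq R (kaehlerCurv K) (wedge x (star y)) := by
  set X := ∑ i, ‖x i‖ ^ 2 with hX
  set Y := ∑ i, ‖y i‖ ^ 2 with hY
  have hX0 : 0 ≤ X := by positivity
  have hY0 : 0 ≤ Y := by positivity
  have hzero : wedge x (star y) = 0 → TraceIneq R (kaehlerCurv K) (wedge x (star y)) := fun hw => by
    rw [hw, herm_zero]
    simp [ricPair]
  rcases hX0.eq_or_lt with hXz | hXp
  · apply hzero
    rw [eq_zero_of_star_dot (x := x) (by rw [star_dot_self, ← hX, ← hXz]; simp)]
    ext i j; simp [wedge_apply]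
  rcases hY0.eq_or_lt with hYz | hYp
  · apply hzero
    rw [eq_zero_of_star_dot (x := y) (by rw [star_dot_self, ← hY, ← hYz]; simp)]
    ext i j; simp [wedge_apply]
  clear hzero
  obtain ⟨θ, hθ, hθ'⟩ := exists_phase (conj (star x ⬝ᵥ y))
  have hθn : conj θ * θ = 1 := hθ
  set c : ℂ := (√Y : ℂ) * (θ * θ) with hc
  set d : ℂ := (√X : ℂ) with hd
  have sX : (√X : ℂ) * (√X : ℂ) = X := by rw [← ofReal_mul, mul_self_sqrt hX0]
  have sY : (√Y : ℂ) * (√Y : ℂ) = Y := by rw [← ofReal_mul, mul_self_sqrt hY0]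
  have hXz : (√X : ℂ) ≠ 0 := ofReal_ne_zero.2 (sqrt_pos.2 hXp).ne'
  have hYz : (√Y : ℂ) ≠ 0 := ofReal_ne_zero.2 (sqrt_pos.2 hYp).ne'
  have hθz : θ ≠ 0 := by rintro rfl; simp at hθn
  set α := c • x with hα
  set β := d • y with hβ
  have hαT : IsT10 K α := by rw [IsT10, hα, mulVec_smul, hx, smul_comm]
  have hβT : IsT10 K β := by rw [IsT10, hβ, mulVec_smul, hy, smul_comm]
  have hxx : star x ⬝ᵥ x = (X : ℂ) := star_dot_self x
  have hyy : star y ⬝ᵥ y = (Y : ℂ) := star_dot_self y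
  have hcc : star c * c = (Y : ℂ) := by
    simp only [hc, star_def, map_mul, conj_ofReal]
    linear_combination (conj θ * θ) ^ 2 * sY + Y * (conj θ * θ + 1) * hθn
  have hαα : star α ⬝ᵥ α = ((X * Y : ℝ) : ℂ) := by
    rw [hα, star_smul, smul_dotProduct, dotProduct_smul, hxx, smul_eq_mul, smul_eq_mul]
    push_cast
    linear_combination X * hcc
  have hββ : star β ⬝ᵥ β = ((X * Y : ℝ) : ℂ) := by
    rw [hβ, star_smul, smul_dotProduct, dotProduct_smul, hyy, smul_eq_mul, smul_eq_mul, hd, star_def, conj_ofReal]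
    push_cast
    linear_combination Y * sX
  obtain ⟨s, hs0, hs⟩ : ∃ s : ℝ, 0 ≤ s ∧ star α ⬝ᵥ β = s := by
    refine ⟨√X * √Y * ‖conj (star x ⬝ᵥ y)‖, by positivity, ?_⟩
    have h1 := congrArg conj hθ'
    rw [map_mul, map_mul, conj_ofReal, Complex.conj_conj] at h1
    rw [hα, hβ, star_smul, smul_dotProduct, dotProduct_smul, smul_eq_mul, smul_eq_mul, hc, hd]
    simp only [star_def, map_mul, conj_ofReal]
    push_cast
    linear_combination (√X : ℂ) * (√Y : ℂ) * h1
  have hs' : star β ⬝ᵥ α = s := by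
    have := congrArg star hs
    rw [star_dotProduct, star_star] at this
    rw [this, star_def, conj_ofReal]
  set p := (1 / 2 : ℂ) • (α + β) with hp
  set q := (1 / 2 : ℂ) • (α - β) with hq
  have hpT : IsT10 K p := by rw [IsT10, hp, mulVec_smul, mulVec_add, hαT, hβT, ← smul_add, smul_comm]
  have hqT : IsT10 K q := by rw [IsT10, hq, mulVec_smul, mulVec_sub, hαT, hβT, ← smul_sub, smul_comm]
  have hpα : p + q = α := by rw [hp, hq]; module
  have hpβ : p - q = β := by rw [hp, hq]; module
  have hst : star (1 / 2 : ℂ) = 1 / 2 := by simp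
  have hpq : star p ⬝ᵥ q = 0 := by
    rw [hp, hq, star_smul, star_add, smul_dotProduct, dotProduct_smul, add_dotProduct, dotProduct_sub, dotProduct_sub,
      hαα, hββ, hs, hs']
    simp
  have hPP : ∑ i, ‖p i‖ ^ 2 = (X * Y + s) / 2 := by
    have e : star p ⬝ᵥ p = (((X * Y + s) / 2 : ℝ) : ℂ) := by
      rw [hp, star_smul, star_add, smul_dotProduct, dotProduct_smul, add_dotProduct, dotProduct_add, dotProduct_add,
        hαα, hββ, hs, hs', hst, smul_eq_mul, smul_eq_mul]
      push_cast
      ring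
    exact sum_sq_of_star_dot e
  have hQQ : ∑ i, ‖q i‖ ^ 2 = (X * Y - s) / 2 := by
    have e : star q ⬝ᵥ q = (((X * Y - s) / 2 : ℝ) : ℂ) := by
      rw [hq, star_smul, star_sub, smul_dotProduct, dotProduct_smul, sub_dotProduct, dotProduct_sub, dotProduct_sub,
        hαα, hββ, hs, hs', hst, smul_eq_mul, smul_eq_mul]
      push_cast
      ring
    exact sum_sq_of_star_dot e
  have hwe : wedge α (star β) = (c * d) • wedge x (star y) := by
    ext i j
    simp only [wedge_apply, hα, hβ, hd, Pi.smul_apply, Pi.star_apply, smul_eq_mul, Matrix.smul_apply, star_def, map_mul,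
      conj_ofReal]
    ring
  have hcd : c * d ≠ 0 := mul_ne_zero (mul_ne_zero hYz (mul_ne_zero hθz hθz)) hXz
  have hXY : 0 < X * Y := mul_pos hXp hYp
  have hαβ : star α ⬝ᵥ star β = 0 := by rw [star_dotProduct_star, hβT.dotProduct_eq_zero hK hαT, star_zero]
  have hprs : bF R (pr α) (pV K) + bF R (pr β) (pV K) = 2 * (bF R (pr p) (pV K) + bF R (pr q) (pV K)) := by
    rw [← bF_add_left, ← bF_add_left, ← hpα, ← hpβ, pr_add_pr_sub]
    have := bF_smul_left (R := R) 2 (pr p + pr q) (pV K)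
    push_cast at this
    exact this
  have main : TraceIneq R (kaehlerCurv K) (wedge α (star β)) := by
    have hnα : ∑ i, ‖α i‖ ^ 2 = X * Y := sum_sq_of_star_dot hαα
    have hnβ : ∑ i, ‖β i‖ ^ 2 = X * Y := sum_sq_of_star_dot hββ
    rw [wedge_mul_conjTranspose' hαβ, star_star, dotProduct_comm β, hββ, hαα, ricPair_add, ricPair_smul, ricPair_smul,
      add_re, re_ofReal_mul, re_ofReal_mul, ricPair_pr hRK hK2 hαT, ricPair_pr_star hRK hK2 hβT, ← mul_add, hprs,
      herm_kaehlerCurv_wedge hK hK2 hαT hβT, hnα, hnβ, hs, norm_real, norm_eq_abs, sq_abs, scal_eq_bF hR hRK hK2]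
    nlinarith [bF_projection_ineq hR hK hK2 h hpT hqT hpq (by rw [hpα, hpβ, hwe, herm_smul, h0, mul_zero]) hPP.symm hQQ.symm (by linarith) (by linarith)]
  rw [hwe] at main
  have h2 := trace_ineq_smul (c * d)⁻¹ main
  rwa [smul_smul, inv_mul_cancel₀ hcd, one_smul] at h2

section ConeDatum

lemma herm_add_mul (R I₀ : Tℝ n) (α : ℝ) (v : Mℂ n) : Herm (fun i j k l => R i j k l + α * I₀ i j k l) v = Herm R v + α
      * Herm I₀ v := by rw [herm, curvForm_add_mul, add_re, re_ofReal_mul, herm, herm]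

/-- A set `S` of skew matrices defining a curvature condition, with the model tensor `I₀`, for
which the reaction estimate holds for all curvature tensors compatible with the matrices in `𝒦`. -/
structure ConeDatum (S : Set Mℂ n) (I₀ : Tℝ n) (𝒦 : Set Mℝ n) (C : ℝ) : Prop where
  base : ∀ v ∈ S, ∑ i, ∑ j, ‖v i j‖ ^ 2 ≤ 2 * Herm I₀ v
  cpt : ∃ Q, IsCompact Q ∧ Q ⊆ S ∧ (0 : Mℂ n) ∉ Q ∧ ∀ v ∈ S, v = 0 ∨ ∃ c : ℂ, ∃ u ∈ Q, v = c • u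
  react : ∀ R, IsAlg R → (∀ K ∈ 𝒦, SlotInv K R) → ∀ ℓ : ℝ, 0 ≤ ℓ → (∀ v ∈ S, 0 ≤ Herm (fun i j k l => R i j k l + ℓ * I₀
    i j k l) v) → ∀ v ∈ S, Herm (fun i j k l => R i j k l + ℓ * I₀ i j k l) v = 0 → ∀ Z : Mℝ n, Zᵀ = -Z → (∀ K ∈ 𝒦, Z *
    K = K * Z) → Herm (slot Z R) v = 0 ∧ -Herm (quad R) v ≤ (scal R * ℓ + C * ℓ ^ 2) * Herm I₀ v

/-- The coefficients making a curvature tensor satisfy the curvature condition. -/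
def levelSet (S : Set Mℂ n) (I₀ R : Tℝ n) : Set ℝ := {α | 0 ≤ α ∧ ∀ v ∈ S, 0 ≤ Herm (fun i j k l => R i j k l + α * I₀ i
  j k l) v}

lemma abs_herm_le (R : Tℝ n) (v : Mℂ n) : 2 * |Herm R v| ≤ (∑ i, ∑ j, ∑ k, ∑ l, |R i j k l|) * ∑ i, ∑ j, ‖v i j‖ ^ 2 :=
      by
  set N := ∑ i, ∑ j, ‖v i j‖ ^ 2 with hN
  have hle : ∀ i j, ‖v i j‖ ^ 2 ≤ N := fun i j => (single_le_sum (f := fun j => ‖v i j‖ ^ 2) (fun _ _ => by positivity)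
      (Finset.mem_univ j)).trans (single_le_sum (f := fun i => ∑ j, ‖v i j‖ ^ 2)
        (fun _ _ => by positivity) (Finset.mem_univ i))
  have h1 : ‖∑ i, ∑ j, ∑ k, ∑ l, (R i j k l : ℂ) * v i j * v.map conj k l‖ ≤ (∑ i, ∑ j, ∑ k, ∑ l, |R i j k l|) * N := by
    simp only [sum_mul]
    refine norm_sum_le_of_le _ fun i _ => norm_sum_le_of_le _ fun j _ => norm_sum_le_of_le _ fun k _ =>
      norm_sum_le_of_le _ fun l _ => ?_
    rw [norm_mul, norm_mul, map_apply, RCLike.norm_conj, norm_real, norm_eq_abs, mul_assoc]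
    refine mul_le_mul_of_nonneg_left ?_ (abs_nonneg _)
    nlinarith [hle i j, hle k l, sq_nonneg (‖v i j‖ - ‖v k l‖)]
  have h2 := Complex.abs_re_le_norm (ℛ R v (v.map conj))
  rw [curvForm, norm_mul, show ‖(1 / 4 : ℂ)‖ = 1 / 4 by norm_num] at h2
  rw [herm]
  have h3 : 0 ≤ (∑ i, ∑ j, ∑ k, ∑ l, |R i j k l|) * N := by positivity
  rw [curvForm]
  linarith

variable {S : Set Mℂ n} {I₀ : Tℝ n} {𝒦 : Set Mℝ n} {C : ℝ} (hD : ConeDatum S I₀ 𝒦 C)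
include hD

lemma ConeDatum.model_nonneg (hv : v ∈ S) : 0 ≤ Herm I₀ v := by
  have := hD.base v hv
  have h2 : 0 ≤ ∑ i, ∑ j, ‖v i j‖ ^ 2 := by positivity
  linarith

lemma ConeDatum.abs_le (R : Tℝ n) (hv : v ∈ S) : |Herm R v| ≤ (∑ i, ∑ j, ∑ k, ∑ l, |R i j k l|) * Herm I₀ v := by
  have h := mul_le_mul_of_nonneg_left (hD.base v hv) (show 0 ≤ ∑ i, ∑ j, ∑ k, ∑ l, |R i j k l| by positivity)
  linarith [abs_herm_le R v]

lemma ConeDatum.isLeast (R : Tℝ n) : IsLeast (levelSet S I₀ R) (sInf (levelSet S I₀ R)) := by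
  have hb : BddBelow (levelSet S I₀ R) := ⟨0, fun α h => h.1⟩
  have hc : IsClosed (levelSet S I₀ R) := by
    have : levelSet S I₀ R = Ici 0 ∩ ⋂ v ∈ S, {α | 0 ≤ Herm R v + α * Herm I₀ v} := by
      ext α
      simp [levelSet, herm_add_mul]
    rw [this]
    exact isClosed_Ici.inter (isClosed_biInter fun v _ => isClosed_le continuous_const (by fun_prop))
  refine ⟨hc.csInf_mem ⟨∑ i, ∑ j, ∑ k, ∑ l, |R i j k l|, by positivity, fun v hv => ?_⟩ hb, fun α h => csInf_le hb h⟩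
  rw [herm_add_mul]
  linarith [neg_le_of_abs_le (hD.abs_le R hv)]

lemma ConeDatum.level_le {R R' : Tℝ n} {ℓ ℓ' : ℝ} (h : IsLeast (levelSet S I₀ R) ℓ) (h' : IsLeast (levelSet S I₀ R') ℓ')
    : ℓ' ≤ ℓ + ∑ i, ∑ j, ∑ k, ∑ l, |R' i j k l - R i j k l| := by
  refine h'.2 ⟨add_nonneg h.1.1 (by positivity), fun v hv => ?_⟩
  have h1 := h.1.2 v hv
  have h2 := neg_le_of_abs_le (hD.abs_le (fun i j k l => R' i j k l - R i j k l) hv)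
  have h3 := herm_add_mul R' R (-1) v
  simp only [neg_mul, one_mul, ← sub_eq_add_neg] at h3
  rw [h3] at h2
  rw [herm_add_mul] at h1 ⊢
  linarith

lemma ConeDatum.exists_null {ℓ : ℝ}
    (h : IsLeast (levelSet S I₀ R) ℓ) (hℓ : 0 < ℓ) : ∃ v ∈ S, 0 < Herm I₀ v ∧
      Herm (fun i j k l => R i j k l + ℓ * I₀ i j k l) v = 0 := by
  obtain ⟨Q, hQ, hQS, hQ0, hQc⟩ := hD.cpt
  have hpos : ∀ v ∈ Q, 0 < Herm I₀ v := fun v hv => by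
    refine (hD.model_nonneg (hQS hv)).lt_of_ne fun h0 => hQ0 ?_
    have h1 := hD.base v (hQS hv)
    rw [← h0, mul_zero] at h1
    have : v = 0 := by
      ext i j
      have h2 := (single_le_sum (f := fun j => ‖v i j‖ ^ 2) (fun _ _ => by positivity)
        (Finset.mem_univ j)).trans (single_le_sum (f := fun i => ∑ j, ‖v i j‖ ^ 2)
        (fun _ _ => by positivity) (Finset.mem_univ i))
      have h3 : ‖v i j‖ ^ 2 = 0 := le_antisymm (h2.trans h1) (by positivity)
      simpa using h3
    rwa [← this]
  have hcont : ∀ T : Tℝ n, Continuous fun v => Herm T v :=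
    fun T => by
      unfold herm curvForm
      simp only [map_apply]
      fun_prop
  have hlift : ∀ α : ℝ, 0 ≤ α →
      (∀ u ∈ Q, 0 ≤ Herm (fun i j k l => R i j k l + α * I₀ i j k l) u) →
      α ∈ levelSet S I₀ R := fun α hα hu => ⟨hα, fun v hv => by
    rcases hQc v hv with rfl | ⟨c, u, huQ, rfl⟩
    · rw [herm_zero]
    · rw [herm_smul]
      exact mul_nonneg (by positivity) (hu u huQ)⟩
  rcases Q.eq_empty_or_nonempty with hE | hne
  · exact absurd (h.2 (hlift 0 le_rfl (by simp [hE]))) hℓ.not_ge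
  obtain ⟨u, hu, hmax⟩ := hQ.exists_isMaxOn hne
   
    ((hcont R).neg.continuousOn.div (hcont I₀).continuousOn fun v hv => (hpos v hv).ne')
  have hm : ∀ v ∈ Q, -Herm R v ≤ (-Herm R u / Herm I₀ u) * Herm I₀ v :=
    fun v hv => (div_le_iff₀ (hpos v hv)).1 (hmax hv)
  have h1 : ℓ ≤ max 0 (-Herm R u / Herm I₀ u) :=
    h.2 (hlift _ (le_max_left _ _) fun v hv => by
      rw [herm_add_mul]
      have := mul_le_mul_of_nonneg_right (le_max_right 0 (-Herm R u / Herm I₀ u))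
        (hpos v hv).le
      linarith [hm v hv])
  have h2 :=
    (le_max_iff.1 h1).resolve_left hℓ.not_ge
  rw [le_div_iff₀ (hpos u hu)] at h2
  refine ⟨u, hQS hu, hpos u hu, le_antisymm ?_ (h.1.2 u (hQS hu))⟩
  rw [herm_add_mul]
  linarith

end ConeDatum

lemma exp_neg_mul_exp (w : Mℂ n) (s : ℝ) : NormedSpace.exp (-(s • w)) * NormedSpace.exp (s • w) = 1 := mul_eq_one_comm.1
  (exp_mul_exp_neg w s)

lemma exp_transpose_of_skew (hw : wᵀ = -w) (s : ℝ) : (NormedSpace.exp (s • w))ᵀ = NormedSpace.exp (-(s • w)) := by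
  rw [← exp_transpose, transpose_smul, hw, smul_neg]

lemma CurvCondition.skew {c : CurvCondition} (hv : v ∈ c.gen n) : vᵀ = -v := by
  rw [← mem_so]
  cases c
  exacts [hv, hv.1, hv.1, hv.1, hv.1]

lemma CurvCondition.conj_mem {c : CurvCondition} {A v : Mℂ n} (hA : Aᵀ * A = 1) (hv : v ∈ c.gen n) : A * v * Aᵀ ∈ c.gen
    n := by
  have hA' : A * Aᵀ = 1 := mul_eq_one_comm.1 hA
  have h : A * v * Aᵀ ∈ LieAlgebra.Orthogonal.so (Fin n) ℂ := by rw [mem_so, transpose_mul, transpose_mul,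
      CurvCondition.skew hv, transpose_transpose, neg_mul, mul_neg, mul_assoc]
  have hp : ∀ k, (A * v * Aᵀ) ^ k = A * v ^ k * Aᵀ := fun k => by
    induction k with
    | zero => rw [pow_zero, pow_zero, mul_one, hA']
    | succ k ih =>
      rw [pow_succ, pow_succ, ih]
      simp only [mul_assoc]
      rw [← mul_assoc Aᵀ A, hA, one_mul]
  have hr : (A * v * Aᵀ).rank = v.rank := by
    have h1 := (isUnit_iff_isUnit_det _).1 (IsUnit.of_mul_eq_one _ hA')
    rw [rank_mul_eq_left_of_isUnit_det _ _ (by rwa [det_transpose]), rank_mul_eq_right_of_isUnit_det _ _ h1]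
  cases c
  · exact h
  · refine ⟨h, ?_⟩
    rw [hp, trace_mul_cycle, hA, one_mul, hv.2]
  · exact ⟨h, hr.trans hv.2.1, by rw [hp, hv.2.2, mul_zero, zero_mul]⟩
  · exact ⟨h, hr.trans hv.2.1, by rw [hp, hv.2.2, mul_zero, zero_mul]⟩
  · exact ⟨h, hr.trans hv.2⟩

lemma CurvCondition.conjExp_mem {c : CurvCondition} (hw : wᵀ = -w) (hv : v ∈ c.gen n) (s : ℝ) : conjExp w v s ∈ c.gen n
    := by
  rw [conjExp, ← exp_transpose_of_skew hw]
  exact conj_mem (by rw [exp_transpose_of_skew hw, exp_neg_mul_exp]) hv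

lemma CurvCondition.trace_ineq (c : CurvCondition) (hc : c = pic → n ≠ 6) (hR : IsAlg R) (h : ∀ v ∈ c.gen n, 0 ≤ Herm R
    v) (hv : v ∈ c.gen n) (h0 : Herm R v = 0) (hB : ∀ w : Mℂ n, wᵀ = -w → 0 ≤ Herm R (w * v - v * w)) : TraceIneq R 𝕊 n
    v := by
  cases c
  exacts [trace_ineq_nonneg hR h hv h0, trace_ineq_twoNonneg hR h hv h0, trace_ineq_pic (hc rfl) hR h hv h0 hB,
    trace_ineq_picOne hR h hv h0, trace_ineq_picTwo hR h hv h0]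

lemma IsAlgCurvature.add_mul {R T : Tℝ n} (hR : IsAlg R) (hT : IsAlg T) (α : ℝ) : IsAlg fun i j k l => R i j k l + α * T
    i j k l where
  antisymm i j k l := by rw [hR.antisymm, hT.antisymm]; ring
  pair_symm i j k l := by rw [hR.pair_symm, hT.pair_symm]
  bianchi i j k l := by linear_combination hR.bianchi i j k l + α * hT.bianchi i j k l

lemma slot_add_mul (Z : Mℝ n) (R T : Tℝ n) (α : ℝ) (hT : ∀ i j k l, slot Z T i j k l = 0) : slot Z (fun i j k l => R i j
    k l + α * T i j k l) = slot Z R := by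
  funext i j k l
  have : slot Z (fun i j k l => R i j k l + α * T i j k l) i j k l = slot Z R i j k l + α * slot Z T i j k l := by
    simp only [slot, mul_sum, ← sum_add_distrib]
    exact sum_ext fun q => by ring
  rw [this, hT i j k l, mul_zero, add_zero]

lemma ricPair_self_nonneg {T : Tℝ n} {a : ℝ} (ha : 0 ≤ a) (h : ricci T = a • 1) (v : Mℂ n) : 0 ≤ (ricPair T (v * vᴴ)).re
    := by
  rw [ricPair_of_smul_one h, trace_mul_conjTranspose, re_ofReal_mul, ofReal_re]
  positivity

lemma isCompact_unit_pairs : IsCompact {p : (Vℂ n) × (Vℂ n) | star p.1 ⬝ᵥ p.1 = 1 ∧ star p.2 ⬝ᵥ p.2 = 1} := by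
  refine ((isCompact_closedBall (0 : Vℂ n) 1).prod (isCompact_closedBall (0 : Vℂ n) 1)).of_isClosed_subset ?_ ?_
  · exact (isClosed_eq (by fun_prop) continuous_const).inter (isClosed_eq (by fun_prop) continuous_const)
  · have key : ∀ x : Vℂ n, star x ⬝ᵥ x = 1 → x ∈ Metric.closedBall (0 : Vℂ n) 1 := by
      intro x hx
      rw [star_dot_self, ofReal_eq_one] at hx
      rw [mem_closedBall_zero_iff, pi_norm_le_iff_of_nonneg zero_le_one]
      intro i
      have := single_le_sum (f := fun i => ‖x i‖ ^ 2) (fun _ _ => by positivity) (Finset.mem_univ i)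
      rw [hx] at this
      exact (sq_le_one_iff₀ (norm_nonneg _)).1 this
    exact fun p hp => ⟨key _ hp.1, key _ hp.2⟩

lemma continuous_wedge : Continuous fun p : (Vℂ n) × (Vℂ n) => wedge p.1 p.2 := by
  unfold wedge
  fun_prop

lemma exists_compact_of_rank_two {P : Mℂ n → Prop} (hP : IsClosed {v | P v}) (hs : ∀ (c : ℂ) v, P v → P (c • v)) : ∃ Q,
    IsCompact Q ∧ Q ⊆ {v | vᵀ = -v ∧ v.rank = 2 ∧ P v} ∧ (0 : Mℂ n) ∉ Q ∧ ∀ v, vᵀ = -v → v.rank = 2 → P v → ∃ c : ℂ, ∃ u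
      ∈ Q, v = c • u := by
  have hr : ∀ x y : Vℂ n, star x ⬝ᵥ x = 1 → star y ⬝ᵥ y = 1 → star x ⬝ᵥ y = 0 → (wedge x y).rank = 2 := fun x y hx hy
      hxy =>
    rank_wedge (by rw [hx]; exact one_ne_zero) (by rw [hy]; exact one_ne_zero) hxy
  refine ⟨(fun p : (Vℂ n) × (Vℂ n) => wedge p.1 p.2) '' ({p | star p.1 ⬝ᵥ p.1 = 1 ∧ star p.2 ⬝ᵥ p.2 = 1} ∩ ({p | star
    p.1 ⬝ᵥ p.2 = 0} ∩ {p | P (wedge p.1 p.2)})), ?_, ?_, ?_, ?_⟩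
  · exact (isCompact_unit_pairs.inter_right ((isClosed_eq (by fun_prop) continuous_const).inter (hP.preimage
      continuous_wedge))).image continuous_wedge
  · rintro _ ⟨p, ⟨h1, h2, h3⟩, rfl⟩
    exact ⟨wedge_transpose _ _, hr _ _ h1.1 h1.2 h2, h3⟩
  · rintro ⟨p, ⟨h1, h2, -⟩, h0⟩
    have := hr _ _ h1.1 h1.2 h2
    rw [show wedge p.1 p.2 = 0 from h0, rank_zero] at this
    omega
  · intro v hv hv2 hPv
    obtain ⟨c, x, y, hx, hy, hxy, rfl⟩ := exists_wedge_of_rank_two hv hv2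
    refine ⟨c, _, ⟨(x, y), ⟨⟨hx, hy⟩, hxy, ?_⟩, rfl⟩, rfl⟩
    have hc : c ≠ 0 := by
      rintro rfl
      rw [zero_smul, rank_zero] at hv2
      omega
    have := hs c⁻¹ _ hPv
    rwa [smul_smul, inv_mul_cancel₀ hc, one_smul] at this

lemma exists_compact_of_isClosed {S : Set Mℂ n} (hS : IsClosed S) (hs : ∀ (c : ℂ), ∀ v ∈ S, c • v ∈ S) : ∃ Q, IsCompact
    Q ∧ Q ⊆ S ∧ (0 : Mℂ n) ∉ Q ∧ ∀ v ∈ S, v = 0 ∨ ∃ c : ℂ, ∃ u ∈ Q, v = c • u := by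
  refine ⟨S ∩ {v | ∑ i, ∑ j, ‖v i j‖ ^ 2 = 1}, ?_, inter_subset_left, ?_, ?_⟩
  · refine IsCompact.of_isClosed_subset (s := {v : Mℂ n | v ∈ Set.pi univ fun _ => Set.pi univ fun _ =>
      Metric.closedBall (0 : ℂ) 1}) (isCompact_univ_pi fun _ => isCompact_univ_pi fun _ => isCompact_closedBall _ _)
      (hS.inter (isClosed_eq (by fun_prop) continuous_const)) ?_
    rintro v ⟨-, hv⟩ i - j -
    rw [mem_closedBall_zero_iff, ← sq_le_one_iff₀ (norm_nonneg _), ← show _ = _ from hv]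
    exact (single_le_sum (f := fun j => ‖v i j‖ ^ 2) (fun _ _ => by positivity)
      (Finset.mem_univ j)).trans (single_le_sum (f := fun i => ∑ j, ‖v i j‖ ^ 2)
        (fun _ _ => by positivity) (Finset.mem_univ i))
  · rintro ⟨-, h⟩
    simp at h
  · intro v hv
    by_cases h0 : ∑ i, ∑ j, ‖v i j‖ ^ 2 = 0
    · left
      ext i j
      have h2 := (Finset.sum_eq_zero_iff_of_nonneg fun _ _ => by positivity).1 ((Finset.sum_eq_zero_iff_of_nonneg fun _ _ => by positivity).1 h0 i (Finset.mem_univ i)) j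
        (Finset.mem_univ j)
      simpa using h2
    · right
      set N := ∑ i, ∑ j, ‖v i j‖ ^ 2 with hN
      have hN0 := lt_of_le_of_ne (by positivity) (Ne.symm h0)
      have hsq := (sqrt_pos.2 hN0).ne'
      refine ⟨(√N : ℂ), ((√N)⁻¹ : ℂ) • v, ⟨hs _ _ hv, ?_⟩, ?_⟩
      · simp only [mem_ofPred_eq, Matrix.smul_apply, norm_smul, mul_pow, ← mul_sum, norm_inv, norm_real, norm_eq_abs,
          sq_abs, inv_pow, sq_sqrt hN0.le]
        exact inv_mul_cancel₀ h0
      · rw [smul_smul, mul_inv_cancel₀ (ofReal_ne_zero.2 hsq), one_smul]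

lemma isClosed_skew : IsClosed {v : Mℂ n | vᵀ = -v} := isClosed_eq (by fun_prop) (by fun_prop)

lemma skew_smul (c : ℂ) (hv : vᵀ = -v) : (c • v)ᵀ = -(c • v) := by rw [transpose_smul, hv, smul_neg]

lemma CurvCondition.exists_compact (c : CurvCondition) (n : ℕ) : ∃ Q, IsCompact Q ∧ Q ⊆ c.gen n ∧ (0 : Mℂ n) ∉ Q ∧ ∀ v ∈
      c.gen n, v = 0 ∨ ∃ a : ℂ, ∃ u ∈ Q, v = a • u := by
  have hpow : ∀ k, IsClosed {v : Mℂ n | v ^ k = 0} := fun k => isClosed_eq (by fun_prop) continuous_const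
  have hpow' : ∀ (k : ℕ) (a : ℂ) (v : Mℂ n), v ^ k = 0 → (a • v) ^ k = 0 :=
    fun k a v hv => by rw [smul_pow, hv, smul_zero]
  cases c
  · simp only [CurvCondition.gen, mem_so]
    exact exists_compact_of_isClosed isClosed_skew fun a v hv => skew_smul a hv
  · simp only [CurvCondition.gen, mem_so]
    refine exists_compact_of_isClosed (isClosed_skew.inter (isClosed_eq (by fun_prop) continuous_const)) fun a v hv =>
      ⟨skew_smul a hv.1, ?_⟩
    rw [smul_pow, trace_smul, show (v ^ 2).trace = 0 from hv.2, smul_zero]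
  · obtain ⟨Q, h1, h2, h3, h4⟩ := exists_compact_of_rank_two (hpow 2) (hpow' 2)
    simp only [CurvCondition.gen, mem_so]
    exact ⟨Q, h1, h2, h3, fun v hv => Or.inr (h4 v hv.1 hv.2.1 hv.2.2)⟩
  · obtain ⟨Q, h1, h2, h3, h4⟩ := exists_compact_of_rank_two (hpow 3) (hpow' 3)
    simp only [CurvCondition.gen, mem_so]
    exact ⟨Q, h1, h2, h3, fun v hv => Or.inr (h4 v hv.1 hv.2.1 hv.2.2)⟩
  · obtain ⟨Q, h1, h2, h3, h4⟩ := exists_compact_of_rank_two isClosed_univ fun _ _ _ => trivial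
    simp only [CurvCondition.gen, mem_so]
    exact ⟨Q, h1, fun v hv => ⟨(h2 hv).1, (h2 hv).2.1⟩, h3, fun v hv => Or.inr (h4 v hv.1 hv.2 trivial)⟩

lemma CurvCondition.coneDatum (c : CurvCondition) (n : ℕ) (hc : c = pic → n ≠ 6) : ConeDatum (c.gen n) 𝕊 n ∅ (scal 𝕊 n +
    2) where
  base v hv := (two_herm_sphere (CurvCondition.skew hv)).ge
  cpt := c.exists_compact n
  react R hR _ ℓ hℓ h v hv h0 Z hZ _ := by
    have hT := hR.add_mul (isAlg_sphere n) ℓ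
    have hI := isAlg_sphere n
    have hv' := CurvCondition.skew hv
    have hZ' : (Z.map ofReal)ᵀ = -Z.map ofReal := by rw [← transpose_map, hZ]; ext i j; simp
    have hB : ∀ w : Mℂ n, wᵀ = -w → 0 ≤ Herm (fun i j k l => R i j k l + ℓ * sphereCurv n i j k l) (w * v - v * w) :=
      fun w hw => second_variation h h0 fun a s => CurvCondition.conjExp_mem (skew_smul a hw) hv s
    constructor
    · have := slot_eq_zero_of_zero h h0 hZ fun s => CurvCondition.conjExp_mem hZ' hv s
      rwa [slot_add_mul Z R _ ℓ (slot_sphereCurv hZ)] at this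
    · refine reaction_bound hR hℓ hv' h0 (herm_hashT_nonneg hT hv' hB) (herm_hashT_sphere hT hv') (herm_hashT_sphere hI
        hv') ?_ (c.trace_ineq hc hT h hv h0 hB)
      rcases Nat.eq_zero_or_pos n with rfl | hn
      · simp [ricPair]
      · exact ricPair_self_nonneg (sub_nonneg.2 (by exact_mod_cast hn)) (ricci_sphereCurv n) v

/-- The matrices `x ∧ ȳ` with `x`, `y` of type `(1,0)`. -/
def kaehlerGen (K : Mℝ n) : Set Mℂ n := {v | ∃ x y, IsT10 K x ∧ IsT10 K y ∧ v = wedge x (star y)}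

lemma IsT10.star_of {z : Vℂ n} (hz : cK K *ᵥ z = -I • z) : IsT10 K (star z) := by
  have h := congrArg star hz
  rw [star_smul, Matrix.star_mulVec, ← Matrix.mulVec_transpose] at h
  have e : (cK K)ᴴᵀ = cK K := by
    ext i j
    simp [cK_apply]
  rw [e] at h
  simpa [IsT10] using h

lemma conjExp_wedge (hw : wᵀ = -w) (x y : Vℂ n) (s : ℝ) : conjExp w (wedge x y) s = wedge (NormedSpace.exp (s • w) *ᵥ x)
      (NormedSpace.exp (s • w) *ᵥ y) := by rw [conjExp, ← exp_transpose_of_skew hw, wedge, mul_sub, sub_mul,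
    mul_vecMulVec, mul_vecMulVec, vecMulVec_mul, vecMulVec_mul, vecMul_transpose, vecMul_transpose, wedge]

open scoped Matrix.Norms.Operator in
lemma conjExp_mem_kaehlerGen (hw : wᵀ = -w) (hc : cK K * w = w * cK K) (hv : v ∈ kaehlerGen K) (s : ℝ) : conjExp w v s ∈
    kaehlerGen K := by
  obtain ⟨x, y, hx, hy, rfl⟩ := hv
  have hcs := ((show Commute (cK K) w from hc).smul_right s).exp_right
  have hm : ∀ {a : ℂ} {z : Vℂ n}, cK K *ᵥ z = a • z → cK K *ᵥ (NormedSpace.exp (s • w) *ᵥ z) = a • (NormedSpace.exp (s •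
      w) *ᵥ z) := by
    intro a z hz
    rw [mulVec_mulVec, hcs.eq, ← mulVec_mulVec, hz, mulVec_smul]
  exact ⟨_, star (NormedSpace.exp (s • w) *ᵥ star y), hm hx,
    IsT10.star_of (hm hy.star_mulVec), by rw [conjExp_wedge hw, star_star]⟩

lemma two_herm_sphere_wedge (hK : Kᵀ = -K) (hx : IsT10 K x) (hy : IsT10 K y) : ∑ i, ∑ j, ‖wedge x (star y) i j‖ ^ 2 = 2
      * ((∑ i, ‖x i‖ ^ 2) * (∑ i, ‖y i‖ ^ 2)) := by
  have hxy : star x ⬝ᵥ star y = 0 := by rw [star_dotProduct_star, hy.dotProduct_eq_zero hK hx, star_zero]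
  have t : ∀ z : Vℂ n, (pr z).trace = star z ⬝ᵥ z := fun z => by rw [pr, trace_vecMulVec, dotProduct_comm]
  have h := trace_mul_conjTranspose (wedge x (star y))
  rw [wedge_mul_conjTranspose' hxy, trace_add, trace_smul, trace_smul, t, t, star_star, dotProduct_comm y,
    star_dot_self, star_dot_self, smul_eq_mul, smul_eq_mul, ← ofReal_mul, ← ofReal_mul, ← ofReal_add,
    Complex.ofReal_inj] at h
  rw [← h]
  ring

lemma kaehlerGen_exists_compact (hK : Kᵀ = -K) : ∃ Q, IsCompact Q ∧ Q ⊆ kaehlerGen K ∧ (0 : Mℂ n) ∉ Q ∧ ∀ v ∈ kaehlerGen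
      K, v = 0 ∨ ∃ a : ℂ, ∃ u ∈ Q, v = a • u := by
  have hcl : ∀ f : (Vℂ n) × (Vℂ n) → Vℂ n, Continuous f → IsClosed {p | IsT10 K (f p)} := fun f hf => isClosed_eq (by
      fun_prop) (by fun_prop)
  refine ⟨(fun p : (Vℂ n) × (Vℂ n) => wedge p.1 (star p.2)) '' ({p | star p.1 ⬝ᵥ p.1 = 1 ∧ star p.2 ⬝ᵥ p.2 = 1} ∩ ({p |
    IsT10 K p.1} ∩ {p | IsT10 K p.2})), ?_, ?_, ?_, ?_⟩
  · exact (isCompact_unit_pairs.inter_right ((hcl _ continuous_fst).inter (hcl _ continuous_snd))).image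
        (continuous_wedge.comp (continuous_fst.prodMk continuous_snd.star))
  · rintro _ ⟨p, ⟨-, h2, h3⟩, rfl⟩
    exact ⟨p.1, p.2, h2, h3, rfl⟩
  · rintro ⟨p, ⟨h1, h2, h3⟩, h0⟩
    have h := two_herm_sphere_wedge hK h2 h3
    rw [mem_ofPred_eq, star_dot_self, star_dot_self, ofReal_eq_one, ofReal_eq_one] at h1
    rw [show wedge p.1 (star p.2) = 0 from h0, h1.1, h1.2] at h
    norm_num at h
  · rintro _ ⟨x, y, hx, hy, rfl⟩
    have hz : ∀ z : Vℂ n, IsT10 K z → z = 0 ∨ ∃ (a : ℂ) (u : Vℂ n), IsT10 K u ∧ star u ⬝ᵥ u = 1 ∧ z = a • u := fun z hz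
        => by
      by_cases h0 : ∑ i, ‖z i‖ ^ 2 = 0
      · left
        apply eq_zero_of_star_dot
        rw [star_dot_self, h0, ofReal_zero]
      · right
        set N := ∑ i, ‖z i‖ ^ 2 with hN
        have hN0 := lt_of_le_of_ne (by positivity) (Ne.symm h0)
        have hsq := ofReal_ne_zero.2 (sqrt_pos.2 hN0).ne'
        refine ⟨(√N : ℂ), (√N : ℂ)⁻¹ • z, ?_, ?_, ?_⟩
        · rw [IsT10, mulVec_smul, hz, smul_comm]
        · rw [star_smul, smul_dotProduct, dotProduct_smul, star_dot_self, ← hN, smul_eq_mul, smul_eq_mul, star_inv₀,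
            star_def, conj_ofReal, show (N : ℂ) = √N * √N by rw [← ofReal_mul, mul_self_sqrt hN0.le]]
          field_simp
        · rw [smul_smul, mul_inv_cancel₀ hsq, one_smul]
    rcases hz x hx with rfl | ⟨a, u, hu, hu1, rfl⟩
    · left; ext i j; simp [wedge_apply]
    rcases hz y hy with rfl | ⟨b, u', hu', hu1', rfl⟩
    · left; ext i j; simp [wedge_apply]
    refine Or.inr ⟨a * star b, _, ⟨(u, u'), ⟨⟨hu1, hu1'⟩, hu, hu'⟩, rfl⟩, ?_⟩
    ext i j
    simp only [wedge_apply, Pi.smul_apply, Pi.star_apply, smul_eq_mul, Matrix.smul_apply, star_mul']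
    ring

lemma SlotInv.add_mul {T : Tℝ n} (hR : SlotInv K R) (hT : SlotInv K T) (α : ℝ) : SlotInv K fun i j k l => R i j k l + α
    * T i j k l := fun a b c d => by
  have h := congrArg₂ (fun s t => s + α * t) (hR a b c d) (hT a b c d)
  simp only [mul_zero, add_zero] at h
  rw [← h, mul_sum, ← sum_add_distrib]
  exact sum_ext fun q => by ring

lemma kaehler_coneDatum (hK : Kᵀ = -K) (hK2 : K * K = -1) : ConeDatum (kaehlerGen K) (kaehlerCurv K) {K} (scal
    (kaehlerCurv K) + 2) where
  base v hv := by
    obtain ⟨x, y, hx, hy, rfl⟩ := hv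
    rw [herm_kaehlerCurv_wedge hK hK2 hx hy, two_herm_sphere_wedge hK hx hy]
    have := sq_nonneg ‖star x ⬝ᵥ y‖
    linarith
  cpt := kaehlerGen_exists_compact hK
  react R hR hRK ℓ hℓ h v hv h0 Z hZ hZK := by
    have hI := isAlg_kaehler hK
    have hIK := kaehlerCurv_slotInvariant hK hK2
    have hT := hR.add_mul hI ℓ
    have hTK := (hRK K rfl).add_mul hIK ℓ
    have hcm : cK K * v = v * cK K := by
      obtain ⟨x, y, hx, hy, rfl⟩ := hv
      exact wedge_commute hK hx hy
    have hv' : vᵀ = -v := by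
      obtain ⟨x, y, -, -, rfl⟩ := hv
      exact wedge_transpose _ _
    have hZ' : (Z.map ofReal)ᵀ = -Z.map ofReal := by rw [← transpose_map, hZ]; ext i j; simp
    have hZc : cK K * Z.map ofReal = Z.map ofReal * cK K := by
      have := congrArg (fun M : Mℝ n => M.map ofRealHom) (hZK K rfl)
      simp only [Matrix.map_mul] at this
      exact this.symm
    have hB : ∀ w : Mℂ n, wᵀ = -w → 0 ≤ Herm (fun i j k l => R i j k l + ℓ * kaehlerCurv K i j k l) (w * v - v * w) :=
      fun w hw => herm_bracket_nonneg hT hTK hK hK2 hcm (fun w hw hwc => second_variation h h0 fun a s =>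
        conjExp_mem_kaehlerGen (skew_smul a hw) (by rw [Matrix.mul_smul, Matrix.smul_mul, hwc]) hv s) hw
    constructor
    · have := slot_eq_zero_of_zero h h0 hZ fun s => conjExp_mem_kaehlerGen hZ' hZc hv s
      rwa [slot_add_mul Z R _ ℓ (slot_kaehlerCurv hZ (hZK K rfl))] at this
    · refine reaction_bound hR hℓ hv' h0 (herm_hashT_nonneg hT hv' hB) (herm_hashT_kaehler hT hTK hK hK2 hv' hcm)
        (herm_hashT_kaehler hI hIK hK hK2 hv' hcm) (ricPair_self_nonneg (by positivity) (ricci_kaehlerCurv hK hK2) v) ?_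
      obtain ⟨x, y, hx, hy, rfl⟩ := hv
      exact trace_ineq_kaehler hT hTK hK hK2 (fun p q hp hq => h _ ⟨p, q, hp, hq, rfl⟩) hx hy h0

lemma sum4_eq_curvForm (R : Tℝ n) (p q r s : Vℂ n) : ∑ i, ∑ j, ∑ k, ∑ l, (R i j k l : ℂ) * p i * q j * r k * s l = 4 * ℛ
      R (vecMulVec p q) (vecMulVec r s) := by
  rw [four_curvForm]
  exact sum4_congr fun i j k l => by simp only [vecMulVec_apply]; ring

lemma bisectional_eq (hR : IsAlg R) (hRK : SlotInv K R) (hK : Kᵀ = -K) (hK2 : K * K = -1) (hx : IsT10 K x) (hy : IsT10 K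
    y) : bisectional R x y = Herm R (wedge x (star y)) := by
  have hu : cK K * vecMulVec (star y) (star x) = -(vecMulVec (star y) (star x) * cK K) := by
    rw [mul_vecMulVec, vecMulVec_mul, hy.star_mulVec, ← mulVec_transpose,
      cK_transpose hK, neg_mulVec, hx.star_mulVec, ← neg_smul, neg_neg, smul_vecMulVec, vecMulVec_smul, neg_smul]
  have h1 := sum4_eq_curvForm R (star y) (star x) x y
  rw [curvForm_eq_zero_of_anticomm hRK hK hK2 hu (vecMulVec x y), mul_zero] at h1
  have rot : ∀ f : Fin n → Fin n → Vℂ n, ∑ b, ∑ c, ∑ a, f a b c = ∑ a, ∑ b, ∑ c, f a b c := fun f => (sum_ext fun b =>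
    sum_comm).trans sum_comm
  have key : ctr R (pr x) (pr (star y)) = -∑ i, ∑ j, ∑ k, ∑ l, (R i j k l : ℂ) * x i * conj (x j) * y k * conj (y l) :=
      by
    have e1 := (rot fun a b c => ∑ d, (R b c a d : ℂ) * star y b * star x c * x a * y d).symm.trans h1
    have e2 := sum_congr (M := ℂ) (s₁ := Finset.univ) rfl fun a _ => rot fun b c d => (R a c d b : ℂ) * x a * conj (x c)
      * y d * conj (y b)
    rw [ctr_apply, ← sub_eq_zero, sub_neg_eq_add, e2, ← neg_eq_zero, ← e1]
    simp only [← sum_add_distrib, ← sum_neg_distrib]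
    refine sum4_congr fun a b c d => ?_
    have hb := congrArg (fun t : ℝ => (t : ℂ)) (hR.bianchi a b c d)
    have ha := congrArg (fun t : ℝ => (t : ℂ)) ((hR.antisymm c a b d).trans (congrArg Neg.neg (hR.antisymm' a c b d)))
    simp only [pr_apply, Pi.star_apply, star_def, Complex.conj_conj]
    push_cast at hb ha ⊢
    linear_combination (-1 : ℂ) * x a * conj (x c) * conj (y b) * y d * (hb - ha)
  rw [bisectional, herm_wedge hR, key, Complex.neg_re]

section Barrier

variable {G : Sℝ n → Mℝ n} {V : Set Sℝ n} {x : Sℝ n}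

/-- The heat operator of a time-dependent metric. -/
def heatST (G : Sℝ n → Mℝ n) (f : Sℝ n → ℝ) (x : Sℝ n) : ℝ := dD (tDir n) f x - laplaceST G f x

lemma dD_sum_const_mul {ι : Type*} [Fintype ι] {f : ι → X → ℝ} {V : Set X} (hV : IsOpen V) (hf : ∀ i, C∞ (f i) V) (c : ι
    → ℝ) (v : X) {y : X} (hy : y ∈ V) : dD v (fun y => ∑ i, c i * f i y) y = ∑ i, c i * dD v (f i) y := by
  have hd := fun i => smooth_diffAt hV (hf i) hy
  rw [dD_sum fun i _ => (hd i).const_mul (c i)]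
  exact sum_ext fun i => dD_const_mul (hd i) _ _

lemma laplaceST_sum_const_mul {ι : Type*} [Fintype ι] {f : ι → Sℝ n → ℝ} (hV : IsOpen V) (hf : ∀ i, C∞ (f i) V) (c : ι →
    ℝ) (hx : x ∈ V) : laplaceST G (fun y => ∑ i, c i * f i y) x = ∑ i, c i * laplaceST G (f i) x := by
  have h2 : ∀ v w, dD v (dD w fun y => ∑ i, c i * f i y) x = ∑ i, c i * dD v (dD w (f i)) x := fun v w => by
      rw [dD_congr hV (fun y hy => dD_sum_const_mul hV hf c w hy) hx,
        dD_sum_const_mul hV (fun i => smooth_dD hV (hf i) w) c v hx]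
  have h3 : ∀ i j, (G x)⁻¹ i j * (∑ a, c a * dD (sDir i) (dD (sDir j) (f a)) x - ∑ k, conn sDir G i x k j * ∑ a, c a *
      dD (sDir k) (f a) x) = ∑ a, c a * ((G x)⁻¹ i j * (dD (sDir i) (dD (sDir j) (f a)) x - ∑ k, conn sDir G i x k j *
        dD (sDir k) (f a) x)) := fun i j => by
    have h4 : ∑ k, conn sDir G i x k j * ∑ a, c a * dD (sDir k) (f a) x = ∑ a, c a * ∑ k, conn sDir G i x k j * dD (sDir
        k) (f a) x := by
      simp only [mul_sum]
      rw [sum_comm]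
      exact sum_ext fun _ => sum_ext fun _ => by ring
    rw [h4, ← sum_sub_distrib, mul_sum]
    exact sum_ext fun _ => by ring
  simp only [laplaceST, h2, dD_sum_const_mul hV hf c _ hx, h3]
  rw [sum_ext fun i => sum_comm, sum_comm]
  simp only [mul_sum]

lemma heatST_sum_const_mul {ι : Type*} [Fintype ι] {f : ι → Sℝ n → ℝ} (hV : IsOpen V) (hf : ∀ i, C∞ (f i) V) (c : ι → ℝ)
    (hx : x ∈ V) : heatST G (fun y => ∑ i, c i * f i y) x = ∑ i, c i * heatST G (f i) x := by
  simp only [heatST, mul_sub, sum_sub_distrib, dD_sum_const_mul hV hf c _ hx, laplaceST_sum_const_mul hV hf c hx]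

lemma herm_eq_sum (R : Tℝ n) (v : Mℂ n) : Herm R v = ∑ p : (Fin n × Fin n) × Fin n × Fin n, (v p.1.1 p.1.2 * conj (v
      p.2.1 p.2.2)).re / 4 * R p.1.1 p.1.2 p.2.1 p.2.2 := by
  have h := congrArg re (four_curvForm R v (v.map conj))
  rw [show (4 : ℂ) = ((4 : ℝ) : ℂ) by norm_num, re_ofReal_mul] at h
  rw [herm, ← mul_right_inj' (four_ne_zero' ℝ), h, mul_sum]
  simp only [sum_prod_type, re_sum, map_apply]
  refine sum4_congr fun i j k l => ?_
  rw [mul_assoc, re_ofReal_mul]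
  ring

lemma heatST_nonpos_of_min {E : Mℝ n} (hV : IsOpen V) (hx : x ∈ V) (hE : (G x)⁻¹ = E * Eᵀ) {f : Sℝ n → ℝ} (hf : C∞ f V)
    (h0 : ∀ y ∈ V, f x ≤ f y) : heatST G f x ≤ 0 := by
  have hmin : IsLocalMin f x := Filter.eventually_of_mem (hV.mem_nhds hx) h0
  have h1 : ∀ v, dD v f x = 0 := fun v => by rw [dD, hmin.fderiv_eq_zero]; rfl
  have h2 : ∀ v, 0 ≤ dD v (dD v f) x := by
    intro v
    have hl : ∀ s : ℝ, HasDerivAt (fun s : ℝ => x + s • v) v s := fun s => by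
      simpa using ((hasDerivAt_id s).smul_const v).const_add x
    have hcont : Continuous fun s : ℝ => x + s • v := by fun_prop
    have hev : ∀ᶠ s in nhds (0 : ℝ), x + s • v ∈ V := hcont.continuousAt.eventually_mem (by simpa using hV.mem_nhds hx)
    have hd : ∀ g : Sℝ n → ℝ, C∞ g V → ∀ s : ℝ, x + s • v ∈ V → HasDerivAt (fun s : ℝ => g (x + s • v)) (dD v g (x + s •
        v)) s := fun g hg s hs => (smooth_diffAt hV hg hs).hasFDerivAt.comp_hasDerivAt s (hl s)
    have e : deriv (fun s : ℝ => f (x + s • v)) =ᶠ[nhds 0] fun s => dD v f (x + s • v) := by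
      filter_upwards [hev] with s hs using (hd f hf s hs).deriv
    have h3 : deriv (deriv fun s : ℝ => f (x + s • v)) 0 = dD v (dD v f) x := by
      rw [e.deriv_eq, (hd _ (smooth_dD hV hf v) 0 (by simpa using hx)).deriv, zero_smul, add_zero]
    rw [← h3]
    refine IsLocalMin.deriv_deriv_nonneg ?_ ?_
    · filter_upwards [hev] with s hs
      simpa using h0 _ hs
    · exact (hd f hf 0 (by simpa using hx)).continuousAt
  rw [heatST, h1, laplaceST, zero_sub, neg_nonpos, hE]
  simp only [h1, mul_zero, sum_const_zero, sub_zero]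
  have h3 : ∑ i, ∑ j, (E * Eᵀ) i j * dD (sDir i) (dD (sDir j) f) x = ∑ m, dD (∑ i, E i m • sDir i) (dD (∑ j, E j m •
      sDir j) f) x := by
    have lin : ∀ (g : Sℝ n → ℝ) (m : Fin n) y, dD (∑ i, E i m • sDir i) g y = ∑ i, E i m * dD (sDir i) g y := fun g m y
        => by simp [dD, map_sum]
    have e2 : ∀ m, dD (∑ i, E i m • sDir i) (dD (∑ j, E j m • sDir j) f) x = ∑ i, ∑ j, E i m * E j m * dD (sDir i) (dD
        (sDir j) f) x := fun m => by
      rw [lin]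
      refine sum_ext fun i => ?_
      rw [dD_congr hV (fun y _ => lin f m y) hx, dD_sum_const_mul hV (fun j => smooth_dD hV hf (sDir j)) (fun j => E j
        m) _ hx, mul_sum]
      exact sum_ext fun j => by ring
    simp only [e2, mul_apply, transpose_apply, sum_mul]
    exact (sum_ext fun i => sum_comm).trans sum_comm
  rw [h3]
  exact sum_nonneg fun m _ => h2 _

variable {S : Set Mℂ n} {I₀ : Tℝ n} {𝒦 : Set Mℝ n} {C : ℝ} (hD : ConeDatum S I₀ 𝒦 C) {R : Sℝ n → Tℝ n} {u : Sℝ n → ℝ}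
  (hV : IsOpen V) (hx : x ∈ V) (hR : ∀ i j k l, C∞ (fun y => R y i j k l) V) (hu : ∀ y ∈ V, IsLeast (levelSet S I₀ (R
  y)) (u y))
include hD hV hx hR hu

lemma ConeDatum.continuousAt : ContinuousAt u x := by
  have hRc := fun i j k l => (hR i j k l).continuousOn.continuousAt (hV.mem_nhds hx)
  have ht : Filter.Tendsto (fun y => ∑ i, ∑ j, ∑ k, ∑ l, |R y i j k l - R x i j k l|) (nhds x) (nhds 0) := by
    have : ContinuousAt (fun y => ∑ i, ∑ j, ∑ k, ∑ l, |R y i j k l - R x i j k l|) x := by fun_prop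
    simpa [ContinuousAt] using this
  rw [ContinuousAt, tendsto_iff_dist_tendsto_zero]
  refine squeeze_zero' (Filter.Eventually.of_forall fun _ => dist_nonneg) ?_ ht
  filter_upwards [hV.mem_nhds hx] with y hy
  rw [Real.dist_eq, abs_sub_le_iff]
  have h1 := hD.level_le (hu x hx) (hu y hy)
  have h2 := hD.level_le (hu y hy) (hu x hx)
  simp only [abs_sub_comm (R x _ _ _ _)] at h2
  constructor <;> linarith

lemma ConeDatum.exists_barrier (hA : IsAlg (R x)) (hK : ∀ K ∈ 𝒦, SlotInv K (R x)) {Z : Mℝ n} (hZ : Zᵀ = -Z) (hZK : ∀ K ∈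
    𝒦, Z * K = K * Z) (hev : ∀ a b c d, heatST G (fun y => R y a b c d) x = quad (R x) a b c d + slot Z (R x) a b c d) :
    ∃ φ, C∞ φ V ∧ (∀ y ∈ V, φ y ≤ u y) ∧ φ x = u x ∧ heatST G φ x ≤ scal (R x) * u x + C * u x ^ 2 := by
  rcases (hu x hx).1.1.eq_or_lt with h0 | h0
  · refine ⟨fun _ => 0, contDiffOn_const, fun y hy => (hu y hy).1.1, h0, ?_⟩
    have e : ∀ v : Sℝ n, dD v (fun _ : Sℝ n => (0 : ℝ)) = fun _ => 0 := fun v => funext fun y => dD_const v 0 y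
    rw [← h0]
    simp [heatST, laplaceST, e]
  · obtain ⟨v, hv, hpos, hnull⟩ := hD.exists_null (hu x hx) h0
    set w : (Fin n × Fin n) × Fin n × Fin n → ℝ := fun p => -(Herm I₀ v)⁻¹ * ((v p.1.1 p.1.2 * conj (v p.2.1 p.2.2)).re
      / 4) with hw
    have hsum : ∀ T : Tℝ n, ∑ p, w p * T p.1.1 p.1.2 p.2.1 p.2.2 = -Herm T v / Herm I₀ v := fun T => by
      rw [herm_eq_sum T v, neg_div, div_eq_inv_mul, ← neg_mul, mul_sum]
      exact sum_ext fun p => by rw [hw]; ring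
    have hs : ∀ p : (Fin n × Fin n) × Fin n × Fin n, C∞ (fun y => R y p.1.1 p.1.2 p.2.1 p.2.2) V := fun p => hR _ _ _ _
    refine ⟨fun y => ∑ p, w p * R y p.1.1 p.1.2 p.2.1 p.2.2, ContDiffOn.sum fun p _ => contDiffOn_const.mul (hs p), fun
      y hy => ?_, ?_, ?_⟩
    · beta_reduce
      rw [hsum, div_le_iff₀ hpos]
      have := (hu y hy).1.2 v hv
      rw [herm_add_mul] at this
      linarith
    · beta_reduce
      rw [hsum, div_eq_iff hpos.ne']
      rw [herm_add_mul] at hnull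
      linarith
    · obtain ⟨h1, h2⟩ := hD.react _ hA hK _ h0.le (hu x hx).1.2 v hv hnull Z hZ hZK
      rwa [heatST_sum_const_mul hV hs w hx, sum_ext fun p => by rw [hev],
        sum_ext fun p => mul_add _ _ _, sum_add_distrib, hsum, hsum, h1, neg_zero, zero_div, add_zero, div_le_iff₀ hpos]

end Barrier

section FrameBarrier

lemma sum_rotate {ι M : Type*} [Fintype ι] [AddCommMonoid M] (f : ι → ι → ι → M) : ∑ b, ∑ c, ∑ a, f a b c = ∑ a, ∑ b, ∑
    c, f a b c := (sum_ext fun b => sum_comm).trans sum_comm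

lemma IsAlgCurvature.inFrame (hR : IsAlg R) (E : Mℝ n) : IsAlg (inFrame R E) where
  antisymm a b c d := by
    rw [_root_.inFrame, _root_.inFrame, sum_comm]
    simp only [← sum_neg_distrib]
    exact sum4_congr fun i j k l => by rw [hR.antisymm]; ring
  pair_symm a b c d := by
    rw [_root_.inFrame, _root_.inFrame, sum_comm_pairs]
    exact sum4_congr fun i j k l => by rw [hR.pair_symm]; ring
  bianchi a b c d := by
    simp only [_root_.inFrame]
    rw [(sum_rotate fun i j k => ∑ l, R j k i l * E j b * E k c * E i a * E l d), ← (sum_rotate fun k i j => ∑ l, R k i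
      j l * E k c * E i a * E j b * E l d)]
    simp only [← sum_add_distrib]
    refine sum_eq_zero fun i _ => sum_eq_zero fun j _ => sum_eq_zero fun k _ => sum_eq_zero fun l _ => ?_
    linear_combination E i a * E j b * E k c * E l d * hR.bianchi i j k l

lemma SlotInv.ricci_comm (h : SlotInv K R) (hR : IsAlg R) (hK : Kᵀ = -K) : ricci R * K = K * ricci R := by
  ext a c
  simp only [mul_apply, ricci, of_apply, sum_mul, mul_sum]
  have h1 : ∑ b, ∑ q, (K q a * R q b c b + K q b * R a q c b) = 0 := sum_eq_zero fun b _ => h a b c b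
  have h2 : ∑ b, ∑ q, (K q c * R q b a b + K q b * R c q a b) = 0 := sum_eq_zero fun b _ => h c b a b
  simp only [sum_add_distrib] at h1 h2
  have h3 : ∑ b, ∑ q, K q b * R c q a b = -∑ b, ∑ q, K q b * R a q c b := by
    rw [sum_comm, ← sum_neg_distrib]
    refine sum_ext fun b => ?_
    rw [← sum_neg_distrib]
    refine sum_ext fun q => ?_
    rw [skew_apply hK b q, hR.pair_symm a]
    ring
  rw [sum_comm] at h1 h2
  have e1 : ∀ q b, R a b q b * K q c = K q c * R q b a b := fun q b => by rw [hR.pair_symm a b q b, mul_comm]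
  have e2 : ∀ q b, K a q * R q b c b = -(K q a * R q b c b) := fun q b => by rw [skew_apply hK q a]; ring
  simp only [e1, e2, sum_neg_distrib]
  linarith

variable {G : Sℝ n → Mℝ n} {U : Set Sℝ n} {x : Sℝ n}

lemma slotInvariant_of_comm {e : Fin n → X} {G : X → Mℝ n} {U : Set X} {x : X} (hG : IsMetric G U) (hx : x ∈ U) {E K K₀
    : Mℝ n} (hE : Eᵀ * G x * E = 1) (hKE : K * E = E * K₀) (hc : ∀ i j, curvMat e (conn e G) i j x * K = K * curvMat e
    (conn e G) i j x) (hK : K₀ᵀ = -K₀) : SlotInv K₀ (inFrame (riem e G x) E) := by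
  have hA := (hG.isAlgCurvature hx (e := e)).inFrame E
  have hL : Eᵀ * G x * K = K₀ * (Eᵀ * G x) := by
    have h2 : E * (Eᵀ * G x) = 1 := mul_eq_one_comm.1 hE
    calc Eᵀ * G x * K = Eᵀ * G x * (K * E) * (Eᵀ * G x) := by rw [mul_assoc (Eᵀ * G x), mul_assoc K, h2, mul_one]
      _ = _ := by rw [hKE, ← mul_assoc (Eᵀ * G x), hE, one_mul]
  set M : Fin n → Fin n → Mℝ n := fun i j => Eᵀ * G x * curvMat e (conn e G) i j x * E with hM
  have hMK : ∀ i j, M i j * K₀ = K₀ * M i j := fun i j => by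
    rw [hM]
    beta_reduce
    rw [mul_assoc _ E, ← hKE, ← mul_assoc, mul_assoc (Eᵀ * G x) _ K, hc, ← mul_assoc, hL]
    simp only [mul_assoc]
  have hin : ∀ a b c d, inFrame (riem e G x) E a b c d = ∑ i, ∑ j, E i a * E j b * M i j c d := fun a b c d => by
    have hr : ∀ i j, M i j c d = ∑ k, ∑ l, riem e G x i j k l * E k c * E l d := fun i j => by
      simp only [hM, riem]
      rw [mul_assoc Eᵀ, mul_assoc Eᵀ, mul_apply]
      refine sum_ext fun k => ?_
      rw [mul_apply, mul_sum]
      exact sum_ext fun l => by rw [transpose_apply]; ring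
    simp only [hr, inFrame, mul_sum]
    exact sum4_congr fun i j k l => by ring
  intro a b c d
  have hsw : ∀ q, K₀ q a * inFrame (riem e G x) E q b c d + K₀ q b * inFrame (riem e G x) E a q c d = ∑ i, ∑ j, E i c *
      E j d * (M i j a q * K₀ q b - K₀ a q * M i j q b) := fun q => by
    rw [hA.pair_symm q, hA.pair_symm a, hin, hin, mul_sum, mul_sum, ← sum_add_distrib]
    refine sum_ext fun i => ?_
    rw [mul_sum, mul_sum, ← sum_add_distrib]
    refine sum_ext fun j => ?_
    rw [skew_apply hK q a]
    ring
  rw [sum_ext fun q => hsw q, sum_comm]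
  refine sum_eq_zero fun i _ => ?_
  rw [sum_comm]
  refine sum_eq_zero fun j _ => ?_
  have := congr_fun₂ (hMK i j) a b
  rw [mul_apply, mul_apply] at this
  rw [← mul_sum, sum_sub_distrib, this, sub_self, mul_zero]

lemma scal_inFrame {e : Fin n → X} {G : X → Mℝ n} {x : X} {E : Mℝ n} (hE : (G x)⁻¹ = E * Eᵀ) : scal (inFrame (riem e G
    x) E) = ∑ i, ∑ j, (G x)⁻¹ i j * ric e G x i j := by
  have h : ∀ i, ricci (inFrame (riem e G x) E) i i = ∑ a, ∑ c, E a i * E c i * ric e G x a c := fun i => by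
    have := contract_inFrame (riem e G x) E 1 i i
    rw [mul_one, ← hE] at this
    simp only [ric, of_apply]
    rw [← this]
    simp [ricci, Matrix.one_apply]
  simp only [scal, trace, diag_apply, h, hE, mul_apply, transpose_apply, sum_mul]
  exact (sum_rotate fun i a c => _).symm

lemma inv_eq_mul_transpose {A E : Mℝ n} (h : Eᵀ * A * E = 1) : A⁻¹ = E * Eᵀ := by
  refine inv_eq_left_inv ?_
  rw [mul_assoc]
  exact mul_eq_one_comm.1 h

lemma ConeDatum.exists_barrier_of_frame {S : Set Mℂ n} {I₀ : Tℝ n} {𝒦 : Set Mℝ n} {C : ℝ} (hD : ConeDatum S I₀ 𝒦 C) (hG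
    : IsMetric G U) (hx : x ∈ U) (hflow : ∀ y ∈ U, mD (tDir n) G y = (-2 : ℝ) • ric sDir G y) {E : Sℝ n → Mℝ n} (hE :
    MSmooth E U) (hEG : ∀ y ∈ U, (E y)ᵀ * G y * E y = 1) (hpar : ∀ i, mD (sDir i) E x = -(conn sDir G i x * E x)) (h𝒦 :
    ∀ K₀ ∈ 𝒦, K₀ᵀ = -K₀ ∧ ∃ K : Sℝ n → Mℝ n, MSmooth K U ∧ (∀ y ∈ U, mD (tDir n) K y = 0) ∧ (∀ y ∈ U, ∀ i, mD (sDir i) K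
      y + (conn sDir G i y * K y - K y * conn sDir G i y) = 0) ∧ ∀ y ∈ U, K y * E y = E y * K₀) {u : Sℝ n → ℝ} (hu : ∀ y
    ∈ U, IsLeast (levelSet S I₀ (Rm G E y)) (u y)) : ContinuousAt u x ∧ ∃ φ, C∞ φ U ∧ (∀ y ∈ U, φ y ≤ u y) ∧ φ x = u x ∧
      heatST G φ x ≤ (∑ i, ∑ j, (G x)⁻¹ i j * ric sDir G x i j) * u x + C * u x ^ 2 := by
  have hR : ∀ a b c d, C∞ (fun y => Rm G E y a b c d) U := fun a b c d => ContDiffOn.sum fun i _ => ContDiffOn.sum fun j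
    _ => ContDiffOn.sum fun k _ => ContDiffOn.sum fun l _ => ((((hG.riem_smooth i j k l).mul (hE i a)).mul (hE j b)).mul
        (hE k c)).mul (hE l d)
  have hA := (hG.isAlgCurvature hx (e := sDir)).inFrame (E x)
  have hinv : ∀ K ∈ 𝒦, SlotInv K (Rm G E x) := by
    intro K₀ hK₀
    obtain ⟨hsk, K, hK, -, hKp, hKE⟩ := h𝒦 K₀ hK₀
    exact slotInvariant_of_comm hG hx (hEG x hx) (hKE x hx) (curvMat_comm_parallel hG hx hK hKp) hsk
  obtain ⟨Z, hZ, hZK, hev⟩ := evolution_in_frame hG hx hflow hE hEG hpar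
  have hZK' : ∀ K ∈ 𝒦, Z * K = K * Z := by
    intro K₀ hK₀
    obtain ⟨hsk, K, hK, hKt, hKp, hKE⟩ := h𝒦 K₀ hK₀
    exact hZK K K₀ hK hKt hKp hKE ((hinv K₀ hK₀).ricci_comm hA hsk)
  rw [← scal_inFrame (inv_eq_mul_transpose (hEG x hx))]
  exact ⟨hD.continuousAt (R := fun y => Rm G E y) hG.isOpen hx hR hu, hD.exists_barrier (R := fun y => Rm G E y)
    hG.isOpen hx hR hu hA hinv hZ hZK' hev⟩

end FrameBarrier

variable {M : Type*} [TopologicalSpace M] [ChartedSpace Eℝ n M] [IsManifold (𝓡 n) ∞ M] {g : ℝ → RMetric n M} {T : Set ℝ}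

local notation:max "gST" g:max q:max => fun z : Sℝ n => coordMetric (g (Prod.snd z)) q (Prod.fst z)

section Charts

lemma contMDiffOn_coordVec (q : M) (i : Fin n) : ContMDiffOn 𝓘(ℝ, Eℝ n) ((𝓡 n).prod 𝓘(ℝ, Eℝ n)) ∞ (fun y =>
      TotalSpace.mk' Eℝ n (E := fun m : M => TangentSpace (𝓡 n) m) ((χ n q).symm y) (coordVec q y i)) (χ n q).target :=
        by
  have ho : IsOpen (χ n q).target := isOpen_extChartAt_target q
  have h1 := (contMDiffOn_extChartAt_symm (n := ∞) (I := 𝓡 n) q).contMDiffOn_tangentMapWithin (m := ∞) (by simp)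
    ho.uniqueMDiffOn
  have h2 : ContMDiffOn 𝓘(ℝ, Eℝ n) 𝓘(ℝ, Eℝ n).tangent ∞ (fun y => (⟨y, EuclideanSpace.single i (1 : ℝ)⟩ : TangentBundle
        𝓘(ℝ, Eℝ n) Eℝ n)) (χ n q).target := contMDiffOn_vectorSpace_iff_contDiffOn.2 contDiffOn_const
  refine (h1.comp h2 fun y hy => hy).congr fun y hy => ?_
  simp only [Function.comp, tangentMapWithin, mfderivWithin_of_isOpen ho hy]
  rfl

lemma contMDiffOn_chart_prod (q : M) (T : Set ℝ) : ContMDiffOn 𝓘(ℝ, Sℝ n) ((𝓡 n).prod 𝓘(ℝ, ℝ)) ∞ (fun z => ((χ n q).symm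
      z.1, z.2)) ((χ n q).target ×ˢ T) := ((contMDiffOn_extChartAt_symm q).comp contDiff_fst.contMDiff.contMDiffOn fun z
    hz => hz.1).prodMk contDiff_snd.contMDiff.contMDiffOn

lemma contMDiffOn_coordVec_prod (q : M) (i : Fin n) (T : Set ℝ) : ContMDiffOn 𝓘(ℝ, Sℝ n) ((𝓡 n).prod 𝓘(ℝ, Eℝ n)) ∞ (fun
      z : Sℝ n => TotalSpace.mk' Eℝ n
 ((χ n q).symm z.1) (coordVec q z.1 i)) ((χ n q).target ×ˢ T) :=
  (contMDiffOn_coordVec q i).comp contDiff_fst.contMDiff.contMDiffOn fun z hz => hz.1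

lemma contDiffOn_metric_apply {g : ℝ → RMetric n M} {T : Set ℝ} (hg : IsRicciFlow g T) (q : M) {v w : ∀ z : Sℝ n,
    TangentSpace (𝓡 n) ((χ n q).symm z.1)} (hv : ContMDiffOn 𝓘(ℝ, Sℝ n) ((𝓡 n).prod 𝓘(ℝ, Eℝ n)) ∞ (fun z =>
      TotalSpace.mk' Eℝ n ((χ n q).symm z.1) (v z)) ((χ n q).target ×ˢ T)) (hw : ContMDiffOn 𝓘(ℝ, Sℝ n) ((𝓡 n).prod 𝓘(ℝ,
      Eℝ n)) ∞ (fun z => TotalSpace.mk' Eℝ n ((χ n q).symm z.1) (w z)) ((χ n q).target ×ˢ T)) : C∞ (fun z => (g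
    z.2).inner ((χ n q).symm z.1) (v z) (w z)) ((χ n q).target ×ˢ T) := by
  rw [← contMDiffOn_iff_contDiffOn]
  intro z hz
  have h1 := (hg.smooth.comp (contMDiffOn_chart_prod q T) fun z hz => ⟨mem_univ _, hz.2⟩) z hz
  have h2 := ContMDiffWithinAt.clm_bundle_apply₂ (E₃ := fun _ : M => ℝ) (b := fun z : Sℝ n => (χ n q).symm z.1) h1 (hv z
    hz) (hw z hz)
  simp only [contMDiffWithinAt_totalSpace] at h2
  exact h2.2

lemma msmooth_coordMetric (hg : IsRicciFlow g T) (q : M) : MSmooth gST g q ((χ n q).target ×ˢ T) := fun i j =>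
  contDiffOn_metric_apply hg q (contMDiffOn_coordVec_prod q i T) (contMDiffOn_coordVec_prod q j T)

lemma map_eq_sum_single {F : Type*} [AddCommGroup F] [Module ℝ F] [TopologicalSpace F] (L : Eℝ n →L[ℝ] F) (v : Eℝ n) : L
    v = ∑ i, v i • L (EuclideanSpace.single i (1 : ℝ)) := by
  conv_lhs => rw [show v = ∑ i, v i • EuclideanSpace.single i (1 : ℝ) by
    ext j; simp [Finset.sum_apply, Pi.single_apply]]
  simp

lemma mfderiv_chart_coordVec (q : M) {y : Eℝ n} (hy : y ∈ (χ n q).target) (i : Fin n) : mfderiv (𝓡 n) 𝓘(ℝ, Eℝ n) (χ n q)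
      ((χ n q).symm y) (coordVec q y i) = EuclideanSpace.single i (1 : ℝ) := by
  have h := congrArg (fun L => L (EuclideanSpace.single i (1 : ℝ) : Eℝ n))
    (mfderiv_extChartAt_comp_mfderivWithin_extChartAt_symm hy)
  have hr : range (𝓡 n) = univ := by simp
  rwa [hr, mfderivWithin_univ] at h

lemma eq_sum_coordVec (q : M) {y : Eℝ n} (hy : y ∈ (χ n q).target) (v : TangentSpace (𝓡 n) ((χ n q).symm y)) : v = ∑ i,
    (show Eℝ n from mfderiv (𝓡 n) 𝓘(ℝ, Eℝ n) (χ n q) ((χ n q).symm y) v) i • coordVec q y i := by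
  have h := congrArg (fun L => L v) (mfderivWithin_extChartAt_symm_comp_mfderiv_extChartAt hy)
  have hr : range (𝓡 n) = univ := by simp
  rw [hr, mfderivWithin_univ] at h
  refine h.symm.trans ?_
  exact map_eq_sum_single (mfderiv 𝓘(ℝ, Eℝ n) (𝓡 n) (χ n q).symm y) _

def chartTrans (p q : M) (z : Eℝ n) : Eℝ n := χ n q ((χ n p).symm z)

/-- The domain of the transition map between two charts. -/
def overlap (p q : M) : Set Eℝ n := (χ n p).target ∩ (χ n p).symm ⁻¹' (χ n q).source

/-- The Jacobian of the transition map between two charts. -/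
def transJac (p q : M) (z : Eℝ n) : Mℝ n := of fun a i => fderiv ℝ (chartTrans p q) z (EuclideanSpace.single i (1 : ℝ))
  a

lemma isOpen_overlap (p q : M) : IsOpen (overlap (n := n) p q) := (continuousOn_extChartAt_symm p).isOpen_inter_preimage
  (isOpen_extChartAt_target p) (isOpen_extChartAt_source q)

lemma contDiffOn_chartTrans (p q : M) : C∞ (chartTrans (n := n) p q) (overlap p q) := by
  rw [← contMDiffOn_iff_contDiffOn]
  have h : ContMDiffOn (𝓡 n) 𝓘(ℝ, Eℝ n) ∞ (χ n q) (χ n q).source := by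
    rw [extChartAt_source]; exact contMDiffOn_extChartAt
  exact h.comp ((contMDiffOn_extChartAt_symm p).mono inter_subset_left) fun z hz => hz.2

variable {p q : M} {z : Eℝ n} (hz : z ∈ overlap p q)
include hz

lemma symm_chartTrans : (χ n q).symm (chartTrans p q z) = (χ n p).symm z := (χ n q).left_inv hz.2

lemma chartTrans_mem : chartTrans p q z ∈ overlap q p := ⟨(χ n q).map_source hz.2, by
    rw [mem_preimage, symm_chartTrans hz]; exact (χ n p).map_target hz.1⟩

lemma chartTrans_chartTrans : chartTrans q p (chartTrans p q z) = z := by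
  rw [chartTrans, symm_chartTrans hz, (χ n p).right_inv hz.1]

lemma fderiv_chartTrans (v : Eℝ n) (a : Fin n) : fderiv ℝ (chartTrans p q) z v a = (transJac p q z *ᵥ v) a := by
  rw [map_eq_sum_single]
  simp [mulVec, dotProduct, transJac, mul_comm]

lemma transJac_mul : transJac q p (chartTrans p q z) * transJac p q z = 1 := by
  have h1 := (((contDiffOn_chartTrans p q).differentiableOn (by simp)).differentiableAt ((isOpen_overlap p q).mem_nhds
    hz)).hasFDerivAt
  have h2 := (((contDiffOn_chartTrans q p).differentiableOn (by simp)).differentiableAt ((isOpen_overlap q p).mem_nhds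
    (chartTrans_mem hz))).hasFDerivAt
  have h3 := (h2.comp z h1).congr_of_eventuallyEq (f₁ := id) (by
    filter_upwards [(isOpen_overlap p q).mem_nhds hz] with y hy using (chartTrans_chartTrans hy).symm)
  ext i j
  have h5 := congrArg (fun L => L (EuclideanSpace.single j (1 : ℝ)) i) (h3.unique (hasFDerivAt_id z))
  simp only [ContinuousLinearMap.comp_apply] at h5
  rw [fderiv_chartTrans (chartTrans_mem hz)] at h5
  rw [mul_apply]
  refine (show _ = _ from h5).trans ?_
  simp [Matrix.one_apply]

lemma coordVec_change (i : Fin n) : (show Eℝ n from coordVec p z i) = ∑ a, transJac p q z a i • (show Eℝ n from coordVec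
    q (chartTrans p q z) a) := by
  have ho := isOpen_overlap (n := n) p q
  have hm := (chartTrans_mem hz).1
  have h1 := (((contDiffOn_chartTrans p q).differentiableOn (by simp)).differentiableAt (ho.mem_nhds
    hz)).mdifferentiableAt
  have h2 : MDifferentiableAt 𝓘(ℝ, Eℝ n) (𝓡 n) (χ n q).symm (chartTrans p q z) := (mdifferentiableOn_extChartAt_symm (I
    := 𝓡 n) (x := q) _ hm).mdifferentiableAt ((isOpen_extChartAt_target (I := 𝓡 n) q).mem_nhds hm)
  have h3 : (χ n p).symm =ᶠ[nhds z] (χ n q).symm ∘ chartTrans p q := by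
    filter_upwards [ho.mem_nhds hz] with y hy using (symm_chartTrans hy).symm
  have h4 := congrArg (fun L : Eℝ n →L[ℝ] Eℝ n => L (EuclideanSpace.single i (1 : ℝ))) (h3.mfderiv_eq (I := 𝓘(ℝ, Eℝ n))
      (I' := 𝓡 n))
  rw [mfderiv_comp z h2 h1, mfderiv_eq_fderiv] at h4
  refine (show _ = _ from h4).trans ?_
  exact map_eq_sum_single (mfderiv 𝓘(ℝ, Eℝ n) (𝓡 n) (χ n q).symm (chartTrans p q z)) _

end Charts

section ChartChange

/-- The coordinate directions of Euclidean space. -/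
def eDir (i : Fin n) : Eℝ n := EuclideanSpace.single i 1

lemma curvTensor_eq_riem {G : Eℝ n → Mℝ n} (y : Eℝ n) : curvTensor G y = riem eDir G y := by
  funext i j k l
  rw [riem, mul_apply]
  refine sum_ext fun m => ?_
  simp only [curvMat, Matrix.add_apply, Matrix.sub_apply, mul_apply, ← sum_sub_distrib]
  rfl

lemma dD_tDir {f : Sℝ n → ℝ} {z : Eℝ n} {t : ℝ} (hf : DifferentiableAt ℝ f (z, t)) : HasDerivAt (fun s => f (z, s)) (dD
    (tDir n) f (z, t)) t := hf.hasFDerivAt.comp_hasDerivAt t ((hasDerivAt_const t z).prodMk (hasDerivAt_id t))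

lemma isCoordChange_chartTrans (p q : M) {T : Set ℝ} (hT : IsOpen T) {t : ℝ} (ht : t ∈ T) : CoordChange eDir sDir
    (overlap p q) ((χ n q).target ×ˢ T) (fun z => (chartTrans p q z, t)) (transJac p q) := by
  have ho := isOpen_overlap (n := n) p q
  have hs := contDiffOn_chartTrans (n := n) p q
  have hc : ∀ a, C∞ (fun z => chartTrans p q z a) (overlap p q) := fun a => contDiffOn_euclidean.1 hs a
  have hd : ∀ z ∈ overlap p q, HasFDerivAt (chartTrans p q) (fderiv ℝ (chartTrans p q) z) z := fun z hz =>
    (((hs.differentiableOn (by simp)).differentiableAt (ho.mem_nhds hz))).hasFDerivAt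
  have hj : ∀ i a, ∀ z ∈ overlap p q, transJac p q z a i = dD (eDir i) (fun z => chartTrans p q z a) z := fun i a z hz
      =>
    congrArg (fun L => L (eDir i)) (((EuclideanSpace.proj a : Eℝ n →L[ℝ] ℝ) |>.hasFDerivAt.comp z (hd z
      hz)).fderiv).symm
  refine ⟨ho, (isOpen_extChartAt_target q).prod hT, fun z hz => ⟨(chartTrans_mem hz).1, ht⟩, hs.prodMk contDiffOn_const,
    fun a i => (smooth_dD ho (hc a) (eDir i)).congr (hj i a), fun z hz i => ?_, fun z hz i j a => ?_, fun z hz => ?_⟩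
  · rw [((hd z hz).prodMk (hasFDerivAt_const t z)).fderiv]
    exact sum_smul_sDir _ _ (fun a => rfl) rfl
  · rw [dD_congr ho (hj i a) hz, dD_congr ho (hj j a) hz, dD_comm ho (hc a) hz]
  · have := congrArg det (transJac_mul hz)
    rw [det_mul, det_one] at this
    exact IsUnit.of_mul_eq_one_right _ this

lemma overlap_self (q : M) : overlap q q = (χ n q).target := inter_eq_left.2 fun _ hz => (χ n q).map_target hz

lemma chartTrans_self {q : M} {z : Eℝ n}
    (hz : z ∈ (χ n q).target) : chartTrans q q z = z :=
  (χ n q).right_inv hz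

lemma transJac_self {q : M} {z : Eℝ n}
    (hz : z ∈ (χ n q).target) : transJac q q z = 1 := by
  ext a i
  have h : chartTrans q q =ᶠ[nhds z] id := by
    filter_upwards [(isOpen_extChartAt_target q).mem_nhds hz] with y hy
      using chartTrans_self hy
  rw [transJac, of_apply, h.fderiv_eq, fderiv_id, Matrix.one_apply]
  simp

lemma RMetric.inner_congr (g : RMetric n M) {m m' : M} (h : m' = m) (v w : Eℝ n) : g.inner m (show TangentSpace (𝓡 n) m
    from v) (show TangentSpace (𝓡 n) m from w) = g.inner m' (show TangentSpace (𝓡 n) m' from v) (show TangentSpace (𝓡 n)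
      m' from w) := by subst h; rfl

lemma RMetric.inner_sum (g : RMetric n M) (m : M) (x y : Fin n → ℝ) (v w : Fin n → TangentSpace (𝓡 n) m) : g.inner m (∑
    a, x a • v a) (∑ b, y b • w b) = ∑ a, ∑ b, x a * (g.inner m (v a) (w b) * y b) := by
  simp only [map_sum, map_smul, _root_.sum_apply, _root_.smul_apply, smul_eq_mul, mul_sum]
  rw [sum_comm]
  exact sum_ext fun a => sum_ext fun b => by ring

lemma coordMetric_change (g : RMetric n M) {p q : M} {z : Eℝ n} (hz : z ∈ overlap p q) : coordMetric g p z = (transJac p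
      q z)ᵀ * (coordMetric g q (chartTrans p q z) * transJac p q z) := by
  ext i j
  refine (g.inner_congr (symm_chartTrans hz) (coordVec p z i) (coordVec p z j)).trans ((congrArg₂ (fun v w : Eℝ n =>
    g.inner ((χ n q).symm (chartTrans p q z)) v w) (coordVec_change hz i) (coordVec_change hz j)).trans ((g.inner_sum _
      _ _ _ _).trans ?_))
  simp only [mul_apply, transpose_apply, mul_sum]
  rfl

lemma sum_smul_coordVec_ne_zero {q : M} {y : Eℝ n} (hy : y ∈ (χ n q).target) {x : Fin n → ℝ} (hx : x ≠ 0) : ∑ i, x i •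
    coordVec q y i ≠ 0 := fun h => by
  refine hx (funext fun j => ?_)
  have h1 := congrArg (mfderiv (𝓡 n) 𝓘(ℝ, Eℝ n) (χ n q) ((χ n q).symm y)) h
  simp only [map_sum, map_smul, map_zero, mfderiv_chart_coordVec q hy] at h1
  have h2 : ∑ i, x i • (EuclideanSpace.single i 1 : Eℝ n) = WithLp.toLp 2 x := by
    ext k
    simp [Finset.sum_apply, Pi.single_apply]
  exact congrArg (fun v : Eℝ n => v j) (h2.symm.trans h1)

lemma coordMetric_symm (g : RMetric n M) (q : M) (y : Eℝ n) : (coordMetric g q y)ᵀ = coordMetric g q y := by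
  ext i j
  exact g.symm _ _ _

lemma coordMetric_posDef (g : RMetric n M) {q : M} {y : Eℝ n} (hy : y ∈ (χ n q).target) : (coordMetric g q y).PosDef :=
    by
  refine .of_dotProduct_mulVec_pos (coordMetric_symm g q y) fun x hx => ?_
  have h := g.pos _ _ (sum_smul_coordVec_ne_zero hy hx)
  rw [g.inner_sum] at h
  simp only [dotProduct, mulVec, mul_sum]
  exact h

open scoped MatrixOrder in
lemma exists_frame_of_posDef {A : Mℝ n} (hA : A.PosDef) : ∃ B : Mℝ n, Bᵀ * A * B = 1 := by
  obtain ⟨C, hC⟩ := CStarAlgebra.nonneg_iff_eq_star_mul_self.mp hA.posSemidef.nonneg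
  have hC' : A = Cᵀ * C := hC
  have hdet : IsUnit C.det := by
    have h := (isUnit_iff_isUnit_det _).1 hA.isUnit
    rw [hC', det_mul] at h
    exact isUnit_of_mul_isUnit_right h
  refine ⟨C⁻¹, ?_⟩
  rw [hC', mul_assoc, mul_assoc, mul_nonsing_inv _ hdet, mul_one, ← transpose_mul, mul_nonsing_inv _ hdet,
    transpose_one]

lemma IsRicciFlow.isMetricOn (hg : IsRicciFlow g T) (hT : IsOpen T) (q : M) : IsMetric gST g q ((χ n q).target ×ˢ T)
      where
  isOpen := (isOpen_extChartAt_target q).prod hT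
  smooth := msmooth_coordMetric hg q
  symm z _ := coordMetric_symm _ q z.1
  det z hz := (isUnit_iff_isUnit_det _).1 (coordMetric_posDef _ hz.1).isUnit

lemma riem_congr {e : Fin n → X} {G G' : X → Mℝ n} {U : Set X} (hU : IsOpen U) (h : ∀ y ∈ U, G y = G' y) {x : X} (hx : x
    ∈ U) : riem e G x = riem e G' x := by
  have hc : ∀ i, ∀ y ∈ U, conn e G i y = conn e G' i y := fun i y hy => by
    have hd : ∀ v a b, dD v (fun z => G z a b) y = dD v (fun z => G' z a b) y := fun v a b =>
      dD_congr hU (fun z hz => by rw [h z hz]) hy v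
    simp only [conn, hd, h y hy]
  funext i j k l
  simp only [riem, curvMat, h x hx, mD_congr hU hx (hc _), hc _ x hx]

lemma IsRicciFlow.curvTensor_eq (hg : IsRicciFlow g T) (hT : IsOpen T) {t : ℝ} (ht : t ∈ T) {p q : M} {z : Eℝ n} (hz : z
    ∈ overlap p q) : curvTensor (coordMetric (g t) p) z = inFrame (riem sDir gST g q (chartTrans p q z, t)) (transJac p
      q z) := by
  rw [curvTensor_eq_riem, ← (isCoordChange_chartTrans p q hT ht).riem_eq (hg.isMetricOn hT q) hz]
  exact riem_congr (isOpen_overlap p q) (fun y hy => coordMetric_change (g t) hy) hz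

lemma IsRicciFlow.curvTensor_eq_self (hg : IsRicciFlow g T) (hT : IsOpen T) {t : ℝ} (ht : t ∈ T) {q : M} {z : Eℝ n} (hz
    : z ∈ (χ n q).target) : curvTensor (coordMetric (g t) q) z = riem sDir gST g q (z, t) := by
  rw [hg.curvTensor_eq hT ht (by rwa [overlap_self]), transJac_self hz, chartTrans_self hz, inFrame_one]

lemma IsRicciFlow.ricciTensor_eq_self (hg : IsRicciFlow g T) (hT : IsOpen T) {t : ℝ} (ht : t ∈ T) {q : M} {z : Eℝ n} (hz
    : z ∈ (χ n q).target) (i j : Fin n) : ricciTensor (coordMetric (g t) q) z i j = ric sDir gST g q (z, t) i j := by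
  rw [ricciTensor, hg.curvTensor_eq_self hT ht hz]
  rfl

lemma IsRicciFlow.mD_tDir (hg : IsRicciFlow g T) (hT : IsOpen T) (q : M) : ∀ y ∈ (χ n q).target ×ˢ T, mD (tDir n) gST g
      q y = (-2 : ℝ) • ric sDir gST g q y := by
  rintro ⟨z, t⟩ ⟨hz, ht⟩
  have hG := hg.isMetricOn hT q
  ext i j
  refine (dD_tDir (smooth_diffAt hG.isOpen (hG.smooth i j) ⟨hz, ht⟩)).unique ?_
  rw [Matrix.smul_apply, smul_eq_mul, ← hg.ricciTensor_eq_self hT ht hz]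
  exact hg.evolution t ht q z hz i j

end ChartChange

section Slices

variable {G : Sℝ n → Mℝ n} {U V : Set Sℝ n} {f : Sℝ n → ℝ} {z : Eℝ n} {t : ℝ}

lemma dD_slice (hf : DifferentiableAt ℝ f (z, t)) (i : Fin n) : dD (eDir i) (fun y => f (y, t)) z = dD (sDir i) f (z, t)
    := congrArg (fun L : Eℝ n →L[ℝ] ℝ => L (eDir i)) (HasFDerivAt.comp z (f := fun y => (y, t)) hf.hasFDerivAt
    ((hasFDerivAt_id z).prodMk (hasFDerivAt_const t z))).fderiv

lemma IsMetric.conn_slice (hG : IsMetric G U) (hx : (z, t) ∈ U) (i : Fin n) : conn eDir (fun y => G (y, t)) i z = conn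
    sDir G i (z, t) := by
  have hd := fun i a b => dD_slice (smooth_diffAt hG.isOpen (hG.smooth a b) hx) i
  simp only [conn, hd]

lemma IsMetric.laplaceCoord_slice (hG : IsMetric G U) (hx : (z, t) ∈ U) (hV : IsOpen V) (hf : C∞ f V) (hxV : (z, t) ∈ V)
    : laplaceCoord (fun y => G (y, t)) (fun y => f (y, t)) z = laplaceST G f (z, t) := by
  have hVt : IsOpen {y : Eℝ n | (y, t) ∈ V} := hV.preimage (Continuous.prodMk_left t)
  have h1 : ∀ k, ∀ y ∈ {y : Eℝ n | (y, t) ∈ V}, partialD k (fun y => f (y, t)) y = dD (sDir k) f (y, t) := fun k y hy =>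
    dD_slice (smooth_diffAt hV hf hy) k
  have h2 : ∀ i j, partialD i (partialD j (fun y => f (y, t))) z = dD (sDir i) (dD (sDir j) f) (z, t) := fun i j =>
    (dD_congr hVt (h1 j) hxV (eDir i)).trans (dD_slice (smooth_diffAt hV (smooth_dD hV hf (sDir j)) hxV) i)
  have h3 : ∀ i j k, christoffel (fun y => G (y, t)) k i j z = conn sDir G i (z, t) k j := fun i j k => congr_fun₂
    (hG.conn_slice hx i) k j
  simp only [laplaceCoord, laplaceST, h1 _ z hxV, h2, h3]

end Slices

section ComplexStructure

variable {J : ∀ q : M, TangentSpace (𝓡 n) q →L[ℝ] TangentSpace (𝓡 n) q}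

lemma sum_smul_sum_smul {V : Type*} [AddCommGroup V] [Module ℝ V] (A : Mℝ n) (c : Fin n → ℝ) (w : Fin n → V) : ∑ i, c i
    • ∑ a, A a i • w a = ∑ a, (A *ᵥ c) a • w a := by
  simp only [Finset.smul_sum, mulVec, dotProduct, Finset.sum_smul]
  rw [sum_comm]
  exact sum_ext fun _ => sum_ext fun _ => by rw [smul_smul, mul_comm]

lemma coordVec_coeff_unique {q : M} {y : Eℝ n} (hy : y ∈ (χ n q).target) {c d : Fin n → ℝ} (h : ∑ i, c i • coordVec q y
    i = ∑ i, d i • coordVec q y i) : c = d := by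
  by_contra hne
  refine sum_smul_coordVec_ne_zero hy (sub_ne_zero.2 hne) ?_
  simp only [Pi.sub_apply, sub_smul, sum_sub_distrib, h, sub_self]

lemma map_coordVec {q : M} {y : Eℝ n} (hy : y ∈ (χ n q).target) (j : Fin n) : J _ (coordVec q y j) = ∑ i, coordEndo J q
    y i j • coordVec q y i := eq_sum_coordVec q hy _

lemma map_sum_coordVec {q : M} {y : Eℝ n} (hy : y ∈ (χ n q).target) (c : Fin n → ℝ) : J _ (∑ j, c j • coordVec q y j) =
    ∑ i, (coordEndo J q y *ᵥ c) i • coordVec q y i := by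
  simp only [map_sum, map_smul, map_coordVec hy]
  exact sum_smul_sum_smul _ _ _

lemma coordEndo_mul_self (hJ : ∀ q v, J q (J q v) = -v) {q : M} {y : Eℝ n} (hy : y ∈ (χ n q).target) : coordEndo J q y *
    coordEndo J q y = -1 := by
  ext i j
  have h := hJ _ (coordVec q y j)
  rw [map_coordVec hy, map_sum_coordVec hy] at h
  have h2 := coordVec_coeff_unique hy (d := fun i => (-1 : Mℝ n) i j) (h.trans (by
    simp only [Matrix.neg_apply, Matrix.one_apply, neg_smul, sum_neg_distrib, ite_smul, one_smul, zero_smul,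
      sum_ite_eq', Finset.mem_univ, if_true]))
  exact congrFun h2 i

lemma coordMetric_mul_coordEndo (g : RMetric n M) {q : M} {y : Eℝ n} (hy : y ∈ (χ n q).target) (i j : Fin n) : g.inner _
    (coordVec q y i) (J _ (coordVec q y j)) = (coordMetric g q y * coordEndo J q y) i j := by
  rw [map_coordVec hy]
  simp only [map_sum, map_smul, smul_eq_mul, mul_apply]
  exact sum_ext fun _ => mul_comm _ _

lemma coordEndo_orthogonal {g : RMetric n M} (hJ : ∀ q v w, g.inner q (J q v) (J q w) = g.inner q v w) {q : M} {y : Eℝ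
    n} (hy : y ∈ (χ n q).target) : (coordEndo J q y)ᵀ * coordMetric g q y * coordEndo J q y = coordMetric g q y := by
  ext i j
  have h := hJ _ (coordVec q y i) (coordVec q y j)
  rw [map_coordVec hy, map_coordVec hy, g.inner_sum] at h
  refine Eq.trans ?_ h
  rw [mul_assoc]
  simp only [mul_apply, transpose_apply, mul_sum]
  rfl

lemma endo_congr {m m' : M} (h : m' = m) (v : Eℝ n) : (show Eℝ n from J m v) = (show Eℝ n from J m' v) := by
  subst h; rfl

lemma sum_smul_coordVec_change {p q : M} {z : Eℝ n} (hz : z ∈ overlap p q) (c : Fin n → ℝ) : (show Eℝ n from ∑ i, c i •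
    coordVec p z i) = ∑ a, (transJac p q z *ᵥ c) a • (show Eℝ n from coordVec q (chartTrans p q z) a) := by
  refine (sum_ext fun i => congrArg (fun v : Eℝ n => c i • v) (coordVec_change hz i)).trans ?_
  exact sum_smul_sum_smul _ _ _

lemma coordEndo_change {p q : M} {z : Eℝ n} (hz : z ∈ overlap p q) : transJac p q z * coordEndo J p z = coordEndo J q
    (chartTrans p q z) * transJac p q z := by
  have hm : chartTrans p q z ∈ (χ n q).target := (chartTrans_mem hz).1
  ext i j
  have h1 : (show Eℝ n from J _ (coordVec p z j)) = _ := (map_coordVec hz.1 j).trans (sum_smul_coordVec_change hz _)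
  have h2 := (endo_congr (symm_chartTrans hz) (coordVec p z j)).trans ((congrArg (fun v : Eℝ n => J ((χ n q).symm
      (chartTrans p q z)) v) (coordVec_change hz j)).trans (map_sum_coordVec hm _))
  exact congrFun (coordVec_coeff_unique hm (h1.symm.trans h2)) i

lemma IsRicciFlow.msmooth_coordEndo (hg : IsRicciFlow g T) (hT : IsOpen T)
    (hK : ∀ t ∈ T, IsKaehler (g t) J) (q : M) :
    MSmooth (fun z : Sℝ n => coordEndo J q z.1)
      ((χ n q).target ×ˢ T) := by
  have hG := hg.isMetricOn hT q
  have hW : MSmooth (fun z : Sℝ n => coordMetric (g z.2) q z.1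
      * coordEndo J q z.1) ((χ n q).target ×ˢ T) := fun i j => by
    rcases T.eq_empty_or_nonempty with rfl | ⟨t, ht⟩
    · simp
    refine (contDiffOn_metric_apply hg q (contMDiffOn_coordVec_prod q i T)
      fun z hz => ?_).congr fun z hz =>
        (coordMetric_mul_coordEndo (g z.2) hz.1 i j).symm
    exact ContMDiffWithinAt.clm_bundle_apply
     
      (((hK t ht).smooth.contMDiffOn (s := univ)).comp ((contMDiffOn_extChartAt_symm q).comp
        contDiff_fst.contMDiff.contMDiffOn fun z hz => hz.1) (fun _ _ => mem_univ _) z hz) (contMDiffOn_coordVec_prod q j T z hz)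
  exact (hG.inv_smooth.mul hW).congr fun z hz =>
    (nonsing_inv_mul_cancel_left _ _ (hG.det z hz)).symm

lemma IsRicciFlow.parallel_coordEndo (hg : IsRicciFlow g T) (hT : IsOpen T) (hK : ∀ t ∈ T, IsKaehler (g t) J) (q : M) :
    ∀ y ∈ (χ n q).target ×ˢ T, ∀ i, mD (sDir i) (fun z : Sℝ n => coordEndo J q z.1) y + (conn sDir gST g q i y *
            coordEndo J q y.1 - coordEndo J q y.1 * conn sDir gST g q i y) = 0 := by
  rintro ⟨z, t⟩ hz i
  have hG := hg.isMetricOn hT q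
  ext k j
  have h := (hK t hz.2).parallel q z hz.1 i j k
  have h1 : partialD i (fun z => coordEndo J q z k j) z = dD (sDir i) (fun z : Sℝ n => coordEndo J q z.1 k j) (z, t) :=
    dD_slice (smooth_diffAt hG.isOpen (hg.msmooth_coordEndo hT hK q k j) hz) i
  have h3 : ∀ k j, christoffel (coordMetric (g t) q) k i j z = _ := fun k j => congr_fun₂ (hG.conn_slice hz i) k j
  rw [h1, sum_sub_distrib] at h
  simp only [h3] at h
  rw [Matrix.add_apply, Matrix.sub_apply, mul_apply, mul_apply]
  refine Eq.trans ?_ h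
  congr 2
  exact sum_ext fun _ => mul_comm _ _

lemma mD_tDir_fst (K : Eℝ n → Mℝ n) {U : Set Sℝ n} (hU : IsOpen U) (hK : MSmooth (fun z : Sℝ n => K z.1) U) {y : Sℝ n}
    (hy : y ∈ U) : mD (tDir n) (fun z : Sℝ n => K z.1) y = 0 := by
  ext i j
  exact (dD_tDir (smooth_diffAt hU (hK i j) hy)).unique (hasDerivAt_const y.2 (K y.1 i j))

end ComplexStructure

section FrameChange

variable {E : Mℝ n}

lemma cMat_inFrame (R : Tℝ n) (E : Mℝ n) : cMat (inFrame R E) = (cK E ⊗ₖ cK E)ᵀ * cMat R * (cK E ⊗ₖ cK E) := by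
  have h := congrArg (fun A => A.map ofRealHom) (asMat_inFrame R E)
  simp only [Matrix.map_mul] at h
  refine h.trans ?_
  congr 2 <;> (ext a b; simp [Matrix.kroneckerMap_apply])

lemma curvForm_inFrame (R : Tℝ n) (v w : Mℂ n) : ℛ (inFrame R E) v w = ℛ R (cK E * v * (cK E)ᵀ) (cK E * w * (cK E)ᵀ) :=
    by rw [curvForm_eq_dot, curvForm_eq_dot, ← kronecker_pairVec,
    ← kronecker_pairVec, cMat_inFrame, ← mulVec_mulVec, ← mulVec_mulVec, dotProduct_mulVec, vecMul_transpose]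

lemma herm_inFrame (R : Tℝ n) (v w : Mℂ n) : herm (inFrame R E) v w = herm R (cK E * v * (cK E)ᵀ) (cK E * w * (cK E)ᵀ)
    := by rw [herm, herm, curvForm_inFrame, Matrix.map_mul, Matrix.map_mul, cK_map_conj, ← transpose_map, cK_map_conj]

lemma bisectional_inFrame (R : Tℝ n) (x y : Vℂ n) : bisectional (inFrame R E) x y = bisectional R (cK E *ᵥ x) (cK E *ᵥ
    y) := by
  have hs : ∀ x : Vℂ n, star (cK E *ᵥ x) = cK E *ᵥ star x := fun x => by
    rw [star_mulVec, ← mulVec_transpose]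
    congr 1
    exact cK_map_conj
  have h : ∀ (R : Tℝ n) (x y : Vℂ n), bisectional R x y = -(4 * ℛ R (vecMulVec x (star x)) (vecMulVec y (star y))).re :=
      fun R x y => by rw [← sum4_eq_curvForm]; rfl
  rw [h, h, curvForm_inFrame, hs, hs, mul_vecMulVec, mul_vecMulVec, vecMulVec_mul, vecMulVec_mul, vecMul_transpose,
    vecMul_transpose]

lemma inFrame_add_mul (R T : Tℝ n) (α : ℝ) : inFrame (fun i j k l => R i j k l + α * T i j k l) E = fun a b c d =>
      inFrame R E a b c d + α * inFrame T E a b c d := by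
  funext a b c d
  simp only [inFrame, mul_sum, ← sum_add_distrib]
  exact sum4_congr fun i j k l => by ring

lemma conj_apply_eq_sum (A : Mℝ n) (a c : Fin n) : (Eᵀ * A * E) a c = ∑ i, ∑ k, A i k * E i a * E k c := by
  simp only [mul_apply, transpose_apply, sum_mul]
  rw [sum_comm]
  exact sum_ext fun _ => sum_ext fun _ => by ring

/-- The curvature tensor of constant holomorphic sectional curvature of a hermitian form. -/
def hermitianCurv (h w : Mℝ n) (i j k l : Fin n) : ℝ := (1 / 2) * (h i k * h j l - h i l * h j k + w i k * w j l - w i l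
  * w j k + 2 * w i j * w k l)

lemma inFrame_hermitianCurv (h w : Mℝ n) : inFrame (hermitianCurv h w) E = hermitianCurv (Eᵀ * h * E) (Eᵀ * w * E) := by
  have e1 : ∀ (A B : Mℝ n) (a b c d : Fin n), ∑ i, ∑ j, ∑ k, ∑ l, A i j * B k l * E i a * E j b * E k c * E l d = (Eᵀ *
        A * E) a b * (Eᵀ * B * E) c d := fun A B a b c d => by
    rw [conj_apply_eq_sum, conj_apply_eq_sum]
    simp only [sum_mul]
    simp only [mul_sum]
    exact sum4_congr fun i j k l => by ring
  have e2 : ∀ (A B : Mℝ n) (a b c d : Fin n), ∑ i, ∑ j, ∑ k, ∑ l, A i k * B j l * E i a * E j b * E k c * E l d = (Eᵀ *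
        A * E) a c * (Eᵀ * B * E) b d := fun A B a b c d => by
    rw [← e1]
    refine sum_ext fun i => sum_comm.trans ?_
    exact sum_ext fun k => sum_ext fun j => sum_ext fun l => by ring
  have e3 : ∀ (A B : Mℝ n) (a b c d : Fin n), ∑ i, ∑ j, ∑ k, ∑ l, A i l * B j k * E i a * E j b * E k c * E l d = (Eᵀ *
        A * E) a d * (Eᵀ * B * E) b c := fun A B a b c d => by
    rw [← e1]
    refine sum_ext fun i => (sum_rotate _).trans ?_
    exact sum_ext fun l => sum_ext fun j => sum_ext fun k => by ring
  funext a b c d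
  rw [hermitianCurv, mul_assoc 2, ← e2 h h a b c d, ← e3 h h a b c d, ← e2 w w a b c d, ← e3 w w a b c d, ← e1 w w a b c
    d]
  simp only [inFrame, hermitianCurv, mul_sum, ← sum_add_distrib, ← sum_sub_distrib]
  exact sum4_congr fun i j k l => by ring

lemma kaehlerCurv_eq (K : Mℝ n) : kaehlerCurv K = hermitianCurv 1 K := by
  funext i j k l
  simp only [kaehlerCurv, hermitianCurv, sphereCurv, Matrix.one_apply]

lemma sphereCurv_eq : sphereCurv n = fun i j k l => 2 * hermitianCurv 1 0 i j k l := by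
  funext i j k l
  simp only [hermitianCurv, sphereCurv, Matrix.one_apply, Matrix.zero_apply]
  ring

lemma inFrame_sphereCurv (hE : Eᵀ * E = 1) : inFrame 𝕊 n E = sphereCurv n := by
  have h := inFrame_add_mul (E := E) (fun _ _ _ _ => 0) (hermitianCurv 1 0) 2
  have h0 : ∀ a b c d, inFrame (fun _ _ _ _ => (0 : ℝ)) E a b c d = 0 := fun a b c d => by simp [inFrame]
  simpa only [h0, zero_add, inFrame_hermitianCurv, mul_one, hE, mul_zero, zero_mul, ← sphereCurv_eq] using h

lemma CurvCondition.levelSet_subset_inFrame (c : CurvCondition) (hE : Eᵀ * E = 1) (R : Tℝ n) : levelSet (c.gen n) 𝕊 n R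
    ⊆ levelSet (c.gen n) 𝕊 n (inFrame R E) := by
  refine fun α hα => ⟨hα.1, fun v hv => ?_⟩
  have h := inFrame_add_mul (E := E) R 𝕊 n α
  rw [inFrame_sphereCurv hE] at h
  rw [← h, herm_inFrame]
  refine hα.2 _ (CurvCondition.conj_mem ?_ hv)
  have h1 := congrArg (fun A => A.map ofRealHom) hE
  simp only [Matrix.map_mul] at h1
  exact h1.trans (Matrix.map_one _ ofReal_zero ofReal_one)

lemma CurvCondition.levelSet_eq (c : CurvCondition) {A F : Mℝ n} (hA : Aᵀ = A) (hE : Eᵀ * A * E = 1) (hF : Fᵀ * A * F =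
    1) : levelSet (c.gen n) 𝕊 n (inFrame R E) = levelSet (c.gen n) 𝕊 n (inFrame R F) := by
  have key : ∀ {E F : Mℝ n}, Eᵀ * A * E = 1 → Fᵀ * A * F = 1 → levelSet (c.gen n) 𝕊 n (inFrame R E) ⊆ levelSet (c.gen n)
        𝕊 n (inFrame R F) := fun {E F} hE hF => by
    have h1 : E * (Eᵀ * A) = 1 := mul_eq_one_comm.1 hE
    have h2 : E * (Eᵀ * A * F) = F := by rw [← mul_assoc, h1, one_mul]
    rw [← h2, ← inFrame_inFrame]
    refine c.levelSet_subset_inFrame ?_ _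
    calc (Eᵀ * A * F)ᵀ * (Eᵀ * A * F) = Fᵀ * A * (E * (Eᵀ * A)) * F := by
          simp only [transpose_mul, transpose_transpose, hA, mul_assoc]
      _ = 1 := by rw [h1, mul_one, hF]
  exact (key hE hF).antisymm (key hF hE)

end FrameChange

section Levels

/-- The metric of a Ricci flow on space-time in the chart at `q`. -/
def stMetric (g : ℝ → RMetric n M) (q : M) (z : Sℝ n) : Mℝ n := coordMetric (g z.2) q z.1

lemma cK_mul (A B : Mℝ n) : cK (A * B) = cK A * cK B := Matrix.map_mul (f := ofRealHom)

lemma mem_overlap {p q : M} (hp : p ∈ (χ n q).source) : χ n p p ∈ overlap p q :=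
  ⟨mem_extChartAt_target p, by rwa [mem_preimage, extChartAt_to_inv]⟩

lemma chartTrans_apply (p q : M) : chartTrans p q (χ n p p) = χ n q p := by rw [chartTrans, extChartAt_to_inv]

variable (hg : IsRicciFlow g T) (hT : IsOpen T) {t : ℝ} (ht : t ∈ T) {p q : M} (hp : p ∈ (χ n q).source) {E : Mℝ n} (hE
  : Eᵀ * coordMetric (g t) q (χ n q p) * E = 1)
include hg hT ht hp

lemma IsRicciFlow.curvAt_eq : curvAt (g t) p = inFrame (riem sDir (stMetric g q) (χ n q p, t)) (transJac p q (χ n p p))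
    := by
  rw [curvAt, hg.curvTensor_eq hT ht (mem_overlap hp), chartTrans_apply]
  rfl

lemma IsRicciFlow.isAlgCurvature : IsAlg (inFrame (riem sDir (stMetric g q) (χ n q p, t)) E) := ((hg.isMetricOn hT
  q).isAlgCurvature ⟨(χ n q).map_source hp, ht⟩).inFrame E

include hE

lemma IsRicciFlow.ellSet_eq (c : CurvCondition) : ellSet c (g t) p = levelSet (c.gen n) 𝕊 n (inFrame (riem sDir
      (stMetric g q) (χ n q p, t)) E) := by
  have hz := mem_overlap hp
  have hL := (isCoordChange_chartTrans p q hT ht).det _ hz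
  have hm := coordMetric_change (g t) hz
  have hR := hg.curvAt_eq hT ht hp
  rw [chartTrans_apply] at hm
  set L := transJac p q (χ n p p)
  have hc : ∀ b, curvInFrame (g t) p b = inFrame (riem sDir (stMetric g q) (χ n q p, t)) (L * of fun i a => b a i) :=
      fun b => by
    rw [← inFrame_inFrame, ← hR]
    rfl
  have hb : ∀ b, IsOrthonormalFrame (g t) p b ↔ (L * of fun i a => b a i)ᵀ * coordMetric (g t) q (χ n q p) * (L * of fun
      i a => b a i) = 1 := fun b => by
      rw [transpose_mul, show ∀ A B C D : Mℝ n, A * B * C * (L * D)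
        = A * (B * (C * L)) * D from fun A B C D => by simp only [mul_assoc], ← hm, ← ext_iff]
      simp only [conj_apply_eq_sum, Matrix.one_apply]
      rfl
  ext α
  constructor
  · refine fun hα => ⟨hα.1, fun v hv => ?_⟩
    have h := hα.2 fun a i => (L⁻¹ * E) i a
    have e : (of fun i a => (L⁻¹ * E) i a) = L⁻¹ * E := rfl
    rw [hb, hc, e, mul_nonsing_inv_cancel_left _ _ hL] at h
    exact (h hE).2 v hv
  · refine fun hα => ⟨hα.1, fun b hb' => ?_⟩
    rw [c.levelSet_eq (coordMetric_symm (g t) q _) hE ((hb b).1 hb')] at hα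
    rw [hc]
    exact ⟨(hg.isAlgCurvature hT ht hp).add_mul (isAlg_sphere n) α, hα.2⟩

lemma IsRicciFlow.ellKaehlerSet_eq {J : ∀ q : M, TangentSpace (𝓡 n) q →L[ℝ] TangentSpace (𝓡 n) q} (hK : ∀ t ∈ T,
    IsKaehler (g t) J) {J₀ : Mℝ n} (hJ : coordEndo J q (χ n q p) * E = E * J₀) : ellKaehlerSet (g t) J p = levelSet
    (kaehlerGen J₀) (kaehlerCurv J₀) (inFrame (riem sDir (stMetric g q) (χ n q p, t)) E) := by
  have hz := mem_overlap hp
  have hq := (χ n q).map_source hp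
  have hG := hg.isMetricOn hT q
  obtain ⟨hJt, hJ2⟩ := complexStructure_in_frame (coordMetric_symm (g t) q _) hE (coordEndo_mul_self (hK t ht).sq hq)
    (coordEndo_orthogonal (hK t ht).orthogonal hq) hJ
  have hL := (isCoordChange_chartTrans p q hT ht).det _ hz
  have hm := coordMetric_change (g t) hz
  have hj := coordEndo_change (J := J) hz
  have hR := hg.curvAt_eq hT ht hp
  rw [chartTrans_apply] at hm hj
  have hpr : projCurv (g t) J p = hermitianCurv (coordMetric (g t) p (χ n p p)) (coordMetric (g t) p (χ n p p) *
    coordEndo J p (χ n p p)) := rfl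
  have hty : ∀ x, IsTypeOneZero J p x ↔ cK (coordEndo J p (χ n p p)) *ᵥ x = I • x := fun x => funext_iff.symm
  set L := transJac p q (χ n p p)
  set A := coordMetric (g t) p (χ n p p)
  set K := coordEndo J p (χ n p p)
  set R := riem sDir (stMetric g q) (χ n q p, t)
  set B := L⁻¹ * E with hBdef
  have hLB : L * B = E := mul_nonsing_inv_cancel_left _ _ hL
  have hB : Bᵀ * A * B = 1 := by
    have h : ∀ C, Bᵀ * (Lᵀ * (C * L)) * B = (L * B)ᵀ * C * (L * B) := fun C => by
      rw [transpose_mul L B]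
      simp only [mul_assoc]
    rw [hm, h, hLB, hE]
  have hKB : K * B = B * J₀ := by rw [← nonsing_inv_mul_cancel_left (A := L) (K * B) hL, ← mul_assoc L, hj,
      mul_assoc _ L, hLB, hJ, ← mul_assoc]
  have hBB : B * (Bᵀ * A) = 1 := mul_eq_one_comm.1 hB
  have hLK : J₀ * (Bᵀ * A) = Bᵀ * A * K := by rw [← one_mul (J₀ * _), ← hB, mul_assoc (Bᵀ * A), ← mul_assoc B, ← hKB,
      mul_assoc K, hBB, mul_one]
  have hin : ∀ α : ℝ, inFrame (fun i j k l => curvAt (g t) p i j k l + α * projCurv (g t) J p i j k l) B = fun i j k l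
      => inFrame R E i j k l + α * kaehlerCurv J₀ i j k l := fun α => by
    rw [inFrame_add_mul, hR, inFrame_inFrame, hLB, hpr, inFrame_hermitianCurv, hB,
      mul_assoc _ _ B, mul_assoc A, hKB, ← mul_assoc A, ← mul_assoc Bᵀ, ← mul_assoc Bᵀ, hB, one_mul, kaehlerCurv_eq]
  have hto : ∀ x, IsT10 J₀ x → IsTypeOneZero J p (cK B *ᵥ x) := fun x hx => by
    rw [hty, mulVec_mulVec, ← cK_mul, hKB, cK_mul, ← mulVec_mulVec, hx, mulVec_smul]
  have hof : ∀ x, IsTypeOneZero J p x → IsT10 J₀ (cK (Bᵀ * A) *ᵥ x) := fun x hx => by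
    rw [IsT10, mulVec_mulVec, ← cK_mul, hLK, cK_mul, ← mulVec_mulVec, (hty x).1 hx, mulVec_smul]
  have hinv : ∀ x, cK B *ᵥ (cK (Bᵀ * A) *ᵥ x) = x := fun x => by
    rw [mulVec_mulVec, ← cK_mul, hBB]
    simp
  have hA := hg.isAlgCurvature hT ht hp (E := E)
  have hS : SlotInv J₀ (inFrame R E) := slotInvariant_of_comm hG ⟨hq, ht⟩ hE hJ (curvMat_comm_parallel hG ⟨hq, ht⟩
    (hg.msmooth_coordEndo hT hK q) (hg.parallel_coordEndo hT hK q)) hJt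
  have hb : ∀ (α : ℝ) x y, IsT10 J₀ x → IsT10 J₀ y → bisectional (fun i j k l => curvAt (g t) p i j k l + α * projCurv
      (g t) J p i j k l) (cK B *ᵥ x) (cK B *ᵥ y) = Herm (fun i j k l => inFrame R E i j k l + α * kaehlerCurv J₀ i j k
        l) (wedge x (star y)) := fun α x y hx hy => by
    rw [← bisectional_inFrame, hin, bisectional_eq (hA.add_mul (isAlg_kaehler hJt) α)
      (hS.add_mul (kaehlerCurv_slotInvariant hJt hJ2) α) hJt hJ2 hx hy]
  ext α
  constructor
  · rintro ⟨h0, h⟩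
    refine ⟨h0, ?_⟩
    rintro v ⟨x, y, hx, hy, rfl⟩
    rw [← hb α x y hx hy]
    exact h _ _ (hto x hx) (hto y hy)
  · rintro ⟨h0, h⟩
    refine ⟨h0, fun x y hx hy => ?_⟩
    rw [← hinv x, ← hinv y, hb α _ _ (hof x hx) (hof y hy)]
    exact h _ ⟨_, _, hof x hx, hof y hy, rfl⟩

end Levels

section Transfer

variable {G : Sℝ n → Mℝ n} {V : Set Sℝ n} {x : Sℝ n} {f f' : Sℝ n → ℝ}

lemma IsMetric.mono {G : X → Mℝ n} {U V : Set X} (hG : IsMetric G U) (hV : IsOpen V) (h : V ⊆ U) : IsMetric G V := ⟨hV,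
  hG.smooth.mono h, fun x hx => hG.symm x (h hx), fun x hx => hG.det x (h hx)⟩

lemma heatST_congr (hV : IsOpen V) (h : ∀ y ∈ V, f y = f' y) (hx : x ∈ V) : heatST G f x = heatST G f' x := by
  have h1 : ∀ v, ∀ y ∈ V, dD v f y = dD v f' y := fun v y hy => dD_congr hV h hy v
  simp only [heatST, laplaceST, h1 _ x hx, dD_congr hV (h1 _) hx]

lemma heatST_le_of_touching (hV : IsOpen V) (hx : x ∈ V) {E : Mℝ n} (hE : (G x)⁻¹ = E * Eᵀ) (hf : C∞ f V) (hf' : C∞ f'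
    V) (h : ∀ y ∈ V, f' y ≤ f y) (h0 : f' x = f x) : heatST G f x ≤ heatST G f' x := by
  have e : ∀ y, ∑ i : Fin 2, ![(1 : ℝ), -1] i * ![f, f'] i y = f y - f' y := fun y => by
    simp [Fin.sum_univ_two, sub_eq_add_neg]
  have hs : ∀ i, C∞ (![f, f'] i) V := fun i => by
    fin_cases i
    exacts [hf, hf']
  have h1 := heatST_sum_const_mul (G := G) hV hs ![1, -1] hx
  simp only [e] at h1
  rw [Fin.sum_univ_two] at h1
  have h2 := heatST_nonpos_of_min hV hx hE (hf.sub hf') fun y hy => by linarith [h y hy]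
  rw [h1] at h2
  simp only [cons_val_zero, cons_val_one] at h2
  linarith

/-- The domain in space-time coordinates of a function defined on a subset of `M × ℝ`. -/
def stDomain (q : M) (T : Set ℝ) (U : Set (M × ℝ)) : Set Sℝ n := ((χ n q).target ×ˢ T) ∩ (fun z => ((χ n q).symm z.1,
  z.2)) ⁻¹' U

lemma isOpen_stDomain (q : M) {T : Set ℝ} (hT : IsOpen T) {U : Set (M × ℝ)} (hU : IsOpen U) : IsOpen (stDomain (n := n)
    q T U) := ContinuousOn.isOpen_inter_preimage (((continuousOn_extChartAt_symm q).comp continuous_fst.continuousOn fun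
    _ hz => hz.1).prodMk continuous_snd.continuousOn) ((isOpen_extChartAt_target q).prod hT) hU

lemma contDiffOn_stDomain (q : M) {U : Set (M × ℝ)} {ψ : M × ℝ → ℝ} (hψ : ContMDiffOn ((𝓡 n).prod 𝓘(ℝ, ℝ)) 𝓘(ℝ, ℝ) ∞ ψ
    U) : C∞ (fun z => ψ ((χ n q).symm z.1, z.2)) (stDomain q T U) := by
  rw [← contMDiffOn_iff_contDiffOn]
  exact hψ.comp ((contMDiffOn_chart_prod q T).mono inter_subset_left) fun _ hz => hz.2

lemma IsRicciFlow.heat_eq (hg : IsRicciFlow g T) (hT : IsOpen T) {q : M} {τ : ℝ} (hτ : τ ∈ T) {U : Set (M × ℝ)} (hU :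
    IsOpen U) (hq : (q, τ) ∈ U) {ψ : M × ℝ → ℝ} (hψ : ContMDiffOn ((𝓡 n).prod 𝓘(ℝ, ℝ)) 𝓘(ℝ, ℝ) ∞ ψ U) : deriv (fun t =>
    ψ (q, t)) τ - laplaceAt (g τ) (fun p => ψ (p, τ)) q = heatST (stMetric g q) (fun z => ψ ((χ n q).symm z.1, z.2)) (χ
        n q q, τ) := by
  have hx : (χ n q q, τ) ∈ stDomain q T U := ⟨⟨mem_extChartAt_target q, hτ⟩, by rwa [mem_preimage, extChartAt_to_inv]⟩
  have hf := contDiffOn_stDomain (T := T) q hψ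
  have ho := isOpen_stDomain (n := n) q hT hU
  have h1 := (dD_tDir (smooth_diffAt ho hf hx)).deriv
  simp only [extChartAt_to_inv] at h1
  have hG : IsMetric (stMetric g q) _ := hg.isMetricOn hT q
  have h2 := hG.laplaceCoord_slice hx.1 ho hf hx
  rw [heatST, h1, ← h2]
  rfl

lemma IsRicciFlow.scalAt_eq (hg : IsRicciFlow g T) (hT : IsOpen T) (q : M) {τ : ℝ} (hτ : τ ∈ T) : scalAt (g τ) q = ∑ i,
    ∑ j, (stMetric g q (χ n q q, τ))⁻¹ i j * ric sDir (stMetric g q) (χ n q q, τ) i j := by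
  simp only [scalAt, scalarCurv, hg.ricciTensor_eq_self hT hτ (mem_extChartAt_target q)]
  rfl

lemma IsRicciFlow.evolution_inequality (hg : IsRicciFlow g T) (hT : IsOpen T) {C : ℝ} {u : M → ℝ → ℝ} (h : ∀ q, ∀ τ ∈ T,
    ∃ V, IsOpen V ∧ (χ n q q, τ) ∈ V ∧ V ⊆ (χ n q).target ×ˢ T ∧ ContinuousAt (fun z => u ((χ n q).symm z.1) z.2) (χ n q
      q, τ) ∧ ∃ φ, C∞ φ V ∧ (∀ z ∈ V, φ z ≤ u ((χ n q).symm z.1) z.2) ∧ φ (χ n q q, τ) = u q τ ∧ heatST (stMetric g q) φ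
        (χ n q q, τ) ≤ scalAt (g τ) q * u q τ + C * u q τ ^ 2) : BarrierIneq g T u (fun p t => scalAt (g t) p * u p t +
    C * u p t ^ 2) ∧ ViscosityIneq g T u (fun p t => scalAt (g t) p * u p t + C * u p t ^ 2) := by
  have hcs : ∀ q : M, ContMDiffOn (𝓡 n) 𝓘(ℝ, Eℝ n) ∞ (χ n q) (χ n q).source := fun q => by
    rw [extChartAt_source]; exact contMDiffOn_extChartAt
  have hc : ∀ q : M, ContMDiffOn ((𝓡 n).prod 𝓘(ℝ, ℝ)) 𝓘(ℝ, Sℝ n) ∞ (fun z : M × ℝ => (χ n q z.1, z.2)) ((χ n q).source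
      ×ˢ univ) := fun q => ((hcs q).comp contMDiff_fst.contMDiffOn fun _ hz => hz.1).prodMk_space
      contMDiff_snd.contMDiffOn
  refine ⟨fun q τ hτ => ?_, fun z hz => ?_, fun q τ hτ U hU hqU _ ψ hψ hle heq => ?_⟩
  · obtain ⟨V, hV, hxV, hVT, -, φ, hφ, hle, heq, hheat⟩ := h q τ hτ
    have hU := (hc q).continuousOn.isOpen_inter_preimage ((isOpen_extChartAt_source q).prod isOpen_univ) hV
    have hφs : ContMDiffOn ((𝓡 n).prod 𝓘(ℝ, ℝ)) 𝓘(ℝ, ℝ) ∞ (fun z : M × ℝ => φ (χ n q z.1, z.2)) _ := hφ.contMDiffOn.comp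
      ((hc q).mono inter_subset_left) fun z hz => hz.2
    have hqU : (q, τ) ∈ (χ n q).source ×ˢ univ ∩ (fun z : M × ℝ => (χ n q z.1, z.2)) ⁻¹' V := ⟨⟨mem_extChartAt_source q,
      mem_univ _⟩, hxV⟩
    refine ⟨_, hU, hqU, fun z hz => ⟨mem_univ _, (hVT hz.2).2⟩, _, hφs, fun z hz => ?_, heq, ?_⟩
    · have := hle _ hz.2
      rwa [(χ n q).left_inv hz.1.1] at this
    · rw [hg.heat_eq hT hτ hU hqU hφs]
      refine (heatST_congr hV (fun y hy => ?_) hxV).trans_le hheat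
      exact congrArg φ (Prod.ext ((χ n q).right_inv (hVT hy).1) rfl)
  · obtain ⟨q, τ⟩ := z
    obtain ⟨V, hV, hxV, hVT, hcont, -⟩ := h q τ hz.2
    have hn : (χ n q).source ×ˢ univ ∈ nhds (q, τ) := ((isOpen_extChartAt_source q).prod isOpen_univ).mem_nhds
        ⟨mem_extChartAt_source q, mem_univ _⟩
    have h1 := ContinuousAt.comp (x := (q, τ)) (f := fun z : M × ℝ => (χ n q z.1, z.2)) hcont ((hc
      q).continuousOn.continuousAt hn)
    refine (h1.congr ?_).continuousWithinAt.upperSemicontinuousWithinAt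
    filter_upwards [hn] with z hz
    simp only [Function.comp, (χ n q).left_inv hz.1]
  · obtain ⟨V, hV, hxV, hVT, -, φ, hφ, hle', heq', hheat⟩ := h q τ hτ
    have hx : (χ n q q, τ) ∈ stDomain q T U := ⟨⟨mem_extChartAt_target q, hτ⟩, by rwa [mem_preimage, extChartAt_to_inv]⟩
    obtain ⟨B, hB⟩ := exists_frame_of_posDef (coordMetric_posDef (g τ) (mem_extChartAt_target q))
    have hinv := inv_eq_mul_transpose hB
    have hψ' := (contDiffOn_stDomain (T := T) q hψ).mono (inter_subset_left (t := V))
    rw [hg.heat_eq hT hτ hU hqU hψ]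
    refine (heatST_le_of_touching ((isOpen_stDomain q hT hU).inter hV) ⟨hx, hxV⟩ hinv hψ' (hφ.mono inter_subset_right)
      (fun y hy => ?_) ?_).trans hheat
    · exact (hle' y hy.2).trans (hle _ hy.1.2)
    · rw [heq', ← heq]
      simp

end Transfer

section Levels

lemma IsRicciFlow.isLeast_ell (hg : IsRicciFlow g T) (hT : IsOpen T) {c : CurvCondition} (hc : c = pic → n ≠ 6) {t : ℝ}
    (ht : t ∈ T) (p : M) : IsLeast (ellSet c (g t) p) (ell c (g t) p) := by
  obtain ⟨B, hB⟩ := exists_frame_of_posDef (coordMetric_posDef (g t) (mem_extChartAt_target p))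
  rw [ell, hg.ellSet_eq hT ht (mem_extChartAt_source p) hB]
  exact (c.coneDatum n hc).isLeast _

lemma IsRicciFlow.ell_evolution (hg : IsRicciFlow g T) (hT : IsOpen T) {c : CurvCondition} (hc : c = pic → n ≠ 6) :
    BarrierIneq g T (fun p t => ell c (g t) p) (fun p t => scalAt (g t) p * ell c (g t) p + (scal 𝕊 n + 2) * ell c (g t)
        p ^ 2) ∧ ViscosityIneq g T (fun p t => ell c (g t) p) (fun p t => scalAt (g t) p * ell c (g t) p + (scal 𝕊 n +
        2) * ell c (g t) p ^ 2) := by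
  refine hg.evolution_inequality hT fun q τ hτ => ?_
  have hG : IsMetric (stMetric g q) _ := hg.isMetricOn hT q
  have hx : (χ n q q, τ) ∈ (χ n q).target ×ˢ T := ⟨mem_extChartAt_target q, hτ⟩
  obtain ⟨B, hB⟩ := exists_frame_of_posDef (coordMetric_posDef (g τ) (mem_extChartAt_target q))
  obtain ⟨V, E, hV, hxV, hVU, hE, -, hEG, hpar⟩ := hG.exists_frame hx hB
  have h := (c.coneDatum n hc).exists_barrier_of_frame (hG.mono hV hVU) hxV (fun y hy => hg.mD_tDir hT q y (hVU hy)) hE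
    hEG hpar (fun _ h => h.elim) (u := fun z => ell c (g z.2) ((χ n q).symm z.1)) fun y hy => by
      have hy' := (χ n q).right_inv (hVU hy).1
      have := hg.ellSet_eq hT (hVU hy).2 ((χ n q).map_target (hVU hy).1) (by rw [hy']; exact hEG y hy) c
      rw [hy'] at this
      exact this ▸ hg.isLeast_ell hT hc (hVU hy).2 _
  rw [hg.scalAt_eq hT q hτ]
  simp only [extChartAt_to_inv] at h
  exact ⟨V, hV, hxV, hVU, h⟩

variable {J : ∀ q : M, TangentSpace (𝓡 n) q →L[ℝ] TangentSpace (𝓡 n) q}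

lemma exists_complexStructure_in_frame {g : RMetric n M} (hK : IsKaehler g J) {q : M} {y : Eℝ n} (hy : y ∈ (χ n
    q).target) : ∃ B J₀ : Mℝ n, Bᵀ * coordMetric g q y * B = 1 ∧ coordEndo J q y * B = B * J₀ ∧ J₀ᵀ = -J₀ ∧ J₀ * J₀ = -1
      := by
  obtain ⟨B, hB⟩ := exists_frame_of_posDef (coordMetric_posDef g hy)
  have hJ : coordEndo J q y * B = B * (Bᵀ * coordMetric g q y * (coordEndo J q y * B)) := by
    rw [← mul_assoc B, show B * (Bᵀ * coordMetric g q y) = 1 from mul_eq_one_comm.1 hB, one_mul]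
  exact ⟨B, _, hB, hJ, complexStructure_in_frame (coordMetric_symm g q y) hB (coordEndo_mul_self hK.sq hy)
    (coordEndo_orthogonal hK.orthogonal hy) hJ⟩

lemma IsRicciFlow.isLeast_ellKaehler (hg : IsRicciFlow g T) (hT : IsOpen T) (hK : ∀ t ∈ T, IsKaehler (g t) J) {t : ℝ}
    (ht : t ∈ T) (p : M) : IsLeast (ellKaehlerSet (g t) J p) (ellKaehler (g t) J p) := by
  obtain ⟨B, J₀, hB, hJ, hJt, hJ2⟩ := exists_complexStructure_in_frame (hK t ht) (mem_extChartAt_target p)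
  rw [ellKaehler, hg.ellKaehlerSet_eq hT ht (mem_extChartAt_source p) hB hK hJ]
  exact (kaehler_coneDatum hJt hJ2).isLeast _

lemma IsRicciFlow.ellKaehler_evolution (hg : IsRicciFlow g T) (hT : IsOpen T)
    (hK : ∀ t ∈ T, IsKaehler (g t) J) :
    BarrierIneq g T (fun p t => ellKaehler (g t) J p)
        (fun p t => scalAt (g t) p * ellKaehler (g t) J p
          + ((n : ℝ) * (((n : ℝ) + 2) / 2) + 2) * ellKaehler (g t) J p ^ 2) ∧
      ViscosityIneq g T (fun p t => ellKaehler (g t) J p)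
        (fun p t => scalAt (g t) p * ellKaehler (g t) J p
          + ((n : ℝ) * (((n : ℝ) + 2) / 2) + 2) * ellKaehler (g t) J p ^ 2) := by
  refine hg.evolution_inequality hT fun q τ hτ => ?_
  have hG : IsMetric (stMetric g q) _ := hg.isMetricOn hT q
  have hx : (χ n q q, τ) ∈ (χ n q).target ×ˢ T :=
    ⟨mem_extChartAt_target q, hτ⟩
  obtain ⟨B, J₀, hB, hJ, hJt, hJ2⟩ :=
    exists_complexStructure_in_frame (hK τ hτ) (mem_extChartAt_target q)
  have hKs := hg.msmooth_coordEndo hT hK q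
  have hKp := hg.parallel_coordEndo hT hK q
  obtain ⟨V, E, hV, hxV, hVU, hE, -, hEG, hpar, hKE⟩ := hG.exists_unitary_frame hx hB hKs
    (hKp _ hx) (fun y hy => coordEndo_mul_self (hK y.2 hy.2).sq hy.1)
    (fun y hy => coordEndo_orthogonal (hK y.2 hy.2).orthogonal hy.1) hJ
  have h := (kaehler_coneDatum hJt hJ2).exists_barrier_of_frame (hG.mono hV hVU) hxV
    (fun y hy => hg.mD_tDir hT q y (hVU hy)) hE hEG hpar (fun K₀ h => by
      obtain rfl : K₀ = J₀ := h
      exact ⟨hJt, _, hKs.mono hVU, fun y hy => mD_tDir_fst _ hG.isOpen hKs (hVU hy),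
        fun y hy => hKp y (hVU hy), hKE⟩)
    (u := fun z => ellKaehler (g z.2) J ((χ n q).symm z.1)) fun y hy => by
      have hy' := (χ n q).right_inv (hVU hy).1
      have := hg.ellKaehlerSet_eq hT (hVU hy).2 ((χ n q).map_target (hVU hy).1)
        (by rw [hy']; exact hEG y hy) hK (by rw [hy']; exact hKE y hy)
      rw [hy'] at this
      exact this ▸ hg.isLeast_ellKaehler hT hK (hVU hy).2 _
  rw [hg.scalAt_eq hT q hτ]
  simp only [extChartAt_to_inv, scal_kaehlerCurv hJt hJ2] at h
  exact ⟨V, hV, hxV, hVU, h⟩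

end Levels

end

theorem mainTheorem7 :
    (∀ (n : ℕ) (c : CurvCondition), (c = CurvCondition.pic → n ≠ 6) →
      ∃ C : ℝ, 0 < C ∧
        ∀ (M : Type*) [TopologicalSpace M] [T2Space M] [SecondCountableTopology M]
          [ChartedSpace (EuclideanSpace ℝ (Fin n)) M] [IsManifold (𝓡 n) ∞ M]
          (T : Set ℝ) (g : ℝ → RMetric n M), IsOpen T → T.OrdConnected → IsRicciFlow g T →
          (∀ t ∈ T, ∀ p, IsLeast (ellSet c (g t) p) (ell c (g t) p)) ∧
          BarrierIneq g T (fun p t => ell c (g t) p)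
            (fun p t => scalAt (g t) p * ell c (g t) p + C * ell c (g t) p ^ 2) ∧
          ViscosityIneq g T (fun p t => ell c (g t) p)
            (fun p t => scalAt (g t) p * ell c (g t) p + C * ell c (g t) p ^ 2)) ∧
    (∀ m : ℕ,
      ∃ C : ℝ, 0 < C ∧
        ∀ (M : Type*) [TopologicalSpace M] [T2Space M] [SecondCountableTopology M]
          [ChartedSpace (EuclideanSpace ℝ (Fin (2 * m))) M] [IsManifold (𝓡 (2 * m)) ∞ M]
          (T : Set ℝ) (g : ℝ → RMetric (2 * m) M)
          (J : ∀ q : M, TangentSpace (𝓡 (2 * m)) q →L[ℝ] TangentSpace (𝓡 (2 * m)) q),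
          IsOpen T → T.OrdConnected → IsRicciFlow g T → (∀ t ∈ T, IsKaehler (g t) J) →
          (∀ t ∈ T, ∀ p, IsLeast (ellKaehlerSet (g t) J p) (ellKaehler (g t) J p)) ∧
          BarrierIneq g T (fun p t => ellKaehler (g t) J p)
            (fun p t => scalAt (g t) p * ellKaehler (g t) J p
              + C * ellKaehler (g t) J p ^ 2) ∧
          ViscosityIneq g T (fun p t => ellKaehler (g t) J p)
            (fun p t => scalAt (g t) p * ellKaehler (g t) J p
              + C * ellKaehler (g t) J p ^ 2)) := by
  refine ⟨fun n c hc => ⟨scal (sphereCurv n) + 2, ?_, fun M _ _ _ _ _ T g hT _ hg =>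
    ⟨fun t ht p => hg.isLeast_ell hT hc ht p, hg.ell_evolution hT hc⟩⟩,
    fun m => ⟨((2 * m : ℕ) : ℝ) * ((((2 * m : ℕ) : ℝ) + 2) / 2) + 2, by positivity,
      fun M _ _ _ _ _ T g J hT _ hg hK =>
        ⟨fun t ht p => hg.isLeast_ellKaehler hT hK ht p, hg.ellKaehler_evolution hT hK⟩⟩⟩
  rw [scal_sphereCurv]
  rcases n with - | n
  · norm_num
  · push_cast
    rw [add_sub_cancel_right]
    positivity
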